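/- Setting. For $m,n\ge 0$ let $\mathrm{Cob}^m_n$ be the category whose objects are planar diagrams (properly embedded $1$-manifolds in a rectangle, up to isotopy rel boundary) with $m$ endpoints on the top edge and $n$ on the bottom edge, formally shifted as $q^k a$, $k\in\mathbb Z$. Its morphisms are $\mathbb Z[\alpha]$-linear combinations of dotted cobordisms, modulo homeomorphism rel boundary and the local relations: the sphere with $0,1,2,3$ dots equals $0,1,0,\alpha$; neck cutting (a tube is the sum of the two ways of replacing it by two disks, one of which carries a dot); a handle equals twice a dot. A cobordism $S:q^ka\to q^lb$ with $\delta$ dots has $q$-degree $l-k-\chi(S)+\tfrac{m+n}{2}+2\delta$, and $\deg\alpha=4$. Let $\mathrm{BN}^m_n$ be its closure under finite direct sums. Complexes over $\mathrm{BN}^m_n$ have cohomological differentials, of $q$-degree $0$, and all those below live in nonpositive homological degrees; diagrams and such complexes can be glued in the plane, gluing of complexes being the total complex. Write $1_n$ for $n$ vertical strands. For complexes $A,B$ over $\mathrm{BN}^m_n$ let $\mathrm{Hom}^\bullet(A,B)$ be the bigraded complex of abelian groups spanned by bihomogeneous maps, with differential $f\mapsto d_B f-(-1)^{|f|}f d_A$;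 let $\mathrm{End}^\bullet(A)=\mathrm{Hom}^\bullet(A,A)$ and, for $C$ over $\mathrm{BN}^0_0$, $|C\rangle=\mathrm{Hom}^\bullet(\emptyset,C)$, where $\emptyset$ is the empty diagram. For a $q$-graded complex $V$ put $(q^eV)_d=V_{d-e}$. Below, $\simeq$ is homotopy equivalence of complexes of $q$-graded abelian groups, by maps and homotopies of $q$-degree $0$. A universal projector on $n$ strands is a complex $P_n$ over $\mathrm{BN}^n_n$ in nonpositive degrees such that $(P_n)^0\cong 1_n$, no shift $q^k1_n$ is a direct summand of $(P_n)^i$ for $i\neq0$, and gluing an arc joining two adjacent endpoints to the top of $P_n$, or to the bottom of $P_n$, gives a contractible complex. Fix a universal projector $P_n$ for each $n\ge 0$. Placing a label $n$ on an edge of a planar network means inserting $P_n$ there. Three labels are admissible if their sum is even and each is at most the sum of the other two; the edges with admissible labels $a,b,c$ are joined at a trivalent vertex by the planar diagram with $\tfrac{a+b-c}2$, $\tfrac{b+c-a}2$, $\tfrac{a+c-b}2$ arcs between the respective pairs of edges. Proposition. 1. For every $a\ge0$, $\mathrm{End}^\bullet(P_a)\simeq q^{a}\,|\mathrm{Tr}\,P_a\rangle$,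 where $\mathrm{Tr}$ is the Markov trace, i.e. $\mathrm{Tr}\,P_a$ is the $a$-colored unknot. 2. For every admissible triple $(a,b,c)$, let $V$ be the network consisting of one trivalent vertex with edge $a$ going to the top and edges $b,c$ going to the bottom, and let $\Theta$ be the theta network: two trivalent vertices joined by three edges labelled $a,b,c$. Then $\mathrm{End}^\bullet(V)\simeq q^{(a+b+c)/2}\,|\Theta\rangle$. 3. For all $a,b,c,d,i$ with $(i,a,b)$ and $(i,c,d)$ admissible, let $I$ be the network in which edges $a,b$ going to the top meet at a vertex, edges $c,d$ going to the bottom meet at a vertex, and an edge $i$ joins the two vertices. Let $\Pi$ be the pill network: the closed planar trivalent network with four vertices and six edges, obtained from two edges labelled $i$ by joining their upper ends by a pair of edges $a,b$ and their lower ends by a pair of edges $c,d$. Then $\mathrm{End}^\bullet(I)\simeq q^{(a+b+c+d)/2}\,|\Pi\rangle$. -/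

import Mathlib

open CategoryTheory

noncomputable section

namespace SpinNet

/-! ### Finite weighted pieces and their gluings -/

open Classical in
/-- Push a weight function forward along a map of finite sets, summing over fibres. -/
def push {K B M : Type} [Fintype K] [AddCommMonoid M] (g : K → B) (w : K → M) (b : B) : M :=
  ∑ k, if g k = b then w k else 0

/-- The relation on `A ⊕ B` generated by `s` on `A`, by `t` on `B`, and by `f k ∼ g k`. -/
inductive GlueRel {A B K : Type} (s : Setoid A) (t : Setoid B) (f : K → A) (g : K → B) :
    A ⊕ B → A ⊕ B → Prop
  | left {a a' : A} (h : s a a') : GlueRel s t f g (.inl a) (.inl a')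
  | right {b b' : B} (h : t b b') : GlueRel s t f g (.inr b) (.inr b')
  | glue (k : K) : GlueRel s t f g (.inl (f k)) (.inr (g k))

/-- Connectedness after gluing `f k` to `g k` for all `k`. -/
def glueConn {A B K : Type} (s : Setoid A) (t : Setoid B) (f : K → A) (g : K → B) :
    Setoid (A ⊕ B) :=
  Relation.EqvGen.setoid (GlueRel s t f g)

/-- Euler characteristics after gluing along pieces of Euler characteristic `κ`:
each glued piece is subtracted once. -/
def glueEuler {A B K : Type} [Fintype K] (χ : A → ℤ) (χ' : B → ℤ) (g : K → B) (κ : K → ℤ) :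
    A ⊕ B → ℤ :=
  Sum.elim χ (fun b => χ' b - push g κ b)

/-- Connected components. -/
abbrev Comp {A : Type} (s : Setoid A) : Type := Quotient s

/-- The total weight of a connected component. -/
def compSum {A M : Type} [Fintype A] [AddCommMonoid M] (s : Setoid A) (w : A → M) :
    Comp s → M :=
  push (Quotient.mk s) w

/-! ### Planar diagrams -/

/-- Planar diagrams (properly embedded 1-manifolds) in a rectangle, in Morse position, with `m`
points on the top and `n` points on the bottom: `strands n` is `n` vertical strands, `cap` is the
arc `∩` joining two bottom points, `cup` is the arc `∪` joining two top points, `stack a b` puts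
`a` on top of `b`, and `beside a b` puts `a` to the left of `b`. -/
inductive Diag : ℕ → ℕ → Type
  | strands (n : ℕ) : Diag n n
  | cap : Diag 0 2
  | cup : Diag 2 0
  | stack {m k n : ℕ} (a : Diag m k) (b : Diag k n) : Diag m n
  | beside {m n m' n' : ℕ} (a : Diag m n) (b : Diag m' n') : Diag (m + m') (n + n')

namespace Diag

/-- The elementary arcs of which a diagram is glued. -/
def Piece : {m n : ℕ} → Diag m n → Type
  | _, _, strands n => Fin n
  | _, _, cap => Unit
  | _, _, cup => Unit
  | _, _, stack a b => a.Piece ⊕ b.Piece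
  | _, _, beside a b => a.Piece ⊕ b.Piece

instance instFintypePiece : {m n : ℕ} → (a : Diag m n) → Fintype a.Piece
  | _, _, strands n => inferInstanceAs (Fintype (Fin n))
  | _, _, cap => inferInstanceAs (Fintype Unit)
  | _, _, cup => inferInstanceAs (Fintype Unit)
  | _, _, stack a b =>
    letI := instFintypePiece a; letI := instFintypePiece b
    inferInstanceAs (Fintype (a.Piece ⊕ b.Piece))
  | _, _, beside a b =>
    letI := instFintypePiece a; letI := instFintypePiece b
    inferInstanceAs (Fintype (a.Piece ⊕ b.Piece))

/-- The piece containing a given top boundary point. -/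
def top : {m n : ℕ} → (a : Diag m n) → Fin m → a.Piece
  | _, _, strands _ => fun i => i
  | _, _, cap => fun i => i.elim0
  | _, _, cup => fun _ => ()
  | _, _, stack a _ => fun i => .inl (a.top i)
  | _, _, beside a b => fun i => Sum.map a.top b.top (finSumFinEquiv.symm i)

/-- The piece containing a given bottom boundary point. -/
def bot : {m n : ℕ} → (a : Diag m n) → Fin n → a.Piece
  | _, _, strands _ => fun i => i
  | _, _, cap => fun _ => ()
  | _, _, cup => fun i => i.elim0
  | _, _, stack _ b => fun i => .inr (b.bot i)
  | _, _, beside a b => fun i => Sum.map a.bot b.bot (finSumFinEquiv.symm i)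

/-- Two pieces are connected if they lie on the same component of the 1-manifold. -/
def conn : {m n : ℕ} → (a : Diag m n) → Setoid a.Piece
  | _, _, strands _ => ⊥
  | _, _, cap => ⊥
  | _, _, cup => ⊥
  | _, _, stack a b => glueConn a.conn b.conn a.bot b.top
  | _, _, beside a b => glueConn (K := Empty) a.conn b.conn Empty.elim Empty.elim

/-- Weights whose sum over a component is its Euler characteristic: `1` for an arc and `0` for a
circle. -/
def euler : {m n : ℕ} → (a : Diag m n) → a.Piece → ℤ
  | _, _, strands _ => fun _ => 1
  | _, _, cap => fun _ => 1
  | _, _, cup => fun _ => 1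
  | _, _, stack a b => glueEuler a.euler b.euler b.top (fun _ => 1)
  | _, _, beside a b => glueEuler (K := Empty) a.euler b.euler Empty.elim Empty.elim

/-- The components of the 1-manifold. -/
abbrev Components {m n : ℕ} (a : Diag m n) : Type := Comp a.conn

/-- The circle. -/
def circle : Diag 0 0 := stack cap cup

/-- The turnback `∪` above `∩`. -/
def turn : Diag 2 2 := stack cup cap

/-- Reflection in the horizontal axis. -/
def flip : {m n : ℕ} → Diag m n → Diag n m
  | _, _, strands n => strands n
  | _, _, cap => cup
  | _, _, cup => cap
  | _, _, stack a b => stack b.flip a.flip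
  | _, _, beside a b => beside a.flip b.flip

/-- Transport along equalities of the numbers of boundary points. -/
def cast {m n m' n' : ℕ} (hm : m = m') (hn : n = n') (a : Diag m n) : Diag m' n' :=
  hm ▸ hn ▸ a

/-- `n` nested arcs `∩`. -/
def rainbow : (n : ℕ) → Diag 0 (n + n)
  | 0 => strands 0
  | n + 1 =>
    stack (rainbow n)
      (cast rfl (by omega) (beside (beside (strands n) cap) (strands n)) :
        Diag (n + n) (n + 1 + (n + 1)))

/-- `i` strands, then an arc `∩`, then `j` strands. -/
def capAt (i j : ℕ) : Diag (i + 0 + j) (i + 2 + j) :=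
  beside (beside (strands i) cap) (strands j)

end Diag

/-! ### Dotted cobordisms -/

/-- Dotted cobordisms between planar diagrams with the same boundary points, as composites of
elementary ones: the trace of an isotopy (a bijection of components compatible with the
boundary points and with the distinction between arcs and circles), a single dot on
`a × [0,1]`, the birth and the death of a circle, the two saddles, the composition `comp` of
cobordisms, and the planar gluings `stack` and `beside` of cobordisms along vertical walls. -/
inductive Cob : {m n : ℕ} → Diag m n → Diag m n → Type
  | isotopy {m n : ℕ} {a b : Diag m n} (e : a.Components ≃ b.Components)
      (htop : ∀ i, e (Quotient.mk _ (a.top i)) = Quotient.mk _ (b.top i))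
      (hbot : ∀ i, e (Quotient.mk _ (a.bot i)) = Quotient.mk _ (b.bot i))
      (heuler : ∀ c, compSum b.conn b.euler (e c) = compSum a.conn a.euler c) : Cob a b
  | dot {m n : ℕ} (a : Diag m n) (p : a.Piece) : Cob a a
  | birth : Cob (Diag.strands 0) Diag.circle
  | death : Cob Diag.circle (Diag.strands 0)
  | saddle : Cob (Diag.strands 2) Diag.turn
  | cosaddle : Cob Diag.turn (Diag.strands 2)
  | comp {m n : ℕ} {a b c : Diag m n} (f : Cob a b) (g : Cob b c) : Cob a c
  | stack {m k n : ℕ} {a a' : Diag m k} {b b' : Diag k n} (f : Cob a a') (g : Cob b b') :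
      Cob (a.stack b) (a'.stack b')
  | beside {m n m' n' : ℕ} {a a' : Diag m n} {b b' : Diag m' n'} (f : Cob a a') (g : Cob b b') :
      Cob (a.beside b) (a'.beside b')

/-- The combinatorial data of a dotted surface with lower boundary `a` and upper boundary `b`: a
finite set of pieces glued according to `conn`, the pieces on which the pieces of `a` and of `b`
lie, and the Euler characteristic and the number of dots, distributed over the pieces. -/
structure Surface {m n : ℕ} (a b : Diag m n) where
  Piece : Type
  [fintypePiece : Fintype Piece]
  conn : Setoid Piece
  inn : a.Piece → Piece
  out : b.Piece → Piece
  euler : Piece → ℤ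
  dots : Piece → ℕ

attribute [instance] Surface.fintypePiece

/-- Two dotted surfaces are homeomorphic relative to the boundary (respecting the number of dots
on each component): there is a bijection between their components that is compatible with the
boundary, the Euler characteristics, and the numbers of dots. (All surfaces here are
orientable, so that the boundary and the Euler characteristic determine a component.) -/
def Surface.Homeo {m n : ℕ} {a b : Diag m n} (S T : Surface a b) : Prop :=
  ∃ e : Comp S.conn ≃ Comp T.conn,
    (∀ p, e (Quotient.mk _ (S.inn p)) = Quotient.mk _ (T.inn p)) ∧
    (∀ p, e (Quotient.mk _ (S.out p)) = Quotient.mk _ (T.out p)) ∧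
    (∀ c, compSum T.conn T.euler (e c) = compSum S.conn S.euler c) ∧
    (∀ c, compSum T.conn T.dots (e c) = compSum S.conn S.dots c)

namespace Surface

open Classical in
/-- Attach a handle to (the component of) a piece. -/
def handle {m n : ℕ} {a b : Diag m n} (S : Surface a b) (p : S.Piece) : Surface a b :=
  { S with euler := S.euler - Pi.single p 2 }

/-- The surface `a × [0,1]`. -/
abbrev cylinder {m n : ℕ} (a : Diag m n) : Surface a a where
  Piece := a.Piece
  conn := a.conn
  inn := id
  out := id
  euler := a.euler
  dots := 0

/-- A disk with the given boundary. -/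
abbrev disk {m n : ℕ} (a b : Diag m n) : Surface a b where
  Piece := Unit
  conn := ⊥
  inn := fun _ => ()
  out := fun _ => ()
  euler := 1
  dots := 0

/-- Composition: gluing along the common boundary diagram. -/
abbrev comp {m n : ℕ} {a b c : Diag m n} (S : Surface a b) (T : Surface b c) : Surface a c where
  Piece := S.Piece ⊕ T.Piece
  conn := glueConn S.conn T.conn S.out T.inn
  inn := fun p => .inl (S.inn p)
  out := fun p => .inr (T.out p)
  euler := glueEuler S.euler T.euler T.inn b.euler
  dots := Sum.elim S.dots T.dots

/-- Planar gluing along the `k` vertical intervals `{j} × [0,1]`. -/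
abbrev stack {m k n : ℕ} {a a' : Diag m k} {b b' : Diag k n} (S : Surface a a')
    (T : Surface b b') : Surface (a.stack b) (a'.stack b') where
  Piece := S.Piece ⊕ T.Piece
  conn := glueConn S.conn T.conn (fun j => S.inn (a.bot j)) (fun j => T.inn (b.top j))
  inn := Sum.map S.inn T.inn
  out := Sum.map S.out T.out
  euler := glueEuler S.euler T.euler (fun j => T.inn (b.top j)) (fun _ => 1)
  dots := Sum.elim S.dots T.dots

/-- Juxtaposition: disjoint union. -/
abbrev beside {m n m' n' : ℕ} {a a' : Diag m n} {b b' : Diag m' n'} (S : Surface a a')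
    (T : Surface b b') : Surface (a.beside b) (a'.beside b') where
  Piece := S.Piece ⊕ T.Piece
  conn := glueConn (K := Empty) S.conn T.conn Empty.elim Empty.elim
  inn := Sum.map S.inn T.inn
  out := Sum.map S.out T.out
  euler := glueEuler (K := Empty) S.euler T.euler Empty.elim Empty.elim
  dots := Sum.elim S.dots T.dots

end Surface

namespace Cob

open Classical in
/-- The surface underlying a cobordism. -/
def surface : {m n : ℕ} → {a b : Diag m n} → Cob a b → Surface a b
  | _, _, a, _, isotopy e _ _ _ =>
    { Surface.cylinder a with out := fun p => (e.symm (Quotient.mk _ p)).out }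
  | _, _, _, _, dot a p => { Surface.cylinder a with dots := Pi.single p 1 }
  | _, _, _, _, birth => Surface.disk _ _
  | _, _, _, _, death => Surface.disk _ _
  | _, _, _, _, saddle => Surface.disk _ _
  | _, _, _, _, cosaddle => Surface.disk _ _
  | _, _, _, _, comp f g => f.surface.comp g.surface
  | _, _, _, _, stack f g => f.surface.stack g.surface
  | _, _, _, _, beside f g => f.surface.beside g.surface

/-- The quantum degree `-χ(S) + (m + n) / 2 + 2 · #dots`: each birth and death contributes `-1`,
each saddle `1`, each dot `2`. -/
def deg : {m n : ℕ} → {a b : Diag m n} → Cob a b → ℤ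
  | _, _, _, _, isotopy _ _ _ _ => 0
  | _, _, _, _, dot _ _ => 2
  | _, _, _, _, birth => -1
  | _, _, _, _, death => -1
  | _, _, _, _, saddle => 1
  | _, _, _, _, cosaddle => 1
  | _, _, _, _, comp f g => f.deg + g.deg
  | _, _, _, _, stack f g => f.deg + g.deg
  | _, _, _, _, beside f g => f.deg + g.deg

/-- The identity cobordism `a × [0,1]`. -/
def refl {m n : ℕ} (a : Diag m n) : Cob a a :=
  isotopy (Equiv.refl _) (fun _ => rfl) (fun _ => rfl) (fun _ => rfl)

end Cob

/-! ### Basic facts on gluing -/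

section Gluing

theorem push_push {K B C M : Type} [Fintype K] [Fintype B] [AddCommMonoid M] (g : K → B)
    (h : B → C) (w : K → M) : push h (push g w) = push (fun k => h (g k)) w := by
  classical
  funext c
  simp only [push]
  have : ∀ b, (if h b = c then ∑ k, (if g k = b then w k else 0) else 0)
      = ∑ k, if g k = b then (if h (g k) = c then w k else 0) else 0 := by
    intro b
    split_ifs with hb
    · exact Finset.sum_congr rfl fun k _ => by
        split_ifs with h1 h2 <;> first | rfl | (subst h1; exact absurd hb h2)
    · exact (Finset.sum_eq_zero fun k _ => by
        split_ifs with h1 h2 <;> first | rfl | (subst h1; exact absurd h2 hb)).symm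
  rw [Finset.sum_congr rfl fun b _ => this b, Finset.sum_comm]
  exact Finset.sum_congr rfl fun k _ => by simp

theorem push_sum {A B C M : Type} [Fintype A] [Fintype B] [AddCommMonoid M] (h : A ⊕ B → C)
    (w : A ⊕ B → M) :
    push h w = push (fun a => h (.inl a)) (fun a => w (.inl a)) +
      push (fun b => h (.inr b)) (fun b => w (.inr b)) := by
  funext c
  simp [push]

theorem push_id {A M : Type} [Fintype A] [AddCommMonoid M] (w : A → M) :
    push (fun a => a) w = w := by
  classical
  funext c
  simp [push]

theorem push_sub {A C : Type} [Fintype A] (h : A → C) (w w' : A → ℤ) :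
    push h (fun a => w a - w' a) = push h w - push h w' := by
  funext c
  simp only [push, Pi.sub_apply, ← Finset.sum_sub_distrib]
  exact Finset.sum_congr rfl fun k _ => by split_ifs <;> simp

theorem push_zero {A C M : Type} [Fintype A] [AddCommMonoid M] (h : A → C) :
    push h (0 : A → M) = 0 := by
  funext c
  simp [push]

theorem push_apply_equiv {A B M : Type} [Fintype A] [AddCommMonoid M] (e : A ≃ B) (w : A → M)
    (a : A) : push e w (e a) = w a := by
  classical
  simp [push]

theorem push_inj {A B C M : Type} [Fintype A] [AddCommMonoid M] {h : B → C}
    (hh : Function.Injective h) (g : A → B) (w : A → M) (b : B) :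
    push (fun a => h (g a)) w (h b) = push g w b := by
  classical
  simp only [push]
  refine Finset.sum_congr rfl fun x _ => ?_
  by_cases hx : g x = b
  · rw [if_pos hx, if_pos (congrArg h hx)]
  · rw [if_neg hx, if_neg fun h' => hx (hh h')]

theorem push_inl_inl {A B C M : Type} [Fintype A] [AddCommMonoid M] (h : A → B) (w : A → M)
    (b : B) : push (fun a => (Sum.inl (h a) : B ⊕ C)) w (.inl b) = push h w b :=
  push_inj Sum.inl_injective h w b

theorem push_inr_inr {A B C M : Type} [Fintype A] [AddCommMonoid M] (h : A → B) (w : A → M)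
    (b : B) : push (fun a => (Sum.inr (h a) : C ⊕ B)) w (.inr b) = push h w b :=
  push_inj Sum.inr_injective h w b

theorem push_inl_inr {A B C M : Type} [Fintype A] [AddCommMonoid M] (h : A → B) (w : A → M)
    (c : C) : push (fun a => (Sum.inl (h a) : B ⊕ C)) w (.inr c) = 0 := by
  simp [push]

theorem push_inr_inl {A B C M : Type} [Fintype A] [AddCommMonoid M] (h : A → B) (w : A → M)
    (c : C) : push (fun a => (Sum.inr (h a) : C ⊕ B)) w (.inl c) = 0 := by
  simp [push]

theorem push_empty {C M : Type} [AddCommMonoid M] (h : Empty → C) (w : Empty → M) :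
    push h w = 0 := by
  funext c
  simp [push]

theorem sum_push {K B M : Type} [Fintype K] [Fintype B] [AddCommMonoid M] (g : K → B)
    (w : K → M) : ∑ b, push g w b = ∑ k, w k := by
  classical
  simp only [push]
  rw [Finset.sum_comm]
  exact Finset.sum_congr rfl fun k _ => by simp

theorem sum_glueEuler {A B K : Type} [Fintype A] [Fintype B] [Fintype K] (χ : A → ℤ)
    (χ' : B → ℤ) (g : K → B) (κ : K → ℤ) :
    ∑ p, glueEuler χ χ' g κ p = ∑ p, χ p + ∑ p, χ' p - ∑ k, κ k := by
  simp only [glueEuler, Fintype.sum_sum_type, Sum.elim_inl, Sum.elim_inr,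
    Finset.sum_sub_distrib, sum_push]
  ring

variable {A B K : Type} {s : Setoid A} {t : Setoid B} {f : K → A} {g : K → B}

theorem glueConn_inl {a a' : A} (h : s a a') : glueConn s t f g (.inl a) (.inl a') :=
  .rel _ _ (.left h)

theorem glueConn_inr {b b' : B} (h : t b b') : glueConn s t f g (.inr b) (.inr b') :=
  .rel _ _ (.right h)

theorem glueConn_glue (k : K) : glueConn s t f g (.inl (f k)) (.inr (g k)) :=
  .rel _ _ (.glue k)

theorem glueConn_le {C : Type} {r : Setoid C} (φ : A ⊕ B → C)
    (h1 : ∀ a a', s a a' → r (φ (.inl a)) (φ (.inl a')))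
    (h2 : ∀ b b', t b b' → r (φ (.inr b)) (φ (.inr b')))
    (h3 : ∀ k, r (φ (.inl (f k))) (φ (.inr (g k)))) {x y : A ⊕ B}
    (h : glueConn s t f g x y) : r (φ x) (φ y) := by
  induction h with
  | rel x y h =>
    cases h with
    | left h => exact h1 _ _ h
    | right h => exact h2 _ _ h
    | glue k => exact h3 k
  | refl x => exact r.refl _
  | symm x y _ ih => exact r.symm ih
  | trans x y z _ _ ih1 ih2 => exact r.trans ih1 ih2

end Gluing

section Homeo

variable {m n : ℕ} {a b : Diag m n}

/-- A map of pieces that is bijective on components and compatible with all data is a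
homeomorphism. -/
theorem Surface.Homeo.of_map {S T : Surface a b} (φ : S.Piece → T.Piece)
    (ψ : T.Piece → S.Piece)
    (h1 : ∀ x y, S.conn x y → T.conn (φ x) (φ y)) (h2 : ∀ x y, T.conn x y → S.conn (ψ x) (ψ y))
    (h3 : ∀ x, S.conn (ψ (φ x)) x) (h4 : ∀ x, T.conn (φ (ψ x)) x)
    (hi : ∀ p, T.conn (φ (S.inn p)) (T.inn p)) (ho : ∀ p, T.conn (φ (S.out p)) (T.out p))
    (he : push φ S.euler = T.euler) (hd : push φ S.dots = T.dots) : S.Homeo T := by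
  refine ⟨⟨Quotient.map φ h1, Quotient.map ψ h2, ?_, ?_⟩, ?_, ?_, ?_, ?_⟩
  · rintro ⟨x⟩; exact Quotient.sound (h3 x)
  · rintro ⟨x⟩; exact Quotient.sound (h4 x)
  · intro p; exact Quotient.sound (hi p)
  · intro p; exact Quotient.sound (ho p)
  all_goals
    intro c
    simp only [compSum]
    first
      | rw [← he, push_push]
      | rw [← hd, push_push]
    generalize hE : (⟨Quotient.map φ h1, Quotient.map ψ h2, _, _⟩ :
      Comp S.conn ≃ Comp T.conn) = E
    have hE' : (fun k => Quotient.mk T.conn (φ k)) = fun k => E (Quotient.mk S.conn k) := by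
      subst hE; rfl
    rw [hE']
    exact push_inj E.injective _ _ _

theorem Surface.Homeo.of_equiv {S T : Surface a b} (e : S.Piece ≃ T.Piece)
    (h1 : ∀ x y, S.conn x y → T.conn (e x) (e y))
    (h2 : ∀ x y, T.conn x y → S.conn (e.symm x) (e.symm y))
    (hi : ∀ p, T.conn (e (S.inn p)) (T.inn p)) (ho : ∀ p, T.conn (e (S.out p)) (T.out p))
    (he : ∀ x, T.euler (e x) = S.euler x) (hd : ∀ x, T.dots (e x) = S.dots x) : S.Homeo T := by
  refine .of_map e e.symm h1 h2 (fun x => by simp)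
    (fun x => by simp) hi ho ?_ ?_
  · funext x
    obtain ⟨x, rfl⟩ := e.surjective x
    rw [push_apply_equiv, he]
  · funext x
    obtain ⟨x, rfl⟩ := e.surjective x
    rw [push_apply_equiv, hd]

/-- The boundary of a surface is embedded compatibly with the connectedness of diagrams and with
the vertical intervals over the boundary points. -/
structure Surface.Compat (S : Surface a b) : Prop where
  inn : ∀ p q, a.conn p q → S.conn (S.inn p) (S.inn q)
  out : ∀ p q, b.conn p q → S.conn (S.out p) (S.out q)
  top : ∀ i, S.conn (S.inn (a.top i)) (S.out (b.top i))
  bot : ∀ i, S.conn (S.inn (a.bot i)) (S.out (b.bot i))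

end Homeo

namespace Surface

variable {m n : ℕ} {a b c d : Diag m n}

theorem Compat.comp {S : Surface a b} {T : Surface b c} (hS : S.Compat) (hT : T.Compat) :
    (S.comp T).Compat where
  inn _ _ h := glueConn_inl (hS.inn _ _ h)
  out _ _ h := glueConn_inr (hT.out _ _ h)
  top i := Setoid.trans' _ (glueConn_inl (hS.top i))
    (Setoid.trans' _ (glueConn_glue _) (glueConn_inr (hT.top i)))
  bot i := Setoid.trans' _ (glueConn_inl (hS.bot i))
    (Setoid.trans' _ (glueConn_glue _) (glueConn_inr (hT.bot i)))

theorem Compat.stack {m k n : ℕ} {a a' : Diag m k} {b b' : Diag k n} {S : Surface a a'}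
    {T : Surface b b'} (hS : S.Compat) (hT : T.Compat) : (S.stack T).Compat where
  inn _ _ h := glueConn_le (r := (S.stack T).conn) (Sum.map S.inn T.inn)
    (fun _ _ h => glueConn_inl (hS.inn _ _ h)) (fun _ _ h => glueConn_inr (hT.inn _ _ h))
    (fun j => glueConn_glue j) h
  out _ _ h := glueConn_le (r := (S.stack T).conn) (Sum.map S.out T.out)
    (fun _ _ h => glueConn_inl (hS.out _ _ h)) (fun _ _ h => glueConn_inr (hT.out _ _ h))
    (fun j => Setoid.trans' _ (Setoid.symm' _ (glueConn_inl (hS.bot j)))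
      (Setoid.trans' _ (glueConn_glue j) (glueConn_inr (hT.top j)))) h
  top i := glueConn_inl (hS.top i)
  bot i := glueConn_inr (hT.bot i)

theorem Compat.beside {m n m' n' : ℕ} {a a' : Diag m n} {b b' : Diag m' n'} {S : Surface a a'}
    {T : Surface b b'} (hS : S.Compat) (hT : T.Compat) : (S.beside T).Compat where
  inn _ _ h := glueConn_le (r := (S.beside T).conn) (Sum.map S.inn T.inn)
    (fun _ _ h => glueConn_inl (hS.inn _ _ h)) (fun _ _ h => glueConn_inr (hT.inn _ _ h))
    (fun j => j.elim) h
  out _ _ h := glueConn_le (r := (S.beside T).conn) (Sum.map S.out T.out)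
    (fun _ _ h => glueConn_inl (hS.out _ _ h)) (fun _ _ h => glueConn_inr (hT.out _ _ h))
    (fun j => j.elim) h
  top i := by
    change (S.beside T).conn (Sum.map S.inn T.inn (Sum.map a.top b.top (finSumFinEquiv.symm i)))
      (Sum.map S.out T.out (Sum.map a'.top b'.top (finSumFinEquiv.symm i)))
    rcases finSumFinEquiv.symm i with x | x
    · exact glueConn_inl (hS.top x)
    · exact glueConn_inr (hT.top x)
  bot i := by
    change (S.beside T).conn (Sum.map S.inn T.inn (Sum.map a.bot b.bot (finSumFinEquiv.symm i)))
      (Sum.map S.out T.out (Sum.map a'.bot b'.bot (finSumFinEquiv.symm i)))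
    rcases finSumFinEquiv.symm i with x | x
    · exact glueConn_inl (hS.bot x)
    · exact glueConn_inr (hT.bot x)

theorem Homeo.id_comp {I : Surface a a} (S : Surface a b) (hS : S.Compat)
    {o : a.Piece → a.Piece} (ho : ∀ p, a.conn (o p) p)
    (hI : I = { cylinder a with out := o }) : (I.comp S).Homeo S := by
  subst hI
  refine .of_map (Sum.elim S.inn id) Sum.inr ?_ ?_ ?_ ?_ ?_ ?_ ?_ ?_
  · intro x y h
    exact glueConn_le (r := S.conn) (Sum.elim S.inn id)
      (fun _ _ h => hS.inn _ _ h) (fun _ _ h => h) (fun k => hS.inn _ _ (ho k)) h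
  · intro x y h; exact glueConn_inr h
  · rintro (x | x)
    · exact Setoid.symm' _ (Setoid.trans' _ (glueConn_inl (Setoid.symm' _ (ho x)))
        (glueConn_glue x))
    · exact Setoid.refl' _ _
  · intro x; exact Setoid.refl' _ _
  · intro x; exact Setoid.refl' _ _
  · intro x; exact Setoid.refl' _ _
  · rw [push_sum]
    change push S.inn a.euler + push (fun p => p) (fun p => S.euler p - push S.inn a.euler p)
      = S.euler
    rw [push_id]
    exact add_sub_cancel _ _
  · rw [push_sum]
    change push S.inn 0 + push (fun p => p) S.dots = S.dots
    rw [push_id, push_zero, zero_add]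

theorem Homeo.comp_id {I : Surface b b} (S : Surface a b) (hS : S.Compat)
    {o : b.Piece → b.Piece} (ho : ∀ p, b.conn (o p) p)
    (hI : I = { cylinder b with out := o }) : (S.comp I).Homeo S := by
  subst hI
  refine .of_map (Sum.elim id S.out) Sum.inl ?_ ?_ ?_ ?_ ?_ ?_ ?_ ?_
  · intro x y h
    exact glueConn_le (r := S.conn) (Sum.elim id S.out)
      (fun _ _ h => h) (fun _ _ h => hS.out _ _ h) (fun k => Setoid.refl' _ _) h
  · intro x y h; exact glueConn_inl h
  · rintro (x | x)
    · exact Setoid.refl' _ _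
    · exact glueConn_glue x
  · intro x; exact Setoid.refl' _ _
  · intro x; exact Setoid.refl' _ _
  · intro x; exact hS.out _ _ (ho x)
  · rw [push_sum]
    change push (fun p => p) S.euler
      + push S.out (fun p => b.euler p - push (fun p => p) b.euler p) = S.euler
    rw [push_id, push_id]
    simp only [sub_self]
    exact (congrArg _ (push_zero _)).trans (add_zero _)
  · rw [push_sum]
    change push (fun p => p) S.dots + push S.out 0 = S.dots
    rw [push_id, push_zero, add_zero]

theorem Homeo.assoc (S : Surface a b) (T : Surface b c) (U : Surface c d) :
    ((S.comp T).comp U).Homeo (S.comp (T.comp U)) := by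
  refine .of_equiv (Equiv.sumAssoc _ _ _) ?_ ?_ ?_ ?_ ?_ ?_
  · intro x y hxy
    refine glueConn_le (r := (S.comp (T.comp U)).conn) (Equiv.sumAssoc _ _ _)
      (fun x y hxy => ?_) (fun _ _ h => glueConn_inr (glueConn_inr h))
      (fun k => ?_) hxy
    swap
    · exact glueConn_inr (glueConn_glue k)
    exact glueConn_le (r := (S.comp (T.comp U)).conn)
      (fun x => Equiv.sumAssoc _ _ U.Piece (.inl x))
      (fun _ _ h => glueConn_inl h) (fun _ _ h => glueConn_inr (glueConn_inl h))
      (fun k => glueConn_glue k) hxy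
  · intro x y hxy
    refine glueConn_le (r := ((S.comp T).comp U).conn) (Equiv.sumAssoc _ _ _).symm
      (fun _ _ h => glueConn_inl (glueConn_inl h)) (fun x y hxy => ?_)
      (fun k => ?_) hxy
    swap
    · exact glueConn_inl (glueConn_glue k)
    exact glueConn_le (r := ((S.comp T).comp U).conn)
      (fun x => (Equiv.sumAssoc S.Piece _ _).symm (.inr x))
      (fun _ _ h => glueConn_inl (glueConn_inr h)) (fun _ _ h => glueConn_inr h)
      (fun k => glueConn_glue k) hxy
  · intro p; exact Setoid.refl' _ _
  · intro p; exact Setoid.refl' _ _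
  · rintro ((x | x) | x)
    · rfl
    · change T.euler x - push (fun p => (Sum.inl (T.inn p) : T.Piece ⊕ U.Piece)) b.euler (.inl x)
        = T.euler x - push T.inn b.euler x
      rw [push_inl_inl]
    · change U.euler x - push U.inn c.euler x -
          push (fun p => (Sum.inl (T.inn p) : T.Piece ⊕ U.Piece)) b.euler (.inr x)
        = U.euler x - push U.inn c.euler x
      rw [push_inl_inr, sub_zero]
  · rintro ((x | x) | x) <;> rfl

theorem Homeo.stack_comp {m k n : ℕ} {a a' a'' : Diag m k} {b b' b'' : Diag k n}
    (S : Surface a a') (S' : Surface a' a'') (T : Surface b b') (T' : Surface b' b'')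
    (hS : S.Compat) (hT : T.Compat) :
    ((S.comp S').stack (T.comp T')).Homeo ((S.stack T).comp (S'.stack T')) := by
  refine .of_equiv (Equiv.sumSumSumComm _ _ _ _) ?_ ?_ ?_ ?_ ?_ ?_
  · intro x y hxy
    refine glueConn_le (r := ((S.stack T).comp (S'.stack T')).conn)
      (Equiv.sumSumSumComm _ _ _ _) (fun x y hxy => ?_) (fun x y hxy => ?_)
      (fun k => ?_) hxy
    · exact glueConn_le (r := ((S.stack T).comp (S'.stack T')).conn)
        (fun x => Equiv.sumSumSumComm _ _ T.Piece T'.Piece (.inl x))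
        (fun _ _ h => glueConn_inl (glueConn_inl h)) (fun _ _ h => glueConn_inr (glueConn_inl h))
        (fun k => glueConn_glue (f := Sum.map S.out T.out) (Sum.inl k)) hxy
    · exact glueConn_le (r := ((S.stack T).comp (S'.stack T')).conn)
        (fun x => Equiv.sumSumSumComm S.Piece S'.Piece _ _ (.inr x))
        (fun _ _ h => glueConn_inl (glueConn_inr h)) (fun _ _ h => glueConn_inr (glueConn_inr h))
        (fun k => glueConn_glue (f := Sum.map S.out T.out) (Sum.inr k)) hxy
    · exact glueConn_inl (glueConn_glue k)
  · intro x y hxy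
    refine glueConn_le (r := ((S.comp S').stack (T.comp T')).conn)
      (Equiv.sumSumSumComm _ _ _ _).symm
      (fun x y hxy => ?_) (fun x y hxy => ?_) (fun k => ?_) hxy
    · exact glueConn_le (r := ((S.comp S').stack (T.comp T')).conn)
        (fun x => (Equiv.sumSumSumComm _ S'.Piece _ T'.Piece).symm (.inl x))
        (fun _ _ h => glueConn_inl (glueConn_inl h)) (fun _ _ h => glueConn_inr (glueConn_inl h))
        (fun k => glueConn_glue k) hxy
    · refine glueConn_le (r := ((S.comp S').stack (T.comp T')).conn)
        (fun x => (Equiv.sumSumSumComm S.Piece _ T.Piece _).symm (.inr x))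
        (fun _ _ h => glueConn_inl (glueConn_inr h)) (fun _ _ h => glueConn_inr (glueConn_inr h))
        (fun k => ?_) hxy
      have h1 : ((S.comp S').stack (T.comp T')).conn
          (.inl (.inl (S.inn (a.bot k)))) (.inl (.inr (S'.inn (a'.bot k)))) :=
        Setoid.trans' _ (glueConn_inl (glueConn_inl (hS.bot k))) (glueConn_inl (glueConn_glue _))
      have h2 : ((S.comp S').stack (T.comp T')).conn
          (.inr (.inl (T.inn (b.top k)))) (.inr (.inr (T'.inn (b'.top k)))) :=
        Setoid.trans' _ (glueConn_inr (glueConn_inl (hT.top k))) (glueConn_inr (glueConn_glue _))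
      exact Setoid.trans' _ (Setoid.symm' _ h1) (Setoid.trans' _ (glueConn_glue k) h2)
    · rcases k with k | k
      · exact glueConn_inl (glueConn_glue k)
      · exact glueConn_inr (glueConn_glue k)
  · rintro (p | p) <;> exact Setoid.refl' _ _
  · rintro (p | p) <;> exact Setoid.refl' _ _
  · have key : ∀ y, push (Sum.map S'.inn T'.inn) (a'.stack b').euler y =
        Sum.elim (push S'.inn a'.euler) (fun x => push T'.inn b'.euler x -
          push (fun j => T'.inn (b'.top j)) (fun _ => 1) x) y := by
      intro y
      refine (congrFun (push_sum (A := a'.Piece) (B := b'.Piece) _ _) y).trans ?_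
      change push (fun p => (Sum.inl (S'.inn p) : S'.Piece ⊕ T'.Piece)) a'.euler y +
        push (fun p => (Sum.inr (T'.inn p) : S'.Piece ⊕ T'.Piece))
          (fun p => b'.euler p - push b'.top (fun _ => 1) p) y = _
      rcases y with y | y
      · rw [push_inl_inl, push_inr_inl, add_zero]; rfl
      · rw [push_inl_inr, push_inr_inr, zero_add, push_sub]
        exact congrArg (push T'.inn b'.euler y - ·) (congrFun (push_push _ _ _) y)
    rintro ((x | x) | (x | x))
    · rfl
    · exact congrArg (S'.euler x - ·) (key (.inl x))
    · change T.euler x - push (fun j => T.inn (b.top j)) (fun _ => 1) x = T.euler x -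
        push (fun j => (Sum.inl (T.inn (b.top j)) : T.Piece ⊕ T'.Piece)) (fun _ => 1) (.inl x)
      rw [push_inl_inl]
    · change T'.euler x - push (fun j => T'.inn (b'.top j)) (fun _ => 1) x -
          push (Sum.map S'.inn T'.inn) (a'.stack b').euler (.inr x) =
        T'.euler x - push T'.inn b'.euler x -
          push (fun j => (Sum.inl (T.inn (b.top j)) : T.Piece ⊕ T'.Piece)) (fun _ => 1) (.inr x)
      rw [key, push_inl_inr, Sum.elim_inr]
      ring
  · rintro ((x | x) | (x | x)) <;> rfl

theorem Homeo.beside_comp {m n m' n' : ℕ} {a a' a'' : Diag m n} {b b' b'' : Diag m' n'}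
    (S : Surface a a') (S' : Surface a' a'') (T : Surface b b') (T' : Surface b' b'') :
    ((S.comp S').beside (T.comp T')).Homeo ((S.beside T).comp (S'.beside T')) := by
  refine .of_equiv (Equiv.sumSumSumComm _ _ _ _) ?_ ?_ ?_ ?_ ?_ ?_
  · intro x y hxy
    refine glueConn_le (r := ((S.beside T).comp (S'.beside T')).conn)
      (Equiv.sumSumSumComm _ _ _ _) (fun x y hxy => ?_) (fun x y hxy => ?_)
      (fun k => k.elim) hxy
    · exact glueConn_le (r := ((S.beside T).comp (S'.beside T')).conn)
        (fun x => Equiv.sumSumSumComm _ _ T.Piece T'.Piece (.inl x))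
        (fun _ _ h => glueConn_inl (glueConn_inl h)) (fun _ _ h => glueConn_inr (glueConn_inl h))
        (fun k => glueConn_glue (f := Sum.map S.out T.out) (Sum.inl k)) hxy
    · exact glueConn_le (r := ((S.beside T).comp (S'.beside T')).conn)
        (fun x => Equiv.sumSumSumComm S.Piece S'.Piece _ _ (.inr x))
        (fun _ _ h => glueConn_inl (glueConn_inr h)) (fun _ _ h => glueConn_inr (glueConn_inr h))
        (fun k => glueConn_glue (f := Sum.map S.out T.out) (Sum.inr k)) hxy
  · intro x y hxy
    refine glueConn_le (r := ((S.comp S').beside (T.comp T')).conn)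
      (Equiv.sumSumSumComm _ _ _ _).symm
      (fun x y hxy => ?_) (fun x y hxy => ?_) (fun k => ?_) hxy
    · exact glueConn_le (r := ((S.comp S').beside (T.comp T')).conn)
        (fun x => (Equiv.sumSumSumComm _ S'.Piece _ T'.Piece).symm (.inl x))
        (fun _ _ h => glueConn_inl (glueConn_inl h)) (fun _ _ h => glueConn_inr (glueConn_inl h))
        (fun k => k.elim) hxy
    · exact glueConn_le (r := ((S.comp S').beside (T.comp T')).conn)
        (fun x => (Equiv.sumSumSumComm S.Piece _ T.Piece _).symm (.inr x))
        (fun _ _ h => glueConn_inl (glueConn_inr h)) (fun _ _ h => glueConn_inr (glueConn_inr h))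
        (fun k => k.elim) hxy
    · rcases k with k | k
      · exact glueConn_inl (glueConn_glue k)
      · exact glueConn_inr (glueConn_glue k)
  · rintro (p | p) <;> exact Setoid.refl' _ _
  · rintro (p | p) <;> exact Setoid.refl' _ _
  · have key : ∀ y, push (Sum.map S'.inn T'.inn) (a'.beside b').euler y =
        Sum.elim (push S'.inn a'.euler) (push T'.inn b'.euler) y := by
      intro y
      refine (congrFun (push_sum (A := a'.Piece) (B := b'.Piece) _ _) y).trans ?_
      change push (fun p => (Sum.inl (S'.inn p) : S'.Piece ⊕ T'.Piece)) a'.euler y +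
        push (fun p => (Sum.inr (T'.inn p) : S'.Piece ⊕ T'.Piece))
          (fun p => b'.euler p - push (K := Empty) _ _ p) y = _
      simp only [push_empty, Pi.zero_apply, sub_zero]
      rcases y with y | y
      · rw [push_inl_inl, push_inr_inl, add_zero]; rfl
      · rw [push_inl_inr, push_inr_inr, zero_add]; rfl
    rintro ((x | x) | (x | x))
    · rfl
    · exact congrArg (S'.euler x - ·) (key (.inl x))
    · change T.euler x - push (K := Empty) _ _ x = T.euler x -
        push (K := Empty) (B := T.Piece ⊕ T'.Piece) _ _ (.inl x)
      simp only [push_empty, Pi.zero_apply]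
    · change T'.euler x - push (K := Empty) _ _ x -
          push (Sum.map S'.inn T'.inn) (a'.beside b').euler (.inr x) =
        T'.euler x - push T'.inn b'.euler x -
          push (K := Empty) (B := T.Piece ⊕ T'.Piece) _ _ (.inr x)
      rw [key, Sum.elim_inr]
      simp only [push_empty, Pi.zero_apply, sub_zero]
  · rintro ((x | x) | (x | x)) <;> rfl

end Surface

namespace Cob

theorem surface_compat {m n : ℕ} {a b : Diag m n} (f : Cob a b) : f.surface.Compat := by
  induction f with
  | @isotopy m n a b e htop hbot heuler =>
    refine ⟨fun p q h => h, fun p q h => ?_, fun i => ?_, fun i => ?_⟩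
    · refine Quotient.exact ?_
      simp only [surface, Quotient.out_eq]
      exact congrArg _ (Quotient.sound h)
    · refine Quotient.exact (Eq.symm ?_)
      simp only [surface, Quotient.out_eq, id]
      rw [← htop]; simp
    · refine Quotient.exact (Eq.symm ?_)
      simp only [surface, Quotient.out_eq, id]
      rw [← hbot]; simp
  | dot a p => exact ⟨fun p q h => h, fun p q h => h, fun i => a.conn.refl _,
      fun i => a.conn.refl _⟩
  | birth => exact ⟨fun _ _ _ => rfl, fun _ _ _ => rfl, fun _ => rfl, fun _ => rfl⟩
  | death => exact ⟨fun _ _ _ => rfl, fun _ _ _ => rfl, fun _ => rfl, fun _ => rfl⟩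
  | saddle => exact ⟨fun _ _ _ => rfl, fun _ _ _ => rfl, fun _ => rfl, fun _ => rfl⟩
  | cosaddle => exact ⟨fun _ _ _ => rfl, fun _ _ _ => rfl, fun _ => rfl, fun _ => rfl⟩
  | comp f g ihf ihg => exact ihf.comp ihg
  | stack f g ihf ihg => exact ihf.stack ihg
  | beside f g ihf ihg => exact ihf.beside ihg

theorem refl_out {m n : ℕ} {a : Diag m n} (p : a.Piece) :
    a.conn ((refl a).surface.out p) p :=
  Quotient.exact (Quotient.out_eq _)

theorem stack_refl_homeo {m k n : ℕ} (a : Diag m k) (b : Diag k n) :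
    (stack (refl a) (refl b)).surface.Homeo (refl (a.stack b)).surface := by
  refine .of_equiv (Equiv.refl _) (fun _ _ h => h) (fun _ _ h => h)
    (fun p => ?_) (fun p => ?_) (fun _ => rfl) ?_
  · rcases p with p | p <;> exact (a.stack b).conn.refl _
  · refine Setoid.trans' _ ?_ (Setoid.symm' _ (refl_out (a := a.stack b) p))
    rcases p with p | p
    · exact glueConn_inl (refl_out p)
    · exact glueConn_inr (refl_out p)
  · rintro (x | x) <;> rfl

theorem beside_refl_homeo {m n m' n' : ℕ} (a : Diag m n) (b : Diag m' n') :
    (beside (refl a) (refl b)).surface.Homeo (refl (a.beside b)).surface := by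
  refine .of_equiv (Equiv.refl _) (fun _ _ h => h) (fun _ _ h => h)
    (fun p => ?_) (fun p => ?_) (fun _ => rfl) ?_
  · rcases p with p | p <;> exact (a.beside b).conn.refl _
  · refine Setoid.trans' _ ?_ (Setoid.symm' _ (refl_out (a := a.beside b) p))
    rcases p with p | p
    · exact glueConn_inl (refl_out p)
    · exact glueConn_inr (refl_out p)
  · rintro (x | x) <;> rfl

end Cob

namespace Diag

theorem two_mul_sum_euler : ∀ {m n : ℕ} (a : Diag m n), 2 * ∑ p, a.euler p = m + n
  | _, _, strands n => by
    change 2 * ∑ _p : Fin n, (1 : ℤ) = _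
    simp [two_mul]
  | _, _, cap => by
    change 2 * ∑ _p : Unit, (1 : ℤ) = _
    simp
  | _, _, cup => by
    change 2 * ∑ _p : Unit, (1 : ℤ) = _
    simp
  | _, _, stack a b => by
    change 2 * ∑ p : a.Piece ⊕ b.Piece, glueEuler a.euler b.euler b.top (fun _ => 1) p = _
    rw [sum_glueEuler, mul_sub, mul_add, two_mul_sum_euler a, two_mul_sum_euler b]
    simp
    ring
  | _, _, beside a b => by
    change 2 * ∑ p : a.Piece ⊕ b.Piece,
      glueEuler (K := Empty) a.euler b.euler Empty.elim Empty.elim p = _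
    rw [sum_glueEuler, mul_sub, mul_add, two_mul_sum_euler a, two_mul_sum_euler b]
    simp
    ring

end Diag

/-- The quantum degree is `-χ(S) + (m + n) / 2 + 2 · #dots`. -/
theorem Cob.deg_eq {m n : ℕ} {a b : Diag m n} (f : Cob a b) :
    2 * f.deg = -2 * ∑ p, f.surface.euler p + (m + n) + 4 * ∑ p, (f.surface.dots p : ℤ) := by
  induction f with
  | @isotopy m n a b e _ _ _ =>
    change 0 = -2 * ∑ p, a.euler p + (m + n) + 4 * ∑ p : a.Piece, ((0 : ℕ) : ℤ)
    rw [← a.two_mul_sum_euler]; simp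
  | @dot m n a p =>
    classical
    change 2 * 2 = -2 * ∑ p, a.euler p + (m + n) + 4 * ∑ q : a.Piece, (((Pi.single p 1 : a.Piece → ℕ) q : ℕ) : ℤ)
    rw [← a.two_mul_sum_euler, ← Nat.cast_sum, Finset.sum_pi_single']; simp
  | birth => change 2 * -1 = -2 * ∑ _p : Unit, (1 : ℤ) + _ + 4 * ∑ _p : Unit, ((0 : ℕ) : ℤ); simp
  | death => change 2 * -1 = -2 * ∑ _p : Unit, (1 : ℤ) + _ + 4 * ∑ _p : Unit, ((0 : ℕ) : ℤ); simp
  | saddle => change 2 * 1 = -2 * ∑ _p : Unit, (1 : ℤ) + _ + 4 * ∑ _p : Unit, ((0 : ℕ) : ℤ); simp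
  | cosaddle => change 2 * 1 = -2 * ∑ _p : Unit, (1 : ℤ) + _ + 4 * ∑ _p : Unit, ((0 : ℕ) : ℤ); simp
  | @comp m n a b c f g ihf ihg =>
    change 2 * (f.deg + g.deg) = -2 * ∑ p : f.surface.Piece ⊕ g.surface.Piece,
      glueEuler f.surface.euler g.surface.euler g.surface.inn b.euler p + (m + n) +
      4 * ∑ p : f.surface.Piece ⊕ g.surface.Piece,
        ((Sum.elim f.surface.dots g.surface.dots p : ℕ) : ℤ)
    rw [sum_glueEuler, Fintype.sum_sum_type]
    have := b.two_mul_sum_euler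
    simp only [Sum.elim_inl, Sum.elim_inr]
    linarith
  | @stack m k n a a' b b' f g ihf ihg =>
    change 2 * (f.deg + g.deg) = -2 * ∑ p : f.surface.Piece ⊕ g.surface.Piece,
      glueEuler f.surface.euler g.surface.euler (fun j => g.surface.inn (b.top j)) (fun _ => 1) p
      + (m + n) + 4 * ∑ p : f.surface.Piece ⊕ g.surface.Piece,
        ((Sum.elim f.surface.dots g.surface.dots p : ℕ) : ℤ)
    rw [sum_glueEuler, Fintype.sum_sum_type]
    simp only [Sum.elim_inl, Sum.elim_inr, Finset.sum_const, Finset.card_univ, Fintype.card_fin,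
      nsmul_eq_mul, mul_one]
    linarith
  | @beside m n m' n' a a' b b' f g ihf ihg =>
    change 2 * (f.deg + g.deg) = -2 * ∑ p : f.surface.Piece ⊕ g.surface.Piece,
      glueEuler (K := Empty) f.surface.euler g.surface.euler Empty.elim Empty.elim p
      + _ + 4 * ∑ p : f.surface.Piece ⊕ g.surface.Piece,
        ((Sum.elim f.surface.dots g.surface.dots p : ℕ) : ℤ)
    rw [sum_glueEuler, Fintype.sum_sum_type]
    simp only [Sum.elim_inl, Sum.elim_inr, Finset.univ_eq_empty, Finset.sum_empty]
    push_cast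
    linarith

/-! ### Linear combinations of dotted cobordisms modulo the local relations -/

/-- The ground ring `ℤ[α]`; the variable `α` is `Polynomial.X`. -/
abbrev Coeff : Type := Polynomial ℤ

open Finsupp in
/-- The linear combinations of dotted cobordisms that are zero: the relations are generated, under
linear combinations, composition and planar gluing, by homeomorphism relative to the boundary, by
the values `0, 1, 0, α` of the sphere with `0, 1, 2, 3` dots, by neck cutting, and by
`handle = 2 · dot`. -/
inductive Null : {m n : ℕ} → {a b : Diag m n} → (Cob a b →₀ Coeff) → Prop
  | zero {m n : ℕ} {a b : Diag m n} : Null (0 : Cob a b →₀ Coeff)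
  | add {m n : ℕ} {a b : Diag m n} {x y : Cob a b →₀ Coeff} : Null x → Null y → Null (x + y)
  | smul {m n : ℕ} {a b : Diag m n} (r : Coeff) {x : Cob a b →₀ Coeff} : Null x → Null (r • x)
  | homeo {m n : ℕ} {a b : Diag m n} (f g : Cob a b) (h : f.surface.Homeo g.surface) :
      Null (single f 1 - single g 1)
  | sphere : Null (single (.comp .birth .death) 1)
  | sphere_dot (p : Diag.circle.Piece) :
      Null (single (.comp (.comp .birth (.dot _ p)) .death) 1 - single (.refl _) 1)
  | sphere_dot_dot (p : Diag.circle.Piece) :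
      Null (single (.comp (.comp (.comp .birth (.dot _ p)) (.dot _ p)) .death) 1)
  | sphere_dot_dot_dot (p : Diag.circle.Piece) :
      Null (single (.comp (.comp (.comp (.comp .birth (.dot _ p)) (.dot _ p)) (.dot _ p)) .death) 1
        - single (.refl _) Polynomial.X)
  | neck (p : Diag.circle.Piece) :
      Null (single (.refl Diag.circle) 1
        - (single (.comp (.comp (.dot _ p) .death) .birth) 1
          + single (.comp .death (.comp .birth (.dot _ p))) 1))
  | handle {m n : ℕ} (a : Diag m n) (p : a.Piece) (f : Cob a a)
      (h : f.surface.Homeo ((Surface.cylinder a).handle p)) :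
      Null (single f 1 - single (.dot a p) 2)
  | comp_left {m n : ℕ} {a b c : Diag m n} (f : Cob a b) {x : Cob b c →₀ Coeff} :
      Null x → Null (x.mapDomain fun g => f.comp g)
  | comp_right {m n : ℕ} {a b c : Diag m n} (g : Cob b c) {x : Cob a b →₀ Coeff} :
      Null x → Null (x.mapDomain fun f => f.comp g)
  | stack_left {m k n : ℕ} {a a' : Diag m k} {b b' : Diag k n} (f : Cob a a')
      {x : Cob b b' →₀ Coeff} : Null x → Null (x.mapDomain fun g => f.stack g)
  | stack_right {m k n : ℕ} {a a' : Diag m k} {b b' : Diag k n} (g : Cob b b')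
      {x : Cob a a' →₀ Coeff} : Null x → Null (x.mapDomain fun f => f.stack g)
  | beside_left {m n m' n' : ℕ} {a a' : Diag m n} {b b' : Diag m' n'} (f : Cob a a')
      {x : Cob b b' →₀ Coeff} : Null x → Null (x.mapDomain fun g => f.beside g)
  | beside_right {m n m' n' : ℕ} {a a' : Diag m n} {b b' : Diag m' n'} (g : Cob b b')
      {x : Cob a a' →₀ Coeff} : Null x → Null (x.mapDomain fun f => f.beside g)

/-- The submodule of null combinations. -/
def nullSubmodule {m n : ℕ} (a b : Diag m n) : Submodule Coeff (Cob a b →₀ Coeff) where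
  carrier := {x | Null x}
  zero_mem' := .zero
  add_mem' := .add
  smul_mem' r _ := .smul r

/-- Morphisms (of all quantum degrees) between planar diagrams: `ℤ[α]`-linear combinations of
dotted cobordisms modulo the local relations. -/
abbrev CobHom {m n : ℕ} (a b : Diag m n) : Type := (Cob a b →₀ Coeff) ⧸ nullSubmodule a b

/-- The class of a cobordism. -/
def cls {m n : ℕ} {a b : Diag m n} (f : Cob a b) : CobHom a b :=
  (nullSubmodule a b).mkQ (Finsupp.single f 1)

theorem cls_eq_of_homeo {m n : ℕ} {a b : Diag m n} {f g : Cob a b}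
    (h : f.surface.Homeo g.surface) : cls f = cls g :=
  (Submodule.Quotient.eq _).2 (.homeo f g h)

theorem CobHom.induction {m n : ℕ} {a b : Diag m n} {P : CobHom a b → Prop} (h0 : P 0)
    (hadd : ∀ x y, P x → P y → P (x + y)) (hcls : ∀ (r : Coeff) (f : Cob a b), P (r • cls f))
    (x : CobHom a b) : P x := by
  obtain ⟨x, rfl⟩ := (nullSubmodule a b).mkQ_surjective x
  induction x using Finsupp.induction_linear with
  | zero => simpa using h0
  | add x y hx hy => rw [map_add]; exact hadd _ _ hx hy
  | single f r =>
    have := hcls r f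
    rwa [cls, ← map_smul, Finsupp.smul_single, smul_eq_mul, mul_one] at this

section Bilinear

variable {m n m' n' m'' n'' : ℕ} {a b : Diag m n} {a' b' : Diag m' n'} {a'' b'' : Diag m'' n''}

/-- The bilinear extension of a binary operation on cobordisms that preserves null
combinations. -/
def bilinear (op : Cob a b → Cob a' b' → Cob a'' b'')
    (hl : ∀ f {x}, Null x → Null (x.mapDomain fun g => op f g))
    (hr : ∀ g {x}, Null x → Null (x.mapDomain fun f => op f g)) :
    CobHom a b →ₗ[Coeff] CobHom a' b' →ₗ[Coeff] CobHom a'' b'' :=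
  ((nullSubmodule a' b').liftQ
    ((nullSubmodule a b).liftQ
      ((Finsupp.linearCombination Coeff fun f => Finsupp.lmapDomain Coeff Coeff (op f)).compr₂
        (nullSubmodule a'' b'').mkQ)
      (by
        intro x hx
        refine LinearMap.mem_ker.2 (LinearMap.ext fun y => ?_)
        refine (Submodule.Quotient.mk_eq_zero _).2 ?_
        induction y using Finsupp.induction_linear with
        | zero => rw [map_zero]; exact Submodule.zero_mem _
        | add y z hy hz => rw [map_add]; exact Submodule.add_mem _ hy hz
        | single g r =>
          have : Finsupp.linearCombination Coeff
              (fun f => Finsupp.lmapDomain Coeff Coeff (op f)) x (Finsupp.single g r)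
              = r • x.mapDomain fun f => op f g := by
            rw [Finsupp.linearCombination_apply, Finsupp.sum, LinearMap.sum_apply,
              Finsupp.mapDomain, Finsupp.sum, Finset.smul_sum]
            refine Finset.sum_congr rfl fun f _ => ?_
            simp [mul_comm]
          rw [this]
          exact Submodule.smul_mem _ _ (hr g hx))).flip
    (by
      intro y hy
      refine LinearMap.mem_ker.2 (LinearMap.ext fun x => ?_)
      induction x using CobHom.induction with
      | h0 => simp
      | hadd x x' h h' => rw [map_add, h, h']; simp
      | hcls r f =>
      rw [map_smul]
      have : Null (y.mapDomain fun g => op f g) := hl f hy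
      simp only [cls, LinearMap.flip_apply, Submodule.mkQ_apply, Submodule.liftQ_apply,
        LinearMap.compr₂_apply, Finsupp.linearCombination_single, one_smul,
        Finsupp.lmapDomain_apply, LinearMap.zero_apply]
      rw [(Submodule.Quotient.mk_eq_zero _).2 this, smul_zero])).flip

theorem bilinear_cls (op : Cob a b → Cob a' b' → Cob a'' b'') (hl) (hr) (f : Cob a b)
    (g : Cob a' b') : bilinear op hl hr (cls f) (cls g) = cls (op f g) := by
  simp [bilinear, cls]

end Bilinear

/-- Composition. -/
def compHom {m n : ℕ} {a b c : Diag m n} :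
    CobHom a b →ₗ[Coeff] CobHom b c →ₗ[Coeff] CobHom a c :=
  bilinear Cob.comp (fun f _ => .comp_left f) (fun g _ => .comp_right g)

/-- Stacking of morphisms. -/
def stackHom {m k n : ℕ} {a a' : Diag m k} {b b' : Diag k n} :
    CobHom a a' →ₗ[Coeff] CobHom b b' →ₗ[Coeff] CobHom (a.stack b) (a'.stack b') :=
  bilinear Cob.stack (fun f _ => .stack_left f) (fun g _ => .stack_right g)

/-- Juxtaposition of morphisms. -/
def besideHom {m n m' n' : ℕ} {a a' : Diag m n} {b b' : Diag m' n'} :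
    CobHom a a' →ₗ[Coeff] CobHom b b' →ₗ[Coeff] CobHom (a.beside b) (a'.beside b') :=
  bilinear Cob.beside (fun f _ => .beside_left f) (fun g _ => .beside_right g)

theorem compHom_cls {m n : ℕ} {a b c : Diag m n} (f : Cob a b) (g : Cob b c) :
    compHom (cls f) (cls g) = cls (f.comp g) := bilinear_cls _ _ _ f g

theorem stackHom_cls {m k n : ℕ} {a a' : Diag m k} {b b' : Diag k n} (f : Cob a a')
    (g : Cob b b') : stackHom (cls f) (cls g) = cls (f.stack g) := bilinear_cls _ _ _ f g

theorem besideHom_cls {m n m' n' : ℕ} {a a' : Diag m n} {b b' : Diag m' n'} (f : Cob a a')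
    (g : Cob b b') : besideHom (cls f) (cls g) = cls (f.beside g) := bilinear_cls _ _ _ f g

section Laws

variable {m n : ℕ} {a b c d : Diag m n}

theorem refl_compHom (x : CobHom a b) : compHom (cls (.refl a)) x = x := by
  induction x using CobHom.induction with
  | h0 => simp
  | hadd x y hx hy => rw [map_add, hx, hy]
  | hcls r f =>
  rw [map_smul, compHom_cls]
  exact congrArg _ (cls_eq_of_homeo (.id_comp _ f.surface_compat Cob.refl_out rfl))

theorem compHom_refl (x : CobHom a b) : compHom x (cls (.refl b)) = x := by
  induction x using CobHom.induction with
  | h0 => simp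
  | hadd x y hx hy => rw [map_add, LinearMap.add_apply, hx, hy]
  | hcls r f =>
  rw [map_smul, LinearMap.smul_apply, compHom_cls]
  exact congrArg _ (cls_eq_of_homeo (.comp_id _ f.surface_compat Cob.refl_out rfl))

theorem compHom_assoc (x : CobHom a b) (y : CobHom b c) (z : CobHom c d) :
    compHom (compHom x y) z = compHom x (compHom y z) := by
  induction x using CobHom.induction with
  | h0 => simp
  | hadd x y hx hy => simp only [map_add, LinearMap.add_apply, hx, hy]
  | hcls r f =>
  induction y using CobHom.induction with
  | h0 => simp
  | hadd x y hx hy => simp only [map_add, LinearMap.add_apply, hx, hy]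
  | hcls s g =>
  induction z using CobHom.induction with
  | h0 => simp
  | hadd x y hx hy => simp only [map_add, hx, hy]
  | hcls t h =>
  simp only [map_smul, LinearMap.smul_apply, compHom_cls]
  rw [cls_eq_of_homeo (f := (f.comp g).comp h) (g := f.comp (g.comp h))
    (Surface.Homeo.assoc f.surface g.surface h.surface)]

theorem stackHom_refl {m k n : ℕ} (a : Diag m k) (b : Diag k n) :
    stackHom (cls (.refl a)) (cls (.refl b)) = cls (.refl (a.stack b)) := by
  rw [stackHom_cls]
  exact cls_eq_of_homeo (Cob.stack_refl_homeo a b)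

theorem besideHom_refl {m n m' n' : ℕ} (a : Diag m n) (b : Diag m' n') :
    besideHom (cls (.refl a)) (cls (.refl b)) = cls (.refl (a.beside b)) := by
  rw [besideHom_cls]
  exact cls_eq_of_homeo (Cob.beside_refl_homeo a b)

theorem stackHom_comp {m k n : ℕ} {a a' a'' : Diag m k} {b b' b'' : Diag k n}
    (x : CobHom a a') (x' : CobHom a' a'') (y : CobHom b b') (y' : CobHom b' b'') :
    stackHom (compHom x x') (compHom y y') = compHom (stackHom x y) (stackHom x' y') := by
  induction x using CobHom.induction with
  | h0 => simp
  | hadd _ _ h h' => simp only [map_add, LinearMap.add_apply, h, h']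
  | hcls r f =>
  induction x' using CobHom.induction with
  | h0 => simp
  | hadd _ _ h h' => simp only [map_add, LinearMap.add_apply, h, h']
  | hcls r' f' =>
  induction y using CobHom.induction with
  | h0 => simp
  | hadd _ _ h h' => simp only [map_add, LinearMap.add_apply, h, h']
  | hcls s g =>
  induction y' using CobHom.induction with
  | h0 => simp
  | hadd _ _ h h' => simp only [map_add, h, h']
  | hcls s' g' =>
  simp only [map_smul, LinearMap.smul_apply, compHom_cls, stackHom_cls]
  rw [cls_eq_of_homeo (f := (f.comp f').stack (g.comp g')) (g := (f.stack g).comp (f'.stack g'))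
    (Surface.Homeo.stack_comp f.surface f'.surface g.surface g'.surface
      f.surface_compat g.surface_compat)]
  simp only [smul_smul]
  congr 1
  ring

theorem besideHom_comp {m n m' n' : ℕ} {a a' a'' : Diag m n} {b b' b'' : Diag m' n'}
    (x : CobHom a a') (x' : CobHom a' a'') (y : CobHom b b') (y' : CobHom b' b'') :
    besideHom (compHom x x') (compHom y y') = compHom (besideHom x y) (besideHom x' y') := by
  induction x using CobHom.induction with
  | h0 => simp
  | hadd _ _ h h' => simp only [map_add, LinearMap.add_apply, h, h']
  | hcls r f =>
  induction x' using CobHom.induction with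
  | h0 => simp
  | hadd _ _ h h' => simp only [map_add, LinearMap.add_apply, h, h']
  | hcls r' f' =>
  induction y using CobHom.induction with
  | h0 => simp
  | hadd _ _ h h' => simp only [map_add, LinearMap.add_apply, h, h']
  | hcls s g =>
  induction y' using CobHom.induction with
  | h0 => simp
  | hadd _ _ h h' => simp only [map_add, h, h']
  | hcls s' g' =>
  simp only [map_smul, LinearMap.smul_apply, compHom_cls, besideHom_cls]
  rw [cls_eq_of_homeo (f := (f.comp f').beside (g.comp g'))
    (g := (f.beside g).comp (f'.beside g'))
    (Surface.Homeo.beside_comp f.surface f'.surface g.surface g'.surface)]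
  simp only [smul_smul]
  congr 1
  ring

end Laws

/-! ### The quantum grading -/

/-- The morphisms that are homogeneous of quantum degree `d`, where `α` has degree `4`. -/
def homDeg {m n : ℕ} (a b : Diag m n) (d : ℤ) : AddSubgroup (CobHom a b) :=
  AddSubgroup.closure
    {x | ∃ (j : ℕ) (f : Cob a b), 4 * j + f.deg = d ∧ x = (Polynomial.X ^ j : Coeff) • cls f}

theorem refl_mem_homDeg {m n : ℕ} (a : Diag m n) : cls (.refl a) ∈ homDeg a a 0 :=
  AddSubgroup.subset_closure ⟨0, .refl a, by simp [Cob.refl, Cob.deg], by simp⟩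

theorem homDeg_congr {m n : ℕ} {a b : Diag m n} {d d' : ℤ} (h : d = d') {x : CobHom a b}
    (hx : x ∈ homDeg a b d) : x ∈ homDeg a b d' := h ▸ hx

theorem bilinear_mem_homDeg {m n m' n' m'' n'' : ℕ} {a b : Diag m n} {a' b' : Diag m' n'}
    {a'' b'' : Diag m'' n''} {op : Cob a b → Cob a' b' → Cob a'' b''} {hl} {hr}
    (hdeg : ∀ f g, (op f g).deg = f.deg + g.deg) {d d' : ℤ} {x : CobHom a b}
    {y : CobHom a' b'} (hx : x ∈ homDeg a b d) (hy : y ∈ homDeg a' b' d') :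
    bilinear op hl hr x y ∈ homDeg a'' b'' (d + d') := by
  induction hx using AddSubgroup.closure_induction with
  | mem x hx =>
    obtain ⟨j, f, hf, rfl⟩ := hx
    induction hy using AddSubgroup.closure_induction with
    | mem y hy =>
      obtain ⟨k, g, hg, rfl⟩ := hy
      refine AddSubgroup.subset_closure ⟨j + k, op f g, ?_, ?_⟩
      · rw [hdeg]; push_cast; linarith
      · rw [map_smul, LinearMap.map_smul₂, bilinear_cls, smul_smul, pow_add, mul_comm]
    | zero => rw [map_zero]; exact zero_mem _
    | add y y' _ _ h h' => rw [map_add]; exact add_mem h h'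
    | neg y _ h => rw [map_neg]; exact neg_mem h
  | zero => rw [map_zero]; exact zero_mem _
  | add y y' _ _ h h' => rw [map_add]; exact add_mem h h'
  | neg y _ h => rw [map_neg]; exact neg_mem h

/-- A planar diagram with a formal shift `q ^ shift` of the quantum degree. -/
structure GrDiag (m n : ℕ) where
  diag : Diag m n
  shift : ℤ

namespace GrDiag

variable {m n : ℕ}

/-- Morphisms `q ^ k a ⟶ q ^ l b` of quantum degree zero: a cobordism `S`, times `α ^ j`, has
quantum degree `l - k - χ(S) + (m + n) / 2 + 2 · #dots + 4 j`. -/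
instance : Category (GrDiag m n) where
  Hom A B := homDeg A.diag B.diag (A.shift - B.shift)
  id A := ⟨cls (.refl _), by rw [sub_self]; exact refl_mem_homDeg _⟩
  comp f g := ⟨compHom f.1 g.1, homDeg_congr (sub_add_sub_cancel _ _ _)
    (bilinear_mem_homDeg (op := Cob.comp) (fun _ _ => rfl) f.2 g.2)⟩
  id_comp f := Subtype.ext (refl_compHom _)
  comp_id f := Subtype.ext (compHom_refl _)
  assoc f g h := Subtype.ext (compHom_assoc _ _ _)

instance : Preadditive (GrDiag m n) where
  homGroup A B := inferInstanceAs (AddCommGroup (homDeg A.diag B.diag (A.shift - B.shift)))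
  add_comp _ _ _ f f' g := Subtype.ext (LinearMap.map_add₂ compHom f.1 f'.1 g.1)
  comp_add _ _ _ f g g' := Subtype.ext ((compHom f.1).map_add g.1 g'.1)

/-- The shift functor `q ^ d`. -/
def qShift (d : ℤ) : GrDiag m n ⥤ GrDiag m n where
  obj A := ⟨A.diag, A.shift + d⟩
  map f := ⟨f.1, homDeg_congr (add_sub_add_right_eq_sub _ _ d).symm f.2⟩
  map_id _ := rfl
  map_comp _ _ := rfl

instance (d : ℤ) : (qShift d : GrDiag m n ⥤ GrDiag m n).Additive where
  map_add := rfl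

/-- The bifunctor given by vertical stacking. -/
def stackFunctor (m k n : ℕ) : GrDiag m k × GrDiag k n ⥤ GrDiag m n where
  obj A := ⟨A.1.diag.stack A.2.diag, A.1.shift + A.2.shift⟩
  map f := ⟨stackHom f.1.1 f.2.1, homDeg_congr (add_sub_add_comm _ _ _ _).symm
    (bilinear_mem_homDeg (op := Cob.stack) (fun _ _ => rfl) f.1.2 f.2.2)⟩
  map_id _ := Subtype.ext (stackHom_refl _ _)
  map_comp _ _ := Subtype.ext (stackHom_comp _ _ _ _)

/-- The bifunctor given by horizontal juxtaposition. -/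
def besideFunctor (m n m' n' : ℕ) : GrDiag m n × GrDiag m' n' ⥤ GrDiag (m + m') (n + n') where
  obj A := ⟨A.1.diag.beside A.2.diag, A.1.shift + A.2.shift⟩
  map f := ⟨besideHom f.1.1 f.2.1, homDeg_congr (add_sub_add_comm _ _ _ _).symm
    (bilinear_mem_homDeg (op := Cob.beside) (fun _ _ => rfl) f.1.2 f.2.2)⟩
  map_id _ := Subtype.ext (besideHom_refl _ _)
  map_comp _ _ := Subtype.ext (besideHom_comp _ _ _ _)

theorem stackFunctor_map_add_left {m k n : ℕ} {A A' : GrDiag m k} {B B' : GrDiag k n}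
    (f f' : A ⟶ A') (g : B ⟶ B') :
    (stackFunctor m k n).map (X := (A, B)) (Y := (A', B')) (f + f', g) =
      (stackFunctor m k n).map (X := (A, B)) (Y := (A', B')) (f, g) +
        (stackFunctor m k n).map (X := (A, B)) (Y := (A', B')) (f', g) :=
  Subtype.ext (LinearMap.map_add₂ stackHom f.1 f'.1 g.1)

theorem stackFunctor_map_add_right {m k n : ℕ} {A A' : GrDiag m k} {B B' : GrDiag k n}
    (f : A ⟶ A') (g g' : B ⟶ B') :
    (stackFunctor m k n).map (X := (A, B)) (Y := (A', B')) (f, g + g') =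
      (stackFunctor m k n).map (X := (A, B)) (Y := (A', B')) (f, g) +
        (stackFunctor m k n).map (X := (A, B)) (Y := (A', B')) (f, g') :=
  Subtype.ext ((stackHom f.1).map_add g.1 g'.1)

theorem besideFunctor_map_add_left {m n m' n' : ℕ} {A A' : GrDiag m n} {B B' : GrDiag m' n'}
    (f f' : A ⟶ A') (g : B ⟶ B') :
    (besideFunctor m n m' n').map (X := (A, B)) (Y := (A', B')) (f + f', g) =
      (besideFunctor m n m' n').map (X := (A, B)) (Y := (A', B')) (f, g) +
        (besideFunctor m n m' n').map (X := (A, B)) (Y := (A', B')) (f', g) :=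
  Subtype.ext (LinearMap.map_add₂ besideHom f.1 f'.1 g.1)

theorem besideFunctor_map_add_right {m n m' n' : ℕ} {A A' : GrDiag m n} {B B' : GrDiag m' n'}
    (f : A ⟶ A') (g g' : B ⟶ B') :
    (besideFunctor m n m' n').map (X := (A, B)) (Y := (A', B')) (f, g + g') =
      (besideFunctor m n m' n').map (X := (A, B)) (Y := (A', B')) (f, g) +
        (besideFunctor m n m' n').map (X := (A, B)) (Y := (A', B')) (f, g') :=
  Subtype.ext ((besideHom f.1).map_add g.1 g'.1)

end GrDiag

/-! ### Additive closure -/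

section MatBifunctor

variable {C D E : Type} [Category.{0} C] [Category.{0} D] [Category.{0} E] [Preadditive C]
  [Preadditive D] [Preadditive E]

/-- A functor of two variables that is additive in each variable. -/
structure Biadditive (F : C × D ⥤ E) : Prop where
  left {A A' : C} {B B' : D} (f f' : A ⟶ A') (g : B ⟶ B') :
    F.map (X := (A, B)) (Y := (A', B')) (f + f', g) =
      F.map (X := (A, B)) (Y := (A', B')) (f, g) + F.map (X := (A, B)) (Y := (A', B')) (f', g)
  right {A A' : C} {B B' : D} (f : A ⟶ A') (g g' : B ⟶ B') :
    F.map (X := (A, B)) (Y := (A', B')) (f, g + g') =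
      F.map (X := (A, B)) (Y := (A', B')) (f, g) + F.map (X := (A, B)) (Y := (A', B')) (f, g')

namespace Biadditive

variable {F : C × D ⥤ E} (hF : Biadditive F)

/-- `F.map` as a biadditive map. -/
def mapHom (A A' : C) (B B' : D) :
    (A ⟶ A') →+ (B ⟶ B') →+ (F.obj (A, B) ⟶ F.obj (A', B')) :=
  AddMonoidHom.mk' (fun f => AddMonoidHom.mk' (fun g => F.map (X := (A, B)) (Y := (A', B')) (f, g))
    (hF.right f)) (fun f f' => AddMonoidHom.ext fun g => hF.left f f' g)

/-- The bifunctor induced on finite formal direct sums, given on morphisms by the Kronecker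
product of matrices. -/
def mat : Mat_ C × Mat_ D ⥤ Mat_ E where
  obj M := { ι := M.1.ι × M.2.ι, X := fun i => F.obj (M.1.X i.1, M.2.X i.2) }
  map {M N} f := fun i j =>
    F.map (X := (M.1.X i.1, M.2.X i.2)) (Y := (N.1.X j.1, N.2.X j.2)) (f.1 i.1 j.1, f.2 i.2 j.2)
  map_id M := by
    refine Mat_.hom_ext _ _ fun i j => ?_
    obtain ⟨i, i'⟩ := i
    obtain ⟨j, j'⟩ := j
    change hF.mapHom (M.1.X i) (M.1.X j) (M.2.X i') (M.2.X j') ((𝟙 M.1 : M.1 ⟶ M.1) i j)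
      ((𝟙 M.2 : M.2 ⟶ M.2) i' j') = _
    by_cases h : i = j
    · by_cases h' : i' = j'
      · subst h h'
        rw [Mat_.id_apply_self, Mat_.id_apply_self, Mat_.id_apply_self]
        exact F.map_id (M.1.X i, M.2.X i')
      · rw [Mat_.id_apply_of_ne _ _ _ h', map_zero]
        have e : (i, i') ≠ (j, j') := fun e => h' (Prod.mk.inj e).2
        exact (Mat_.id_apply_of_ne
          { ι := M.1.ι × M.2.ι, X := fun i => F.obj (M.1.X i.1, M.2.X i.2) } _ _ e).symm
    · rw [Mat_.id_apply_of_ne _ _ _ h, map_zero, AddMonoidHom.zero_apply]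
      have e : (i, i') ≠ (j, j') := fun e => h (Prod.mk.inj e).1
      exact (Mat_.id_apply_of_ne
          { ι := M.1.ι × M.2.ι, X := fun i => F.obj (M.1.X i.1, M.2.X i.2) } _ _ e).symm
  map_comp {L M N} f g := by
    refine Mat_.hom_ext _ _ fun i j => ?_
    simp only [prod_comp, Mat_.comp_apply]
    refine (DFunLike.congr_fun (map_sum (hF.mapHom _ _ _ _) _ _) _).trans ?_
    rw [AddMonoidHom.finsetSum_apply]
    refine Eq.trans (Finset.sum_congr rfl fun k _ => map_sum (hF.mapHom _ _ _ _ _) _ _) ?_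
    refine Eq.trans ?_ (Fintype.sum_prod_type _).symm
    refine Finset.sum_congr rfl fun k _ => Finset.sum_congr rfl fun k' _ => ?_
    exact F.map_comp (X := (L.1.X i.1, L.2.X i.2)) (Y := (M.1.X k, M.2.X k'))
      (Z := (N.1.X j.1, N.2.X j.2)) (f.1 i.1 k, f.2 i.2 k') (g.1 k j.1, g.2 k' j.2)

/-- The curried form of `mat`. -/
def matCurried : Mat_ C ⥤ Mat_ D ⥤ Mat_ E := Functor.curry.obj hF.mat

theorem mat_map_add_left {A A' : Mat_ C} {B B' : Mat_ D} (f f' : A ⟶ A') (g : B ⟶ B') :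
    hF.mat.map (X := (A, B)) (Y := (A', B')) (f + f', g) =
      hF.mat.map (X := (A, B)) (Y := (A', B')) (f, g) +
        hF.mat.map (X := (A, B)) (Y := (A', B')) (f', g) :=
  Mat_.hom_ext _ _ fun _ _ => hF.left _ _ _

theorem mat_map_add_right {A A' : Mat_ C} {B B' : Mat_ D} (f : A ⟶ A') (g g' : B ⟶ B') :
    hF.mat.map (X := (A, B)) (Y := (A', B')) (f, g + g') =
      hF.mat.map (X := (A, B)) (Y := (A', B')) (f, g) +
        hF.mat.map (X := (A, B)) (Y := (A', B')) (f, g') :=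
  Mat_.hom_ext _ _ fun _ _ => hF.right _ _ _

instance : hF.matCurried.Additive where
  map_add := by
    intros
    ext B : 2
    exact hF.mat_map_add_left _ _ (𝟙 B)

instance (A : Mat_ C) : (hF.matCurried.obj A).Additive where
  map_add := hF.mat_map_add_right (𝟙 A) _ _

instance (B : Mat_ D) : (hF.matCurried.flip.obj B).Additive where
  map_add := hF.mat_map_add_left _ _ (𝟙 B)

end Biadditive

end MatBifunctor

theorem stack_biadditive (m k n : ℕ) : Biadditive (GrDiag.stackFunctor m k n) :=
  ⟨GrDiag.stackFunctor_map_add_left, GrDiag.stackFunctor_map_add_right⟩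

theorem beside_biadditive (m n m' n' : ℕ) : Biadditive (GrDiag.besideFunctor m n m' n') :=
  ⟨GrDiag.besideFunctor_map_add_left, GrDiag.besideFunctor_map_add_right⟩

/-- The graded additive category of planar diagrams with `m` points on the top and `n` points on
the bottom: finite formal direct sums of shifted diagrams, and matrices of morphisms of quantum
degree zero. -/
abbrev BN (m n : ℕ) : Type 1 := Mat_ (GrDiag m n)

instance {m n : ℕ} (d : ℤ) :
    (Functor.mapMat_ (GrDiag.qShift d : GrDiag m n ⥤ GrDiag m n)).Additive where
  map_add := Mat_.hom_ext _ _ fun _ _ => (GrDiag.qShift d).map_add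

/-- A diagram, shifted by `q ^ k`, as an object of `BN m n`. -/
def ofDiag {m n : ℕ} (a : Diag m n) (k : ℤ) : BN m n := (Mat_.embedding _).obj ⟨a, k⟩

/-! ### Complexes and planar compositions -/

/-- Complexes over `BN m n` concentrated in nonpositive cohomological degrees: the object in
(homological) degree `i : ℕ` is the chain object in cohomological degree `-i`. -/
abbrev Cplx (m n : ℕ) : Type 1 := ChainComplex (BN m n) ℕ

namespace Cplx

instance (n : ℕ) : Finite
    (ComplexShape.π (.down ℕ) (.down ℕ) (.down ℕ) ⁻¹' ({n} : Set ℕ)) :=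
  inferInstanceAs (Finite ((fun i : ℕ × ℕ => i.1 + i.2) ⁻¹' ({n} : Set ℕ)))

instance hasMapBifunctor {C D E : Type 1} [Category.{0} C] [Category.{0} D] [Category.{0} E]
    [Preadditive C] [Preadditive D] [Preadditive E] [Limits.HasFiniteBiproducts E]
    (F : C ⥤ D ⥤ E) [F.PreservesZeroMorphisms] [∀ X, (F.obj X).PreservesZeroMorphisms]
    (K : ChainComplex C ℕ) (L : ChainComplex D ℕ) :
    HomologicalComplex.HasMapBifunctor K L F (.down ℕ) := by
  intro n
  infer_instance

/-- The total complex of the vertical composition: `A` on top of `B`. -/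
def stack {m k n : ℕ} (A : Cplx m k) (B : Cplx k n) : Cplx m n :=
  HomologicalComplex.mapBifunctor A B (stack_biadditive m k n).matCurried (.down ℕ)

/-- The total complex of the juxtaposition: `A` to the left of `B`. -/
def beside {m n m' n' : ℕ} (A : Cplx m n) (B : Cplx m' n') : Cplx (m + m') (n + n') :=
  HomologicalComplex.mapBifunctor A B (beside_biadditive m n m' n').matCurried (.down ℕ)

/-- The diagram `a` on top of the complex `B`. -/
def above {m k n : ℕ} (a : Diag m k) (B : Cplx k n) : Cplx m n :=
  (((stack_biadditive m k n).matCurried.obj (ofDiag a 0)).mapHomologicalComplex _).obj B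

/-- The complex `A` on top of the diagram `b`. -/
def below {m k n : ℕ} (A : Cplx m k) (b : Diag k n) : Cplx m n :=
  (((stack_biadditive m k n).matCurried.flip.obj (ofDiag b 0)).mapHomologicalComplex _).obj A

/-- The complex `A` to the left of the diagram `b`. -/
def leftOf {m n m' n' : ℕ} (A : Cplx m n) (b : Diag m' n') : Cplx (m + m') (n + n') :=
  (((beside_biadditive m n m' n').matCurried.flip.obj (ofDiag b 0)).mapHomologicalComplex _).obj A

/-- The Markov trace: connect the `i`-th top point with the `i`-th bottom point, for every `i`, by
nested arcs around the right of the picture. -/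
def tr {n : ℕ} (A : Cplx n n) : Cplx 0 0 :=
  above (Diag.rainbow n) (below (leftOf A (Diag.strands n)) (Diag.rainbow n).flip)

/-- The shift `q ^ d A`. -/
def qShift {m n : ℕ} (d : ℤ) (A : Cplx m n) : Cplx m n :=
  ((Functor.mapMat_ (GrDiag.qShift d : GrDiag m n ⥤ GrDiag m n)).mapHomologicalComplex _).obj A

/-- The empty diagram, as a complex in degree zero. -/
def empty : Cplx 0 0 := (ChainComplex.single₀ _).obj (ofDiag (Diag.strands 0) 0)

/-- `A` as a cochain complex indexed by `ℤ`. -/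
def toInt {m n : ℕ} (A : Cplx m n) : CochainComplex (BN m n) ℤ :=
  HomologicalComplex.extend A ComplexShape.embeddingDownNat

/-- A complex is contractible if its identity is nullhomotopic. -/
def Contractible {m n : ℕ} (A : Cplx m n) : Prop := Nonempty (Homotopy (𝟙 A) 0)

end Cplx

/-! ### Bigraded complexes of abelian groups -/

/-- Cochain complexes of (quantum) graded abelian groups, with differential of quantum degree
zero: the value at `d` is the part of quantum degree `d`. -/
abbrev GrCplx : Type 1 := ℤ → CochainComplex AddCommGrpCat.{0} ℤ

namespace GrCplx

/-- The shift `q ^ e V`. -/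
def qShift (e : ℤ) (V : GrCplx) : GrCplx := fun d => V (d - e)

/-- Homotopy equivalence by maps and homotopies of quantum degree zero. -/
def HEquiv (V W : GrCplx) : Prop := ∀ d, Nonempty (HomotopyEquiv (V d) (W d))

end GrCplx

/-- The complex `Hom^•(A, B)` of bihomogeneous maps, with differential the supercommutator
`f ↦ d f - (-1)^|f| f d`. A map `A ⟶ B` of quantum degree `d` is a map `q ^ d A ⟶ B` of quantum
degree zero. -/
def homCplx {m n : ℕ} (A B : Cplx m n) : GrCplx := fun d =>
  CochainComplex.HomComplex (A.qShift d).toInt B.toInt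

/-- `End^•(A)`. -/
abbrev endCplx {m n : ℕ} (A : Cplx m n) : GrCplx := homCplx A A

/-- `|A⟩ = Hom^•(∅, A)`. -/
abbrev ket (A : Cplx 0 0) : GrCplx := homCplx Cplx.empty A

/-! ### Universal projectors and spin networks -/

/-- `P` is a universal projector on `n` strands: it is concentrated in nonpositive degrees, the
chain object in degree zero is the identity diagram `1_n`, no shift of `1_n` is a direct summand of
any other chain object, and `P` kills turnbacks from above and from below. -/
structure IsUniversalProjector (n : ℕ) (P : Cplx n n) : Prop where
  degree_zero : Nonempty (P.X 0 ≅ ofDiag (Diag.strands n) 0)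
  no_identity_summand (i : ℕ) (hi : i ≠ 0) (k : ℤ) :
    IsEmpty (Retract (ofDiag (Diag.strands n) k) (P.X i))
  kills_above (i j : ℕ) (h : i + 2 + j = n) :
    (Cplx.above ((Diag.capAt i j).cast rfl h) P).Contractible
  kills_below (i j : ℕ) (h : i + 2 + j = n) :
    (Cplx.below P ((Diag.capAt i j).cast rfl h).flip).Contractible

/-- The labels `a`, `b`, `c` may meet at a trivalent vertex. -/
structure Admissible (a b c : ℕ) : Prop where
  even : Even (a + b + c)
  le_left : a ≤ b + c
  le_mid : b ≤ a + c
  le_right : c ≤ a + b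

/-- The planar diagram connecting `a` points on the top with `b + c` points on the bottom without
turnbacks at any of the three groups: `(a + b - c) / 2` strands on the left, then
`(b + c - a) / 2` nested arcs `∩`, then `(a + c - b) / 2` strands. -/
def vertexDiag (a b c : ℕ) (h : Admissible a b c) : Diag a (b + c) :=
  Diag.cast
    (by obtain ⟨⟨r, hr⟩, h1, h2, h3⟩ := h; omega)
    (by obtain ⟨⟨r, hr⟩, h1, h2, h3⟩ := h; omega)
    (Diag.beside
      (Diag.beside (Diag.strands ((a + b - c) / 2)) (Diag.rainbow ((b + c - a) / 2)))
      (Diag.strands ((a + c - b) / 2)))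

section Networks

variable (P : (n : ℕ) → Cplx n n)

/-- The trivalent vertex network: edge `a` on the top, edges `b`, `c` on the bottom. -/
def vertexNet (a b c : ℕ) (h : Admissible a b c) : Cplx a (b + c) :=
  ((P a).below (vertexDiag a b c h)).stack ((P b).beside (P c))

/-- The theta network: two vertices joined by three edges `a`, `b`, `c`. -/
def thetaNet (a b c : ℕ) (h : Admissible a b c) : Cplx 0 0 :=
  ((vertexNet P a b c h).below (vertexDiag a b c h).flip).tr

/-- The I-shaped network: edges `a`, `b` on the top meet at a vertex, edges `c`, `d` on the bottom
meet at a vertex, and a vertical edge `i` joins the two vertices. -/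
def iNet (a b c d i : ℕ) (h : Admissible i a b) (h' : Admissible i c d) : Cplx (a + b) (c + d) :=
  (((P a).beside (P b)).below (vertexDiag i a b h).flip).stack (vertexNet P i c d h')

/-- The pill network: two copies of the edge `i`, whose upper ends are joined by edges `a`, `b` and
whose lower ends are joined by edges `c`, `d`. -/
def pillNet (a b c d i : ℕ) (h : Admissible i a b) (h' : Admissible i c d) : Cplx 0 0 :=
  (((iNet P a b c d i h h').below (vertexDiag i c d h').flip).stack
    ((P i).below (vertexDiag i a b h))).tr

end Networks

end SpinNet

end

noncomputable section
namespace SpinNet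

/-! ### Euler characteristics from boundary points -/

section Push

variable {A B C K M : Type}

/-! Planar diagrams are dualizable: up to a shift, every diagram `y` is left adjoint to its
reflection `y.flip` (`Diag.exists_adjunction`). A diagram glued to the source of a morphism space
can therefore be reflected and glued to the target instead.

Let `A` be one of the three networks. In degree zero all projectors contribute identities, so `A` is
a single diagram `v` there. In any other degree at least one projector contributes a term other than
an identity, and such a term has an arc joining adjacent points at its top and another at its
bottom. Through such an arc the term factors, up to direct summands, over fewer points. Moving the
narrow part from the first argument of Hom(A^i, A) to the second puts it next to a projector of the
second copy of `A`, which it kills. Hence Hom(q^d A^i, A) is contractible for i ≠ 0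
(`projector_misses`, `vertexNet_misses`, `iNet_misses`). Homological perturbation then gives Hom(q^d
A, A) ≃ Hom(q^d v, A) (`homComplex_equiv`); although `A` may be unbounded, the geometric series
involved is finite in each coordinate of a product (`Lowering.exists_inverse`).

Duality next moves `v` to the target, and bending strands one by one identifies morphisms out of the
identity diagram on m strands with morphisms from the empty diagram to the closure, at the price of
q^m (`Hole.coyo_closure`). The total shift is half the number of ends of the network. For a
projector and for a vertex the closure obtained is the unknot and the theta network. For the
I-shaped network it is the pill network with one of the two projectors on the edges `i` replaced by
plain strands. The missing projector can be inserted because its terms in nonzero degrees have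
returns and are killed by the complex above it (`stack_projector_equiv`).

The input on planar diagrams is twofold. Reading off components along the top and along the bottom
gives two words that agree in a free product of groups of order two. A diagram with at least as many
upper as lower points therefore has a return at the top or consists of vertical strands and circles
(`Diag.topReturn_or`). Moreover a diagram with a return has the same matching of boundary points as
its composite with a turnback, so the two agree after adding circles; as the empty diagram is a
summand of a shifted circle, the diagram is a summand of one that factors through fewer points
(`GrDiag.exists_retract_of_topReturn`).

Two devices keep the coherence questions small. Isotopies are bijections of components compatible
with the boundary, and homeomorphisms are detected by a defect that is additive under gluing, so
that identities between isotopies are checked on pieces. Contractibility of glued complexes is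
tested only after applying additive functors to abelian groups (`Kills`), so that gluing functors
need to be compared only on single diagrams. -/

theorem push_comp_equiv [Fintype A] [Fintype B] [AddCommMonoid M] (e : A ≃ B) (g : B → C)
    (w : B → M) : push (fun a => g (e a)) (fun a => w (e a)) = push g w := by
  funext c
  exact Fintype.sum_equiv e _ _ fun _ => rfl

theorem push_const_fin_add {m n : ℕ} [AddCommMonoid M] (φ : Fin m ⊕ Fin n → C) (x : M) :
    push (fun i : Fin (m + n) => φ (finSumFinEquiv.symm i)) (fun _ => x) =
      push (fun i => φ (.inl i)) (fun _ => x) + push (fun i => φ (.inr i)) (fun _ => x) := by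
  rw [← push_sum φ fun _ => x]
  exact push_comp_equiv finSumFinEquiv.symm φ fun _ => x

theorem push_glueEuler [Fintype A] [Fintype B] [Fintype K] (h : A ⊕ B → C) (χ : A → ℤ)
    (χ' : B → ℤ) (g : K → B) (κ : K → ℤ) :
    push h (glueEuler χ χ' g κ) = push (fun a => h (.inl a)) χ +
      (push (fun b => h (.inr b)) χ' - push (fun k => h (.inr (g k))) κ) := by
  rw [push_sum]
  congr 1
  change push (fun b => h (.inr b)) (fun b => χ' b - push g κ b) = _
  rw [push_sub, push_push]

end Push

/-- A function respects a setoid if it is constant on its classes. -/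
def Respects {A C : Type} (s : Setoid A) (h : A → C) : Prop := ∀ ⦃x y⦄, s x y → h x = h y

section Respects

variable {A B C D K : Type} {s : Setoid A} {t : Setoid B} {f : K → A} {g : K → B}

theorem Respects.glue {h : A ⊕ B → C} (h1 : Respects s fun a => h (.inl a))
    (h2 : Respects t fun b => h (.inr b)) (h3 : ∀ k, h (.inl (f k)) = h (.inr (g k))) :
    Respects (glueConn s t f g) h := fun _ _ hxy =>
  glueConn_le (r := ⊥) h (fun _ _ h => h1 h) (fun _ _ h => h2 h) h3 hxy

theorem Respects.inl {h : A ⊕ B → C} (hh : Respects (glueConn s t f g) h) :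
    Respects s fun a => h (.inl a) := fun _ _ hxy => hh (glueConn_inl hxy)

theorem Respects.inr {h : A ⊕ B → C} (hh : Respects (glueConn s t f g) h) :
    Respects t fun b => h (.inr b) := fun _ _ hxy => hh (glueConn_inr hxy)

theorem Respects.glued {h : A ⊕ B → C} (hh : Respects (glueConn s t f g) h) (k : K) :
    h (.inl (f k)) = h (.inr (g k)) := hh (glueConn_glue k)

theorem Respects.bot (h : A → C) : Respects (⊥ : Setoid A) h := fun _ _ e => congrArg h e

theorem Respects.mk (s : Setoid A) : Respects s (Quotient.mk s) := fun _ _ e => Quotient.sound e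

theorem Respects.then {h : A → C} (hh : Respects s h) (φ : C → D) :
    Respects s fun a => φ (h a) := fun _ _ e => congrArg φ (hh e)

/-- The function on classes induced by a function that respects the relation. -/
def Respects.desc {h : A → C} (hh : Respects s h) : Comp s → C := Quotient.lift h hh

@[simp] theorem Respects.desc_mk {h : A → C} (hh : Respects s h) (a : A) :
    hh.desc (Quotient.mk s a) = h a := rfl

/-- The component of the glued space that contains a component of the first part. -/
def glueInl (s : Setoid A) (t : Setoid B) (f : K → A) (g : K → B) :
    Comp s → Comp (glueConn s t f g) := Quotient.map Sum.inl fun _ _ h => glueConn_inl h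

/-- The component of the glued space that contains a component of the second part. -/
def glueInr (s : Setoid A) (t : Setoid B) (f : K → A) (g : K → B) :
    Comp t → Comp (glueConn s t f g) := Quotient.map Sum.inr fun _ _ h => glueConn_inr h

@[simp] theorem glueInl_mk (a : A) : glueInl s t f g (Quotient.mk s a) = Quotient.mk _ (.inl a) :=
  rfl

@[simp] theorem glueInr_mk (b : B) : glueInr s t f g (Quotient.mk t b) = Quotient.mk _ (.inr b) :=
  rfl

theorem mk_glue (k : K) : (Quotient.mk (glueConn s t f g) (.inl (f k))) =
    Quotient.mk (glueConn s t f g) (.inr (g k)) := Quotient.sound (glueConn_glue k)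

section GlueMap

variable {A' B' : Type} {s' : Setoid A'} {t' : Setoid B'} {f' : K → A'} {g' : K → B'}

/-- Maps of components that are compatible with the gluing maps induce a map of the components
after gluing. -/
def glueMap (e : Comp s → Comp s') (e' : Comp t → Comp t')
    (hf : ∀ k, e (Quotient.mk _ (f k)) = Quotient.mk _ (f' k))
    (hg : ∀ k, e' (Quotient.mk _ (g k)) = Quotient.mk _ (g' k)) :
    Comp (glueConn s t f g) → Comp (glueConn s' t' f' g') :=
  Respects.desc (s := glueConn s t f g)
    (h := Sum.elim (fun p => glueInl s' t' f' g' (e (Quotient.mk _ p)))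
      (fun p => glueInr s' t' f' g' (e' (Quotient.mk _ p))))
    (.glue (fun _ _ h => congrArg (fun x => glueInl _ _ _ _ (e x)) (Quotient.sound h))
      (fun _ _ h => congrArg (fun x => glueInr _ _ _ _ (e' x)) (Quotient.sound h))
      (fun k => by
        simp only [Sum.elim_inl, Sum.elim_inr, hf, hg, glueInl_mk, glueInr_mk]
        exact mk_glue k))

theorem glueMap_inl (e : Comp s → Comp s') (e' : Comp t → Comp t') (hf) (hg) (x : Comp s) :
    glueMap (f := f) (g := g) (f' := f') (g' := g') e e' hf hg (glueInl s t f g x) =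
      glueInl _ _ _ _ (e x) := by
  obtain ⟨p, rfl⟩ := Quotient.exists_rep x; rfl

theorem glueMap_inr (e : Comp s → Comp s') (e' : Comp t → Comp t') (hf) (hg) (x : Comp t) :
    glueMap (f := f) (g := g) (f' := f') (g' := g') e e' hf hg (glueInr s t f g x) =
      glueInr _ _ _ _ (e' x) := by
  obtain ⟨p, rfl⟩ := Quotient.exists_rep x; rfl

theorem glue_cases {P : Comp (glueConn s t f g) → Prop} (h1 : ∀ x, P (glueInl s t f g x))
    (h2 : ∀ x, P (glueInr s t f g x)) (x) : P x := by
  obtain ⟨p | p, rfl⟩ := Quotient.exists_rep x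
  · exact h1 (Quotient.mk _ p)
  · exact h2 (Quotient.mk _ p)

/-- Bijections of components that are compatible with the gluing maps induce a bijection of the
components after gluing. -/
def glueEquiv (e : Comp s ≃ Comp s') (e' : Comp t ≃ Comp t')
    (hf : ∀ k, e (Quotient.mk _ (f k)) = Quotient.mk _ (f' k))
    (hg : ∀ k, e' (Quotient.mk _ (g k)) = Quotient.mk _ (g' k)) :
    Comp (glueConn s t f g) ≃ Comp (glueConn s' t' f' g') where
  toFun := glueMap e e' hf hg
  invFun := glueMap e.symm e'.symm (fun k => by rw [← hf, Equiv.symm_apply_apply])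
    (fun k => by rw [← hg, Equiv.symm_apply_apply])
  left_inv := glue_cases (fun x => by rw [glueMap_inl, glueMap_inl, Equiv.symm_apply_apply])
    (fun x => by rw [glueMap_inr, glueMap_inr, Equiv.symm_apply_apply])
  right_inv := glue_cases (fun x => by rw [glueMap_inl, glueMap_inl, Equiv.apply_symm_apply])
    (fun x => by rw [glueMap_inr, glueMap_inr, Equiv.apply_symm_apply])

end GlueMap

end Respects

/-- The base case of the two arcs: the doubled Euler characteristic of an arc counts its two ends,
which lie on one side, while the other side is empty. -/
theorem two_smul_push_unit {C : Type} (h : Unit → C) (h' : Fin 2 → C) (hh : ∀ i, h' i = h ())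
    (h0 : Fin 0 → C) : (2 : ℤ) • push h (fun _ => 1) =
      push h0 (fun _ => (1 : ℤ)) + push h' (fun _ => 1) := by
  funext c
  obtain rfl : h' = fun _ => h () := funext hh
  simp only [push, Pi.smul_apply, Pi.add_apply, Finset.univ_unique, Finset.sum_singleton,
    Finset.univ_eq_empty, Finset.sum_empty, Fin.sum_univ_two]
  simp only [PUnit.default_eq_unit]
  split_ifs <;> simp

/-- A glued point is counted once at the bottom of the first part and once at the top of the second.
Gluing subtracts it twice from the doubled Euler characteristic, and since `h` respects the gluing
the contributions cancel. -/
theorem two_smul_push_glue {A B C K : Type} [Fintype A] [Fintype B] [Fintype K] {s : Setoid A}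
    {t : Setoid B} {f : K → A} {g : K → B} {h : A ⊕ B → C} (hh : Respects (glueConn s t f g) h)
    {χ : A → ℤ} {χ' : B → ℤ} {x y : C → ℤ}
    (ha : (2 : ℤ) • push (fun a => h (.inl a)) χ = x + push (fun k => h (.inl (f k))) (fun _ => 1))
    (hb : (2 : ℤ) • push (fun b => h (.inr b)) χ' = push (fun k => h (.inr (g k))) (fun _ => 1) + y) :
    (2 : ℤ) • push h (glueEuler χ χ' g fun _ => 1) = x + y := by
  have e : push (fun k => h (.inr (g k))) (fun _ => (1 : ℤ)) =
      push (fun k => h (.inl (f k))) (fun _ => 1) :=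
    congrArg (push · _) (funext fun k => (hh.glued k).symm)
  rw [push_glueEuler, smul_add, smul_sub, ha, hb, two_smul ℤ (push (fun k => _) fun _ => (1 : ℤ)), e]
  abel

theorem two_smul_push_beside {A B C : Type} [Fintype A] [Fintype B] {m n m' n' : ℕ}
    {h : A ⊕ B → C} {χ : A → ℤ} {χ' : B → ℤ} (a : Fin m → A) (a' : Fin n → A) (b : Fin m' → B)
    (b' : Fin n' → B) (ha : (2 : ℤ) • push (fun a => h (.inl a)) χ =
      push (fun i => h (.inl (a i))) (fun _ => 1) + push (fun i => h (.inl (a' i))) (fun _ => 1))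
    (hb : (2 : ℤ) • push (fun b => h (.inr b)) χ' =
      push (fun i => h (.inr (b i))) (fun _ => 1) + push (fun i => h (.inr (b' i))) (fun _ => 1)) :
    (2 : ℤ) • push h (glueEuler (K := Empty) χ χ' Empty.elim Empty.elim) =
      push (fun i => h (Sum.map a b (finSumFinEquiv.symm i))) (fun _ => 1) +
        push (fun i => h (Sum.map a' b' (finSumFinEquiv.symm i))) (fun _ => 1) := by
  rw [push_const_fin_add fun x => h (Sum.map a b x), push_const_fin_add fun x => h (Sum.map a' b' x),
    push_glueEuler, smul_add, smul_sub, ha, hb, push_empty]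
  simp only [Sum.map_inl, Sum.map_inr]
  abel

/-- Twice the Euler characteristic of a component of a planar diagram is its number of boundary
points. -/
theorem Diag.two_smul_push_euler : ∀ {m n : ℕ} (a : Diag m n) {C : Type} (h : a.Piece → C),
    Respects a.conn h → (2 : ℤ) • push h a.euler =
      push (fun i => h (a.top i)) (fun _ => 1) + push (fun i => h (a.bot i)) (fun _ => 1)
  | _, _, strands _, _, _, _ => two_smul ℤ _
  | _, _, cap, _, h, _ => two_smul_push_unit h _ (fun _ => rfl) _
  | _, _, cup, _, h, _ => (two_smul_push_unit h _ (fun _ => rfl) _).trans (add_comm _ _)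
  | _, _, stack a b, _, _, hh => two_smul_push_glue hh (two_smul_push_euler a _ hh.inl)
      (two_smul_push_euler b _ hh.inr)
  | _, _, beside a b, _, _, hh => two_smul_push_beside a.top a.bot b.top b.bot
      (two_smul_push_euler a _ hh.inl) (two_smul_push_euler b _ hh.inr)

/-! ### Isotopies -/

/-- A bijection between the components of two diagrams that is compatible with the boundary. -/
@[ext] structure DIso {m n : ℕ} (a b : Diag m n) where
  comps : a.Components ≃ b.Components
  top : ∀ i, comps (Quotient.mk _ (a.top i)) = Quotient.mk _ (b.top i)
  bot : ∀ i, comps (Quotient.mk _ (a.bot i)) = Quotient.mk _ (b.bot i)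

namespace DIso

variable {m n : ℕ} {a b c : Diag m n}

/-- The Euler characteristic of a component is half its number of boundary points, which the
bijection preserves. The last condition of `Cob.isotopy` is thus automatic. -/
theorem euler (e : DIso a b) (x : a.Components) :
    compSum b.conn b.euler (e.comps x) = compSum a.conn a.euler x := by
  have hb := congrFun (b.two_smul_push_euler _ (Respects.mk b.conn)) (e.comps x)
  have ha := congrFun (a.two_smul_push_euler _ (Respects.mk a.conn)) x
  have ht : push (fun i => Quotient.mk b.conn (b.top i)) (fun _ => (1 : ℤ)) (e.comps x) =
      push (fun i => Quotient.mk a.conn (a.top i)) (fun _ => 1) x := by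
    simp only [← e.top]; exact push_inj e.comps.injective _ _ _
  have hb' : push (fun i => Quotient.mk b.conn (b.bot i)) (fun _ => (1 : ℤ)) (e.comps x) =
      push (fun i => Quotient.mk a.conn (a.bot i)) (fun _ => 1) x := by
    simp only [← e.bot]; exact push_inj e.comps.injective _ _ _
  simp only [Pi.smul_apply, Pi.add_apply, smul_eq_mul] at ha hb
  unfold compSum
  linarith

/-- The cobordism traced out by an isotopy. -/
def cob (e : DIso a b) : Cob a b := .isotopy e.comps e.top e.bot e.euler

/-- A bijection of components from maps of pieces. -/
def ofMaps (φ : a.Piece → b.Components) (ψ : b.Piece → a.Components) (hφ : Respects a.conn φ)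
    (hψ : Respects b.conn ψ) (h1 : ∀ p, hψ.desc (φ p) = Quotient.mk _ p)
    (h2 : ∀ p, hφ.desc (ψ p) = Quotient.mk _ p) (ht : ∀ i, φ (a.top i) = Quotient.mk _ (b.top i))
    (hb : ∀ i, φ (a.bot i) = Quotient.mk _ (b.bot i)) : DIso a b where
  comps := ⟨hφ.desc, hψ.desc, by rintro ⟨p⟩; exact h1 p, by rintro ⟨p⟩; exact h2 p⟩
  top := ht
  bot := hb

/-- The identity. -/
def refl (a : Diag m n) : DIso a a := ⟨.refl _, fun _ => rfl, fun _ => rfl⟩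

/-- The inverse. -/
def symm (e : DIso a b) : DIso b a :=
  ⟨e.comps.symm, fun i => by rw [← e.top, Equiv.symm_apply_apply],
    fun i => by rw [← e.bot, Equiv.symm_apply_apply]⟩

/-- The composite. -/
def trans (e : DIso a b) (e' : DIso b c) : DIso a c :=
  ⟨e.comps.trans e'.comps, fun i => by simp [e.top, e'.top], fun i => by simp [e.bot, e'.bot]⟩

theorem ext_mk {e e' : DIso a b}
    (h : ∀ p, e.comps (Quotient.mk _ p) = e'.comps (Quotient.mk _ p)) : e = e' :=
  DIso.ext (Equiv.ext fun x => by obtain ⟨p, rfl⟩ := Quotient.exists_rep x; exact h p)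

/-- Stacking. -/
def stack {m k n : ℕ} {a a' : Diag m k} {b b' : Diag k n} (e : DIso a a') (e' : DIso b b') :
    DIso (a.stack b) (a'.stack b') where
  comps := glueEquiv e.comps e'.comps e.bot e'.top
  top i := congrArg (glueInl _ _ _ _) (e.top i)
  bot i := congrArg (glueInr _ _ _ _) (e'.bot i)

theorem glueEquiv_sumMap {A B A' B' K : Type} {s : Setoid A} {t : Setoid B} {f : K → A} {g : K → B}
    {s' : Setoid A'} {t' : Setoid B'} {f' : K → A'} {g' : K → B'}
    (e : Comp s ≃ Comp s') (e' : Comp t ≃ Comp t') (hf) (hg) {I J : Type} (p : I → A) (p' : I → A')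
    (q : J → B) (q' : J → B') (hp : ∀ i, e (Quotient.mk _ (p i)) = Quotient.mk _ (p' i))
    (hq : ∀ i, e' (Quotient.mk _ (q i)) = Quotient.mk _ (q' i)) (x : I ⊕ J) :
    glueEquiv (f := f) (g := g) (f' := f') (g' := g') e e' hf hg (Quotient.mk _ (Sum.map p q x)) =
      Quotient.mk _ (Sum.map p' q' x) := by
  rcases x with i | i
  · exact congrArg (glueInl _ _ _ _) (hp i)
  · exact congrArg (glueInr _ _ _ _) (hq i)

/-- Juxtaposition. -/
def beside {m n m' n' : ℕ} {a a' : Diag m n} {b b' : Diag m' n'} (e : DIso a a')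
    (e' : DIso b b') : DIso (a.beside b) (a'.beside b') where
  comps := glueEquiv e.comps e'.comps (fun k => k.elim) (fun k => k.elim)
  top _ := glueEquiv_sumMap _ _ _ _ _ _ _ _ e.top e'.top _
  bot _ := glueEquiv_sumMap _ _ _ _ _ _ _ _ e.bot e'.bot _

end DIso

/-! ### Homeomorphisms from maps of pieces -/

namespace Surface

variable {m n : ℕ} {a b c : Diag m n} {C : Type}

/-- Twice the Euler characteristic minus the number of vertical boundary intervals, pushed forward
along a map of pieces. -/
def defect (S : Surface a b) (h : S.Piece → C) : C → ℤ :=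
  (2 : ℤ) • push h S.euler - push (fun i => h (S.inn (a.top i))) (fun _ => 1) -
    push (fun i => h (S.inn (a.bot i))) (fun _ => 1)

/-- The vertical intervals on a component are determined by the lower boundary, so equality of
defects is the same as equality of Euler characteristics. Defects are the better invariant: they add
up under all three gluings and vanish on traces of isotopies. -/
theorem Homeo.of_comps {S T : Surface a b} (φ : S.Piece → Comp T.conn) (ψ : T.Piece → Comp S.conn)
    (hφ : Respects S.conn φ) (hψ : Respects T.conn ψ) (h1 : ∀ p, hψ.desc (φ p) = Quotient.mk _ p)
    (h2 : ∀ p, hφ.desc (ψ p) = Quotient.mk _ p)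
    (hi : ∀ p, φ (S.inn p) = Quotient.mk _ (T.inn p))
    (ho : ∀ p, φ (S.out p) = Quotient.mk _ (T.out p))
    (he : S.defect φ = T.defect (Quotient.mk _))
    (hd : push φ S.dots = push (Quotient.mk _) T.dots) : S.Homeo T := by
  let E : Comp S.conn ≃ Comp T.conn :=
    ⟨hφ.desc, hψ.desc, by rintro ⟨p⟩; exact h1 p, by rintro ⟨p⟩; exact h2 p⟩
  have hE : φ = fun p => E (Quotient.mk _ p) := rfl
  refine ⟨E, hi, ho, fun c => ?_, fun c => ?_⟩
  · have := congrFun he (E c)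
    simp only [defect, hi, Pi.sub_apply, sub_left_inj, Pi.smul_apply, smul_eq_mul] at this
    have h2 : push φ S.euler (E c) = push (Quotient.mk _) T.euler (E c) := by linarith
    unfold compSum
    rw [← h2, hE]
    exact push_inj E.injective _ _ _
  · unfold compSum
    rw [← hd, hE]
    exact push_inj E.injective _ _ _

/-- Gluing subtracts the Euler characteristic of the common diagram `b`. Doubled, this is the number
of endpoints of `b`, which is exactly what the defect of `T` subtracts. Compatibility of `T` ensures
that the pieces of `b` are pushed forward along a function respecting their connectedness. -/
theorem defect_comp (S : Surface a b) {T : Surface b c} (hT : T.Compat)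
    (h : S.Piece ⊕ T.Piece → C) (hh : Respects (S.comp T).conn h) :
    (S.comp T).defect h = S.defect (fun p => h (.inl p)) + T.defect (fun p => h (.inr p)) := by
  have key := b.two_smul_push_euler (fun p => h (.inr (T.inn p)))
    (fun _ _ e => hh (glueConn_inr (hT.inn _ _ e)))
  change (2 : ℤ) • push (K := S.Piece ⊕ T.Piece) h (glueEuler _ _ _ _) -
    push (fun i => h (.inl (S.inn (a.top i)))) _ - push (fun i => h (.inl (S.inn (a.bot i)))) _ = _
  rw [push_glueEuler, smul_add, smul_sub, key]
  simp only [defect]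
  abel

theorem defect_stack {m k n : ℕ} {a a' : Diag m k} {b b' : Diag k n} (S : Surface a a')
    (T : Surface b b') (h : S.Piece ⊕ T.Piece → C) (hh : Respects (S.stack T).conn h) :
    (S.stack T).defect h = S.defect (fun p => h (.inl p)) + T.defect (fun p => h (.inr p)) := by
  have e : push (fun j => h (.inr (T.inn (b.top j)))) (fun _ => (1 : ℤ)) =
      push (fun j => h (.inl (S.inn (a.bot j)))) (fun _ => 1) :=
    congrArg (push · _) (funext fun j => (hh.glued j).symm)
  change (2 : ℤ) • push (K := S.Piece ⊕ T.Piece) h (glueEuler _ _ _ _) -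
    push (fun i => h (.inl (S.inn (a.top i)))) _ - push (fun i => h (.inr (T.inn (b.bot i)))) _ = _
  rw [push_glueEuler, smul_add, smul_sub, two_smul ℤ (push (fun j => _) fun _ => (1 : ℤ))]
  simp only [defect]
  rw [e]
  abel

theorem defect_beside {m n m' n' : ℕ} {a a' : Diag m n} {b b' : Diag m' n'} (S : Surface a a')
    (T : Surface b b') (h : S.Piece ⊕ T.Piece → C) :
    (S.beside T).defect h = S.defect (fun p => h (.inl p)) + T.defect (fun p => h (.inr p)) := by
  have e1 := push_const_fin_add
    (fun x => h (Sum.map S.inn T.inn (Sum.map a.top b.top x))) (1 : ℤ)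
  have e2 := push_const_fin_add
    (fun x => h (Sum.map S.inn T.inn (Sum.map a.bot b.bot x))) (1 : ℤ)
  change (2 : ℤ) • push (K := S.Piece ⊕ T.Piece) h (glueEuler (K := Empty) _ _ _ _) -
    push (fun i : Fin (m + m') =>
      h (Sum.map S.inn T.inn (Sum.map a.top b.top (finSumFinEquiv.symm i)))) _ -
    push (fun i : Fin (n + n') =>
      h (Sum.map S.inn T.inn (Sum.map a.bot b.bot (finSumFinEquiv.symm i)))) _ = _
  rw [e1, e2, push_glueEuler, push_empty, smul_add, sub_zero]
  simp only [defect, Sum.map_inl, Sum.map_inr]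
  abel

theorem dots_comp (S : Surface a b) (T : Surface b c) (h : S.Piece ⊕ T.Piece → C) :
    push h (S.comp T).dots = push (fun p => h (.inl p)) S.dots + push (fun p => h (.inr p)) T.dots :=
  push_sum _ _

theorem dots_stack {m k n : ℕ} {a a' : Diag m k} {b b' : Diag k n} (S : Surface a a')
    (T : Surface b b') (h : S.Piece ⊕ T.Piece → C) :
    push h (S.stack T).dots = push (fun p => h (.inl p)) S.dots + push (fun p => h (.inr p)) T.dots :=
  push_sum _ _

theorem dots_beside {m n m' n' : ℕ} {a a' : Diag m n} {b b' : Diag m' n'} (S : Surface a a')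
    (T : Surface b b') (h : S.Piece ⊕ T.Piece → C) :
    push h (S.beside T).dots =
      push (fun p => h (.inl p)) S.dots + push (fun p => h (.inr p)) T.dots :=
  push_sum _ _

end Surface

namespace DIso

variable {m n : ℕ} {a b c : Diag m n} {C : Type}

/-- The surface traced out by an isotopy. -/
abbrev surf (e : DIso a b) : Surface a b :=
  { Surface.cylinder a with out := fun p => (e.comps.symm (Quotient.mk _ p)).out }

theorem defect_surf (e : DIso a b) (h : a.Piece → C) (hh : Respects a.conn h) :
    e.surf.defect h = 0 := by
  change (2 : ℤ) • push h a.euler - push (fun i => h (a.top i)) _ -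
    push (fun i => h (a.bot i)) _ = _
  rw [a.two_smul_push_euler h hh]
  abel

theorem dots_surf (e : DIso a b) (h : a.Piece → C) : push h e.surf.dots = 0 := push_zero h

theorem mk_out (e : DIso a b) (p : b.Piece) :
    Quotient.mk a.conn (e.surf.out p) = e.comps.symm (Quotient.mk _ p) :=
  Quotient.out_eq _

theorem surf_compat (e : DIso a b) : e.surf.Compat := e.cob.surface_compat

end DIso

end SpinNet
end

/-! ### Composition, gluing and naturality of isotopies -/

noncomputable section
namespace SpinNet

namespace Surface

variable {m n : ℕ} {a b : Diag m n}

/-- The component of the surface that contains a component of the lower boundary. -/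
def innComp {S : Surface a b} (hS : S.Compat) : Comp a.conn → Comp S.conn :=
  Quotient.map S.inn hS.inn

/-- The component of the surface that contains a component of the upper boundary. -/
def outComp {S : Surface a b} (hS : S.Compat) : Comp b.conn → Comp S.conn :=
  Quotient.map S.out hS.out

end Surface

namespace DIso

variable {m n : ℕ} {a b c a' b' : Diag m n}

theorem homeo_trans (e : DIso a b) (e' : DIso b c) :
    (e.surf.comp e'.surf).Homeo (e.trans e').surf := by
  have hφ : Respects (e.surf.comp e'.surf).conn
      (Sum.elim (fun p => Quotient.mk a.conn p) (fun q => e.comps.symm (Quotient.mk _ q))) :=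
    .glue (Respects.mk _) (fun _ _ h => congrArg e.comps.symm (Quotient.sound h))
      (fun k => e.mk_out k)
  refine Surface.Homeo.of_comps _
    (fun p => Quotient.mk _ (.inl p)) hφ (fun _ _ h => Quotient.sound (glueConn_inl h)) ?_
    (fun _ => rfl) (fun _ => rfl) ?_ ?_ ?_
  · rintro (p | q)
    · rfl
    · rw [Sum.elim_inr, ← e.mk_out]
      exact Quotient.sound (glueConn_glue q)
  · intro p
    change e.comps.symm (Quotient.mk _ (e'.surf.out p)) = _
    rw [e'.mk_out]
    exact ((e.trans e').mk_out p).symm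
  · rw [Surface.defect_comp e.surf e'.surf_compat _ hφ, (e.trans e').defect_surf _ (Respects.mk _),
      e.defect_surf _ hφ.inl, e'.defect_surf _ hφ.inr, add_zero]
  · rw [Surface.dots_comp, (e.trans e').dots_surf, e.dots_surf, e'.dots_surf, add_zero]

theorem cls_trans (e : DIso a b) (e' : DIso b c) :
    compHom (cls e.cob) (cls e'.cob) = cls (e.trans e').cob := by
  rw [compHom_cls]
  exact cls_eq_of_homeo (homeo_trans e e')

theorem homeo_stack {m k n : ℕ} {a a' : Diag m k} {b b' : Diag k n} (e : DIso a a')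
    (e' : DIso b b') : (e.surf.stack e'.surf).Homeo (e.stack e').surf := by
  have hm : Respects (glueConn a.conn b.conn a.bot b.top) (Quotient.mk _) :=
    Respects.mk _
  refine Surface.Homeo.of_comps (T := (e.stack e').surf) (Quotient.mk _) (Quotient.mk _) hm
    (Respects.mk _) (fun _ => rfl) (fun _ => rfl) ?_ ?_ ?_ ?_
  · rintro (p | p) <;> rfl
  · intro p
    refine Eq.trans ?_ ((e.stack e').mk_out p).symm
    rcases p with p | p
    · exact congrArg (glueInl _ _ _ _) (e.mk_out p)
    · exact congrArg (glueInr _ _ _ _) (e'.mk_out p)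
  · refine (Surface.defect_stack e.surf e'.surf _ hm).trans ?_
    rw [e.defect_surf _ hm.inl, e'.defect_surf _ hm.inr, add_zero]
    exact ((e.stack e').defect_surf _ (Respects.mk _)).symm
  · exact (Surface.dots_stack e.surf e'.surf _).trans ((congrArg₂ (· + ·) (e.dots_surf _)
      (e'.dots_surf _)).trans ((add_zero 0).trans ((e.stack e').dots_surf _).symm))

theorem cls_stack {m k n : ℕ} {a a' : Diag m k} {b b' : Diag k n} (e : DIso a a')
    (e' : DIso b b') : stackHom (cls e.cob) (cls e'.cob) = cls (e.stack e').cob := by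
  rw [stackHom_cls]
  exact cls_eq_of_homeo (homeo_stack e e')

theorem homeo_beside {m n m' n' : ℕ} {a a' : Diag m n} {b b' : Diag m' n'} (e : DIso a a')
    (e' : DIso b b') : (e.surf.beside e'.surf).Homeo (e.beside e').surf := by
  have hm : Respects (glueConn (K := Empty) a.conn b.conn Empty.elim Empty.elim)
      (Quotient.mk _) := Respects.mk _
  refine Surface.Homeo.of_comps (T := (e.beside e').surf) (Quotient.mk _) (Quotient.mk _) hm
    (Respects.mk _) (fun _ => rfl) (fun _ => rfl) ?_ ?_ ?_ ?_
  · rintro (p | p) <;> rfl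
  · intro p
    refine Eq.trans ?_ ((e.beside e').mk_out p).symm
    rcases p with p | p
    · exact congrArg (glueInl _ _ _ _) (e.mk_out p)
    · exact congrArg (glueInr _ _ _ _) (e'.mk_out p)
  · exact (Surface.defect_beside e.surf e'.surf _).trans ((congrArg₂ (· + ·)
      (e.defect_surf _ hm.inl) (e'.defect_surf _ hm.inr)).trans
        ((add_zero 0).trans ((e.beside e').defect_surf _ (Respects.mk _)).symm))
  · exact (Surface.dots_beside e.surf e'.surf _).trans ((congrArg₂ (· + ·) (e.dots_surf _)
      (e'.dots_surf _)).trans ((add_zero 0).trans ((e.beside e').dots_surf _).symm))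

theorem cls_beside {m n m' n' : ℕ} {a a' : Diag m n} {b b' : Diag m' n'} (e : DIso a a')
    (e' : DIso b b') : besideHom (cls e.cob) (cls e'.cob) = cls (e.beside e').cob := by
  rw [besideHom_cls]
  exact cls_eq_of_homeo (homeo_beside e e')

/-- Isotopies that carry one surface into another intertwine them. -/
theorem homeo_naturality {S : Surface a b} {T : Surface a' b'} (hS : S.Compat) (hT : T.Compat)
    (e : DIso a a') (e' : DIso b b') (φ : S.Piece → Comp T.conn) (ψ : T.Piece → Comp S.conn)
    (hφ : Respects S.conn φ) (hψ : Respects T.conn ψ)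
    (h1 : ∀ p, hψ.desc (φ p) = Quotient.mk _ p) (h2 : ∀ p, hφ.desc (ψ p) = Quotient.mk _ p)
    (hi : ∀ p, φ (S.inn p) = Surface.innComp hT (e.comps (Quotient.mk _ p)))
    (ho : ∀ p, φ (S.out p) = Surface.outComp hT (e'.comps (Quotient.mk _ p)))
    (he : ∀ {C : Type} (F : Comp T.conn → C), S.defect (fun p => F (φ p)) =
      T.defect (fun p => F (Quotient.mk _ p)))
    (hd : ∀ {C : Type} (F : Comp T.conn → C), push (fun p => F (φ p)) S.dots =
      push (fun p => F (Quotient.mk _ p)) T.dots) :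
    (S.comp e'.surf).Homeo (e.surf.comp T) := by
  have hφ' : ∀ x y, hφ.desc x = y → x = hψ.desc y := by
    rintro x y rfl
    obtain ⟨p, rfl⟩ := Quotient.exists_rep x
    exact (h1 p).symm
  let R := glueInr e.surf.conn T.conn e.surf.out T.inn
  let Li := glueInl S.conn e'.surf.conn S.out e'.surf.inn
  -- In the composite on the right, a piece of `a` is glued to `T` along the isotopy, so it lies in
  -- the component of `T` that contains its image in `a'`.
  have hi' : ∀ p, R (φ (S.inn p)) = Quotient.mk _ (Sum.inl p) := fun p => by
    obtain ⟨k, hk⟩ := Quotient.exists_rep (e.comps (Quotient.mk _ p))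
    rw [hi, ← hk]
    refine (Quotient.sound (glueConn_glue k)).symm.trans ?_
    have h : Quotient.mk a.conn (e.surf.out k) = Quotient.mk a.conn p := by
      rw [e.mk_out, hk, Equiv.symm_apply_apply]
    exact congrArg (glueInl e.surf.conn T.conn e.surf.out T.inn) h
  have HS : Respects (S.comp e'.surf).conn (Sum.elim (fun p => R (φ p))
      (fun q => R (Surface.outComp hT (e'.comps (Quotient.mk _ q))))) :=
    .glue (hφ.then R) (fun _ _ h => congrArg
      (fun x => R (Surface.outComp hT (e'.comps x))) (Quotient.sound h))
      (fun k => congrArg R (ho k))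
  have HT : Respects (e.surf.comp T).conn (Sum.elim
      (fun p => Li (Quotient.mk _ (S.inn p))) (fun x => Li (ψ x))) :=
    .glue (fun _ _ h => congrArg Li (Quotient.sound (hS.inn _ _ h))) (hψ.then Li)
      (fun k => congrArg Li (by
        refine hφ' (Quotient.mk _ (S.inn (e.surf.out k))) (Quotient.mk _ (T.inn k)) ?_
        rw [Respects.desc_mk, hi, e.mk_out, Equiv.apply_symm_apply]; rfl))
  have HTr : ∀ x, HT.desc (R x) = Li (hψ.desc x) := fun x => by
    obtain ⟨p, rfl⟩ := Quotient.exists_rep x; rfl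
  have HSl : ∀ x, HS.desc (Li x) = R (hφ.desc x) := fun x => by
    obtain ⟨p, rfl⟩ := Quotient.exists_rep x; rfl
  refine Surface.Homeo.of_comps _ _ HS HT ?_ ?_ hi' ?_ ?_ ?_
  · rintro (p | q)
    · rw [Sum.elim_inl, HTr, h1]; rfl
    · rw [Sum.elim_inr, HTr, ← ho, h1]
      exact Quotient.sound (glueConn_glue q)
  · rintro (p | x)
    · rw [Sum.elim_inl, HSl]
      exact hi' p
    · rw [Sum.elim_inr, HSl, h2]; rfl
  · intro p
    change R (Surface.outComp hT (e'.comps (Quotient.mk _ (e'.surf.out p)))) = _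
    rw [e'.mk_out, Equiv.apply_symm_apply]; rfl
  · rw [Surface.defect_comp S e'.surf_compat _ HS, Surface.defect_comp e.surf hT _ (Respects.mk _),
      e'.defect_surf _ HS.inr, e.defect_surf _ (Respects.inl (Respects.mk _)), add_zero, zero_add]
    exact he R
  · rw [Surface.dots_comp, Surface.dots_comp, e'.dots_surf, e.dots_surf, add_zero, zero_add]
    exact hd R

end DIso

end SpinNet
end

noncomputable section
namespace SpinNet

/-! ### Coherence isotopies -/

/-- A bijection that is compatible with two relations induces a bijection of the classes. -/
def compEquiv {A B : Type} {s : Setoid A} {t : Setoid B} (E : A ≃ B)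
    (h1 : ∀ x y, s x y → t (E x) (E y)) (h2 : ∀ x y, t x y → s (E.symm x) (E.symm y)) :
    Comp s ≃ Comp t where
  toFun := Quotient.map E h1
  invFun := Quotient.map E.symm h2
  left_inv := by rintro ⟨p⟩; exact congrArg (Quotient.mk s) (E.symm_apply_apply p)
  right_inv := by rintro ⟨p⟩; exact congrArg (Quotient.mk t) (E.apply_symm_apply p)

section GlueEquivs

variable {A B C A' B' K K' L : Type}

theorem glueConn_assoc (s : Setoid A) (t : Setoid B) (u : Setoid C) (f : K → A) (g : K → B)
    (f' : L → B) (g' : L → C) {x y}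
    (h : glueConn (glueConn s t f g) u (fun l => .inr (f' l)) g' x y) :
    glueConn s (glueConn t u f' g') f (fun k => .inl (g k)) (Equiv.sumAssoc _ _ _ x)
      (Equiv.sumAssoc _ _ _ y) :=
  Quotient.exact (Respects.glue (f := (fun l => .inr (f' l) : L → A ⊕ B)) (g := g') (h := fun x => Quotient.mk
      (glueConn s (glueConn t u f' g') f (fun k => .inl (g k))) (Equiv.sumAssoc _ _ _ x))
    (.glue (fun _ _ h => Quotient.sound (glueConn_inl h))
      (fun _ _ h => Quotient.sound (glueConn_inr (glueConn_inl h)))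
      (fun k => mk_glue (t := glueConn t u f' g') (g := fun k => .inl (g k)) k))
    (fun _ _ h => Quotient.sound (glueConn_inr (glueConn_inr h)))
    (fun l => congrArg (glueInr s (glueConn t u f' g') f fun k => .inl (g k)) (mk_glue (s := t) (t := u) (f := f') (g := g') l)) h)

theorem glueConn_assoc_symm (s : Setoid A) (t : Setoid B) (u : Setoid C) (f : K → A) (g : K → B)
    (f' : L → B) (g' : L → C) {x y}
    (h : glueConn s (glueConn t u f' g') f (fun k => .inl (g k)) x y) :
    glueConn (glueConn s t f g) u (fun l => .inr (f' l)) g' ((Equiv.sumAssoc _ _ _).symm x)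
      ((Equiv.sumAssoc _ _ _).symm y) :=
  Quotient.exact (Respects.glue (f := f) (g := (fun k => .inl (g k) : K → B ⊕ C)) (h := fun x => Quotient.mk
      (glueConn (glueConn s t f g) u (fun l => .inr (f' l)) g') ((Equiv.sumAssoc _ _ _).symm x))
    (fun _ _ h => Quotient.sound (glueConn_inl (glueConn_inl h)))
    (.glue (fun _ _ h => Quotient.sound (glueConn_inl (glueConn_inr h)))
      (fun _ _ h => Quotient.sound (glueConn_inr h))
      (fun l => mk_glue (s := glueConn s t f g) (f := fun l => .inr (f' l)) l))
    (fun k => congrArg (glueInl (glueConn s t f g) u (fun l => .inr (f' l)) g') (mk_glue (s := s) (t := t) (f := f) (g := g) k)) h)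

/-- The bijection `σ` stands for `finSumFinEquiv.symm`: the points along which juxtaposed diagrams
are stacked are those of the left pair followed by those of the right pair. -/
theorem glueConn_interchange (s : Setoid A) (t : Setoid B) (s' : Setoid A') (t' : Setoid B')
    (f : K → A) (g : K → B) (f' : K' → A') (g' : K' → B') (σ : L ≃ K ⊕ K') {x y}
    (h : glueConn (K := Empty) (glueConn s t f g) (glueConn s' t' f' g') Empty.elim Empty.elim
      x y) :
    glueConn (glueConn (K := Empty) s s' Empty.elim Empty.elim)
      (glueConn (K := Empty) t t' Empty.elim Empty.elim) (fun l => Sum.map f f' (σ l))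
      (fun l => Sum.map g g' (σ l)) (Equiv.sumSumSumComm _ _ _ _ x)
      (Equiv.sumSumSumComm _ _ _ _ y) := by
  have key := mk_glue (s := glueConn (K := Empty) s s' Empty.elim Empty.elim)
      (t := glueConn (K := Empty) t t' Empty.elim Empty.elim) (f := fun l => Sum.map f f' (σ l))
      (g := fun l => Sum.map g g' (σ l))
  refine Quotient.exact (Respects.glue (h := fun x => Quotient.mk (glueConn
      (glueConn (K := Empty) s s' Empty.elim Empty.elim)
      (glueConn (K := Empty) t t' Empty.elim Empty.elim) (fun l => Sum.map f f' (σ l))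
      (fun l => Sum.map g g' (σ l))) (Equiv.sumSumSumComm _ _ _ _ x))
    (.glue (fun _ _ h => Quotient.sound (glueConn_inl (glueConn_inl h)))
      (fun _ _ h => Quotient.sound (glueConn_inr (glueConn_inl h))) (fun k => ?_))
    (.glue (fun _ _ h => Quotient.sound (glueConn_inl (glueConn_inr h)))
      (fun _ _ h => Quotient.sound (glueConn_inr (glueConn_inr h))) (fun k => ?_))
    (fun k => k.elim) h)
  · simpa using key (σ.symm (.inl k))
  · simpa using key (σ.symm (.inr k))

theorem glueConn_interchange_symm (s : Setoid A) (t : Setoid B) (s' : Setoid A') (t' : Setoid B')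
    (f : K → A) (g : K → B) (f' : K' → A') (g' : K' → B') (σ : L ≃ K ⊕ K') {x y}
    (h : glueConn (glueConn (K := Empty) s s' Empty.elim Empty.elim)
      (glueConn (K := Empty) t t' Empty.elim Empty.elim) (fun l => Sum.map f f' (σ l))
      (fun l => Sum.map g g' (σ l)) x y) :
    glueConn (K := Empty) (glueConn s t f g) (glueConn s' t' f' g') Empty.elim Empty.elim
      ((Equiv.sumSumSumComm _ _ _ _).symm x) ((Equiv.sumSumSumComm _ _ _ _).symm y) := by
  refine Quotient.exact (Respects.glue (h := fun x => Quotient.mk (glueConn (K := Empty)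
      (glueConn s t f g) (glueConn s' t' f' g') Empty.elim Empty.elim)
      ((Equiv.sumSumSumComm _ _ _ _).symm x))
    (.glue (fun _ _ h => Quotient.sound (glueConn_inl (glueConn_inl h)))
      (fun _ _ h => Quotient.sound (glueConn_inr (glueConn_inl h))) (fun k => k.elim))
    (.glue (fun _ _ h => Quotient.sound (glueConn_inl (glueConn_inr h)))
      (fun _ _ h => Quotient.sound (glueConn_inr (glueConn_inr h))) (fun k => k.elim))
    (fun k => ?_) h)
  rcases σ k with l | l
  · exact Quotient.sound (glueConn_inl (glueConn_glue l))
  · exact Quotient.sound (glueConn_inr (glueConn_glue l))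

/-- Gluing `K` to itself along the identity changes nothing. -/
def glueRightUnit (s : Setoid A) (f : K → A) : Comp (glueConn s (⊥ : Setoid K) f id) ≃ Comp s where
  toFun := Respects.desc (s := glueConn s (⊥ : Setoid K) f id)
    (h := Sum.elim (Quotient.mk s) (fun k => Quotient.mk s (f k)))
    (.glue (Respects.mk s) (Respects.bot _) fun _ => rfl)
  invFun := glueInl _ _ _ _
  left_inv := by
    rintro ⟨p | k⟩
    · rfl
    · exact mk_glue k
  right_inv := by rintro ⟨p⟩; rfl

/-- Gluing `K` to itself along the identity changes nothing. -/
def glueLeftUnit (s : Setoid A) (f : K → A) : Comp (glueConn (⊥ : Setoid K) s id f) ≃ Comp s where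
  toFun := Respects.desc (s := glueConn (⊥ : Setoid K) s id f)
    (h := Sum.elim (fun k => Quotient.mk s (f k)) (Quotient.mk s))
    (.glue (Respects.bot _) (Respects.mk s) fun _ => rfl)
  invFun := glueInr _ _ _ _
  left_inv := by
    rintro ⟨k | p⟩
    · exact (mk_glue k).symm
    · rfl
  right_inv := by rintro ⟨p⟩; rfl

end GlueEquivs

namespace DIso

variable {m k l n m' k' n' : ℕ}

/-- Associativity of stacking. -/
def assoc (a : Diag m k) (b : Diag k l) (c : Diag l n) :
    DIso ((a.stack b).stack c) (a.stack (b.stack c)) where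
  comps := compEquiv (Equiv.sumAssoc a.Piece b.Piece c.Piece)
    (fun _ _ h => glueConn_assoc _ _ _ _ _ _ _ h) (fun _ _ h => glueConn_assoc_symm _ _ _ _ _ _ _ h)
  top _ := rfl
  bot _ := rfl

/-- Interchange of stacking and juxtaposition. -/
def interchange (a : Diag m k) (b : Diag k n) (a' : Diag m' k') (b' : Diag k' n') :
    DIso ((a.stack b).beside (a'.stack b')) ((a.beside a').stack (b.beside b')) where
  comps := compEquiv (Equiv.sumSumSumComm a.Piece b.Piece a'.Piece b'.Piece)
    (fun _ _ h => glueConn_interchange _ _ _ _ _ _ _ _ finSumFinEquiv.symm h)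
    (fun _ _ h => glueConn_interchange_symm _ _ _ _ _ _ _ _ finSumFinEquiv.symm h)
  top i := by
    change Quotient.mk _ (Equiv.sumSumSumComm _ _ _ _ (Sum.map (fun i => Sum.inl (a.top i))
      (fun i => Sum.inl (a'.top i)) (finSumFinEquiv.symm i))) =
      Quotient.mk _ (Sum.inl (Sum.map a.top a'.top (finSumFinEquiv.symm i)))
    rcases finSumFinEquiv.symm i with j | j <;> rfl
  bot i := by
    change Quotient.mk _ (Equiv.sumSumSumComm _ _ _ _ (Sum.map (fun i => Sum.inr (b.bot i))
      (fun i => Sum.inr (b'.bot i)) (finSumFinEquiv.symm i))) =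
      Quotient.mk _ (Sum.inr (Sum.map b.bot b'.bot (finSumFinEquiv.symm i)))
    rcases finSumFinEquiv.symm i with j | j <;> rfl

/-- Vertical strands at the bottom can be omitted. -/
def rightUnit (a : Diag m n) : DIso (a.stack (.strands n)) a where
  comps := glueRightUnit a.conn a.bot
  top _ := rfl
  bot _ := rfl

/-- Vertical strands at the top can be omitted. -/
def leftUnit (a : Diag m n) : DIso ((Diag.strands m).stack a) a where
  comps := glueLeftUnit a.conn a.top
  top _ := rfl
  bot _ := rfl

theorem glueConn_bot_bot {A B : Type} {x y : A ⊕ B}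
    (h : glueConn (K := Empty) (⊥ : Setoid A) (⊥ : Setoid B) Empty.elim Empty.elim x y) : x = y :=
  Respects.glue (h := id) (Respects.bot _) (Respects.bot _) (fun k => k.elim) h

/-- Juxtaposed vertical strands. -/
def strandsBeside (m n : ℕ) :
    DIso ((Diag.strands m).beside (.strands n)) (.strands (m + n)) where
  comps := Quotient.congr (ra := glueConn (K := Empty) ⊥ ⊥ Empty.elim Empty.elim) (rb := ⊥)
    finSumFinEquiv fun x y => ⟨fun h => congrArg finSumFinEquiv (glueConn_bot_bot h), fun h => by
      obtain rfl := finSumFinEquiv.injective h; exact Setoid.refl' _ _⟩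
  top i := by
    change Quotient.mk _ (finSumFinEquiv (Sum.map id id (finSumFinEquiv.symm i))) = _
    simp; rfl
  bot i := by
    change Quotient.mk _ (finSumFinEquiv (Sum.map id id (finSumFinEquiv.symm i))) = _
    simp; rfl

/-- Isotopies induced by a bijection of pieces intertwine surfaces with matching pieces. -/
theorem homeo_naturality_of_equiv {a b a' b' : Diag m n}
    {S : Surface a b} {T : Surface a' b'} (hS : S.Compat) (hT : T.Compat)
    (e : DIso a a') (e' : DIso b b') (E : S.Piece ≃ T.Piece)
    (h1 : ∀ x y, S.conn x y → T.conn (E x) (E y))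
    (h2 : ∀ x y, T.conn x y → S.conn (E.symm x) (E.symm y))
    (hi : ∀ p, Quotient.mk _ (E (S.inn p)) = Surface.innComp hT (e.comps (Quotient.mk _ p)))
    (ho : ∀ p, Quotient.mk _ (E (S.out p)) = Surface.outComp hT (e'.comps (Quotient.mk _ p)))
    (he : ∀ {C : Type} (h : T.Piece → C), Respects T.conn h →
      S.defect (fun p => h (E p)) = T.defect h)
    (hd : ∀ {C : Type} (h : T.Piece → C), push (fun p => h (E p)) S.dots = push h T.dots) :
    (S.comp e'.surf).Homeo (e.surf.comp T) := by
  have r1 : Respects S.conn fun p => Quotient.mk T.conn (E p) :=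
    fun _ _ h => Quotient.sound (h1 _ _ h)
  have r2 : Respects T.conn fun p => Quotient.mk S.conn (E.symm p) :=
    fun _ _ h => Quotient.sound (h2 _ _ h)
  exact homeo_naturality hS hT e e' _ _ r1 r2
    (fun p => congrArg (Quotient.mk S.conn) (E.symm_apply_apply p))
    (fun p => congrArg (Quotient.mk T.conn) (E.apply_symm_apply p)) hi ho
    (fun F => he _ ((Respects.mk _).then F)) (fun F => hd fun q => F (Quotient.mk _ q))

/-- Both sides are cut into the same three surfaces. The reassociation of pieces matches their
gluings, and defects and dots are sums over the three surfaces, so only associativity of addition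
remains. -/
theorem cls_assoc {a a' : Diag m k} {b b' : Diag k l} {c c' : Diag l n} (f : Cob a a')
    (g : Cob b b') (h : Cob c c') :
    compHom (cls ((f.stack g).stack h)) (cls (assoc a' b' c').cob) =
      compHom (cls (assoc a b c).cob) (cls (f.stack (g.stack h))) := by
  rw [compHom_cls, compHom_cls]
  refine cls_eq_of_homeo (homeo_naturality_of_equiv
    (S := (f.surface.stack g.surface).stack h.surface)
    (T := f.surface.stack (g.surface.stack h.surface))
    ((f.surface_compat.stack g.surface_compat).stack h.surface_compat)
    (f.surface_compat.stack (g.surface_compat.stack h.surface_compat)) _ _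
    (Equiv.sumAssoc _ _ _) (fun _ _ h => glueConn_assoc _ _ _ _ _ _ _ h)
    (fun _ _ h => glueConn_assoc_symm _ _ _ _ _ _ _ h) ?_ ?_ ?_ ?_)
  · rintro ((p | p) | p) <;> rfl
  · rintro ((p | p) | p) <;> rfl
  · intro C φ hφ
    rw [Surface.defect_stack _ _ _ hφ, Surface.defect_stack g.surface h.surface _ hφ.inr,
      Surface.defect_stack (f.surface.stack g.surface) h.surface _
        (fun _ _ h => hφ (glueConn_assoc _ _ _ _ _ _ _ h)),
      Surface.defect_stack f.surface g.surface _
        (fun _ _ h => hφ (glueConn_assoc _ _ _ _ _ _ _ (glueConn_inl h)))]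
    exact add_assoc _ _ _
  · intro C φ
    rw [Surface.dots_stack f.surface (g.surface.stack h.surface), Surface.dots_stack g.surface,
      Surface.dots_stack (f.surface.stack g.surface), Surface.dots_stack f.surface]
    exact add_assoc _ _ _

theorem cls_interchange {a a₁ : Diag m k} {b b₁ : Diag k n} {a' a₁' : Diag m' k'}
    {b' b₁' : Diag k' n'} (f : Cob a a₁) (g : Cob b b₁) (f' : Cob a' a₁') (g' : Cob b' b₁') :
    compHom (cls ((f.stack g).beside (f'.stack g'))) (cls (interchange a₁ b₁ a₁' b₁').cob) =
      compHom (cls (interchange a b a' b').cob) (cls ((f.beside f').stack (g.beside g'))) := by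
  have hS := (f.surface_compat.stack g.surface_compat).beside
    (f'.surface_compat.stack g'.surface_compat)
  have hT := (f.surface_compat.beside f'.surface_compat).stack
      (g.surface_compat.beside g'.surface_compat)
  -- The two functions differ only in whether the splitting of the boundary points is applied before
  -- or after the passage to the surfaces; the second form is the one to which the interchange of
  -- gluings applies.
  have e1 : (fun j => Sum.map f.surface.inn f'.surface.inn ((a.beside a').bot j)) =
      fun j => Sum.map (fun i => f.surface.inn (a.bot i)) (fun i => f'.surface.inn (a'.bot i))
        (finSumFinEquiv.symm j) := funext fun j => by
    change Sum.map _ _ (Sum.map _ _ (finSumFinEquiv.symm j)) = _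
    rcases finSumFinEquiv.symm j with i | i <;> rfl
  have e2 : (fun j => Sum.map g.surface.inn g'.surface.inn ((b.beside b').top j)) =
      fun j => Sum.map (fun i => g.surface.inn (b.top i)) (fun i => g'.surface.inn (b'.top i))
        (finSumFinEquiv.symm j) := funext fun j => by
    change Sum.map _ _ (Sum.map _ _ (finSumFinEquiv.symm j)) = _
    rcases finSumFinEquiv.symm j with i | i <;> rfl
  have c1 : ∀ x y, ((f.surface.stack g.surface).beside (f'.surface.stack g'.surface)).conn x y →
      ((f.surface.beside f'.surface).stack (g.surface.beside g'.surface)).conn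
        (Equiv.sumSumSumComm _ _ _ _ x) (Equiv.sumSumSumComm _ _ _ _ y) := fun _ _ h => by
    change glueConn _ _ _ _ _ _
    rw [e1, e2]
    exact glueConn_interchange _ _ _ _ _ _ _ _ _ h
  rw [compHom_cls, compHom_cls]
  refine cls_eq_of_homeo (homeo_naturality_of_equiv (S := (f.surface.stack g.surface).beside
      (f'.surface.stack g'.surface))
    (T := (f.surface.beside f'.surface).stack (g.surface.beside g'.surface)) hS hT _ _
    (Equiv.sumSumSumComm _ _ _ _) c1
    (fun _ _ h => ?_) ?_ ?_ ?_ ?_)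
  · change glueConn _ _ (fun j => Sum.map f.surface.inn f'.surface.inn ((a.beside a').bot j))
      (fun j => Sum.map g.surface.inn g'.surface.inn ((b.beside b').top j)) _ _ at h
    rw [e1, e2] at h
    exact glueConn_interchange_symm _ _ _ _ _ _ _ _ _ h
  · rintro ((p | p) | (p | p)) <;> rfl
  · rintro ((p | p) | (p | p)) <;> rfl
  · intro C φ hφ
    rw [Surface.defect_stack _ _ _ hφ, Surface.defect_beside, Surface.defect_beside,
      Surface.defect_beside, Surface.defect_stack f.surface g.surface _
        (fun _ _ h => hφ (c1 _ _ (glueConn_inl h))),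
      Surface.defect_stack f'.surface g'.surface _
        (fun _ _ h => hφ (c1 _ _ (glueConn_inr h)))]
    exact add_add_add_comm _ _ _ _
  · intro C φ
    rw [Surface.dots_stack (f.surface.beside f'.surface) (g.surface.beside g'.surface),
      Surface.dots_beside f.surface, Surface.dots_beside g.surface,
      Surface.dots_beside (f.surface.stack g.surface), Surface.dots_stack f.surface,
      Surface.dots_stack f'.surface]
    exact add_add_add_comm _ _ _ _

theorem cls_rightUnit {a a' : Diag m n} (f : Cob a a') :
    compHom (cls (f.stack (.refl (.strands n)))) (cls (rightUnit a').cob) =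
      compHom (cls (rightUnit a).cob) (cls f) := by
  rw [compHom_cls, compHom_cls]
  let I := (refl (Diag.strands n)).surf
  have hφ : Respects (f.surface.stack I).conn (Sum.elim (Quotient.mk f.surface.conn)
      (fun i => Quotient.mk _ (f.surface.inn (a.bot i)))) :=
    .glue (Respects.mk _) (Respects.bot _) fun _ => rfl
  refine cls_eq_of_homeo (homeo_naturality (S := f.surface.stack I) (T := f.surface)
    (f.surface_compat.stack (refl _).surf_compat) f.surface_compat _ _ _
    (fun p => Quotient.mk _ (.inl p)) hφ (fun _ _ h => Quotient.sound (glueConn_inl h))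
    ?_ (fun _ => rfl) ?_ ?_ ?_ ?_)
  · rintro (p | i)
    · rfl
    · exact mk_glue (s := f.surface.conn) (t := I.conn) i
  · rintro (p | i) <;> rfl
  · rintro (p | i)
    · rfl
    · have : I.out i = i := Quotient.exact ((refl (Diag.strands n)).mk_out i)
      change Quotient.mk f.surface.conn (f.surface.inn (a.bot (I.out i))) = _
      rw [this]
      exact Quotient.sound (f.surface_compat.bot i)
  · intro C F
    rw [Surface.defect_stack f.surface I _ (hφ.then F),
      (refl (Diag.strands n)).defect_surf _ (hφ.then F).inr, add_zero]
    rfl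
  · intro C F
    rw [Surface.dots_stack, (refl (Diag.strands n)).dots_surf, add_zero]
    rfl

theorem cls_leftUnit {a a' : Diag m n} (f : Cob a a') :
    compHom (cls ((Cob.refl (.strands m)).stack f)) (cls (leftUnit a').cob) =
      compHom (cls (leftUnit a).cob) (cls f) := by
  rw [compHom_cls, compHom_cls]
  let I := (refl (Diag.strands m)).surf
  have hφ : Respects (I.stack f.surface).conn (Sum.elim
      (fun i => Quotient.mk _ (f.surface.inn (a.top i))) (Quotient.mk f.surface.conn)) :=
    .glue (Respects.bot _) (Respects.mk _) fun _ => rfl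
  refine cls_eq_of_homeo (homeo_naturality (S := I.stack f.surface) (T := f.surface)
    ((refl _).surf_compat.stack f.surface_compat) f.surface_compat _ _ _
    (fun p => Quotient.mk _ (.inr p)) hφ (fun _ _ h => Quotient.sound (glueConn_inr h))
    ?_ (fun _ => rfl) ?_ ?_ ?_ ?_)
  · rintro (i | p)
    · exact (mk_glue (s := I.conn) (t := f.surface.conn) i).symm
    · rfl
  · rintro (i | p) <;> rfl
  · rintro (i | p)
    · have : I.out i = i := Quotient.exact ((refl (Diag.strands m)).mk_out i)
      change Quotient.mk f.surface.conn (f.surface.inn (a.top (I.out i))) = _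
      rw [this]
      exact Quotient.sound (f.surface_compat.top i)
    · rfl
  · intro C F
    rw [Surface.defect_stack I f.surface _ (hφ.then F),
      (refl (Diag.strands m)).defect_surf _ (hφ.then F).inl, zero_add]
    rfl
  · intro C F
    rw [Surface.dots_stack, (refl (Diag.strands m)).dots_surf, zero_add]
    rfl

end DIso

end SpinNet
end

noncomputable section
namespace SpinNet

/-! ### Coherence isomorphisms in the graded categories -/

section LinearExtension

variable {m k l n m' k' n' : ℕ}

theorem stackHom_assoc {a a' : Diag m k} {b b' : Diag k l} {c c' : Diag l n} (x : CobHom a a')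
    (y : CobHom b b') (z : CobHom c c') :
    compHom (stackHom (stackHom x y) z) (cls (DIso.assoc a' b' c').cob) =
      compHom (cls (DIso.assoc a b c).cob) (stackHom x (stackHom y z)) := by
  induction x using CobHom.induction with
  | h0 => simp
  | hadd x y hx hy => simp only [map_add, LinearMap.add_apply, hx, hy]
  | hcls r f =>
  induction y using CobHom.induction with
  | h0 => simp
  | hadd x y hx hy => simp only [map_add, LinearMap.add_apply, hx, hy]
  | hcls s g =>
  induction z using CobHom.induction with
  | h0 => simp
  | hadd x y hx hy => simp only [map_add, LinearMap.add_apply, hx, hy]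
  | hcls t h =>
  simp only [map_smul, LinearMap.smul_apply, stackHom_cls, DIso.cls_assoc]

theorem stackHom_rightUnit {a a' : Diag m n} (x : CobHom a a') :
    compHom (stackHom x (cls (.refl (.strands n)))) (cls (DIso.rightUnit a').cob) =
      compHom (cls (DIso.rightUnit a).cob) x := by
  induction x using CobHom.induction with
  | h0 => simp
  | hadd x y hx hy => simp only [map_add, LinearMap.add_apply, hx, hy]
  | hcls r f => simp only [map_smul, LinearMap.smul_apply, stackHom_cls, DIso.cls_rightUnit]

theorem stackHom_leftUnit {a a' : Diag m n} (x : CobHom a a') :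
    compHom (stackHom (cls (.refl (.strands m))) x) (cls (DIso.leftUnit a').cob) =
      compHom (cls (DIso.leftUnit a).cob) x := by
  induction x using CobHom.induction with
  | h0 => simp
  | hadd x y hx hy => simp only [map_add, LinearMap.add_apply, hx, hy]
  | hcls r f => simp only [map_smul, LinearMap.smul_apply, stackHom_cls, DIso.cls_leftUnit]

theorem stackHom_interchange {a a₁ : Diag m k} {b b₁ : Diag k n} {a' a₁' : Diag m' k'}
    {b' b₁' : Diag k' n'} (x : CobHom a a₁) (y : CobHom b b₁) (x' : CobHom a' a₁')
    (y' : CobHom b' b₁') :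
    compHom (besideHom (stackHom x y) (stackHom x' y'))
        (cls (DIso.interchange a₁ b₁ a₁' b₁').cob) =
      compHom (cls (DIso.interchange a b a' b').cob)
        (stackHom (besideHom x x') (besideHom y y')) := by
  induction x using CobHom.induction with
  | h0 => simp
  | hadd x y hx hy => simp only [map_add, LinearMap.add_apply, hx, hy]
  | hcls r f =>
  induction y using CobHom.induction with
  | h0 => simp
  | hadd x y hx hy => simp only [map_add, LinearMap.add_apply, hx, hy]
  | hcls s g =>
  induction x' using CobHom.induction with
  | h0 => simp
  | hadd x y hx hy => simp only [map_add, LinearMap.add_apply, hx, hy]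
  | hcls r' f' =>
  induction y' using CobHom.induction with
  | h0 => simp
  | hadd x y hx hy => simp only [map_add, LinearMap.add_apply, hx, hy]
  | hcls s' g' =>
  simp only [map_smul, LinearMap.smul_apply, stackHom_cls, besideHom_cls, DIso.cls_interchange]
  simp only [smul_smul]
  congr 1
  ring

end LinearExtension

namespace DIso

variable {m k n m' n' : ℕ}

theorem cls_mem_homDeg {a b : Diag m n} (e : DIso a b) : cls e.cob ∈ homDeg a b 0 :=
  AddSubgroup.subset_closure ⟨0, e.cob, by simp [cob, Cob.deg], by simp⟩

/-- The morphism given by an isotopy. -/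
def hom {a b : Diag m n} (e : DIso a b) {k l : ℤ} (h : k = l) :
    (⟨a, k⟩ : GrDiag m n) ⟶ ⟨b, l⟩ :=
  ⟨cls e.cob, homDeg_congr (sub_eq_zero.2 h).symm e.cls_mem_homDeg⟩

theorem hom_comp {a b c : Diag m n} (e : DIso a b) (e' : DIso b c) {k l j : ℤ} (h : k = l)
    (h' : l = j) : e.hom h ≫ e'.hom h' = (e.trans e').hom (h.trans h') :=
  Subtype.ext (cls_trans e e')

theorem trans_symm {a b : Diag m n} (e : DIso a b) : e.trans e.symm = refl a :=
  DIso.ext (Equiv.self_trans_symm _)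

theorem symm_trans {a b : Diag m n} (e : DIso a b) : e.symm.trans e = refl b :=
  DIso.ext (Equiv.symm_trans_self _)

/-- The isomorphism given by an isotopy. -/
def iso {a b : Diag m n} (e : DIso a b) {k l : ℤ} (h : k = l) :
    (⟨a, k⟩ : GrDiag m n) ≅ ⟨b, l⟩ where
  hom := e.hom h
  inv := e.symm.hom h.symm
  hom_inv_id := by rw [hom_comp, trans_symm]; rfl
  inv_hom_id := by rw [hom_comp, symm_trans]; rfl

end DIso

/-- The number of points on a horizontal line. -/
structure Pt where
  num : ℕ

namespace Pt

/-- Shifted diagrams are the 1-morphisms and stacking is their composition. Wrapping the number of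
points in a structure keeps these morphisms apart from those of the order on ℕ. -/
instance : CategoryStruct Pt where
  Hom a b := GrDiag a.num b.num
  id a := ⟨.strands a.num, 0⟩
  comp A B := ⟨A.diag.stack B.diag, A.shift + B.shift⟩

instance (a b : Pt) : Category (a ⟶ b) := inferInstanceAs (Category (GrDiag a.num b.num))

/-- Stacking of morphisms. -/
def hcomp {a b c : Pt} {f f' : a ⟶ b} {g g' : b ⟶ c} (η : f ⟶ f') (θ : g ⟶ g') :
    f ≫ g ⟶ f' ≫ g' :=
  (GrDiag.stackFunctor a.num b.num c.num).map (X := (f, g)) (Y := (f', g')) (η, θ)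

theorem hcomp_id {a b c : Pt} (f : a ⟶ b) (g : b ⟶ c) : hcomp (𝟙 f) (𝟙 g) = 𝟙 (f ≫ g) :=
  (GrDiag.stackFunctor a.num b.num c.num).map_id (f, g)

theorem hcomp_comp {a b c : Pt} {f f' f'' : a ⟶ b} {g g' g'' : b ⟶ c} (η : f ⟶ f') (η' : f' ⟶ f'')
    (θ : g ⟶ g') (θ' : g' ⟶ g'') : hcomp (η ≫ η') (θ ≫ θ') = hcomp η θ ≫ hcomp η' θ' :=
  (GrDiag.stackFunctor a.num b.num c.num).map_comp (X := (f, g)) (Y := (f', g')) (Z := (f'', g''))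
    (η, θ) (η', θ')

/-- Associativity of stacking. -/
def assoc {a b c d : Pt} (f : a ⟶ b) (g : b ⟶ c) (h : c ⟶ d) : (f ≫ g) ≫ h ≅ f ≫ g ≫ h :=
  (DIso.assoc f.diag g.diag h.diag).iso (add_assoc _ _ _)

/-- The left unit isomorphism. -/
def leftUnit {a b : Pt} (f : a ⟶ b) : 𝟙 a ≫ f ≅ f := (DIso.leftUnit f.diag).iso (zero_add _)

/-- The right unit isomorphism. -/
def rightUnit {a b : Pt} (f : a ⟶ b) : f ≫ 𝟙 b ≅ f := (DIso.rightUnit f.diag).iso (add_zero _)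

theorem hcomp_assoc {a b c d : Pt} {f f' : a ⟶ b} {g g' : b ⟶ c} {h h' : c ⟶ d} (η : f ⟶ f')
    (θ : g ⟶ g') (κ : h ⟶ h') : hcomp (hcomp η θ) κ ≫ (assoc f' g' h').hom =
      (assoc f g h).hom ≫ hcomp η (hcomp θ κ) :=
  Subtype.ext (stackHom_assoc _ _ _)

theorem hcomp_leftUnit {a b : Pt} {f f' : a ⟶ b} (η : f ⟶ f') :
    hcomp (𝟙 (𝟙 a)) η ≫ (leftUnit f').hom = (leftUnit f).hom ≫ η :=
  Subtype.ext (stackHom_leftUnit _)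

theorem hcomp_rightUnit {a b : Pt} {f f' : a ⟶ b} (η : f ⟶ f') :
    hcomp η (𝟙 (𝟙 b)) ≫ (rightUnit f').hom = (rightUnit f).hom ≫ η :=
  Subtype.ext (stackHom_rightUnit _)

/-- Every 2-morphism in the pentagon is the class of an isotopy, and isotopies compose and glue like
bijections of components. The identity can therefore be tested on pieces, where both sides agree by
definition. -/
theorem pentagon {a b c d e : Pt} (f : a ⟶ b) (g : b ⟶ c) (h : c ⟶ d) (i : d ⟶ e) :
    hcomp (assoc f g h).hom (𝟙 i) ≫ (assoc f (g ≫ h) i).hom ≫ hcomp (𝟙 f) (assoc g h i).hom =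
      (assoc (f ≫ g) h i).hom ≫ (assoc f g (h ≫ i)).hom := by
  let F := f.diag; let G := g.diag; let H := h.diag; let I := i.diag
  refine Subtype.ext ?_
  refine (congrArg₂ (fun x y => compHom x y) (DIso.cls_stack (DIso.assoc F G H) (.refl I))
    ((congrArg (fun y => compHom (cls (DIso.assoc F (G.stack H) I).cob) y)
      (DIso.cls_stack (.refl F) (DIso.assoc G H I))).trans (DIso.cls_trans _ _))).trans ?_
  refine (DIso.cls_trans _ _).trans (Eq.trans (congrArg (fun e => cls (DIso.cob e)) ?_)
    (DIso.cls_trans _ _).symm)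
  refine DIso.ext_mk ?_
  rintro (((p | p) | p) | p) <;> rfl

theorem triangle {a b c : Pt} (f : a ⟶ b) (g : b ⟶ c) :
    (assoc f (𝟙 b) g).hom ≫ hcomp (𝟙 f) (leftUnit g).hom = hcomp (rightUnit f).hom (𝟙 g) := by
  let F := f.diag; let G := g.diag
  refine Subtype.ext ?_
  refine (congrArg (fun y => compHom (cls (DIso.assoc F (.strands _) G).cob) y)
      (DIso.cls_stack (.refl F) (DIso.leftUnit G))).trans ((DIso.cls_trans _ _).trans
    (Eq.trans (congrArg (fun e => cls (DIso.cob e)) ?_)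
      (DIso.cls_stack (DIso.rightUnit F) (.refl G)).symm))
  refine DIso.ext_mk ?_
  rintro ((p | p) | p)
  · rfl
  -- A strand in the middle may be contracted onto `F` or onto `G`; the two resulting pieces are
  -- glued to each other.
  · exact (mk_glue (s := F.conn) (t := G.conn) (f := F.bot) (g := G.top) p).symm
  · rfl

/-- The bicategory gives access to the calculus of adjunctions: their composites, their images under
pseudofunctors, and the induced bijections of morphism spaces. -/
instance : Bicategory Pt where
  homCategory _ _ := inferInstance
  whiskerLeft f _ _ η := hcomp (𝟙 f) η
  whiskerRight η h := hcomp η (𝟙 h)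
  associator := assoc
  leftUnitor := leftUnit
  rightUnitor := rightUnit
  whiskerLeft_id := hcomp_id
  id_whiskerRight := hcomp_id
  whiskerLeft_comp f _ _ _ η θ := by rw [← hcomp_comp, Category.comp_id]
  comp_whiskerRight η θ i := by rw [← hcomp_comp, Category.comp_id]
  id_whiskerLeft η := by rw [← Category.assoc, Iso.eq_comp_inv, hcomp_leftUnit]
  whiskerRight_id η := by rw [← Category.assoc, Iso.eq_comp_inv, hcomp_rightUnit]
  comp_whiskerLeft f g _ _ η := by
    rw [← Category.assoc, Iso.eq_comp_inv, ← hcomp_assoc, hcomp_id]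
  whiskerRight_comp η g h := by rw [Iso.eq_inv_comp, hcomp_assoc, hcomp_id]
  whisker_assoc f _ _ η h := by rw [← Category.assoc, Iso.eq_comp_inv, hcomp_assoc]
  whisker_exchange η θ := by
    rw [← hcomp_comp, ← hcomp_comp, Category.id_comp, Category.comp_id, Category.id_comp,
      Category.comp_id]
  pentagon := pentagon
  triangle := triangle

end Pt

end SpinNet
end

/-! ### Juxtaposition as a pseudofunctor -/

noncomputable section
namespace SpinNet

namespace Pt

open Bicategory

/-- Juxtaposition of morphisms. -/
def tensor {a b a' b' : Pt} {f g : a ⟶ b} {f' g' : a' ⟶ b'} (η : f ⟶ g) (η' : f' ⟶ g') :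
    (⟨f.diag.beside f'.diag, f.shift + f'.shift⟩ : GrDiag (a.num + a'.num) (b.num + b'.num)) ⟶
      ⟨g.diag.beside g'.diag, g.shift + g'.shift⟩ :=
  (GrDiag.besideFunctor a.num b.num a'.num b'.num).map (X := (f, f')) (Y := (g, g')) (η, η')

/-- Juxtaposition, as a homomorphism of bicategories up to the prelax level. -/
def tensorPrelax : PrelaxFunctor (Pt × Pt) Pt where
  obj X := ⟨X.1.num + X.2.num⟩
  map f := (⟨f.1.diag.beside f.2.diag, f.1.shift + f.2.shift⟩ : GrDiag _ _)
  map₂ η := tensor η.1 η.2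
  map₂_id f := (GrDiag.besideFunctor _ _ _ _).map_id (f.1, f.2)
  map₂_comp {_ _ f g h} η θ := (GrDiag.besideFunctor _ _ _ _).map_comp (X := (f.1, f.2))
    (Y := (g.1, g.2)) (Z := (h.1, h.2)) (η.1, η.2) (θ.1, θ.2)

/-- The interchange isomorphism. -/
def tensorComp {a b c : Pt × Pt} (f : a ⟶ b) (g : b ⟶ c) :
    tensorPrelax.map (f ≫ g) ≅ tensorPrelax.map f ≫ tensorPrelax.map g :=
  (DIso.interchange f.1.diag g.1.diag f.2.diag g.2.diag).iso (add_add_add_comm _ _ _ _)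

/-- Juxtaposed identities. -/
def tensorId (a : Pt × Pt) : tensorPrelax.map (𝟙 a) ≅ 𝟙 (tensorPrelax.obj a) :=
  (DIso.strandsBeside a.1.num a.2.num).iso (add_zero _)

theorem tensor_naturality {a b c : Pt × Pt} {f f' : a ⟶ b} {g g' : b ⟶ c} (η : f ⟶ f')
    (θ : g ⟶ g') :
    CategoryStruct.comp (obj := tensorPrelax.obj a ⟶ tensorPrelax.obj c)
      (tensor (hcomp η.1 θ.1) (hcomp η.2 θ.2)) (tensorComp f' g').hom =
      (tensorComp f g).hom ≫ hcomp (tensorPrelax.map₂ η) (tensorPrelax.map₂ θ) :=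
  Subtype.ext (stackHom_interchange _ _ _ _)

/-- As for the pentagon, all arrows are isotopies, so the identity is one between bijections of
components and is checked on pieces. -/
theorem tensor_assoc {a b c d : Pt × Pt} (f : a ⟶ b) (g : b ⟶ c) (h : c ⟶ d) :
    tensorPrelax.map₂ (α_ f g h).hom = (tensorComp (f ≫ g) h).hom ≫
      (tensorComp f g).hom ▷ tensorPrelax.map h ≫
      (α_ (tensorPrelax.map f) (tensorPrelax.map g) (tensorPrelax.map h)).hom ≫
      tensorPrelax.map f ◁ (tensorComp g h).inv ≫ (tensorComp f (g ≫ h)).inv := by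
  let F := f.1.diag; let G := g.1.diag; let H := h.1.diag
  let F' := f.2.diag; let G' := g.2.diag; let H' := h.2.diag
  have e : (DIso.assoc F G H).beside (DIso.assoc F' G' H') =
      (DIso.interchange (F.stack G) H (F'.stack G') H').trans
        (((DIso.interchange F G F' G').stack (.refl (H.beside H'))).trans
          ((DIso.assoc (F.beside F') (G.beside G') (H.beside H')).trans
            (((DIso.refl (F.beside F')).stack (DIso.interchange G H G' H').symm).trans
              (DIso.interchange F (G.stack H) F' (G'.stack H')).symm))) := by
    refine DIso.ext_mk ?_
    rintro (((p | p) | p) | ((p | p) | p)) <;> rfl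
  refine Subtype.ext ?_
  refine (DIso.cls_beside (DIso.assoc F G H) (DIso.assoc F' G' H')).trans ?_
  refine (congrArg (fun e => cls (DIso.cob e)) e).trans ?_
  refine (DIso.cls_trans _ _).symm.trans (congrArg (fun x => compHom _ x) ?_)
  refine (DIso.cls_trans _ _).symm.trans (congrArg₂ (fun x y => compHom x y)
    (DIso.cls_stack _ _).symm ?_)
  refine (DIso.cls_trans _ _).symm.trans (congrArg (fun x => compHom _ x) ?_)
  exact (DIso.cls_trans _ _).symm.trans (congrArg (fun x => compHom x _)
    (DIso.cls_stack _ _).symm)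

theorem tensor_leftUnit {a b : Pt × Pt} (f : a ⟶ b) :
    tensorPrelax.map₂ (λ_ f).hom = (tensorComp (𝟙 a) f).hom ≫
      (tensorId a).hom ▷ tensorPrelax.map f ≫ (λ_ (tensorPrelax.map f)).hom := by
  let F := f.1.diag; let F' := f.2.diag
  have e : (DIso.leftUnit F).beside (DIso.leftUnit F') =
      (DIso.interchange (.strands _) F (.strands _) F').trans
        (((DIso.strandsBeside _ _).stack (.refl (F.beside F'))).trans
          (DIso.leftUnit (F.beside F'))) := by
    refine DIso.ext_mk ?_
    rintro ((p | p) | (p | p))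
    -- Among the juxtaposed strands the strand `p` of the left block has index `finSumFinEquiv (.inl
    -- p)`, and the upper points of `F` beside `F'` are found by splitting this index again.
    · exact congrArg (Quotient.mk (F.beside F').conn) (congrArg (Sum.map F.top F'.top)
        (finSumFinEquiv.symm_apply_apply (Sum.inl p))).symm
    · rfl
    · exact congrArg (Quotient.mk (F.beside F').conn) (congrArg (Sum.map F.top F'.top)
        (finSumFinEquiv.symm_apply_apply (Sum.inr p))).symm
    · rfl
  refine Subtype.ext ?_
  refine (DIso.cls_beside (DIso.leftUnit F) (DIso.leftUnit F')).trans ?_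
  refine (congrArg (fun e => cls (DIso.cob e)) e).trans ?_
  refine (DIso.cls_trans _ _).symm.trans (congrArg (fun x => compHom _ x) ?_)
  exact (DIso.cls_trans _ _).symm.trans (congrArg (fun x => compHom x _)
    (DIso.cls_stack _ _).symm)

theorem tensor_rightUnit {a b : Pt × Pt} (f : a ⟶ b) :
    tensorPrelax.map₂ (ρ_ f).hom = (tensorComp f (𝟙 b)).hom ≫
      tensorPrelax.map f ◁ (tensorId b).hom ≫ (ρ_ (tensorPrelax.map f)).hom := by
  let F := f.1.diag; let F' := f.2.diag
  have e : (DIso.rightUnit F).beside (DIso.rightUnit F') =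
      (DIso.interchange F (.strands _) F' (.strands _)).trans
        (((DIso.refl (F.beside F')).stack (DIso.strandsBeside _ _)).trans
          (DIso.rightUnit (F.beside F'))) := by
    refine DIso.ext_mk ?_
    rintro ((p | p) | (p | p))
    · rfl
    · exact congrArg (Quotient.mk (F.beside F').conn) (congrArg (Sum.map F.bot F'.bot)
        (finSumFinEquiv.symm_apply_apply (Sum.inl p))).symm
    · rfl
    · exact congrArg (Quotient.mk (F.beside F').conn) (congrArg (Sum.map F.bot F'.bot)
        (finSumFinEquiv.symm_apply_apply (Sum.inr p))).symm
  refine Subtype.ext ?_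
  refine (DIso.cls_beside (DIso.rightUnit F) (DIso.rightUnit F')).trans ?_
  refine (congrArg (fun e => cls (DIso.cob e)) e).trans ?_
  refine (DIso.cls_trans _ _).symm.trans (congrArg (fun x => compHom _ x) ?_)
  exact (DIso.cls_trans _ _).symm.trans (congrArg (fun x => compHom x _)
    (DIso.cls_stack _ _).symm)

/-- Juxtaposition is a pseudofunctor. -/
def tensorPseudofunctor : Pseudofunctor (Pt × Pt) Pt where
  toPrelaxFunctor := tensorPrelax
  mapId := tensorId
  mapComp := tensorComp
  map₂_whisker_left f g h η := by
    rw [← Category.assoc, Iso.eq_comp_inv]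
    refine (tensor_naturality (𝟙 f) η).trans ?_
    rw [tensorPrelax.map₂_id]; rfl
  map₂_whisker_right η h := by
    rw [← Category.assoc, Iso.eq_comp_inv]
    refine (tensor_naturality η (𝟙 h)).trans ?_
    rw [tensorPrelax.map₂_id]; rfl
  map₂_associator := tensor_assoc
  map₂_left_unitor := tensor_leftUnit
  map₂_right_unitor := tensor_rightUnit

/-- The product of two adjunctions. -/
def prodAdj {a b a' b' : Pt} {l : a ⟶ b} {r : b ⟶ a} {l' : a' ⟶ b'} {r' : b' ⟶ a'}
    (adj : Bicategory.Adjunction l r) (adj' : Bicategory.Adjunction l' r') :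
    Bicategory.Adjunction (B := Pt × Pt) (a := (a, a')) (b := (b, b')) (l, l') (r, r') where
  unit := (adj.unit, adj'.unit)
  counit := (adj.counit, adj'.counit)
  left_triangle := Prod.ext adj.left_triangle adj'.left_triangle
  right_triangle := Prod.ext adj.right_triangle adj'.right_triangle

end Pt

end SpinNet
end

noncomputable section
namespace SpinNet

/-! ### Connected surfaces -/

namespace Surface

variable {m n : ℕ} {a b c : Diag m n}

/-- A connected surface. -/
structure Connected (S : Surface a b) : Prop where
  nonempty : Nonempty S.Piece
  conn : ∀ x y, S.conn x y

/-- Every component has a lower boundary. -/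
def InnSurj (S : Surface a b) : Prop := ∀ x, ∃ p, S.conn (S.inn p) x

/-- Every component has an upper boundary. -/
def OutSurj (S : Surface a b) : Prop := ∀ x, ∃ p, S.conn (S.out p) x

theorem Connected.comp_left {S : Surface a b} {T : Surface b c} (hS : S.Connected)
    (hT : T.InnSurj) : (S.comp T).Connected := by
  obtain ⟨⟨x0⟩, hS⟩ := hS
  have key : ∀ x, (S.comp T).conn (.inl x0) x := by
    rintro (x | x)
    · exact glueConn_inl (hS _ _)
    · obtain ⟨p, hp⟩ := hT x
      exact Setoid.trans' _ (glueConn_inl (hS _ _)) (Setoid.trans' _ (glueConn_glue p)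
        (glueConn_inr hp))
  exact ⟨⟨.inl x0⟩, fun x y => Setoid.trans' _ (Setoid.symm' _ (key x)) (key y)⟩

theorem Connected.comp_right {S : Surface a b} {T : Surface b c} (hT : T.Connected)
    (hS : S.OutSurj) : (S.comp T).Connected := by
  obtain ⟨⟨x0⟩, hT⟩ := hT
  have key : ∀ x, (S.comp T).conn (.inr x0) x := by
    rintro (x | x)
    · obtain ⟨p, hp⟩ := hS x
      exact Setoid.trans' _ (glueConn_inr (hT _ _)) (Setoid.trans' _
        (Setoid.symm' _ (glueConn_glue p)) (glueConn_inl hp))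
    · exact glueConn_inr (hT _ _)
  exact ⟨⟨.inr x0⟩, fun x y => Setoid.trans' _ (Setoid.symm' _ (key x)) (key y)⟩

theorem InnSurj.comp {S : Surface a b} {T : Surface b c} (hS : S.InnSurj) (hT : T.InnSurj) :
    (S.comp T).InnSurj := by
  rintro (x | x)
  · obtain ⟨p, hp⟩ := hS x
    exact ⟨p, glueConn_inl hp⟩
  · obtain ⟨q, hq⟩ := hT x
    obtain ⟨p, hp⟩ := hS (S.out q)
    exact ⟨p, Setoid.trans' _ (glueConn_inl hp) (Setoid.trans' _ (glueConn_glue q)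
      (glueConn_inr hq))⟩

theorem InnSurj.stack {m k n : ℕ} {a a' : Diag m k} {b b' : Diag k n} {S : Surface a a'}
    {T : Surface b b'} (hS : S.InnSurj) (hT : T.InnSurj) : (S.stack T).InnSurj := by
  rintro (x | x)
  · obtain ⟨p, hp⟩ := hS x
    exact ⟨.inl p, glueConn_inl hp⟩
  · obtain ⟨p, hp⟩ := hT x
    exact ⟨.inr p, glueConn_inr hp⟩

theorem OutSurj.stack {m k n : ℕ} {a a' : Diag m k} {b b' : Diag k n} {S : Surface a a'}
    {T : Surface b b'} (hS : S.OutSurj) (hT : T.OutSurj) : (S.stack T).OutSurj := by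
  rintro (x | x)
  · obtain ⟨p, hp⟩ := hS x
    exact ⟨.inl p, glueConn_inl hp⟩
  · obtain ⟨p, hp⟩ := hT x
    exact ⟨.inr p, glueConn_inr hp⟩

theorem Connected.stack {m k n : ℕ} {a a' : Diag m k} {b b' : Diag k n} {S : Surface a a'}
    {T : Surface b b'} (hS : S.Connected) (hT : T.Connected) (i : Fin k) :
    (S.stack T).Connected := by
  obtain ⟨⟨x0⟩, hS⟩ := hS
  have key : ∀ x, (S.stack T).conn (.inl x0) x := by
    rintro (x | x)
    · exact glueConn_inl (hS _ _)
    · exact Setoid.trans' _ (glueConn_inl (hS _ _)) (Setoid.trans' _ (glueConn_glue i)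
        (glueConn_inr (hT.conn _ _)))
  exact ⟨⟨.inl x0⟩, fun x y => Setoid.trans' _ (Setoid.symm' _ (key x)) (key y)⟩

theorem disk_innSurj (p : a.Piece) : (disk a b).InnSurj := fun _ => ⟨p, rfl⟩

theorem disk_outSurj (p : b.Piece) : (disk a b).OutSurj := fun _ => ⟨p, rfl⟩

theorem disk_connected : (disk a b).Connected := ⟨⟨()⟩, fun _ _ => rfl⟩

end Surface

namespace DIso

variable {m n : ℕ} {a b : Diag m n} (e : DIso a b)

theorem surf_innSurj : e.surf.InnSurj := fun x => ⟨x, Setoid.refl' _ _⟩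

theorem surf_outSurj : e.surf.OutSurj := fun x => by
  obtain ⟨p, hp⟩ := Quotient.exists_rep (e.comps (Quotient.mk _ x))
  refine ⟨p, Quotient.exact ?_⟩
  rw [e.mk_out, hp, Equiv.symm_apply_apply]

theorem surf_connected (x0 : a.Piece) (h : ∀ x, a.conn x0 x) : e.surf.Connected :=
  ⟨⟨x0⟩, fun x y => Setoid.trans' _ (Setoid.symm' _ (h x)) (h y)⟩

end DIso

/-- The total number of dots. -/
def Cob.numDots : {m n : ℕ} → {a b : Diag m n} → Cob a b → ℕ
  | _, _, _, _, isotopy _ _ _ _ => 0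
  | _, _, _, _, dot _ _ => 1
  | _, _, _, _, birth => 0
  | _, _, _, _, death => 0
  | _, _, _, _, saddle => 0
  | _, _, _, _, cosaddle => 0
  | _, _, _, _, comp f g => f.numDots + g.numDots
  | _, _, _, _, stack f g => f.numDots + g.numDots
  | _, _, _, _, beside f g => f.numDots + g.numDots

theorem Cob.sum_dots {m n : ℕ} {a b : Diag m n} (f : Cob a b) :
    ∑ p, f.surface.dots p = f.numDots := by
  induction f with
  | isotopy e _ _ _ => exact Finset.sum_eq_zero fun _ _ => rfl
  | dot a p =>
    classical
    change ∑ q : a.Piece, (Pi.single p 1 : a.Piece → ℕ) q = 1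
    rw [Finset.sum_pi_single']; simp
  | birth => rfl
  | death => rfl
  | saddle => rfl
  | cosaddle => rfl
  | comp f g ihf ihg => exact (Fintype.sum_sum_type _).trans (congrArg₂ (· + ·) ihf ihg)
  | stack f g ihf ihg => exact (Fintype.sum_sum_type _).trans (congrArg₂ (· + ·) ihf ihg)
  | beside f g ihf ihg => exact (Fintype.sum_sum_type _).trans (congrArg₂ (· + ·) ihf ihg)

theorem compSum_of_conn {A M : Type} [Fintype A] [AddCommMonoid M] {s : Setoid A}
    (h : ∀ x y, s x y) (w : A → M) (c : Comp s) : compSum s w c = ∑ a, w a := by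
  classical
  obtain ⟨p, rfl⟩ := Quotient.exists_rep c
  exact Finset.sum_congr rfl fun q _ => if_pos (Quotient.sound (h q p))

/-- Connected cobordisms are determined by the degree and the number of dots. -/
theorem cls_eq_of_connected {m n : ℕ} {a b : Diag m n} {f g : Cob a b}
    (hf : f.surface.Connected) (hg : g.surface.Connected) (hd : f.deg = g.deg)
    (hn : f.numDots = g.numDots) : cls f = cls g := by
  have sf : Subsingleton (Comp f.surface.conn) :=
    ⟨by rintro ⟨x⟩ ⟨y⟩; exact Quotient.sound (hf.conn x y)⟩
  have sg : Subsingleton (Comp g.surface.conn) :=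
    ⟨by rintro ⟨x⟩ ⟨y⟩; exact Quotient.sound (hg.conn x y)⟩
  obtain ⟨x⟩ := hf.nonempty
  obtain ⟨y⟩ := hg.nonempty
  refine cls_eq_of_homeo ⟨⟨fun _ => Quotient.mk _ y, fun _ => Quotient.mk _ x,
    fun _ => Subsingleton.elim _ _, fun _ => Subsingleton.elim _ _⟩,
    fun _ => Subsingleton.elim _ _, fun _ => Subsingleton.elim _ _, fun c => ?_, fun c => ?_⟩
  · rw [compSum_of_conn hf.conn, compSum_of_conn hg.conn]
    -- For equal degrees and equal numbers of dots, the degree formula forces equal total Euler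
    -- characteristics.
    have h1 := f.deg_eq
    have h2 := g.deg_eq
    rw [← Nat.cast_sum, Cob.sum_dots] at h1 h2
    rw [hn] at h1
    linarith
  · rw [compSum_of_conn hf.conn, compSum_of_conn hg.conn, f.sum_dots, g.sum_dots, hn]

/-! ### The adjunction between a diagram and its reflection -/

namespace Pt

open Bicategory

/-- A shifted diagram as a 1-morphism. -/
abbrev mor {k n : ℕ} (y : Diag k n) (s : ℤ) : (⟨k⟩ : Pt) ⟶ ⟨n⟩ := (⟨y, s⟩ : GrDiag k n)

/-- An adjunction from the triangle identities. -/
def mkAdj {a b : Pt} {l : a ⟶ b} {r : b ⟶ a} (η : 𝟙 a ⟶ l ≫ r) (δ : r ≫ l ⟶ 𝟙 b)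
    (h1 : η ▷ l ≫ (α_ l r l).hom ≫ l ◁ δ = (λ_ l).hom ≫ (ρ_ l).inv)
    (h2 : r ◁ η ≫ (α_ r l r).inv ≫ δ ▷ r = (ρ_ r).hom ≫ (λ_ r).inv) :
    Bicategory.Adjunction l r where
  unit := η
  counit := δ
  left_triangle := by simpa [leftZigzag, bicategoricalComp] using h1
  right_triangle := by simpa [rightZigzag, bicategoricalComp] using h2

/-- The morphism given by a cobordism. -/
def ofCob {k n : ℕ} {a b : Diag k n} (f : Cob a b) {s t : ℤ} (h : f.deg = s - t) :
    mor a s ⟶ mor b t :=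
  ⟨cls f, AddSubgroup.subset_closure ⟨0, f, by simpa using h, by simp⟩⟩

/-- The zigzag and the isotopy that it should equal are both connected, of degree zero and without
dots. This already determines their classes, so the surface of a zigzag never has to be computed. -/
theorem zigzag_cls {m n : ℕ} {x y z w : Diag m n} {f : Cob x y} {e : DIso y z} {g : Cob z w}
    {e' : DIso x w} (h : ((f.comp (e.cob.comp g))).surface.Connected) 
    (hx : ∃ x0, ∀ p, x.conn x0 p) (hd : f.deg + g.deg = 0) (hn : f.numDots + g.numDots = 0) :
    compHom (cls f) (compHom (cls e.cob) (cls g)) = cls e'.cob := by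
  rw [compHom_cls, compHom_cls]
  refine cls_eq_of_connected h (e'.surf_connected hx.choose hx.choose_spec) ?_ ?_
  · change f.deg + (0 + g.deg) = 0
    rw [zero_add, hd]
  · change f.numDots + (0 + g.numDots) = 0
    rw [zero_add, hn]

/-- The adjunction of the two arcs: `∩` is left adjoint to `∪`. -/
def capAdj : Bicategory.Adjunction (mor .cap 1) (mor .cup 0) :=
  -- Birth has degree -1 and the saddle back to two strands has degree 1; the shift 1 on `∩` brings
  -- unit and counit to degree zero.
  mkAdj (ofCob .birth rfl) (ofCob .cosaddle rfl)
    (Subtype.ext (by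
      refine (congrArg₂ (fun u v => compHom u (compHom _ v)) (stackHom_cls _ _)
        (stackHom_cls _ _)).trans ((zigzag_cls ?_ ?_ rfl rfl).trans
          (DIso.cls_trans _ _).symm)
      · refine Surface.Connected.comp_right (Surface.Connected.comp_right
          (Surface.Connected.stack ?_ Surface.disk_connected 0) (DIso.surf_outSurj _))
          (Surface.OutSurj.stack (Surface.disk_outSurj (Sum.inl ())) (DIso.surf_outSurj (.refl .cap)))
        exact DIso.surf_connected (.refl .cap) () fun _ => rfl
      · refine ⟨.inr (), ?_⟩
        rintro (p | p)
        · exact p.elim0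
        · rfl))
    (Subtype.ext (by
      refine (congrArg₂ (fun u v => compHom u (compHom _ v)) (stackHom_cls _ _)
        (stackHom_cls _ _)).trans ((zigzag_cls ?_ ?_ rfl rfl).trans
          (DIso.cls_trans _ _).symm)
      · refine Surface.Connected.comp_right (Surface.Connected.comp_right
          (Surface.Connected.stack Surface.disk_connected ?_ 0) (DIso.surf_outSurj _))
          (Surface.OutSurj.stack (DIso.surf_outSurj (.refl .cup)) (Surface.disk_outSurj (Sum.inl ())))
        exact DIso.surf_connected (.refl .cup) () fun _ => rfl
      · refine ⟨.inl (), ?_⟩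
        rintro (p | p)
        · rfl
        · exact p.elim0))

/-- The adjunction of the two arcs: `∪` is left adjoint to `∩`. -/
def cupAdj : Bicategory.Adjunction (mor .cup (-1)) (mor .cap 0) :=
  -- Here the unit is a saddle of degree 1 and the counit a death of degree -1, which forces the
  -- shift -1 on `∪`.
  mkAdj (ofCob .saddle rfl) (ofCob .death rfl)
    (Subtype.ext (by
      refine (congrArg₂ (fun u v => compHom u (compHom _ v)) (stackHom_cls _ _)
        (stackHom_cls _ _)).trans ((zigzag_cls ?_ ?_ rfl rfl).trans
          (DIso.cls_trans _ _).symm)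
      · refine Surface.Connected.comp_left
          (Surface.Connected.stack Surface.disk_connected ?_ 0)
          ((DIso.surf_innSurj _).comp
            (Surface.InnSurj.stack (DIso.surf_innSurj (.refl .cup)) (Surface.disk_innSurj (Sum.inl ()))))
        exact DIso.surf_connected (.refl .cup) () fun _ => rfl
      · refine ⟨.inr (), ?_⟩
        rintro (p | p)
        · exact Setoid.symm' _ (glueConn_glue (f := Diag.bot (.strands 2)) (g := Diag.cup.top) p)
        · rfl))
    (Subtype.ext (by
      refine (congrArg₂ (fun u v => compHom u (compHom _ v)) (stackHom_cls _ _)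
        (stackHom_cls _ _)).trans ((zigzag_cls ?_ ?_ rfl rfl).trans
          (DIso.cls_trans _ _).symm)
      · refine Surface.Connected.comp_left
          (Surface.Connected.stack ?_ Surface.disk_connected 0)
          ((DIso.surf_innSurj _).comp
            (Surface.InnSurj.stack (Surface.disk_innSurj (Sum.inl ())) (DIso.surf_innSurj (.refl .cap))))
        exact DIso.surf_connected (.refl .cap) () fun _ => rfl
      · refine ⟨.inl (), ?_⟩
        rintro (p | p)
        · rfl
        · exact glueConn_glue (f := Diag.cap.bot) (g := Diag.top (.strands 2)) p))

end Pt

/-- Half the difference of the numbers of lower and upper boundary points. -/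
def Diag.index : {k n : ℕ} → Diag k n → ℤ
  | _, _, strands _ => 0
  | _, _, cap => 1
  | _, _, cup => -1
  | _, _, stack a b => a.index + b.index
  | _, _, beside a b => a.index + b.index

theorem Diag.two_mul_index {k n : ℕ} (y : Diag k n) : 2 * y.index = n - k := by
  induction y with
  | strands n => simp [index]
  | cap => rfl
  | cup => rfl
  | stack a b iha ihb => change 2 * (a.index + b.index) = _; linarith
  | beside a b iha ihb => change 2 * (a.index + b.index) = _; push_cast; linarith

theorem Diag.flip_flip : ∀ {k n : ℕ} (y : Diag k n), y.flip.flip = y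
  | _, _, strands _ => rfl
  | _, _, cap => rfl
  | _, _, cup => rfl
  | _, _, stack a b => congrArg₂ stack a.flip_flip b.flip_flip
  | _, _, beside a b => congrArg₂ beside a.flip_flip b.flip_flip

/-- Identities are self-adjoint and the two arcs are treated by `Pt.capAdj` and `Pt.cupAdj`.
Stacking is composition of adjunctions, and juxtaposition applies a pseudofunctor to a product of
adjunctions. Under both operations the shifts of the left adjoints add, as `Diag.index` does. -/
theorem Diag.exists_adjunction : ∀ {k n : ℕ} (y : Diag k n),
    Nonempty (Bicategory.Adjunction (Pt.mor y y.index) (Pt.mor y.flip 0))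
  | _, _, strands n => ⟨.id (⟨n⟩ : Pt)⟩
  | _, _, cap => ⟨Pt.capAdj⟩
  | _, _, cup => ⟨Pt.cupAdj⟩
  | _, _, stack a b => by
    obtain ⟨f⟩ := a.exists_adjunction
    obtain ⟨g⟩ := b.exists_adjunction
    exact ⟨f.comp g⟩
  | _, _, beside a b => by
    obtain ⟨f⟩ := a.exists_adjunction
    obtain ⟨g⟩ := b.exists_adjunction
    exact ⟨Pt.tensorPseudofunctor.mapAdjunction (Pt.prodAdj f g)⟩

end SpinNet
end

noncomputable section
namespace SpinNet

/-! ### Homological perturbation -/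

section Perturbation

/-- An endomorphism of a product of abelian groups is lowering if the coordinates of the value
depend only on the coordinates of lower level. -/
def Lowering {I : Type} {Z : I → Type} [∀ i, AddCommGroup (Z i)] (lev : I → ℕ)
    (N : AddMonoid.End (∀ i, Z i)) : Prop :=
  ∀ x i, (∀ i', lev i' < lev i → x i' = 0) → N x i = 0

/-- Each application of the operator raises by one the lowest level at which a coordinate can be
nonzero. -/
theorem Lowering.neg_pow {I : Type} {Z : I → Type} [∀ i, AddCommGroup (Z i)] {lev : I → ℕ}
    {N : AddMonoid.End (∀ i, Z i)} (hN : Lowering lev N) (k : ℕ) (x : ∀ i, Z i) (i : I)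
    (hi : lev i < k) : ((-N) ^ k) x i = 0 := by
  induction k generalizing i with
  | zero => exact absurd hi (Nat.not_lt_zero _)
  | succ k ih =>
    rw [pow_succ']
    change (-(N (((-N) ^ k) x))) i = 0
    rw [Pi.neg_apply, hN _ _ fun i' hi' => ih i' (by omega), neg_zero]

/-- If `N` is lowering, then `1 + N` is invertible. -/
theorem Lowering.exists_inverse {I : Type} {Z : I → Type} [∀ i, AddCommGroup (Z i)]
    {lev : I → ℕ} {N : AddMonoid.End (∀ i, Z i)} (hN : Lowering lev N) :
    ∃ G : AddMonoid.End (∀ i, Z i), (1 + N) * G = 1 ∧ G * (1 + N) = 1 := by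
  -- The inverse is the geometric series of -N. It need not terminate as a series of operators, but
  -- in the coordinate `i` all terms beyond the exponent `lev i` vanish, so the partial sum of
  -- length `lev i + 1` already has the right value there.
  let A (M : ℕ) : AddMonoid.End (∀ i, Z i) := ∑ k ∈ Finset.range M, (-N) ^ k
  have hA (M : ℕ) (x i) : A M x i = ∑ k ∈ Finset.range M, ((-N) ^ k) x i := by
    induction M with
    | zero => rfl
    | succ M ih =>
      rw [Finset.sum_range_succ, ← ih]
      exact congrArg (fun f : AddMonoid.End (∀ i, Z i) => f x i) (Finset.sum_range_succ _ _)
  have stab (M : ℕ) (x i) (h : lev i < M) : A M x i = A (lev i + 1) x i := by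
    rw [hA, hA]
    refine (Finset.sum_subset (Finset.range_subset_range.2 h) fun k _ hk => ?_).symm
    exact hN.neg_pow k x i (by simpa using hk)
  let G : AddMonoid.End (∀ i, Z i) :=
    { toFun := fun x i => A (lev i + 1) x i
      map_zero' := funext fun i => by rw [map_zero]
      map_add' := fun x y => funext fun i => by rw [map_add]; rfl }
  have hG (M : ℕ) (x i) (h : lev i < M) : G x i = A M x i := (stab M x i h).symm
  have tele (M : ℕ) : A M * (1 + N) = 1 - (-N) ^ M := by
    have := geom_sum_mul_neg (-N) M
    rwa [sub_neg_eq_add] at this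
  have tele' (M : ℕ) : (1 + N) * A M = 1 - (-N) ^ M := by
    have := mul_neg_geom_sum (-N) M
    rwa [sub_neg_eq_add] at this
  refine ⟨G, ?_, ?_⟩
  · refine AddMonoidHom.ext fun x => funext fun i => ?_
    -- The value of `N` at `i` reads only coordinates of lower level, and on these `G x` agrees with
    -- the partial sum.
    have e1 : N (G x) i = N (A (lev i + 1) x) i := by
      have : N (G x - A (lev i + 1) x) i = 0 := hN _ _ fun i' hi' => by
        rw [Pi.sub_apply, hG (lev i + 1) x i' (by omega), sub_self]
      rwa [map_sub, Pi.sub_apply, sub_eq_zero] at this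
    have e2 := congrFun (DFunLike.congr_fun (tele' (lev i + 1)) x) i
    change G x i + N (G x) i = x i
    rw [e1]
    refine e2.trans ?_
    change x i - ((-N) ^ (lev i + 1)) x i = x i
    rw [hN.neg_pow _ _ _ (Nat.lt_succ_self _), sub_zero]
  · refine AddMonoidHom.ext fun x => funext fun i => ?_
    have e2 := congrFun (DFunLike.congr_fun (tele (lev i + 1)) x) i
    refine e2.trans ?_
    change x i - ((-N) ^ (lev i + 1)) x i = x i
    rw [hN.neg_pow _ _ _ (Nat.lt_succ_self _), sub_zero]

variable {ι : Type} {c : ComplexShape ι}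

/-- A presentation of a complex of abelian groups `T` and a complex `A` by graded maps to an
abelian group `E` with a perturbed differential `d₀ + d₁`, and a homotopy `S` contracting `d₀`
onto the image of the projection `P` to `A`. -/
structure Perturbation (T A : HomologicalComplex AddCommGrpCat.{0} c) (E : Type)
    [AddCommGroup E] where
  i (n : ι) : T.X n →+ E
  j (n : ι) : E →+ T.X n
  a (n : ι) : A.X n →+ E
  b (n : ι) : E →+ A.X n
  d₀ : AddMonoid.End E
  d₁ : AddMonoid.End E
  S : AddMonoid.End E
  P : AddMonoid.End E
  prev (n : ι) : ∃ m, c.Rel m n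
  ji (n : ι) (x : T.X n) : j n (i n x) = x
  ba (n : ι) (x : A.X n) : b n (a n x) = x
  iD (n m : ι) (h : c.Rel n m) (x : T.X n) : i m ((T.d n m).hom x) = d₀ (i n x) + d₁ (i n x)
  iD_zero (n : ι) (h : ¬ c.Rel n (c.next n)) (x : T.X n) : d₀ (i n x) + d₁ (i n x) = 0
  aD (n m : ι) (h : c.Rel n m) (x : A.X n) : a m ((A.d n m).hom x) = d₀ (a n x)
  bD (n m : ι) (h : c.Rel n m) (x : E) : (A.d n m).hom (b n x) = b m (d₀ x)
  Pa (n : ι) (x : A.X n) : P (a n x) = a n x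
  bP (n : ι) (x : E) : b n (P x) = b n x
  Pi (n : ι) (x : T.X n) : P (i n x) = a n (b n (i n x))
  ija (n : ι) (x : A.X n) : i n (j n (a n x)) = a n x
  bij (n : ι) (x : E) : b n (i n (j n x)) = b n x
  Sij (m n : ι) (h : c.Rel m n) (x : E) : S (i n (j n x)) = i m (j m (S x))
  contract : d₀ * S + S * d₀ = 1 - P
  SP : S * P = 0
  PS : P * S = 0
  anti : d₁ * d₀ = -(d₀ * d₁)
  sq : d₁ * d₁ = 0

namespace Perturbation

variable {T A : HomologicalComplex AddCommGrpCat.{0} c} {E : Type} [AddCommGroup E]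

/-- A chain map from additive maps. -/
def homMk {T A : HomologicalComplex AddCommGrpCat.{0} c} (f : ∀ n, T.X n →+ A.X n)
    (h : ∀ n m, c.Rel n m → ∀ x, (A.d n m).hom (f n x) = f m ((T.d n m).hom x)) : T ⟶ A where
  f n := AddCommGrpCat.ofHom (f n)
  comm' n m hnm := by ext x; exact h n m hnm x

theorem comm_of_inverse {N G X : AddMonoid.End E} (h1 : (1 + N) * G = 1) (h2 : G * (1 + N) = 1)
    (hX : X * N = N * X) : X * G = G * X := by
  calc X * G = G * ((1 + N) * X) * G := by rw [← mul_assoc, h2, one_mul]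
    _ = G * (X * (1 + N)) * G := by rw [mul_add, add_mul, hX, one_mul, mul_one]
    _ = G * X * ((1 + N) * G) := by simp only [mul_assoc]
    _ = _ := by rw [h1, mul_one]

/-- The idempotent of a graded piece. -/
def proj (p : Perturbation T A E) (n : ι) : AddMonoid.End E := (p.i n).comp (p.j n)

/-- A homotopy between chain maps from a graded additive map. -/
def homotopyMk (p : Perturbation T A E) (H : AddMonoid.End E) (f g : T ⟶ T)
    (hH : ∀ m n, c.Rel m n → ∀ x, H (p.i n x) = p.i m (p.j m (H (p.i n x))))
    (hfg : ∀ n x, (f.f n).hom x = p.j n (H (p.d₀ (p.i n x) + p.d₁ (p.i n x)) +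
      (p.d₀ (H (p.i n x)) + p.d₁ (H (p.i n x)))) + (g.f n).hom x) : Homotopy f g where
  hom n m := open Classical in
    if c.Rel m n then AddCommGrpCat.ofHom ((p.j m).comp ((H : E →+ E).comp (p.i n))) else 0
  zero n m h := if_neg h
  comm n := by
    obtain ⟨m, hm⟩ := p.prev n
    rw [prevD_eq _ hm, if_pos hm]
    ext x
    rw [hfg n x]
    change _ = (dNext n _ + _ + g.f n).hom x
    have e2 : p.j n (p.d₀ (H (p.i n x)) + p.d₁ (H (p.i n x))) =
        (T.d m n).hom (p.j m (H (p.i n x))) := by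
      rw [hH m n hm, ← p.iD m n hm, p.ji, p.ji]
    rw [map_add, e2]
    -- If no differential leaves degree `n`, the term that it would contribute is absent, and
    -- `iD_zero` says that its counterpart in `E` vanishes.
    by_cases h : c.Rel n (c.next n)
    · rw [dNext_eq _ h, if_pos h, ← p.iD n _ h]
      rfl
    · rw [p.iD_zero n h, map_zero, map_zero, dNext, AddMonoidHom.mk'_apply, T.shape _ _ h,
        Limits.zero_comp]
      rfl

/-- If the complement of `A` is a subcomplex on which the perturbation is lowering, then `T` is
homotopy equivalent to `A`. -/
theorem equiv_of_quotient (p : Perturbation T A E) (hP : p.P * p.d₁ = 0)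
    (hij : ∀ n x, p.S (p.d₁ (p.i n (p.j n x))) = p.i n (p.j n (p.S (p.d₁ x))))
    (hG : ∃ G : AddMonoid.End E, (1 + p.S * p.d₁) * G = 1 ∧ G * (1 + p.S * p.d₁) = 1) :
    Nonempty (HomotopyEquiv T A) := by
  obtain ⟨G, h1, h2⟩ := hG
  -- The key point: 1 + S d₁ conjugates the perturbed differential into d₀. Indeed S d₁ d₀ = -S d₀
  -- d₁ = -(1 - P - d₀ S) d₁, where P d₁ = 0, while S d₁ d₁ = 0.
  have hc : (1 + p.S * p.d₁) * (p.d₀ + p.d₁) = p.d₀ * (1 + p.S * p.d₁) := by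
    have e : p.S * p.d₁ * (p.d₀ + p.d₁) = -((1 - p.P - p.d₀ * p.S) * p.d₁) := by
      rw [← p.contract, mul_add, mul_assoc, mul_assoc, p.anti, p.sq]; noncomm_ring
    rw [add_mul, e]
    have : (1 - p.P - p.d₀ * p.S) * p.d₁ = p.d₁ - p.P * p.d₁ - p.d₀ * p.S * p.d₁ := by
      noncomm_ring
    rw [this, hP]; noncomm_ring
  have hDG : (p.d₀ + p.d₁) * G = G * p.d₀ := by
    calc (p.d₀ + p.d₁) * G = G * ((1 + p.S * p.d₁) * (p.d₀ + p.d₁)) * G := by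
          rw [← mul_assoc, h2, one_mul]
      _ = G * p.d₀ * ((1 + p.S * p.d₁) * G) := by rw [hc]; simp only [mul_assoc]
      _ = _ := by rw [h1, mul_one]
  -- Since P S = 0, the operator 1 + S d₁ and its inverse do not change what the projection `P`
  -- sees.
  have hPG : p.P * G = p.P := by
    have : p.P * (1 + p.S * p.d₁) = p.P := by
      rw [mul_add, ← mul_assoc, p.PS, zero_mul, add_zero, mul_one]
    calc p.P * G = p.P * (1 + p.S * p.d₁) * G := by rw [this]
      _ = _ := by rw [mul_assoc, h1, mul_one]
  have hGij (n : ι) : p.proj n * G = G * p.proj n :=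
    comm_of_inverse h1 h2 (AddMonoidHom.ext fun x => (hij n x).symm)
  have hGij' (n : ι) (x) : p.i n (p.j n (G x)) = G (p.i n (p.j n x)) :=
    DFunLike.congr_fun (hGij n) x
  -- Transporting the contraction of d₀ through `G` gives G S, which contracts the perturbed
  -- differential onto the image of G P.
  have hH : G * p.S * (p.d₀ + p.d₁) + (p.d₀ + p.d₁) * (G * p.S) = 1 - G * p.P := by
    rw [← mul_assoc, hDG]
    have : G * p.S * (p.d₀ + p.d₁) + G * p.d₀ * p.S =
        G * ((p.d₀ * p.S + p.S * p.d₀) + p.S * p.d₁) := by noncomm_ring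
    rw [this, p.contract]
    have : G * (1 - p.P + p.S * p.d₁) = G * (1 + p.S * p.d₁) - G * p.P := by noncomm_ring
    rw [this, h2]
  let f : T ⟶ A := homMk (fun n => (p.b n).comp (p.i n)) fun n m h x => by
    change (A.d n m).hom (p.b n (p.i n x)) = p.b m (p.i m ((T.d n m).hom x))
    rw [p.bD n m h, p.iD n m h, map_add, ← p.bP m (p.d₁ _),
      show p.P (p.d₁ (p.i n x)) = 0 from DFunLike.congr_fun hP _, map_zero, add_zero]
  let g : A ⟶ T := homMk (fun n => (p.j n).comp ((G : E →+ E).comp (p.a n))) fun n m h x => by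
    change (T.d n m).hom (p.j n (G (p.a n x))) = p.j m (G (p.a m ((A.d n m).hom x)))
    rw [p.aD n m h, show G (p.d₀ (p.a n x)) = p.d₀ (G (p.a n x)) + p.d₁ (G (p.a n x)) from
      (DFunLike.congr_fun hDG _).symm, ← p.ija n x, ← hGij', ← p.iD n m h, p.ji, p.ji]
  refine ⟨⟨f, g, (p.homotopyMk (G * p.S) _ _ ?_ ?_).symm, .ofEq ?_⟩⟩
  · intro m n h x
    change G (p.S _) = p.i m (p.j m (G (p.S _)))
    rw [hGij', ← p.Sij m n h, p.ji]
  · intro n x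
    have e := DFunLike.congr_fun hH (p.i n x)
    have e' : G (p.S (p.d₀ (p.i n x) + p.d₁ (p.i n x))) +
        (p.d₀ (G (p.S (p.i n x))) + p.d₁ (G (p.S (p.i n x)))) = p.i n x - G (p.P (p.i n x)) := e
    change x = p.j n (G (p.S _) + (p.d₀ (G (p.S _)) + p.d₁ (G (p.S _)))) +
      p.j n (G (p.a n (p.b n (p.i n x))))
    rw [e', map_sub, p.ji, p.Pi, sub_add_cancel]
  · ext n x
    change p.b n (p.i n (p.j n (G (p.a n x)))) = x
    rw [p.bij, ← p.bP, show p.P (G (p.a n x)) = p.P (p.a n x) from DFunLike.congr_fun hPG _,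
      p.bP, p.ba]

/-- If `A` is a subcomplex on whose complement the perturbation is lowering, then `T` is homotopy
equivalent to `A`. -/
theorem equiv_of_sub (p : Perturbation T A E) (hP : p.d₁ * p.P = 0)
    (hij : ∀ n x, p.d₁ (p.S (p.i n (p.j n x))) = p.i n (p.j n (p.d₁ (p.S x))))
    (hG : ∃ G : AddMonoid.End E, (1 + p.d₁ * p.S) * G = 1 ∧ G * (1 + p.d₁ * p.S) = 1) :
    Nonempty (HomotopyEquiv T A) := by
  obtain ⟨G, h1, h2⟩ := hG
  -- The mirror image of the previous conjugation: now d₁ P = 0 and the operator 1 + d₁ S is used on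
  -- the other side.
  have hc : (p.d₀ + p.d₁) * (1 + p.d₁ * p.S) = (1 + p.d₁ * p.S) * p.d₀ := by
    have e : (p.d₀ + p.d₁) * (p.d₁ * p.S) = -(p.d₁ * (1 - p.P - p.S * p.d₀)) := by
      rw [← p.contract, ← mul_assoc, add_mul, p.sq, show p.d₀ * p.d₁ = -(p.d₁ * p.d₀) by
        rw [p.anti, neg_neg]]
      noncomm_ring
    rw [mul_add, e]
    have : p.d₁ * (1 - p.P - p.S * p.d₀) = p.d₁ - p.d₁ * p.P - p.d₁ * p.S * p.d₀ := by
      noncomm_ring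
    rw [this, hP]; noncomm_ring
  have hGD : G * (p.d₀ + p.d₁) = p.d₀ * G := by
    calc G * (p.d₀ + p.d₁) = G * ((p.d₀ + p.d₁) * (1 + p.d₁ * p.S)) * G := by
          rw [mul_assoc, mul_assoc, h1, mul_one]
      _ = G * (1 + p.d₁ * p.S) * (p.d₀ * G) := by rw [hc]; simp only [mul_assoc]
      _ = _ := by rw [h2, one_mul]
  -- As S P = 0, the operator 1 + d₁ S is the identity on the subcomplex, so the inclusion of `A`
  -- needs no correction.
  have hGa (n : ι) (x) : G (p.a n x) = p.a n x := by
    have : (1 + p.d₁ * p.S) * p.P = p.P := by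
      rw [add_mul, mul_assoc, p.SP, mul_zero, add_zero, one_mul]
    have : G * p.P = p.P := by
      calc G * p.P = G * ((1 + p.d₁ * p.S) * p.P) := by rw [this]
        _ = _ := by rw [← mul_assoc, h2, one_mul]
    rw [← p.Pa]
    exact DFunLike.congr_fun this _
  have hGij (n : ι) : p.proj n * G = G * p.proj n :=
    comm_of_inverse h1 h2 (AddMonoidHom.ext fun x => (hij n x).symm)
  have hGij' (n : ι) (x) : p.i n (p.j n (G x)) = G (p.i n (p.j n x)) :=
    DFunLike.congr_fun (hGij n) x
  have hH : p.S * G * (p.d₀ + p.d₁) + (p.d₀ + p.d₁) * (p.S * G) = 1 - p.P * G := by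
    rw [mul_assoc, hGD]
    have : p.S * (p.d₀ * G) + (p.d₀ + p.d₁) * (p.S * G) =
        ((p.d₀ * p.S + p.S * p.d₀) + p.d₁ * p.S) * G := by noncomm_ring
    rw [this, p.contract]
    have : (1 - p.P + p.d₁ * p.S) * G = (1 + p.d₁ * p.S) * G - p.P * G := by noncomm_ring
    rw [this, h1]
  let f : T ⟶ A := homMk (fun n => (p.b n).comp ((G : E →+ E).comp (p.i n))) fun n m h x => by
    change (A.d n m).hom (p.b n (G (p.i n x))) = p.b m (G (p.i m ((T.d n m).hom x)))
    rw [p.bD n m h, p.iD n m h]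
    exact congrArg (p.b m) (DFunLike.congr_fun hGD (p.i n x)).symm
  let g : A ⟶ T := homMk (fun n => (p.j n).comp (p.a n)) fun n m h x => by
    change (T.d n m).hom (p.j n (p.a n x)) = p.j m (p.a m ((A.d n m).hom x))
    have e : p.d₁ (p.a n x) = 0 := by rw [← p.Pa]; exact DFunLike.congr_fun hP _
    rw [p.aD n m h, ← add_zero (p.d₀ _), ← e, ← p.ija n x, ← p.iD n m h, p.ji, p.ji]
  refine ⟨⟨f, g, (p.homotopyMk (p.S * G) _ _ ?_ ?_).symm, .ofEq ?_⟩⟩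
  · intro m n h x
    change p.S (G _) = p.i m (p.j m (p.S (G _)))
    rw [← p.Sij m n h, hGij', p.ji]
  · intro n x
    have e := DFunLike.congr_fun hH (p.i n x)
    have e' : p.S (G (p.d₀ (p.i n x) + p.d₁ (p.i n x))) +
        (p.d₀ (p.S (G (p.i n x))) + p.d₁ (p.S (G (p.i n x)))) = p.i n x - p.P (G (p.i n x)) := e
    change x = p.j n (p.S (G _) + (p.d₀ (p.S (G _)) + p.d₁ (p.S (G _)))) +
      p.j n (p.a n (p.b n (G (p.i n x))))
    have e2 : p.P (G (p.i n x)) = p.a n (p.b n (G (p.i n x))) := by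
      rw [← p.ji n x, ← hGij', p.Pi]
    rw [e', map_sub, p.ji, e2, sub_add_cancel]
  · ext n x
    change p.b n (G (p.i n (p.j n (p.a n x)))) = x
    rw [p.ija, hGa, p.ba]

end Perturbation

end Perturbation

end SpinNet
end

noncomputable section
namespace SpinNet

/-! ### Complexes of homomorphisms -/

section HomComplex

open CochainComplex

variable {C : Type*} [Category.{0} C] [Preadditive C]

/-- The functor `Hom(M, -)`. -/
abbrev coyo (M : C) : C ⥤ AddCommGrpCat.{0} := preadditiveCoyoneda.obj (Opposite.op M)

namespace HomPerturbation

variable (K X : CochainComplex C ℤ)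

/-- All homogeneous homomorphisms. -/
abbrev E : Type := ∀ pq : ℤ × ℤ, K.X pq.1 ⟶ X.X pq.2

variable {K X}

/-- Transport along an equality of indices: the differentials below meet `q - 1 + 1` and `q + 1 -
1`, which are not definitionally `q`. -/
theorem comp_congr (x : E K X) (p : ℤ) {q q' : ℤ} (h : q' = q) (r : ℤ) :
    x (p, q') ≫ X.d q' r = x (p, q) ≫ X.d q r := by subst h; rfl

theorem smul_comp_negOnePow_succ {A B : C} (n n' : ℤ) (h : n' + 1 = n) (f : A ⟶ B) :
    n.negOnePow • f = -(n'.negOnePow • f) := by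
  subst h
  rw [Int.negOnePow_succ, Units.neg_smul]

variable (K X)

/-- Postcomposition with the differential. -/
def d₀ : AddMonoid.End (E K X) where
  toFun x pq := x (pq.1, pq.2 - 1) ≫ X.d (pq.2 - 1) pq.2
  map_zero' := funext fun _ => Limits.zero_comp
  map_add' _ _ := funext fun _ => Preadditive.add_comp _ _ _ _ _ _

/-- Precomposition with the differential, up to sign. -/
def d₁ : AddMonoid.End (E K X) where
  toFun x pq := (pq.2 - pq.1).negOnePow • (K.d pq.1 (pq.1 + 1) ≫ x (pq.1 + 1, pq.2))
  map_zero' := funext fun _ => (congrArg _ Limits.comp_zero).trans (smul_zero _)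
  map_add' _ _ := funext fun _ =>
    (congrArg _ (Preadditive.comp_add _ _ _ _ _ _)).trans (smul_add _ _ _)

variable {K X}

theorem anti : d₁ K X * d₀ K X = -(d₀ K X * d₁ K X) := by
  refine AddMonoidHom.ext fun x => funext fun ⟨p, q⟩ => ?_
  change (q - p).negOnePow • (K.d p (p + 1) ≫ x (p + 1, q - 1) ≫ X.d (q - 1) q) =
    -(((q - 1 - p).negOnePow • (K.d p (p + 1) ≫ x (p + 1, q - 1))) ≫ X.d (q - 1) q)
  rw [smul_comp_negOnePow_succ (q - p) (q - 1 - p) (by ring), Linear.units_smul_comp,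
    Category.assoc]

theorem sq : d₁ K X * d₁ K X = 0 := by
  refine AddMonoidHom.ext fun x => funext fun ⟨p, q⟩ => ?_
  change (q - p).negOnePow • (K.d p (p + 1) ≫ ((q - (p + 1)).negOnePow •
    (K.d (p + 1) (p + 1 + 1) ≫ x (p + 1 + 1, q)))) = 0
  rw [Linear.comp_units_smul, K.d_comp_d_assoc, Limits.zero_comp, smul_zero, smul_zero]

section Homotopy

variable (s : ∀ p q r, (K.X p ⟶ X.X q) →+ (K.X p ⟶ X.X r))

/-- The homotopy. -/
def S : AddMonoid.End (E K X) where
  toFun x pq := s pq.1 (pq.2 + 1) pq.2 (x (pq.1, pq.2 + 1))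
  map_zero' := funext fun _ => map_zero _
  map_add' _ _ := funext fun _ => map_add _ _ _

theorem hom_congr (x : E K X) (p : ℤ) {q q' : ℤ} (e : q' = q) (r : ℤ) :
    s p q' r (x (p, q')) = s p q r (x (p, q)) := by subst e; rfl

end Homotopy

/-- The projection to the components with `p ≥ 0`. -/
def P : AddMonoid.End (E K X) where
  toFun x pq := if pq.1 < 0 then 0 else x pq
  map_zero' := funext fun pq => by split_ifs <;> rfl
  map_add' x y := funext fun pq => by
    change (if pq.1 < 0 then 0 else x pq + y pq) = (if pq.1 < 0 then 0 else x pq) +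
      (if pq.1 < 0 then 0 else y pq)
    split_ifs <;> simp

/-- The inclusion of the maps of degree `n`. -/
def i (n : ℤ) : HomComplex.Cochain K X n →+ E K X where
  toFun x pq := if h : pq.1 + n = pq.2 then x.v pq.1 pq.2 h else 0
  map_zero' := funext fun pq => by split_ifs <;> simp
  map_add' x y := funext fun pq => by
    by_cases h : pq.1 + n = pq.2 <;> simp [h]

/-- The projection to the maps of degree `n`. -/
def j (n : ℤ) : E K X →+ HomComplex.Cochain K X n where
  toFun x := .mk fun p q _ => x (p, q)
  map_zero' := rfl
  map_add' _ _ := rfl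

theorem ij_of_eq (n : ℤ) (x : E K X) {p q : ℤ} (h : p + n = q) : i n (j n x) (p, q) = x (p, q) :=
  dif_pos h

theorem ij_of_ne (n : ℤ) (x : E K X) {p q : ℤ} (h : p + n ≠ q) : i n (j n x) (p, q) = 0 :=
  dif_neg h

theorem i_of_ne (n : ℤ) (x : HomComplex.Cochain K X n) {p q : ℤ} (h : p + n ≠ q) :
    i n x (p, q) = 0 := dif_neg h

theorem i_of_eq (n : ℤ) (x : HomComplex.Cochain K X n) {p q : ℤ} (h : p + n = q) :
    i n x (p, q) = x.v p q h := dif_pos h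

theorem ext_iff {x y : E K X} : x = y ↔ ∀ p q, x (p, q) = y (p, q) :=
  ⟨fun h _ _ => h ▸ rfl, fun h => funext fun ⟨p, q⟩ => h p q⟩

/-- The inclusion of a map from the object in degree zero. -/
def a (n : ℤ) : (K.X 0 ⟶ X.X n) →+ E K X :=
  AddMonoidHom.single (fun pq : ℤ × ℤ => K.X pq.1 ⟶ X.X pq.2) (0, n)

theorem a_self (n : ℤ) (x : K.X 0 ⟶ X.X n) : a n x (0, n) = x := Pi.single_eq_same _ _

theorem a_of_ne (n : ℤ) (x : K.X 0 ⟶ X.X n) {p q : ℤ} (h : p ≠ 0 ∨ q ≠ n) :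
    a n x (p, q) = 0 := Pi.single_eq_of_ne (by
  rintro e
  obtain ⟨rfl, rfl⟩ := Prod.mk.inj e
  simp at h) _

/-- The value of a map on the object in degree zero. -/
def b (n : ℤ) : E K X →+ (K.X 0 ⟶ X.X n) :=
  Pi.evalAddMonoidHom (fun pq : ℤ × ℤ => K.X pq.1 ⟶ X.X pq.2) (0, n)

theorem ji (n : ℤ) (x : HomComplex.Cochain K X n) : j n (i n x) = x :=
  HomComplex.Cochain.ext _ _ fun _ _ hpq => i_of_eq n x hpq

theorem iD (n m : ℤ) (hm : n + 1 = m) (x : HomComplex.Cochain K X n) :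
    i m (HomComplex.δ n m x) = d₀ K X (i n x) + d₁ K X (i n x) := by
  refine ext_iff.2 fun p q => ?_
  change i m (HomComplex.δ n m x) (p, q) = i n x (p, q - 1) ≫ X.d (q - 1) q +
    (q - p).negOnePow • (K.d p (p + 1) ≫ i n x (p + 1, q))
  by_cases hpq : p + m = q
  -- On the component from `K.X p` to `X.X q` of a cochain of degree `m` one has q - p = m, so the
  -- sign in `d₁` is the sign of the second term of `HomComplex.δ`.
  · have e : q - p = m := by omega
    rw [i_of_eq _ _ hpq, HomComplex.δ_v n m hm x p q hpq (q - 1) (p + 1) rfl rfl,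
      i_of_eq n x (by omega), i_of_eq n x (by omega), e]
  · rw [i_of_ne _ _ hpq, i_of_ne _ _ (by omega), i_of_ne _ _ (by omega), Limits.zero_comp,
      Limits.comp_zero, smul_zero, add_zero]

theorem aD (n m : ℤ) (hm : n + 1 = m) (x : K.X 0 ⟶ X.X n) :
    a m (x ≫ X.d n m) = d₀ K X (a n x) := by
  subst hm
  refine ext_iff.2 fun p q => ?_
  change _ = a n x (p, q - 1) ≫ X.d (q - 1) q
  by_cases hpq : p = 0 ∧ q = n + 1
  · obtain ⟨rfl, rfl⟩ := hpq
    rw [a_self]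
    refine Eq.trans ?_ (comp_congr (a n x) 0 (add_sub_cancel_right n 1) _).symm
    rw [a_self]
  · rw [a_of_ne _ _ (by omega), a_of_ne _ _ (by omega), Limits.zero_comp]

theorem bD (n m : ℤ) (hm : n + 1 = m) (x : E K X) : b n x ≫ X.d n m = b m (d₀ K X x) := by
  subst hm
  exact (comp_congr x 0 (add_sub_cancel_right n 1) _).symm

theorem Pa (n : ℤ) (x : K.X 0 ⟶ X.X n) : P (a n x) = a n x := by
  refine ext_iff.2 fun p q => ?_
  change (if p < 0 then 0 else a n x (p, q)) = a n x (p, q)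
  split_ifs with hp
  · rw [a_of_ne _ _ (by omega)]
  · rfl

theorem bP (n : ℤ) (x : E K X) : b n (P x) = b n x :=
  if_neg (t := (0 : K.X 0 ⟶ X.X n)) (show ¬ (0 : ℤ) < 0 from lt_irrefl _)

/-- The projection keeps all components with p ≥ 0; as `K` vanishes in positive degrees, only p = 0
remains. -/
theorem Pi (hK : ∀ p, 0 < p → Limits.IsZero (K.X p)) (n : ℤ) (x : HomComplex.Cochain K X n) :
    P (i n x) = a n (b n (i n x)) := by
  refine ext_iff.2 fun p q => ?_
  change (if p < 0 then 0 else i n x (p, q)) = a n (i n x (0, n)) (p, q)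
  rcases lt_trichotomy p 0 with hp | hp | hp
  · rw [if_pos hp, a_of_ne _ _ (by omega)]
  · subst hp
    rw [if_neg (lt_irrefl _)]
    by_cases hq : q = n
    · subst hq
      rw [a_self]
    · rw [a_of_ne _ _ (by omega), i_of_ne]
      omega
  · exact (hK p hp).eq_of_src _ _

theorem ija (n : ℤ) (x : K.X 0 ⟶ X.X n) : i n (j n (a n x)) = a n x := by
  refine ext_iff.2 fun p q => ?_
  by_cases hpq : p + n = q
  · rw [ij_of_eq _ _ hpq]
  · rw [ij_of_ne _ _ hpq, a_of_ne _ _ (by omega)]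

theorem Sij (s : ∀ p q r, (K.X p ⟶ X.X q) →+ (K.X p ⟶ X.X r)) (m n : ℤ) (hmn : m + 1 = n)
    (x : E K X) : S s (i n (j n x)) = i m (j m (S s x)) := by
  subst hmn
  refine ext_iff.2 fun p q => ?_
  change s p (q + 1) q (i (m + 1) (j (m + 1) x) (p, q + 1)) = _
  by_cases hq : p + m = q
  · rw [ij_of_eq _ _ (by omega), ij_of_eq _ _ hq]; rfl
  · rw [ij_of_ne _ _ (by omega), ij_of_ne _ _ hq]
    exact map_zero _

theorem i_d₁ (n m : ℤ) (hm : n + 1 = m) (x : E K X) :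
    d₁ K X (i n (j n x)) = i m (j m (d₁ K X x)) := by
  subst hm
  refine ext_iff.2 fun p q => ?_
  change (q - p).negOnePow • (K.d p (p + 1) ≫ i n (j n x) (p + 1, q)) = _
  by_cases hpq : p + (n + 1) = q
  · rw [ij_of_eq _ _ hpq, ij_of_eq _ _ (by omega)]; rfl
  · rw [ij_of_ne _ _ hpq, ij_of_ne _ _ (by omega), Limits.comp_zero, smul_zero]

theorem contract (s : ∀ p q r, (K.X p ⟶ X.X q) →+ (K.X p ⟶ X.X r))
    (hs : ∀ p q (y : K.X p ⟶ X.X q), p < 0 →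
      s p q (q - 1) y ≫ X.d (q - 1) q + s p (q + 1) q (y ≫ X.d q (q + 1)) = y)
    (hs0 : ∀ p q r, ¬ p < 0 → s p q r = 0) :
    d₀ K X * S s + S s * d₀ K X = 1 - P := by
  refine AddMonoidHom.ext fun x => ext_iff.2 fun p q => ?_
  change s p (q - 1 + 1) (q - 1) (x (p, q - 1 + 1)) ≫ X.d (q - 1) q +
    s p (q + 1) q (x (p, q + 1 - 1) ≫ X.d (q + 1 - 1) (q + 1)) =
    x (p, q) - (if p < 0 then 0 else x (p, q))
  rw [hom_congr s x p (sub_add_cancel q 1) (q - 1),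
    comp_congr x p (add_sub_cancel_right q 1) (q + 1)]
  by_cases hp : p < 0
  · rw [if_pos hp, sub_zero]
    exact hs p q _ hp
  · rw [if_neg hp, sub_self, hs0 _ _ _ hp, hs0 _ _ _ hp]
    simp

theorem SP (s : ∀ p q r, (K.X p ⟶ X.X q) →+ (K.X p ⟶ X.X r))
    (hs0 : ∀ p q r, ¬ p < 0 → s p q r = 0) : S s * P = 0 := by
  refine AddMonoidHom.ext fun x => ext_iff.2 fun p q => ?_
  change s p (q + 1) q (if p < 0 then 0 else x (p, q + 1)) = 0
  split_ifs with hp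
  · exact map_zero _
  · rw [hs0 _ _ _ hp]; rfl

theorem PS (s : ∀ p q r, (K.X p ⟶ X.X q) →+ (K.X p ⟶ X.X r))
    (hs0 : ∀ p q r, ¬ p < 0 → s p q r = 0) : P * S s = 0 := by
  refine AddMonoidHom.ext fun x => ext_iff.2 fun p q => ?_
  change (if p < 0 then 0 else s p (q + 1) q (x (p, q + 1))) = 0
  split_ifs with hp
  · rfl
  · rw [hs0 _ _ _ hp]; rfl

/-- The component of d₁ x at `p` factors through `K.X (p + 1)`, which is zero for p ≥ 0. This makes
Hom(K⁰, X) a quotient complex of Hom(K, X). -/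
theorem P_d₁ (hK : ∀ p, 0 < p → Limits.IsZero (K.X p)) : P * d₁ K X = 0 := by
  refine AddMonoidHom.ext fun x => ext_iff.2 fun p q => ?_
  change (if p < 0 then 0 else (q - p).negOnePow • (K.d p (p + 1) ≫ x (p + 1, q))) = 0
  split_ifs with hp
  · rfl
  · rw [(hK (p + 1) (by omega)).eq_of_src (x (p + 1, q)) 0, Limits.comp_zero, smul_zero]

/-- Precomposition with the differential computes the component at `p` from the one at p + 1, and
the homotopy keeps `p`; for p < 0 this decreases the level -p. The truncation by `toNat` does no
harm because the homotopy vanishes for p ≥ 0. -/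
theorem lowering (s : ∀ p q r, (K.X p ⟶ X.X q) →+ (K.X p ⟶ X.X r))
    (hs0 : ∀ p q r, ¬ p < 0 → s p q r = 0) :
    Lowering (Z := fun pq : ℤ × ℤ => K.X pq.1 ⟶ X.X pq.2) (fun pq => (-pq.1).toNat)
      (S s * d₁ K X) := fun x ⟨p, q⟩ hx => by
  change s p (q + 1) q ((q + 1 - p).negOnePow • (K.d p (p + 1) ≫ x (p + 1, q + 1))) = 0
  by_cases hp : p < 0
  · rw [hx (p + 1, q + 1) (by simp only; omega), Limits.comp_zero, smul_zero, map_zero]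
  · rw [hs0 _ _ _ hp]; rfl

/-- The perturbation data for the complex of homomorphisms. -/
def data (hK : ∀ p, 0 < p → Limits.IsZero (K.X p))
    (s : ∀ p q r, (K.X p ⟶ X.X q) →+ (K.X p ⟶ X.X r))
    (hs : ∀ p q (y : K.X p ⟶ X.X q), p < 0 →
      s p q (q - 1) y ≫ X.d (q - 1) q + s p (q + 1) q (y ≫ X.d q (q + 1)) = y)
    (hs0 : ∀ p q r, ¬ p < 0 → s p q r = 0) :
    Perturbation (HomComplex K X) (((coyo (K.X 0)).mapHomologicalComplex (.up ℤ)).obj X)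
      (E K X) where
  i := i
  j := j
  a := a
  b := b
  d₀ := d₀ K X
  d₁ := d₁ K X
  S := S s
  P := P
  prev n := ⟨n - 1, sub_add_cancel n 1⟩
  ji := ji
  ba := a_self
  iD := iD
  iD_zero n hn := (hn (CochainComplex.next ℤ n).symm).elim
  aD := aD
  bD := bD
  Pa := Pa
  bP := bP
  Pi := Pi hK
  ija := ija
  bij n x := ij_of_eq n x (zero_add n)
  Sij := Sij s
  contract := contract s hs hs0
  SP := SP s hs0
  PS := PS s hs0
  anti := anti
  sq := sq

end HomPerturbation

/-- The maps of a homotopy between endomorphisms of `Hom(M, X)`. -/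
def coyoHomotopy {M : C} {X : CochainComplex C ℤ}
    (h : Homotopy (𝟙 (((coyo M).mapHomologicalComplex (.up ℤ)).obj X)) 0) (q r : ℤ) :
    (M ⟶ X.X q) →+ (M ⟶ X.X r) := (h.hom q r).hom

theorem coyoHomotopy_apply {M : C} {X : CochainComplex C ℤ}
    (h : Homotopy (𝟙 (((coyo M).mapHomologicalComplex (.up ℤ)).obj X)) 0) (q : ℤ)
    (y : M ⟶ X.X q) :
    coyoHomotopy h q (q - 1) y ≫ X.d (q - 1) q + coyoHomotopy h (q + 1) q (y ≫ X.d q (q + 1)) =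
      y := by
  have := h.comm q
  rw [dNext_eq _ (show (ComplexShape.up ℤ).Rel q (q + 1) from rfl),
    prevD_eq _ (show (ComplexShape.up ℤ).Rel (q - 1) q from sub_add_cancel q 1)] at this
  have := congrArg (fun f => f.hom y) this
  refine Eq.trans ?_ this.symm
  refine Eq.trans (add_comm _ _) (add_zero _).symm

open Classical in
/-- If `K` lives in nonpositive degrees and `Hom(K^p, X)` is contractible for all `p < 0`, then
`Hom(K, X)` is homotopy equivalent to `Hom(K⁰, X)`. -/
theorem homComplex_equiv (K X : CochainComplex C ℤ) (hK : ∀ p, 0 < p → Limits.IsZero (K.X p))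
    (h : ∀ p : ℤ, p < 0 →
      Nonempty (Homotopy (𝟙 (((coyo (K.X p)).mapHomologicalComplex (.up ℤ)).obj X)) 0)) :
    Nonempty (HomotopyEquiv (HomComplex K X)
      (((coyo (K.X 0)).mapHomologicalComplex (.up ℤ)).obj X)) := by
  -- The contractions for different `p` are chosen independently, without any compatibility with the
  -- differential of `K`: the perturbation corrects for this. For p ≥ 0 nothing is contracted and
  -- the homotopy is zero.
  let s (p q r : ℤ) : (K.X p ⟶ X.X q) →+ (K.X p ⟶ X.X r) :=
    if hp : p < 0 then coyoHomotopy (h p hp).some q r else 0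
  have hs0 (p q r : ℤ) (hp : ¬ p < 0) : s p q r = 0 := dif_neg hp
  have hs (p q : ℤ) (y : K.X p ⟶ X.X q) (hp : p < 0) :
      s p q (q - 1) y ≫ X.d (q - 1) q + s p (q + 1) q (y ≫ X.d q (q + 1)) = y := by
    have e (q r : ℤ) : s p q r = coyoHomotopy (h p hp).some q r := dif_pos hp
    rw [e, e]
    exact coyoHomotopy_apply (h p hp).some q y
  refine (HomPerturbation.data hK s hs hs0).equiv_of_quotient (HomPerturbation.P_d₁ hK) ?_
    (HomPerturbation.lowering s hs0).exists_inverse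
  intro n x
  refine (congrArg (HomPerturbation.S s) (HomPerturbation.i_d₁ n (n + 1) rfl x)).trans ?_
  exact HomPerturbation.Sij s n (n + 1) rfl _

end HomComplex

end SpinNet
end

noncomputable section
namespace SpinNet

/-! ### Total complexes -/

section Bicomplex

/-- A double complex of abelian groups in the first quadrant, with commuting differentials that
lower the indices. -/
structure Bicomplex where
  Z : ℕ → ℕ → Type
  [grp : ∀ p q, AddCommGroup (Z p q)]
  h (p q : ℕ) : Z (p + 1) q →+ Z p q
  v (p q : ℕ) : Z p (q + 1) →+ Z p q
  hh (p q : ℕ) (x : Z (p + 1 + 1) q) : h p q (h (p + 1) q x) = 0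
  vv (p q : ℕ) (x : Z p (q + 1 + 1)) : v p q (v p (q + 1) x) = 0
  hv (p q : ℕ) (x : Z (p + 1) (q + 1)) : h p q (v (p + 1) q x) = v p q (h p (q + 1) x)

namespace Bicomplex

attribute [instance] Bicomplex.grp

variable (B : Bicomplex)

/-- All families of elements. -/
abbrev E : Type := ∀ pq : ℕ × ℕ, B.Z pq.1 pq.2

theorem ext_iff' {x y : B.E} : x = y ↔ ∀ p q, x (p, q) = y (p, q) :=
  ⟨fun h _ _ => h ▸ rfl, fun h => funext fun ⟨p, q⟩ => h p q⟩

/-- The horizontal differential. -/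
def d₀ : AddMonoid.End B.E where
  toFun x pq := B.h pq.1 pq.2 (x (pq.1 + 1, pq.2))
  map_zero' := funext fun _ => map_zero _
  map_add' _ _ := funext fun _ => map_add _ _ _

/-- The vertical differential, with signs. -/
def d₁ : AddMonoid.End B.E where
  toFun x pq := ((-1) ^ pq.1 : ℤˣ) • B.v pq.1 pq.2 (x (pq.1, pq.2 + 1))
  map_zero' := funext fun _ => (congrArg _ (map_zero _)).trans (smul_zero _)
  map_add' _ _ := funext fun _ => (congrArg _ (map_add _ _ _)).trans (smul_add _ _ _)

theorem map_units_smul {A A' : Type} [AddCommGroup A] [AddCommGroup A'] (f : A →+ A') (u : ℤˣ)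
    (x : A) : f (u • x) = u • f x := map_zsmul f (u : ℤ) x

theorem anti : B.d₁ * B.d₀ = -(B.d₀ * B.d₁) := by
  refine AddMonoidHom.ext fun x => B.ext_iff'.2 fun p q => ?_
  change ((-1) ^ p : ℤˣ) • B.v p q (B.h p (q + 1) (x (p + 1, q + 1))) =
    -(B.h p q (((-1) ^ (p + 1) : ℤˣ) • B.v (p + 1) q (x (p + 1, q + 1))))
  rw [map_units_smul, B.hv, pow_succ, mul_neg_one, Units.neg_smul, neg_neg]

theorem sq : B.d₁ * B.d₁ = 0 := by
  refine AddMonoidHom.ext fun x => B.ext_iff'.2 fun p q => ?_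
  change ((-1) ^ p : ℤˣ) • B.v p q (((-1) ^ p : ℤˣ) • B.v p (q + 1) (x (p, q + 1 + 1))) = 0
  rw [map_units_smul, B.vv, smul_zero, smul_zero]

variable {B} in
/-- The homotopy, on the rows with `q ≥ 1`. -/
def S (s : ∀ p q, B.Z p q →+ B.Z (p + 1) q) : AddMonoid.End B.E where
  toFun x pq := match pq with
    | (0, _) => 0
    | (_ + 1, 0) => 0
    | (p + 1, q + 1) => s p (q + 1) (x (p, q + 1))
  map_zero' := funext fun ⟨p, q⟩ => by
    cases p <;> cases q <;> first | rfl | exact map_zero _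
  map_add' x y := funext fun ⟨p, q⟩ => by
    cases p <;> cases q <;> first | exact (add_zero _).symm | exact map_add _ _ _

/-- The projection to the row `q = 0`. -/
def P : AddMonoid.End B.E where
  toFun x pq := if pq.2 = 0 then x pq else 0
  map_zero' := funext fun pq => by split_ifs <;> rfl
  map_add' x y := funext fun pq => by
    change (if pq.2 = 0 then x pq + y pq else 0) = (if pq.2 = 0 then x pq else 0) +
      (if pq.2 = 0 then y pq else 0)
    split_ifs <;> simp

/-- A presentation of a complex as the total complex of a double complex. -/
structure Total (T : ChainComplex AddCommGrpCat.{0} ℕ) where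
  i (n : ℕ) : T.X n →+ B.E
  j (n : ℕ) : B.E →+ T.X n
  ji (n : ℕ) (x : T.X n) : j n (i n x) = x
  ij (n : ℕ) (x : B.E) (p q : ℕ) : i n (j n x) (p, q) = if p + q = n then x (p, q) else 0
  iD (n : ℕ) (x : T.X (n + 1)) (p q : ℕ) : i n ((T.d (n + 1) n).hom x) (p, q) =
    B.h p q (i (n + 1) x (p + 1, q)) + ((-1) ^ p : ℤˣ) • B.v p q (i (n + 1) x (p, q + 1))

variable {B}

theorem Total.i_of_ne {T : ChainComplex AddCommGrpCat.{0} ℕ} (t : B.Total T) (n : ℕ) (x : T.X n)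
    (p q : ℕ) (h : p + q ≠ n) : t.i n x (p, q) = 0 := by
  rw [← t.ji n x, t.ij, if_neg h]

/-- The row `q = 0`. -/
structure Row (A : ChainComplex AddCommGrpCat.{0} ℕ) (B : Bicomplex) where
  e (n : ℕ) : A.X n ≃+ B.Z n 0
  eD (n : ℕ) (x : A.X (n + 1)) : e n ((A.d (n + 1) n).hom x) = B.h n 0 (e (n + 1) x)

/-- The inclusion of the row `q = 0`. -/
def Row.a {A : ChainComplex AddCommGrpCat.{0} ℕ} (r : Row A B) (n : ℕ) : A.X n →+ B.E :=
  (AddMonoidHom.single (fun pq : ℕ × ℕ => B.Z pq.1 pq.2) (n, 0)).comp (r.e n).toAddMonoidHom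

theorem Row.a_self {A : ChainComplex AddCommGrpCat.{0} ℕ} (r : Row A B) (n : ℕ) (x : A.X n) :
    r.a n x (n, 0) = r.e n x := Pi.single_eq_same _ _

theorem Row.a_of_ne {A : ChainComplex AddCommGrpCat.{0} ℕ} (r : Row A B) (n : ℕ) (x : A.X n)
    (p q : ℕ) (h : p ≠ n ∨ q ≠ 0) : r.a n x (p, q) = 0 := Pi.single_eq_of_ne (by
  rintro e
  obtain ⟨rfl, rfl⟩ := Prod.mk.inj e
  simp at h) _

/-- The projection to the row `q = 0`. -/
def Row.b {A : ChainComplex AddCommGrpCat.{0} ℕ} (r : Row A B) (n : ℕ) : B.E →+ A.X n :=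
  (r.e n).symm.toAddMonoidHom.comp
    (Pi.evalAddMonoidHom (fun pq : ℕ × ℕ => B.Z pq.1 pq.2) (n, 0))

theorem Row.b_apply {A : ChainComplex AddCommGrpCat.{0} ℕ} (r : Row A B) (n : ℕ) (x : B.E) :
    r.b n x = (r.e n).symm (x (n, 0)) := rfl

/-- The perturbation data of a total complex. -/
def Total.data {T A : ChainComplex AddCommGrpCat.{0} ℕ} (t : B.Total T) (r : Row A B)
    (s : ∀ p q, B.Z p q →+ B.Z (p + 1) q)
    (hs0 : ∀ q (y : B.Z 0 (q + 1)), B.h 0 (q + 1) (s 0 (q + 1) y) = y)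
    (hs : ∀ p q (y : B.Z (p + 1) (q + 1)),
      B.h (p + 1) (q + 1) (s (p + 1) (q + 1) y) + s p (q + 1) (B.h p (q + 1) y) = y) :
    Perturbation T A B.E where
  i := t.i
  j := t.j
  a := r.a
  b := r.b
  d₀ := B.d₀
  d₁ := B.d₁
  S := S s
  P := B.P
  prev n := ⟨n + 1, rfl⟩
  ji := t.ji
  ba n x := by rw [r.b_apply, r.a_self, AddEquiv.symm_apply_apply]
  iD n m hnm x := by
    obtain rfl : m + 1 = n := hnm
    exact B.ext_iff'.2 fun p q => t.iD m x p q
  iD_zero n hn x := by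
    -- Only degree zero has no successor, and there both differentials take their values from
    -- components of total degree one, which vanish.
    obtain rfl : n = 0 := by
      by_contra h
      obtain ⟨k, rfl⟩ := Nat.exists_eq_succ_of_ne_zero h
      exact hn (by rw [ChainComplex.next_nat_succ]; rfl)
    refine B.ext_iff'.2 fun p q => ?_
    change B.h p q (t.i 0 x (p + 1, q)) + ((-1) ^ p : ℤˣ) • B.v p q (t.i 0 x (p, q + 1)) = 0
    rw [t.i_of_ne _ _ _ _ (by omega), t.i_of_ne _ _ _ _ (by omega), map_zero, map_zero, smul_zero,
      add_zero]
  aD n m hnm x := by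
    obtain rfl : m + 1 = n := hnm
    refine B.ext_iff'.2 fun p q => ?_
    change _ = B.h p q (r.a (m + 1) x (p + 1, q))
    by_cases h : p = m ∧ q = 0
    · obtain ⟨rfl, rfl⟩ := h
      rw [r.a_self, r.a_self, r.eD]
    · rw [r.a_of_ne _ _ _ _ (by omega), r.a_of_ne _ _ _ _ (by omega), map_zero]
  bD n m hnm x := by
    obtain rfl : m + 1 = n := hnm
    apply (r.e m).injective
    rw [r.eD, r.b_apply, r.b_apply, AddEquiv.apply_symm_apply, AddEquiv.apply_symm_apply]
    rfl
  Pa n x := by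
    refine B.ext_iff'.2 fun p q => ?_
    change (if q = 0 then r.a n x (p, q) else 0) = _
    split_ifs with hq
    · rfl
    · rw [r.a_of_ne _ _ _ _ (by omega)]
  bP n x := by
    rw [r.b_apply, r.b_apply]
    have e : B.P x (n, 0) = x (n, 0) := by
      change (if (0 : ℕ) = 0 then x (n, 0) else 0) = x (n, 0)
      exact if_pos rfl
    rw [e]
  Pi n x := by
    refine B.ext_iff'.2 fun p q => ?_
    change (if q = 0 then t.i n x (p, q) else 0) = _
    rw [r.b_apply]
    by_cases h : p = n ∧ q = 0
    · obtain ⟨rfl, rfl⟩ := h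
      rw [r.a_self, if_pos rfl, AddEquiv.apply_symm_apply]
    · rw [r.a_of_ne _ _ _ _ (by omega)]
      split_ifs with hq
      · rw [t.i_of_ne _ _ _ _ (by omega)]
      · rfl
  ija n x := by
    refine B.ext_iff'.2 fun p q => ?_
    rw [t.ij]
    split_ifs with hp
    · rfl
    · rw [r.a_of_ne _ _ _ _ (by omega)]
  bij n x := by
    rw [r.b_apply, r.b_apply, t.ij, if_pos (add_zero n)]
  Sij m n hmn x := by
    obtain rfl : n + 1 = m := hmn
    refine B.ext_iff'.2 fun p q => ?_
    rw [t.ij]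
    match p, q with
    | 0, q => split_ifs <;> rfl
    | p + 1, 0 => split_ifs <;> rfl
    | p + 1, q + 1 =>
      change s p (q + 1) (t.i n (t.j n x) (p, q + 1)) =
        if p + 1 + (q + 1) = n + 1 then s p (q + 1) (x (p, q + 1)) else 0
      rw [t.ij]
      split_ifs <;> first | rfl | omega | exact map_zero _
  contract := by
    refine AddMonoidHom.ext fun x => B.ext_iff'.2 fun p q => ?_
    change B.h p q (S s x (p + 1, q)) + S s (B.d₀ x) (p, q) =
      x (p, q) - (if q = 0 then x (p, q) else 0)
    match p, q with
    | 0, 0 =>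
      rw [if_pos rfl, sub_self]
      exact (congrArg₂ _ (map_zero _) rfl).trans (add_zero _)
    | p + 1, 0 =>
      rw [if_pos rfl, sub_self]
      exact (congrArg₂ _ (map_zero _) rfl).trans (add_zero _)
    | 0, q + 1 =>
      rw [if_neg (Nat.succ_ne_zero q), sub_zero]
      exact (add_zero _).trans (hs0 _ _)
    | p + 1, q + 1 =>
      rw [if_neg (Nat.succ_ne_zero q), sub_zero]
      exact hs _ _ _
  SP := by
    refine AddMonoidHom.ext fun x => B.ext_iff'.2 fun p q => ?_
    match p, q with
    | 0, q => rfl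
    | p + 1, 0 => rfl
    | p + 1, q + 1 => exact map_zero (s p (q + 1))
  PS := by
    refine AddMonoidHom.ext fun x => B.ext_iff'.2 fun p q => ?_
    change (if q = 0 then S s x (p, q) else 0) = 0
    match p, q with
    | 0, q => split_ifs <;> rfl
    | p + 1, 0 => split_ifs <;> rfl
    | p + 1, q + 1 => rfl
  anti := B.anti
  sq := B.sq

/-- If the rows with `q ≥ 1` of a double complex are contractible, then its total complex is
homotopy equivalent to the row `q = 0`. -/
theorem Total.equiv {T A : ChainComplex AddCommGrpCat.{0} ℕ} (t : B.Total T) (r : Row A B)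
    (s : ∀ p q, B.Z p q →+ B.Z (p + 1) q)
    (hs0 : ∀ q (y : B.Z 0 (q + 1)), B.h 0 (q + 1) (s 0 (q + 1) y) = y)
    (hs : ∀ p q (y : B.Z (p + 1) (q + 1)),
      B.h (p + 1) (q + 1) (s (p + 1) (q + 1) y) + s p (q + 1) (B.h p (q + 1) y) = y) :
    Nonempty (HomotopyEquiv T A) := by
  refine (t.data r s hs0 hs).equiv_of_sub ?_ ?_ (Lowering.exists_inverse (lev := Prod.fst) ?_)
  -- The row q = 0 is a subcomplex because the vertical differential out of it vanishes.
  · refine AddMonoidHom.ext fun x => B.ext_iff'.2 fun p q => ?_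
    change ((-1) ^ p : ℤˣ) • B.v p q 0 = 0
    rw [map_zero, smul_zero]
  · intro n x
    have h1 := (t.data r s hs0 hs).Sij (n + 1) n rfl x
    refine (congrArg B.d₁ h1).trans (B.ext_iff'.2 fun p q => ?_)
    change ((-1) ^ p : ℤˣ) • B.v p q (t.i (n + 1) (t.j (n + 1) (S s x)) (p, q + 1)) =
      t.i n (t.j n (B.d₁ (S s x))) (p, q)
    rw [t.ij, t.ij]
    by_cases h : p + q = n
    · rw [if_pos h, if_pos (by omega)]; rfl
    · rw [if_neg h, if_neg (by omega), map_zero, smul_zero]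
  -- The homotopy raises `p` by one and the vertical differential keeps it, so the value in column
  -- `p` reads only column p - 1; the level is therefore the column.
  · rintro x ⟨p, q⟩ hx
    change ((-1) ^ p : ℤˣ) • B.v p q (S s x (p, q + 1)) = 0
    match p, hx with
    | 0, _ => exact (congrArg _ (map_zero _)).trans (smul_zero _)
    | p + 1, hx =>
      change ((-1) ^ (p + 1) : ℤˣ) • B.v (p + 1) q (s p (q + 1) (x (p, q + 1))) = 0
      rw [hx (p, q + 1) (Nat.lt_succ_self p), map_zero, map_zero, smul_zero]

end Bicomplex

end Bicomplex

end SpinNet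
end

/-! ### Total complexes of bifunctors -/

noncomputable section
namespace SpinNet

section MapBifunctor

open HomologicalComplex

variable {C D E : Type 1} [Category.{0} C] [Category.{0} D] [Category.{0} E]
    [Preadditive C] [Preadditive D] [Preadditive E] [Limits.HasFiniteBiproducts E]
    (F : C ⥤ D ⥤ E) [F.Additive] [∀ X, (F.obj X).Additive]
    (G : E ⥤ AddCommGrpCat.{0}) [G.Additive]
    (K : ChainComplex C ℕ) (L : ChainComplex D ℕ)

namespace TotalComplex

/-- The projection to a summand of the total complex. -/
def proj (p q n : ℕ) : (mapBifunctor K L F (.down ℕ)).X n ⟶ (F.obj (K.X p)).obj (L.X q) :=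
  mapBifunctorDesc fun p' q' _ =>
    if h : p' = p ∧ q' = q then eqToHom (by rw [h.1, h.2]) else 0

/-- The inclusion of a summand of the total complex. -/
abbrev incl (p q n : ℕ) : (F.obj (K.X p)).obj (L.X q) ⟶ (mapBifunctor K L F (.down ℕ)).X n :=
  ιMapBifunctorOrZero K L F (.down ℕ) p q n

theorem incl_of_ne (p q n : ℕ) (h : p + q ≠ n) : incl F K L p q n = 0 :=
  ιMapBifunctorOrZero_eq_zero _ _ _ _ _ _ _ h

theorem incl_proj (p q n p' q' : ℕ) (h : p + q = n) : incl F K L p q n ≫ proj F K L p' q' n =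
    if h : p = p' ∧ q = q' then eqToHom (by rw [h.1, h.2]) else 0 := by
  rw [incl, ιMapBifunctorOrZero_eq _ _ _ _ _ _ _ h]
  exact ι_mapBifunctorDesc _ _ _ _

theorem incl_proj_self (p q n : ℕ) (h : p + q = n) :
    incl F K L p q n ≫ proj F K L p q n = 𝟙 _ := by
  rw [incl_proj _ _ _ _ _ _ _ _ h, dif_pos ⟨rfl, rfl⟩, eqToHom_refl]

theorem incl_proj_of_ne (p q n p' q' : ℕ) (h : ¬ (p = p' ∧ q = q')) :
    incl F K L p q n ≫ proj F K L p' q' n = 0 := by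
  by_cases hn : p + q = n
  · rw [incl_proj _ _ _ _ _ _ _ _ hn, dif_neg h]
  · rw [incl_of_ne _ _ _ _ _ _ hn, Limits.zero_comp]

variable {F K L} in
theorem hom_ext {n : ℕ} {Y : E} {f g : (mapBifunctor K L F (.down ℕ)).X n ⟶ Y}
    (h : ∀ p q, p + q = n → incl F K L p q n ≫ f = incl F K L p q n ≫ g) : f = g :=
  mapBifunctor.hom_ext fun p q hpq => by
    have := h p q hpq
    rwa [incl, ιMapBifunctorOrZero_eq _ _ _ _ _ _ _ hpq] at this

theorem sum_proj_incl (n : ℕ) : ∑ pq ∈ Finset.HasAntidiagonal.antidiagonal n,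
    proj F K L pq.1 pq.2 n ≫ incl F K L pq.1 pq.2 n = 𝟙 _ := hom_ext fun p q h => by
  rw [Preadditive.comp_sum, Finset.sum_eq_single (p, q)]
  · rw [← Category.assoc, incl_proj_self _ _ _ _ _ _ h, Category.id_comp, Category.comp_id]
  · rintro ⟨p', q'⟩ _ hne
    rw [← Category.assoc, incl_proj_of_ne, Limits.zero_comp]
    rintro ⟨rfl, rfl⟩
    exact hne rfl
  · intro hn
    exact absurd (Finset.HasAntidiagonal.mem_antidiagonal.2 h) hn

theorem incl_d_succ (p q n : ℕ) (h : p + 1 + (q + 1) = n + 1) :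
    incl F K L (p + 1) (q + 1) (n + 1) ≫ (mapBifunctor K L F (.down ℕ)).d (n + 1) n =
      (F.map (K.d (p + 1) p)).app (L.X (q + 1)) ≫ incl F K L p (q + 1) n +
      ((-1) ^ (p + 1) : ℤˣ) • (F.obj (K.X (p + 1))).map (L.d (q + 1) q) ≫ incl F K L (p + 1) q n := by
  rw [incl, ιMapBifunctorOrZero_eq _ _ _ _ _ _ _ h, mapBifunctor.d_eq, Preadditive.comp_add,
    mapBifunctor.ι_D₁, mapBifunctor.ι_D₂, mapBifunctor.d₁_eq' _ _ _ _ (i₁' := p) rfl,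
    mapBifunctor.d₂_eq' _ _ _ _ _ (i₂' := q) rfl]
  congr 1
  exact one_smul _ _

theorem incl_d_left (p n : ℕ) (h : p + 1 + 0 = n + 1) :
    incl F K L (p + 1) 0 (n + 1) ≫ (mapBifunctor K L F (.down ℕ)).d (n + 1) n =
      (F.map (K.d (p + 1) p)).app (L.X 0) ≫ incl F K L p 0 n := by
  rw [incl, ιMapBifunctorOrZero_eq _ _ _ _ _ _ _ h, mapBifunctor.d_eq, Preadditive.comp_add,
    mapBifunctor.ι_D₁, mapBifunctor.ι_D₂, mapBifunctor.d₁_eq' _ _ _ _ (i₁' := p) rfl,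
    mapBifunctor.d₂_eq_zero _ _ _ _ _ _ _ (by simp), add_zero]
  exact one_smul _ _

theorem incl_d_right (q n : ℕ) (h : 0 + (q + 1) = n + 1) :
    incl F K L 0 (q + 1) (n + 1) ≫ (mapBifunctor K L F (.down ℕ)).d (n + 1) n =
      (F.obj (K.X 0)).map (L.d (q + 1) q) ≫ incl F K L 0 q n := by
  rw [incl, ιMapBifunctorOrZero_eq _ _ _ _ _ _ _ h, mapBifunctor.d_eq, Preadditive.comp_add,
    mapBifunctor.ι_D₁, mapBifunctor.ι_D₂, mapBifunctor.d₂_eq' _ _ _ _ _ (i₂' := q) rfl,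
    mapBifunctor.d₁_eq_zero _ _ _ _ _ _ _ (by simp), zero_add]
  exact one_smul _ _

theorem left_term (p' q' p q n : ℕ) (h : p' + q' = n) :
    (F.map (K.d (p' + 1) p')).app (L.X q') ≫ incl F K L p' q' n ≫ proj F K L p q n =
      incl F K L (p' + 1) q' (n + 1) ≫ proj F K L (p + 1) q (n + 1) ≫
        (F.map (K.d (p + 1) p)).app (L.X q) := by
  by_cases e : p' = p ∧ q' = q
  · obtain ⟨rfl, rfl⟩ := e
    rw [incl_proj_self _ _ _ _ _ _ h, ← Category.assoc, incl_proj_self _ _ _ _ _ _ (by omega),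
      Category.id_comp, Category.comp_id]
  · rw [incl_proj_of_ne _ _ _ _ _ _ _ _ e, ← Category.assoc, incl_proj_of_ne, Limits.zero_comp,
      Limits.comp_zero]
    rintro ⟨h1, h2⟩
    exact e ⟨by omega, h2⟩

theorem right_term (p' q' p q n : ℕ) (h : p' + q' = n) :
    ((-1) ^ p' : ℤˣ) • (F.obj (K.X p')).map (L.d (q' + 1) q') ≫ incl F K L p' q' n ≫
      proj F K L p q n = ((-1) ^ p : ℤˣ) •
      incl F K L p' (q' + 1) (n + 1) ≫ proj F K L p (q + 1) (n + 1) ≫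
        (F.obj (K.X p)).map (L.d (q + 1) q) := by
  by_cases e : p' = p ∧ q' = q
  · obtain ⟨rfl, rfl⟩ := e
    rw [incl_proj_self _ _ _ _ _ _ h, ← Category.assoc (incl _ _ _ _ _ _),
      incl_proj_self _ _ _ _ _ _ (by omega), Category.id_comp, Category.comp_id]
  · rw [incl_proj_of_ne _ _ _ _ _ _ _ _ e, ← Category.assoc (incl _ _ _ _ _ _),
      incl_proj_of_ne, Limits.zero_comp, Limits.comp_zero, smul_zero, smul_zero]
    rintro ⟨h1, h2⟩
    exact e ⟨h1, by omega⟩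

/-- An element of the image of the total complex under an additive functor is described by its
components, so the differential is needed followed by the projection to a summand. The formula is
tested on each inclusion; the cases on the edges of the quadrant have only one of the two terms. -/
theorem d_proj (p q n : ℕ) : (mapBifunctor K L F (.down ℕ)).d (n + 1) n ≫ proj F K L p q n =
    proj F K L (p + 1) q (n + 1) ≫ (F.map (K.d (p + 1) p)).app (L.X q) +
      ((-1) ^ p : ℤˣ) • proj F K L p (q + 1) (n + 1) ≫ (F.obj (K.X p)).map (L.d (q + 1) q) := by
  refine hom_ext fun p' q' h => ?_
  rw [← Category.assoc, Preadditive.comp_add, Linear.comp_units_smul]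
  match p', q', h with
  | 0, q' + 1, h =>
    rw [incl_d_right _ _ _ _ _ h, Category.assoc]
    have h1 := right_term F K L 0 q' p q n (by omega)
    rw [pow_zero, one_smul] at h1
    rw [h1, ← Category.assoc (incl _ _ _ _ _ _) _ ((F.map _).app _), incl_proj_of_ne,
      Limits.zero_comp, zero_add]
    omega
  | p' + 1, 0, h =>
    rw [incl_d_left _ _ _ _ _ h, Category.assoc, left_term F K L p' 0 p q n (by omega),
      ← Category.assoc (incl _ _ _ _ _ _) (proj _ _ _ p (q + 1) _), incl_proj_of_ne,
      Limits.zero_comp, smul_zero, add_zero]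
    omega
  | p' + 1, q' + 1, h =>
    rw [incl_d_succ _ _ _ _ _ _ h, Preadditive.add_comp, Linear.units_smul_comp, Category.assoc,
      Category.assoc, left_term F K L p' (q' + 1) p q n (by omega),
      right_term F K L (p' + 1) q' p q n (by omega)]

/-- The double complex of abelian groups. -/
def bicomplex : Bicomplex where
  Z p q := G.obj ((F.obj (K.X p)).obj (L.X q))
  h p q := (G.map ((F.map (K.d (p + 1) p)).app (L.X q))).hom
  v p q := (G.map ((F.obj (K.X p)).map (L.d (q + 1) q))).hom
  hh p q x := by
    rw [← AddCommGrpCat.comp_apply, ← G.map_comp, ← NatTrans.comp_app, ← F.map_comp, K.d_comp_d,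
      Functor.map_zero, NatTrans.app_zero, Functor.map_zero]
    rfl
  vv p q x := by
    rw [← AddCommGrpCat.comp_apply, ← G.map_comp, ← Functor.map_comp, L.d_comp_d,
      Functor.map_zero, Functor.map_zero]
    rfl
  hv p q x := by
    rw [← AddCommGrpCat.comp_apply, ← AddCommGrpCat.comp_apply, ← G.map_comp, ← G.map_comp,
      NatTrans.naturality]

/-- The components of an element of the total complex. -/
def i (n : ℕ) : G.obj ((mapBifunctor K L F (.down ℕ)).X n) →+ (bicomplex F G K L).E :=
  AddMonoidHom.mk' (fun x pq => (G.map (proj F K L pq.1 pq.2 n)).hom x)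
    fun _ _ => funext fun _ => map_add _ _ _

/-- The element of the total complex with given components. -/
def j (n : ℕ) : (bicomplex F G K L).E →+ G.obj ((mapBifunctor K L F (.down ℕ)).X n) :=
  AddMonoidHom.mk' (fun x => ∑ pq ∈ Finset.HasAntidiagonal.antidiagonal n,
      (G.map (incl F K L pq.1 pq.2 n)).hom (x pq))
    fun x y => by
      rw [← Finset.sum_add_distrib]
      exact Finset.sum_congr rfl fun _ _ => map_add _ _ _

theorem ji (n : ℕ) (x : G.obj ((mapBifunctor K L F (.down ℕ)).X n)) :
    j F G K L n (i F G K L n x) = x := by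
  have h : (∑ pq ∈ Finset.HasAntidiagonal.antidiagonal n,
      G.map (proj F K L pq.1 pq.2 n ≫ incl F K L pq.1 pq.2 n)) = 𝟙 _ := by
    rw [← Functor.map_sum, sum_proj_incl, G.map_id]
  have h2 := congrArg (fun f => AddCommGrpCat.homAddEquiv f x) h
  rw [map_sum (AddCommGrpCat.homAddEquiv (M := G.obj ((mapBifunctor K L F (.down ℕ)).X n))
    (N := G.obj ((mapBifunctor K L F (.down ℕ)).X n)))] at h2
  replace h2 := (AddMonoidHom.finsetSum_apply (M := G.obj ((mapBifunctor K L F (.down ℕ)).X n))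
    (N := G.obj ((mapBifunctor K L F (.down ℕ)).X n)) _ _ x).symm.trans h2
  refine Eq.trans ?_ h2
  change (∑ pq ∈ Finset.HasAntidiagonal.antidiagonal n, (G.map (incl F K L pq.1 pq.2 n)).hom
    ((G.map (proj F K L pq.1 pq.2 n)).hom x)) = _
  refine Finset.sum_congr rfl fun pq _ => ?_
  rw [G.map_comp]
  rfl

theorem ij (n : ℕ) (x : (bicomplex F G K L).E) (p q : ℕ) :
    i F G K L n (j F G K L n x) (p, q) = if p + q = n then x (p, q) else 0 := by
  have h0 (r : ℕ × ℕ) (y : G.obj ((F.obj (K.X r.1)).obj (L.X r.2))) (hr : r ≠ (p, q)) :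
      (G.map (proj F K L p q n)).hom ((G.map (incl F K L r.1 r.2 n)).hom y) = 0 := by
    rw [← AddCommGrpCat.comp_apply, ← G.map_comp, incl_proj_of_ne, G.map_zero]
    · rfl
    · exact fun e => hr (Prod.ext e.1 e.2)
  refine (map_sum (G.map (proj F K L p q n)).hom (fun pq : ℕ × ℕ =>
    (G.map (incl F K L pq.1 pq.2 n)).hom (x pq))
    (Finset.HasAntidiagonal.antidiagonal n)).trans ?_
  split_ifs with h
  · refine (Finset.sum_eq_single (p, q) (fun r _ hr => h0 r _ hr)
      fun hn => absurd (Finset.HasAntidiagonal.mem_antidiagonal.2 h) hn).trans ?_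
    refine (congrArg (fun f => f.hom (x (p, q))) (G.map_comp (incl F K L p q n)
      (proj F K L p q n))).symm.trans ?_
    rw [incl_proj_self _ _ _ _ _ _ h, G.map_id]
    rfl
  · refine Finset.sum_eq_zero fun r hr => h0 r _ ?_
    rintro rfl
    exact h (Finset.HasAntidiagonal.mem_antidiagonal.1 hr)

theorem iD (n : ℕ) (x : G.obj ((mapBifunctor K L F (.down ℕ)).X (n + 1))) (p q : ℕ) :
    i F G K L n ((G.map ((mapBifunctor K L F (.down ℕ)).d (n + 1) n)).hom x) (p, q) =
      (bicomplex F G K L).h p q (i F G K L (n + 1) x (p + 1, q)) +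
        ((-1) ^ p : ℤˣ) • (bicomplex F G K L).v p q (i F G K L (n + 1) x (p, q + 1)) := by
  have h := congrArg (fun f => (G.map f).hom x) (d_proj F K L p q n)
  refine Eq.trans ?_ (h.trans ?_)
  · exact (congrArg (fun f => f.hom x) (G.map_comp ((mapBifunctor K L F (.down ℕ)).d (n + 1) n)
      (proj F K L p q n))).symm
  · have e (u : ℤˣ) (f : (mapBifunctor K L F (.down ℕ)).X (n + 1) ⟶
        (F.obj (K.X p)).obj (L.X q)) : (G.map (u • f)).hom x = u • (G.map f).hom x :=
      (congrArg (fun f => f.hom x) (G.map_zsmul (f := f) (r := (u : ℤ)))).trans rfl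
    refine (congrArg (fun f => f.hom x) (G.map_add (f := proj F K L (p + 1) q (n + 1) ≫
      (F.map (K.d (p + 1) p)).app (L.X q)) (g := ((-1) ^ p : ℤˣ) • proj F K L p (q + 1) (n + 1) ≫
        (F.obj (K.X p)).map (L.d (q + 1) q)))).trans ?_
    refine congrArg₂ (· + ·) ?_ ((e _ _).trans (congrArg _ ?_))
    · rw [G.map_comp]; rfl
    · rw [G.map_comp]; rfl

/-- The image of the total complex under an additive functor, as the total complex of a double
complex of abelian groups. -/
def total : (bicomplex F G K L).Total
    ((G.mapHomologicalComplex _).obj (mapBifunctor K L F (.down ℕ))) where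
  i := i F G K L
  j := j F G K L
  ji := ji F G K L
  ij := ij F G K L
  iD := iD F G K L

/-- The row of the double complex given by the degree zero part of the second complex. -/
def row : Bicomplex.Row (((F.flip.obj (L.X 0) ⋙ G).mapHomologicalComplex _).obj K)
    (bicomplex F G K L) where
  e _ := AddEquiv.refl _
  eD _ _ := rfl

end TotalComplex

/-- A homotopy contracting a complex of abelian groups, elementwise. -/
theorem homotopy_apply_zero {A : ChainComplex AddCommGrpCat.{0} ℕ} (h : Homotopy (𝟙 A) 0)
    (x : A.X 0) : (A.d 1 0).hom ((h.hom 0 1).hom x) = x := by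
  have := h.comm 0
  rw [Homotopy.dNext_zero_chainComplex, prevD_eq _ (show (ComplexShape.down ℕ).Rel 1 0 from rfl),
    zero_add] at this
  have := congrArg (fun f => f.hom x) this
  refine Eq.trans ?_ this.symm
  exact (add_zero _).symm

theorem homotopy_apply_succ {A : ChainComplex AddCommGrpCat.{0} ℕ} (h : Homotopy (𝟙 A) 0)
    (n : ℕ) (x : A.X (n + 1)) : (A.d (n + 1 + 1) (n + 1)).hom ((h.hom (n + 1) (n + 1 + 1)).hom x) +
      (h.hom n (n + 1)).hom ((A.d (n + 1) n).hom x) = x := by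
  have := h.comm (n + 1)
  rw [dNext_eq _ (show (ComplexShape.down ℕ).Rel (n + 1) n from rfl),
    prevD_eq _ (show (ComplexShape.down ℕ).Rel (n + 1 + 1) (n + 1) from rfl)] at this
  have := congrArg (fun f => f.hom x) this
  refine Eq.trans ?_ this.symm
  exact (add_comm _ _).trans (add_zero _).symm

/-- If the contributions of the objects of `L` in nonzero degrees are contractible, only the object
in degree zero contributes to the total complex. -/
theorem mapBifunctor_equiv
    (h : ∀ q, q ≠ 0 → Nonempty (Homotopy
      (𝟙 (((F.flip.obj (L.X q) ⋙ G).mapHomologicalComplex (.down ℕ)).obj K)) 0)) :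
    Nonempty (HomotopyEquiv
      ((G.mapHomologicalComplex (.down ℕ)).obj (mapBifunctor K L F (.down ℕ)))
      (((F.flip.obj (L.X 0) ⋙ G).mapHomologicalComplex (.down ℕ)).obj K)) := by
  let s (p q : ℕ) : (TotalComplex.bicomplex F G K L).Z p q →+
      (TotalComplex.bicomplex F G K L).Z (p + 1) q :=
    if hq : q ≠ 0 then ((h q hq).some.hom p (p + 1)).hom else 0
  have hs (p q : ℕ) : s p (q + 1) = ((h (q + 1) q.succ_ne_zero).some.hom p (p + 1)).hom :=
    dif_pos q.succ_ne_zero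
  refine (TotalComplex.total F G K L).equiv (TotalComplex.row F G K L) s ?_ ?_
  · intro q y
    rw [hs]
    exact homotopy_apply_zero (h (q + 1) q.succ_ne_zero).some y
  · intro p q y
    rw [hs, hs]
    exact homotopy_apply_succ (h (q + 1) q.succ_ne_zero).some p y

theorem contractible_of_equiv {A A' : ChainComplex AddCommGrpCat.{0} ℕ} (e : HomotopyEquiv A A')
    (h : Nonempty (Homotopy (𝟙 A') 0)) : Nonempty (Homotopy (𝟙 A) 0) := by
  obtain ⟨h⟩ := h
  exact ⟨e.homotopyHomInvId.symm.trans (((Homotopy.ofEq (by rw [Category.id_comp])).trans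
    (((h.compRight e.inv).compLeft e.hom))).trans (Homotopy.ofEq (by simp)))⟩

/-- If the contributions of all objects of `L` are contractible, so is the total complex. -/
theorem mapBifunctor_contractible
    (h : ∀ q, Nonempty (Homotopy
      (𝟙 (((F.flip.obj (L.X q) ⋙ G).mapHomologicalComplex (.down ℕ)).obj K)) 0)) :
    Nonempty (Homotopy
      (𝟙 ((G.mapHomologicalComplex (.down ℕ)).obj (mapBifunctor K L F (.down ℕ)))) 0) :=
  contractible_of_equiv (mapBifunctor_equiv F G K L fun q _ => h q).some (h 0)

/-- The Koszul sign makes the exchange of the two factors an isomorphism of total complexes.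
Statements about the summands of the first complex then follow from those about the second. -/
instance : TotalComplexShapeSymmetry (.down ℕ) (.down ℕ) (.down ℕ) where
  symm p q := add_comm q p
  σ p q := (-1) ^ (p * q)
  σ_ε₁ := by
    rintro _ p rfl q
    change (-1 : ℤˣ) ^ ((p + 1) * q) * 1 = (-1) ^ q * (-1) ^ (p * q)
    rw [mul_one, add_mul, one_mul, pow_add, mul_comm]
  σ_ε₂ := by
    rintro p _ q rfl
    change (-1 : ℤˣ) ^ (p * (q + 1)) * (-1) ^ p = 1 * (-1) ^ (p * q)
    rw [mul_add, mul_one, pow_add, mul_assoc, Int.units_mul_self, one_mul, mul_one]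

instance : F.flip.Additive where
  map_add := by
    intros
    ext X
    exact (F.obj X).map_add

instance (Y : D) : (F.flip.obj Y).Additive where
  map_add := by
    intro X X' f g
    exact congrArg (fun h => h.app Y) (F.map_add (f := f) (g := g))

/-- If the contributions of all objects of `K` are contractible, so is the total complex. -/
theorem mapBifunctor_contractible'
    (h : ∀ p, Nonempty (Homotopy
      (𝟙 (((F.obj (K.X p) ⋙ G).mapHomologicalComplex (.down ℕ)).obj L)) 0)) :
    Nonempty (Homotopy
      (𝟙 ((G.mapHomologicalComplex (.down ℕ)).obj (mapBifunctor K L F (.down ℕ)))) 0) :=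
  contractible_of_equiv (HomotopyEquiv.ofIso ((G.mapHomologicalComplex (.down ℕ)).mapIso
    (mapBifunctorFlipIso K L F (.down ℕ)).symm)) (mapBifunctor_contractible F.flip G L K h)

end MapBifunctor

end SpinNet
end

noncomputable section
namespace SpinNet

/-! ### Functors on the additive closure and complexes -/

section Contractible

open Limits

theorem contractible_of_iso {V ι : Type*} [Category* V] [Preadditive V] {c : ComplexShape ι}
    {A A' : HomologicalComplex V c} (e : A ≅ A') (h : Nonempty (Homotopy (𝟙 A') 0)) :
    Nonempty (Homotopy (𝟙 A) 0) := by
  obtain ⟨h⟩ := h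
  exact ⟨((Homotopy.ofEq (by simp)).trans ((h.compRight e.inv).compLeft e.hom)).trans
    (Homotopy.ofEq (by simp))⟩

/-- A complex is contractible if its identity is a sum of maps that factor through contractible
complexes. -/
theorem contractible_of_sum {V ι J : Type*} [Category* V] [Preadditive V] {c : ComplexShape ι}
    [Fintype J] {A : HomologicalComplex V c} (B : J → HomologicalComplex V c)
    (hB : ∀ j, Nonempty (Homotopy (𝟙 (B j)) 0)) (f : ∀ j, A ⟶ B j) (g : ∀ j, B j ⟶ A)
    (h : ∑ j, f j ≫ g j = 𝟙 A) : Nonempty (Homotopy (𝟙 A) 0) := by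
  have h1 (j : J) : Homotopy (f j ≫ g j) 0 :=
    ((Homotopy.ofEq (by simp)).trans (((hB j).some.compRight (g j)).compLeft (f j))).trans
      (Homotopy.ofEq (by simp))
  have h2 (s : Finset J) : Nonempty (Homotopy (∑ j ∈ s, f j ≫ g j) 0) := by
    classical
    induction s using Finset.induction_on with
    | empty => exact ⟨Homotopy.ofEq (by simp)⟩
    | insert j s hj ih =>
      rw [Finset.sum_insert hj]
      exact ⟨((h1 j).add ih.some).trans (Homotopy.ofEq (add_zero _))⟩
  rw [← h]
  exact h2 _

theorem contractible_map {V W ι : Type*} [Category* V] [Preadditive V] [Category* W]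
    [Preadditive W] {c : ComplexShape ι} {A : HomologicalComplex V c} (F : V ⥤ W) [F.Additive]
    (h : Nonempty (Homotopy (𝟙 A) 0)) :
    Nonempty (Homotopy (𝟙 ((F.mapHomologicalComplex c).obj A)) 0) := by
  obtain ⟨h⟩ := h
  exact ⟨((Homotopy.ofEq (by simp)).trans (F.mapHomotopy h)).trans (Homotopy.ofEq (by simp))⟩

end Contractible

section Extend

open Limits HomologicalComplex

variable {V W ι ι' : Type*} [Category* V] [Preadditive V] [Category* W] [Preadditive W]
  [HasZeroObject V] [HasZeroObject W] {c : ComplexShape ι} {c' : ComplexShape ι'}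

/-- An additive functor applied to the components of an extended complex. -/
def mapExtendXIso (F : V ⥤ W) [F.Additive] (A : HomologicalComplex V c) :
    ∀ i : Option ι, F.obj (extend.X A i) ≅ extend.X ((F.mapHomologicalComplex c).obj A) i
  | some _ => Iso.refl _
  | none => IsZero.iso (F.map_isZero (isZero_zero V)) (isZero_zero W)

/-- Additive functors commute with the extension of complexes. -/
def mapExtendIso (F : V ⥤ W) [F.Additive] (A : HomologicalComplex V c) (e : c.Embedding c') :
    (F.mapHomologicalComplex c').obj (A.extend e) ≅
      ((F.mapHomologicalComplex c).obj A).extend e :=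
  Hom.isoOfComponents (fun i => mapExtendXIso F A (e.r i)) fun i j _ => by
    change (mapExtendXIso F A (e.r i)).hom ≫ extend.d _ (e.r i) (e.r j) =
      F.map (extend.d A (e.r i) (e.r j)) ≫ (mapExtendXIso F A (e.r j)).hom
    -- The partial inverse of the embedding is either undefined, and then both objects are zero, or
    -- given by an index, and then both differentials are literally equal.
    generalize e.r i = x
    generalize e.r j = y
    match x, y with
    | none, _ => exact IsZero.eq_of_src (F.map_isZero (isZero_zero V)) _ _
    | some _, none => exact IsZero.eq_of_tgt (isZero_zero W) _ _
    | some i, some j => exact (Category.id_comp _).trans (Category.comp_id _).symm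

theorem contractible_extend {A : HomologicalComplex V c} (e : c.Embedding c') [e.IsRelIff]
    (h : Nonempty (Homotopy (𝟙 A) 0)) : Nonempty (Homotopy (𝟙 (A.extend e)) 0) := by
  obtain ⟨h⟩ := h
  exact ⟨((Homotopy.ofEq (by simp)).trans (h.extend e)).trans (Homotopy.ofEq (by simp))⟩

/-- Extension preserves homotopy equivalences. -/
def extendHomotopyEquiv {A A' : HomologicalComplex V c} (h : HomotopyEquiv A A')
    (e : c.Embedding c') [e.IsRelIff] : HomotopyEquiv (A.extend e) (A'.extend e) where
  hom := extendMap h.hom e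
  inv := extendMap h.inv e
  homotopyHomInvId := ((Homotopy.ofEq (extendMap_comp _ _ e).symm).trans
    (h.homotopyHomInvId.extend e)).trans (Homotopy.ofEq (extendMap_id _ e))
  homotopyInvHomId := ((Homotopy.ofEq (extendMap_comp _ _ e).symm).trans
    (h.homotopyInvHomId.extend e)).trans (Homotopy.ofEq (extendMap_id _ e))

end Extend

section Mat

open Limits

variable {C D E : Type} [Category.{0} C] [Category.{0} D] [Category.{0} E] [Preadditive C]
  [Preadditive D] [Preadditive E]

/-- The projection to a summand. -/
def matProj (M : Mat_ C) (j : M.ι) : M ⟶ (Mat_.embedding C).obj (M.X j) :=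
  fun i _ => (𝟙 M : M ⟶ M) i j

/-- The inclusion of a summand. -/
def matIncl (M : Mat_ C) (j : M.ι) : (Mat_.embedding C).obj (M.X j) ⟶ M :=
  fun _ i => (𝟙 M : M ⟶ M) j i

theorem sum_matProj_matIncl (M : Mat_ C) : ∑ j, matProj M j ≫ matIncl M j = 𝟙 M := by
  refine Eq.trans ?_ (Category.id_comp (𝟙 M))
  refine Mat_.hom_ext _ _ fun i k => ?_
  have h (s : Finset M.ι) : (∑ j ∈ s, matProj M j ≫ matIncl M j) i k =
      ∑ j ∈ s, (matProj M j ≫ matIncl M j) i k := by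
    classical
    induction s using Finset.induction_on with
    | empty => rfl
    | insert a s ha ih => rw [Finset.sum_insert ha, Finset.sum_insert ha, Mat_.add_apply, ih]
  rw [h, Mat_.comp_apply]
  refine Finset.sum_congr rfl fun j _ => ?_
  change (∑ _ : PUnit, (𝟙 M : M ⟶ M) i j ≫ (𝟙 M : M ⟶ M) j k) = _
  exact Fintype.sum_unique _

theorem matIncl_comp {M N : Mat_ C} (f : M ⟶ N) (i : M.ι) (k : N.ι) :
    matIncl M i ≫ f ≫ matProj N k = (Mat_.embedding C).map (f i k) := by
  refine Mat_.hom_ext _ _ fun _ _ => ?_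
  change (∑ j, (𝟙 M : M ⟶ M) i j ≫ (f ≫ matProj N k) j PUnit.unit) = f i k
  refine Eq.trans ?_ (congrFun (congrFun (Category.id_comp f) i) k)
  refine Finset.sum_congr rfl fun j _ => congrArg _ ?_
  exact congrFun (congrFun (Category.comp_id f) j) k

variable (G : C ⥤ AddCommGrpCat.{0}) [G.Additive]

/-- The value of `matLift` on morphisms. -/
def matLiftMap {M N : Mat_ C} (f : M ⟶ N) :
    (∀ i, G.obj (M.X i)) →+ ∀ k, G.obj (N.X k) :=
  AddMonoidHom.mk' (fun x k => ∑ i, (G.map (f i k)).hom (x i)) fun x y => funext fun k => by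
    rw [Pi.add_apply, ← Finset.sum_add_distrib]
    exact Finset.sum_congr rfl fun i _ => map_add _ _ _

theorem map_finset_sum_apply {V : Type*} [Category.{0} V] [Preadditive V]
    (G : V ⥤ AddCommGrpCat.{0}) [G.Additive] {X Y : V} {J : Type} (s : Finset J) (f : J → (X ⟶ Y))
    (x : G.obj X) : (G.map (∑ j ∈ s, f j)).hom x = ∑ j ∈ s, (G.map (f j)).hom x := by
  classical
  induction s using Finset.induction_on with
  | empty => rw [Finset.sum_empty, Finset.sum_empty, G.map_zero]; rfl
  | insert j s hj ih =>
    rw [Finset.sum_insert hj, Finset.sum_insert hj, G.map_add, ← ih]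
    rfl

/-- The extension of an additive functor to finite formal direct sums. -/
def matLift : Mat_ C ⥤ AddCommGrpCat.{0} where
  obj M := .of (∀ i, G.obj (M.X i))
  map f := AddCommGrpCat.ofHom (matLiftMap G f)
  map_id M := by
    classical
    refine AddCommGrpCat.hom_ext (AddMonoidHom.ext fun x => funext fun k => ?_)
    change ∑ i, (G.map ((𝟙 M : M ⟶ M) i k)).hom (x i) = x k
    rw [Finset.sum_eq_single k]
    · rw [Mat_.id_apply_self, G.map_id]; rfl
    · intro i _ hi
      rw [Mat_.id_apply_of_ne _ _ _ hi, G.map_zero]; rfl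
    · intro h
      exact absurd (Finset.mem_univ k) h
  map_comp {M N L} f g := by
    refine AddCommGrpCat.hom_ext (AddMonoidHom.ext fun x => funext fun k => ?_)
    change ∑ i, (G.map (∑ j, f i j ≫ g j k)).hom (x i) =
      ∑ j, (G.map (g j k)).hom (∑ i, (G.map (f i j)).hom (x i))
    simp only [map_finset_sum_apply, map_sum, G.map_comp]
    rw [Finset.sum_comm]
    rfl

instance : (matLift G).Additive where
  map_add {M N f g} := by
    refine AddCommGrpCat.hom_ext (AddMonoidHom.ext fun x => funext fun k => ?_)
    change ∑ i, (G.map (f i k + g i k)).hom (x i) =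
      ∑ i, (G.map (f i k)).hom (x i) + ∑ i, (G.map (g i k)).hom (x i)
    rw [← Finset.sum_add_distrib]
    exact Finset.sum_congr rfl fun i _ => by rw [G.map_add]; rfl

/-- The extension restricts to the given functor. -/
def embeddingMatLift : Mat_.embedding C ⋙ matLift G ≅ G :=
  NatIso.ofComponents (fun X => AddEquiv.toAddCommGrpIso
    (AddEquiv.mk' (Equiv.funUnique PUnit (G.obj X)) fun _ _ => rfl)) fun {X Y} f => by
      refine AddCommGrpCat.hom_ext (AddMonoidHom.ext fun x => ?_)
      change (∑ _ : PUnit, (G.map f).hom (x _)) = (G.map f).hom (x PUnit.unit)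
      exact Fintype.sum_unique _

variable {G}

/-- The extension of a natural transformation. -/
def matLiftHom {G' : C ⥤ AddCommGrpCat.{0}} [G'.Additive] (α : G ⟶ G') :
    matLift G ⟶ matLift G' where
  app M := AddCommGrpCat.ofHom (AddMonoidHom.mk' (fun x i => (α.app (M.X i)).hom (x i))
    fun x y => funext fun i => map_add _ _ _)
  naturality M N f := by
    refine AddCommGrpCat.hom_ext (AddMonoidHom.ext fun x => funext fun k => ?_)
    change (α.app (N.X k)).hom (∑ i, (G.map (f i k)).hom (x i)) =
      ∑ i, (G'.map (f i k)).hom ((α.app (M.X i)).hom (x i))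
    rw [map_sum]
    exact Finset.sum_congr rfl fun i _ => congrArg (fun g => g.hom (x i)) (α.naturality (f i k))

/-- An additive functor on finite formal direct sums is determined by its restriction. -/
def matLiftUnique (H : Mat_ C ⥤ AddCommGrpCat.{0}) [H.Additive]
    (α : Mat_.embedding C ⋙ H ≅ G) : H ≅ matLift G :=
  NatIso.ofComponents (fun M => AddEquiv.toAddCommGrpIso
    { toFun := fun x i => (α.hom.app (M.X i)).hom ((H.map (matProj M i)).hom x)
      invFun := fun y => ∑ i, (H.map (matIncl M i)).hom ((α.inv.app (M.X i)).hom (y i))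
      map_add' := fun x y => funext fun i => by rw [map_add, map_add]; rfl
      left_inv := fun x => by
        have h (i : M.ι) : (α.inv.app (M.X i)).hom ((α.hom.app (M.X i)).hom
            ((H.map (matProj M i)).hom x)) = (H.map (matProj M i)).hom x :=
          congrArg (fun g => g.hom ((H.map (matProj M i)).hom x)) (α.hom_inv_id_app (M.X i))
        simp only [h]
        refine Eq.trans (Finset.sum_congr rfl fun i _ => ?_)
          ((map_finset_sum_apply H Finset.univ (fun i => matProj M i ≫ matIncl M i) x).symm.trans ?_)
        · rw [H.map_comp]; rfl
        · rw [sum_matProj_matIncl, H.map_id]; rfl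
      right_inv := fun y => funext fun k => by
        classical
        change (α.hom.app (M.X k)).hom ((H.map (matProj M k)).hom
          (∑ i, (H.map (matIncl M i)).hom ((α.inv.app (M.X i)).hom (y i)))) = y k
        rw [map_sum, map_sum]
        have h (i : M.ι) : (H.map (matProj M k)).hom ((H.map (matIncl M i)).hom
            ((α.inv.app (M.X i)).hom (y i))) =
            (H.map ((Mat_.embedding C).map ((𝟙 M : M ⟶ M) i k))).hom
              ((α.inv.app (M.X i)).hom (y i)) := by
          rw [← matIncl_comp, Category.id_comp, H.map_comp]; rfl
        simp only [h]
        rw [Finset.sum_eq_single k]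
        · rw [Mat_.id_apply_self, CategoryTheory.Functor.map_id, CategoryTheory.Functor.map_id]
          exact congrArg (fun g => g.hom (y k)) (α.inv_hom_id_app (M.X k))
        · intro i _ hi
          rw [Mat_.id_apply_of_ne _ _ _ hi, Functor.map_zero, Functor.map_zero]
          exact map_zero _
        · intro h
          exact absurd (Finset.mem_univ k) h })
    fun {M N} f => by
      refine AddCommGrpCat.hom_ext (AddMonoidHom.ext fun x => funext fun k => ?_)
      change (α.hom.app (N.X k)).hom ((H.map (matProj N k)).hom ((H.map f).hom x)) =
        ∑ i, (G.map (f i k)).hom ((α.hom.app (M.X i)).hom ((H.map (matProj M i)).hom x))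
      have e : f ≫ matProj N k = ∑ i, matProj M i ≫ matIncl M i ≫ f ≫ matProj N k := by
        refine (Category.id_comp _).symm.trans ?_
        rw [← sum_matProj_matIncl, Preadditive.sum_comp]
        exact Finset.sum_congr rfl fun i _ => Category.assoc _ _ _
      have e2 : (H.map (matProj N k)).hom ((H.map f).hom x) = ∑ i,
          (H.map ((Mat_.embedding C).map (f i k))).hom ((H.map (matProj M i)).hom x) := by
        refine (congrArg (fun g => g.hom x) (H.map_comp f (matProj N k))).symm.trans ?_
        rw [e]
        refine (map_finset_sum_apply H _ _ x).trans (Finset.sum_congr rfl fun i _ => ?_)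
        refine (congrArg (fun g => (H.map (matProj M i ≫ g)).hom x) (matIncl_comp f i k)).trans ?_
        rw [H.map_comp]; rfl
      rw [e2, map_sum]
      refine Finset.sum_congr rfl fun i _ => ?_
      exact congrArg (fun g => g.hom ((H.map (matProj M i)).hom x)) (α.hom.naturality (f i k))

variable (G)

/-- The complex of abelian groups obtained by applying an additive functor. -/
abbrev ev (K : ChainComplex (Mat_ C) ℕ) : ChainComplex AddCommGrpCat.{0} ℕ :=
  ((matLift G).mapHomologicalComplex (.down ℕ)).obj K

/-- An additive functor takes a complex to a contractible one. -/
def Kills (K : ChainComplex (Mat_ C) ℕ) : Prop :=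
  Nonempty (Homotopy (𝟙 (ev G K)) 0)

/-- The value of an additive functor on a complex only depends on its restriction. -/
def evIso (H : Mat_ C ⥤ AddCommGrpCat.{0}) [H.Additive]
    (α : Mat_.embedding C ⋙ H ≅ G) (K : ChainComplex (Mat_ C) ℕ) :
    (H.mapHomologicalComplex (.down ℕ)).obj K ≅ ev G K :=
  (NatIso.mapHomologicalComplex (matLiftUnique H α) _).app K

variable {G}

/-- Isomorphic functors have isomorphic values. -/
def evCongr {G' : C ⥤ AddCommGrpCat.{0}} [G'.Additive] (α : G ≅ G')
    (K : ChainComplex (Mat_ C) ℕ) : ev G K ≅ ev G' K :=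
  evIso _ _ (embeddingMatLift G ≪≫ α) K

/-- Evaluation after applying a functor. -/
def evMap (H : Mat_ C ⥤ Mat_ D) [H.Additive] (F : C ⥤ D) [F.Additive]
    (α : Mat_.embedding C ⋙ H ≅ F ⋙ Mat_.embedding D) (G : D ⥤ AddCommGrpCat.{0}) [G.Additive]
    (K : ChainComplex (Mat_ C) ℕ) :
    ev G ((H.mapHomologicalComplex (.down ℕ)).obj K) ≅ ev (F ⋙ G) K :=
  evIso (F ⋙ G) (H ⋙ matLift G) ((Functor.associator _ _ _).symm ≪≫
    Functor.isoWhiskerRight α _ ≪≫ Functor.associator _ _ _ ≪≫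
      Functor.isoWhiskerLeft F (embeddingMatLift G)) K

/-- This is the gain from testing contractibility through functors to abelian groups: an additive
functor on formal direct sums is determined by its restriction to single objects. Different orders
of gluing are thus compared by a natural isomorphism of functors on diagrams, and no isomorphism of
complexes over the additive closure has to be built. -/
theorem Kills.congr {G' : C ⥤ AddCommGrpCat.{0}} [G'.Additive]
    {K : ChainComplex (Mat_ C) ℕ} (h : Kills G' K) (α : G ≅ G') : Kills G K :=
  contractible_of_iso (evCongr α K) h

theorem Kills.of_contractible (G : C ⥤ AddCommGrpCat.{0}) [G.Additive]
    {K : ChainComplex (Mat_ C) ℕ} (h : Nonempty (Homotopy (𝟙 K) 0)) : Kills G K :=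
  contractible_map _ h

theorem Kills.of_retract {G' : C ⥤ AddCommGrpCat.{0}} [G'.Additive]
    {K : ChainComplex (Mat_ C) ℕ} (h : Kills G' K) (α : G ⟶ G') (β : G' ⟶ G) (e : α ≫ β = 𝟙 G) :
    Kills G K := by
  refine contractible_of_sum (J := Unit) (fun _ => ev G' K) (fun _ => h)
    (fun _ => (NatTrans.mapHomologicalComplex (matLiftHom α) _).app K)
    (fun _ => (NatTrans.mapHomologicalComplex (matLiftHom β) _).app K) ?_
  refine (Fintype.sum_unique _).trans ?_
  refine HomologicalComplex.hom_ext _ _ fun n => ?_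
  refine AddCommGrpCat.hom_ext (AddMonoidHom.ext fun x => funext fun i => ?_)
  exact congrArg (fun γ : G ⟶ G => (γ.app ((K.X n).X i)).hom (x i)) e

end Mat

end SpinNet
end

/-! ### Bifunctors and Hom complexes over additive closures -/

noncomputable section
namespace SpinNet

section Bifunctor

open Limits

variable {C D E : Type} [Category.{0} C] [Category.{0} D] [Category.{0} E] [Preadditive C]
  [Preadditive D] [Preadditive E]

-- A bifunctor applied to two single objects gives a formal sum indexed by this product; matrix
-- products over it collapse to one term.
local instance uniqueProdPUnit : Unique (PUnit.{1} × PUnit.{1}) :=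
  ⟨⟨(PUnit.unit, PUnit.unit)⟩, fun _ => rfl⟩

theorem contractible_of_summands {V ι : Type*} [Category* V] [Preadditive V] {c : ComplexShape ι}
    (H : Mat_ D ⥤ HomologicalComplex V c) [H.Additive] (M : Mat_ D)
    (h : ∀ j, Nonempty (Homotopy (𝟙 (H.obj ((Mat_.embedding D).obj (M.X j)))) 0)) :
    Nonempty (Homotopy (𝟙 (H.obj M)) 0) := by
  refine contractible_of_sum _ h (fun j => H.map (matProj M j)) (fun j => H.map (matIncl M j)) ?_
  simp only [← H.map_comp, ← H.map_sum, sum_matProj_matIncl, H.map_id]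

theorem contractible_of_summands_op {V ι : Type*} [Category* V] [Preadditive V]
    {c : ComplexShape ι} (H : (Mat_ D)ᵒᵖ ⥤ HomologicalComplex V c) [H.Additive] (M : Mat_ D)
    (h : ∀ j, Nonempty (Homotopy (𝟙 (H.obj (.op ((Mat_.embedding D).obj (M.X j))))) 0)) :
    Nonempty (Homotopy (𝟙 (H.obj (.op M))) 0) := by
  refine contractible_of_sum _ h (fun j => H.map (matIncl M j).op)
    (fun j => H.map (matProj M j).op) ?_
  simp only [← H.map_comp, ← op_comp, ← H.map_sum, ← op_sum, sum_matProj_matIncl]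
  exact H.map_id _

namespace Biadditive

variable {F : C × D ⥤ E} (hF : Biadditive F)

/-- The functor with the second variable fixed. -/
def fixRight (_ : Biadditive F) (z : D) : C ⥤ E where
  obj c := F.obj (c, z)
  map {c c'} f := F.map (X := (c, z)) (Y := (c', z)) (f, 𝟙 z)
  map_id c := F.map_id (c, z)
  map_comp {a b c} f g := by
    rw [← F.map_comp]
    exact congrArg (fun h => F.map (X := (a, z)) (Y := (c, z)) (f ≫ g, h))
      (Category.id_comp (𝟙 z)).symm

/-- The functor with the first variable fixed. -/
def fixLeft (_ : Biadditive F) (z : C) : D ⥤ E where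
  obj c := F.obj (z, c)
  map {c c'} f := F.map (X := (z, c)) (Y := (z, c')) (𝟙 z, f)
  map_id c := F.map_id (z, c)
  map_comp {a b c} f g := by
    rw [← F.map_comp]
    exact congrArg (fun h => F.map (X := (z, a)) (Y := (z, c)) (h, f ≫ g))
      (Category.id_comp (𝟙 z)).symm

instance (z : D) : (hF.fixRight z).Additive where
  map_add := hF.left _ _ _

instance (z : C) : (hF.fixLeft z).Additive where
  map_add := hF.right _ _ _

/-- The induced functor on formal direct sums, with the second variable fixed. -/
def matFixRight (z : D) : Mat_.embedding C ⋙ hF.matCurried.flip.obj ((Mat_.embedding D).obj z) ≅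
    hF.fixRight z ⋙ Mat_.embedding E :=
  NatIso.ofComponents (fun c =>
    { hom := fun _ _ => 𝟙 (F.obj (c, z))
      inv := fun _ _ => 𝟙 (F.obj (c, z))
      hom_inv_id := Mat_.hom_ext _ _ fun i j => by
        obtain rfl : i = j := Subsingleton.elim (α := PUnit × PUnit) i j
        refine Eq.trans ?_ (Mat_.id_apply_self _ _).symm
        exact (Fintype.sum_unique (fun _ : PUnit => 𝟙 (F.obj (c, z)) ≫ 𝟙 (F.obj (c, z)))).trans
          (Category.id_comp _)
      inv_hom_id := Mat_.hom_ext _ _ fun i j => by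
        obtain rfl : i = j := rfl
        refine Eq.trans ?_ (Mat_.id_apply_self _ _).symm
        exact (Fintype.sum_unique (fun _ : PUnit × PUnit =>
          𝟙 (F.obj (c, z)) ≫ 𝟙 (F.obj (c, z)))).trans (Category.id_comp _) }) fun {c c'} f => by
      refine Mat_.hom_ext _ _ fun i j => ?_
      refine (Fintype.sum_unique (fun _ : PUnit × PUnit =>
        F.map (X := (c, z)) (Y := (c', z)) (f, (𝟙 ((Mat_.embedding D).obj z) :
          (Mat_.embedding D).obj z ⟶ _) PUnit.unit PUnit.unit) ≫ 𝟙 (F.obj (c', z)))).trans ?_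
      refine Eq.trans ?_ (Fintype.sum_unique (fun _ : PUnit =>
        𝟙 (F.obj (c, z)) ≫ F.map (X := (c, z)) (Y := (c', z)) (f, 𝟙 z))).symm
      rw [Category.comp_id, Category.id_comp]
      exact congrArg (fun g => F.map (X := (c, z)) (Y := (c', z)) (f, g)) (Mat_.id_apply_self _ _)

/-- The induced functor on formal direct sums, with the first variable fixed. -/
def matFixLeft (z : C) : Mat_.embedding D ⋙ hF.matCurried.obj ((Mat_.embedding C).obj z) ≅
    hF.fixLeft z ⋙ Mat_.embedding E :=
  NatIso.ofComponents (fun c =>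
    { hom := fun _ _ => 𝟙 (F.obj (z, c))
      inv := fun _ _ => 𝟙 (F.obj (z, c))
      hom_inv_id := Mat_.hom_ext _ _ fun i j => by
        obtain rfl : i = j := Subsingleton.elim (α := PUnit × PUnit) i j
        refine Eq.trans ?_ (Mat_.id_apply_self _ _).symm
        exact (Fintype.sum_unique (fun _ : PUnit => 𝟙 (F.obj (z, c)) ≫ 𝟙 (F.obj (z, c)))).trans
          (Category.id_comp _)
      inv_hom_id := Mat_.hom_ext _ _ fun i j => by
        obtain rfl : i = j := rfl
        refine Eq.trans ?_ (Mat_.id_apply_self _ _).symm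
        exact (Fintype.sum_unique (fun _ : PUnit × PUnit =>
          𝟙 (F.obj (z, c)) ≫ 𝟙 (F.obj (z, c)))).trans (Category.id_comp _) }) fun {c c'} f => by
      refine Mat_.hom_ext _ _ fun i j => ?_
      refine (Fintype.sum_unique (fun _ : PUnit × PUnit =>
        F.map (X := (z, c)) (Y := (z, c')) ((𝟙 ((Mat_.embedding C).obj z) :
          (Mat_.embedding C).obj z ⟶ _) PUnit.unit PUnit.unit, f) ≫ 𝟙 (F.obj (z, c')))).trans ?_
      refine Eq.trans ?_ (Fintype.sum_unique (fun _ : PUnit =>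
        𝟙 (F.obj (z, c)) ≫ F.map (X := (z, c)) (Y := (z, c')) (𝟙 z, f))).symm
      rw [Category.comp_id, Category.id_comp]
      exact congrArg (fun g => F.map (X := (z, c)) (Y := (z, c')) (g, f)) (Mat_.id_apply_self _ _)

variable (G : E ⥤ AddCommGrpCat.{0}) [G.Additive]

/-- Evaluation with the second variable fixed. -/
def evFixRight (z : D) (K : ChainComplex (Mat_ C) ℕ) :
    ev G (((hF.matCurried.flip.obj ((Mat_.embedding D).obj z)).mapHomologicalComplex
      (.down ℕ)).obj K) ≅ ev (hF.fixRight z ⋙ G) K :=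
  evMap _ _ (hF.matFixRight z) G K

/-- Evaluation with the first variable fixed. -/
def evFixLeft (z : C) (K : ChainComplex (Mat_ D) ℕ) :
    ev G (((hF.matCurried.obj ((Mat_.embedding C).obj z)).mapHomologicalComplex
      (.down ℕ)).obj K) ≅ ev (hF.fixLeft z ⋙ G) K :=
  evMap _ _ (hF.matFixLeft z) G K

/-- The complexes obtained by fixing the second variable. -/
def complexRight (K : ChainComplex (Mat_ C) ℕ) : Mat_ D ⥤ ChainComplex AddCommGrpCat.{0} ℕ where
  obj M := ((hF.matCurried.flip.obj M ⋙ matLift G).mapHomologicalComplex (.down ℕ)).obj K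
  map f := (NatTrans.mapHomologicalComplex (Functor.whiskerRight (hF.matCurried.flip.map f)
    (matLift G)) _).app K
  map_id M := HomologicalComplex.hom_ext _ _ fun n =>
    (congrArg (fun f => (matLift G).map (NatTrans.app f (K.X n)))
      (hF.matCurried.flip.map_id M)).trans ((matLift G).map_id _)
  map_comp f g := HomologicalComplex.hom_ext _ _ fun n =>
    (congrArg (fun f => (matLift G).map (NatTrans.app f (K.X n)))
      (hF.matCurried.flip.map_comp f g)).trans ((matLift G).map_comp _ _)

instance (K : ChainComplex (Mat_ C) ℕ) : (hF.complexRight G K).Additive where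
  map_add {_ _ f g} := HomologicalComplex.hom_ext _ _ fun n =>
    (congrArg (fun f => (matLift G).map f)
      (hF.mat_map_add_right (𝟙 (K.X n)) f g)).trans (matLift G).map_add

/-- The complexes obtained by fixing the first variable. -/
def complexLeft (K : ChainComplex (Mat_ D) ℕ) : Mat_ C ⥤ ChainComplex AddCommGrpCat.{0} ℕ where
  obj M := ((hF.matCurried.obj M ⋙ matLift G).mapHomologicalComplex (.down ℕ)).obj K
  map f := (NatTrans.mapHomologicalComplex (Functor.whiskerRight (hF.matCurried.map f)
    (matLift G)) _).app K
  map_id M := HomologicalComplex.hom_ext _ _ fun n =>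
    (congrArg (fun f => (matLift G).map (NatTrans.app f (K.X n)))
      (hF.matCurried.map_id M)).trans ((matLift G).map_id _)
  map_comp f g := HomologicalComplex.hom_ext _ _ fun n =>
    (congrArg (fun f => (matLift G).map (NatTrans.app f (K.X n)))
      (hF.matCurried.map_comp f g)).trans ((matLift G).map_comp _ _)

instance (K : ChainComplex (Mat_ D) ℕ) : (hF.complexLeft G K).Additive where
  map_add {_ _ f g} := HomologicalComplex.hom_ext _ _ fun n =>
    (congrArg (fun f => (matLift G).map f)
      (hF.mat_map_add_left f g (𝟙 (K.X n)))).trans (matLift G).map_add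

/-- If all summands of the second complex contribute contractible complexes, the total complex is
contractible. -/
theorem kills_right (K : ChainComplex (Mat_ C) ℕ) (L : ChainComplex (Mat_ D) ℕ)
    (h : ∀ q j, Kills (hF.fixRight ((L.X q).X j) ⋙ G) K) :
    Kills G (HomologicalComplex.mapBifunctor K L hF.matCurried (.down ℕ)) :=
  mapBifunctor_contractible hF.matCurried (matLift G) K L fun q =>
    contractible_of_summands (hF.complexRight G K) (L.X q) fun j =>
      contractible_of_iso (hF.evFixRight G ((L.X q).X j) K) (h q j)

/-- If all summands of the first complex contribute contractible complexes, the total complex is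
contractible. -/
theorem kills_left (K : ChainComplex (Mat_ C) ℕ) (L : ChainComplex (Mat_ D) ℕ)
    (h : ∀ p j, Kills (hF.fixLeft ((K.X p).X j) ⋙ G) L) :
    Kills G (HomologicalComplex.mapBifunctor K L hF.matCurried (.down ℕ)) :=
  mapBifunctor_contractible' hF.matCurried (matLift G) K L fun p =>
    contractible_of_summands (hF.complexLeft G L) (K.X p) fun j =>
      contractible_of_iso (hF.evFixLeft G ((K.X p).X j) L) (h p j)

/-- If the summands of the second complex in nonzero degrees contribute contractible complexes,
only the degree zero part contributes to the total complex. -/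
theorem equiv_right (K : ChainComplex (Mat_ C) ℕ) (L : ChainComplex (Mat_ D) ℕ) (z : D)
    (e : L.X 0 ≅ (Mat_.embedding D).obj z)
    (h : ∀ q, q ≠ 0 → ∀ j, Kills (hF.fixRight ((L.X q).X j) ⋙ G) K) :
    Nonempty (HomotopyEquiv (ev G (HomologicalComplex.mapBifunctor K L hF.matCurried (.down ℕ)))
      (ev (hF.fixRight z ⋙ G) K)) := by
  obtain ⟨f⟩ := mapBifunctor_equiv hF.matCurried (matLift G) K L fun q hq =>
    contractible_of_summands (hF.complexRight G K) (L.X q) fun j =>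
      contractible_of_iso (hF.evFixRight G ((L.X q).X j) K) (h q hq j)
  exact ⟨f.trans (HomotopyEquiv.ofIso ((hF.complexRight G K).mapIso e ≪≫ hF.evFixRight G z K))⟩

end Biadditive

end Bifunctor

section Coyoneda

variable {C : Type} [Category.{0} C] [Preadditive C]

/-- Homomorphisms between summands. -/
def embeddingCoyo (D : C) : Mat_.embedding C ⋙ coyo ((Mat_.embedding C).obj D) ≅ coyo D :=
  NatIso.ofComponents (fun c => AddEquiv.toAddCommGrpIso
    (X := .of ((Mat_.embedding C).obj D ⟶ (Mat_.embedding C).obj c)) (Y := .of (D ⟶ c))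
    { toFun := fun f => f PUnit.unit PUnit.unit
      invFun := fun f => (Mat_.embedding C).map f
      left_inv := fun _ => rfl
      right_inv := fun _ => rfl
      map_add' := fun _ _ => rfl }) fun {c c'} f => by
    refine AddCommGrpCat.hom_ext (AddMonoidHom.ext fun x => ?_)
    exact Fintype.sum_unique (fun _ : PUnit => x PUnit.unit PUnit.unit ≫ f)

/-- Homomorphisms from a diagram. -/
def evCoyo (D : C) (K : ChainComplex (Mat_ C) ℕ) :
    ((coyo ((Mat_.embedding C).obj D)).mapHomologicalComplex (.down ℕ)).obj K ≅ ev (coyo D) K :=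
  evIso _ _ (embeddingCoyo D) K

/-- The complexes of homomorphisms from an object. -/
def complexCoyo (K : ChainComplex (Mat_ C) ℕ) :
    (Mat_ C)ᵒᵖ ⥤ ChainComplex AddCommGrpCat.{0} ℕ where
  obj M := ((preadditiveCoyoneda.obj M).mapHomologicalComplex (.down ℕ)).obj K
  map f := (NatTrans.mapHomologicalComplex (preadditiveCoyoneda.map f) _).app K
  map_id M := HomologicalComplex.hom_ext _ _ fun n =>
    congrArg (fun f => NatTrans.app f (K.X n)) (preadditiveCoyoneda.map_id M)
  map_comp f g := HomologicalComplex.hom_ext _ _ fun n =>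
    congrArg (fun f => NatTrans.app f (K.X n)) (preadditiveCoyoneda.map_comp f g)

instance (K : ChainComplex (Mat_ C) ℕ) : (complexCoyo K).Additive where
  map_add {_ _ f g} := HomologicalComplex.hom_ext _ _ fun _ =>
    AddCommGrpCat.hom_ext (AddMonoidHom.ext fun x =>
      Preadditive.add_comp _ _ _ f.unop g.unop x)

/-- If `Hom(D, K)` is contractible for all summands `D` of `M`, so is `Hom(M, K)`. -/
theorem contractible_coyo (M : Mat_ C) (K : ChainComplex (Mat_ C) ℕ)
    (h : ∀ j, Kills (coyo (M.X j)) K) :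
    Nonempty (Homotopy (𝟙 (((coyo M).mapHomologicalComplex (.down ℕ)).obj K)) 0) :=
  contractible_of_summands_op (complexCoyo K) M fun j =>
    contractible_of_iso (evCoyo (M.X j) K) (h j)

end Coyoneda

namespace Cplx

variable {m n : ℕ}

theorem embeddingDownNat_f (i : ℕ) : ComplexShape.embeddingDownNat.f i = -(i : ℤ) := rfl

/-- If `Hom(D, B)` is contractible for all summands `D` in nonzero degrees of `A`, and `A` is a
single diagram in degree zero, then `Hom(A, B)` is the complex of homomorphisms from this
diagram. -/
theorem homCplx_equiv (A B : Cplx m n) (d : ℤ) (v : Diag m n) (e : A.X 0 ≅ ofDiag v 0)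
    (h : ∀ i, i ≠ 0 → ∀ j, Kills (coyo ((GrDiag.qShift d).obj ((A.X i).X j))) B) :
    Nonempty (HomotopyEquiv (homCplx A B d)
      ((ev (coyo (⟨v, d⟩ : GrDiag m n)) B).extend ComplexShape.embeddingDownNat)) := by
  have e0 : (A.qShift d).toInt.X 0 ≅ ofDiag v d :=
    HomologicalComplex.extendXIso _ _ (i := 0) (by simp) ≪≫
      (Functor.mapMat_ (GrDiag.qShift d)).mapIso e ≪≫
        eqToIso (by
          change (⟨PUnit, fun _ => ⟨v, 0 + d⟩⟩ : BN m n) = ⟨PUnit, fun _ => ⟨v, d⟩⟩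
          rw [zero_add])
  obtain ⟨f⟩ := homComplex_equiv (A.qShift d).toInt B.toInt
    (fun p hp => HomologicalComplex.isZero_extend_X _ _ _ fun i => by
      rw [embeddingDownNat_f]; omega) (fun p hp => by
      obtain ⟨i, rfl⟩ : ∃ i : ℕ, p = -(i : ℤ) := ⟨p.natAbs, by omega⟩
      have ei : (A.qShift d).toInt.X (-(i : ℤ)) ≅ (A.qShift d).X i :=
        HomologicalComplex.extendXIso _ _ (embeddingDownNat_f i)
      refine contractible_of_iso ((NatIso.mapHomologicalComplex
        (preadditiveCoyoneda.mapIso ei.op) _).symm.app B.toInt ≪≫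
          mapExtendIso (coyo ((A.qShift d).X i)) B ComplexShape.embeddingDownNat) ?_
      exact contractible_extend _ (contractible_coyo _ _ (h i (by omega))))
  exact ⟨f.trans (HomotopyEquiv.ofIso ((NatIso.mapHomologicalComplex
    (preadditiveCoyoneda.mapIso e0.op) _).symm.app B.toInt ≪≫
      mapExtendIso (coyo (ofDiag v d)) B ComplexShape.embeddingDownNat)) |>.trans
        (extendHomotopyEquiv (HomotopyEquiv.ofIso (evCoyo (⟨v, d⟩ : GrDiag m n) B)) _)⟩

end Cplx

end SpinNet
end

noncomputable section
namespace SpinNet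

/-! ### Planar diagrams with a hole -/

/-- Transport of cobordisms along equalities of the numbers of boundary points. -/
def Cob.cast {m n m' n' : ℕ} (hm : m = m') (hn : n = n') {a b : Diag m n} (f : Cob a b) :
    Cob (a.cast hm hn) (b.cast hm hn) := by
  subst hm hn; exact f

/-- Planar diagrams with a rectangular hole with `m` points on the top and `n` on the bottom. -/
inductive Hole (m n : ℕ) : ℕ → ℕ → Type
  | hole : Hole m n m n
  | stackR {a k b : ℕ} (Φ : Hole m n a k) (z : GrDiag k b) : Hole m n a b
  | stackL {a k b : ℕ} (z : GrDiag a k) (Φ : Hole m n k b) : Hole m n a b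
  | besideR {a b a' b' : ℕ} (Φ : Hole m n a b) (z : GrDiag a' b') : Hole m n (a + a') (b + b')
  | besideL {a b a' b' : ℕ} (z : GrDiag a b) (Φ : Hole m n a' b') : Hole m n (a + a') (b + b')
  | cast {a b a' b' : ℕ} (ha : a = a') (hb : b = b') (Φ : Hole m n a b) : Hole m n a' b'

namespace Hole

variable {m n : ℕ}

/-- Fill the hole with a diagram. -/
def obj : {a b : ℕ} → Hole m n a b → Diag m n → Diag a b
  | _, _, hole, c => c
  | _, _, stackR Φ z, c => (Φ.obj c).stack z.diag
  | _, _, stackL z Φ, c => z.diag.stack (Φ.obj c)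
  | _, _, besideR Φ z, c => (Φ.obj c).beside z.diag
  | _, _, besideL z Φ, c => z.diag.beside (Φ.obj c)
  | _, _, cast ha hb Φ, c => (Φ.obj c).cast ha hb

/-- The total quantum shift. -/
def shift : {a b : ℕ} → Hole m n a b → ℤ → ℤ
  | _, _, hole, k => k
  | _, _, stackR Φ z, k => Φ.shift k + z.shift
  | _, _, stackL z Φ, k => z.shift + Φ.shift k
  | _, _, besideR Φ z, k => Φ.shift k + z.shift
  | _, _, besideL z Φ, k => z.shift + Φ.shift k
  | _, _, cast _ _ Φ, k => Φ.shift k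

/-- The pieces outside the hole. -/
def Ext : {a b : ℕ} → Hole m n a b → Type
  | _, _, hole => Empty
  | _, _, stackR Φ z => Φ.Ext ⊕ z.diag.Piece
  | _, _, stackL z Φ => z.diag.Piece ⊕ Φ.Ext
  | _, _, besideR Φ z => Φ.Ext ⊕ z.diag.Piece
  | _, _, besideL z Φ => z.diag.Piece ⊕ Φ.Ext
  | _, _, cast _ _ Φ => Φ.Ext

/-- The pieces inside the hole. -/
def incl : {a b : ℕ} → (Φ : Hole m n a b) → (c : Diag m n) → c.Piece → (Φ.obj c).Piece
  | _, _, hole, _ => id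
  | _, _, stackR Φ _, c => fun p => .inl (Φ.incl c p)
  | _, _, stackL _ Φ, c => fun p => .inr (Φ.incl c p)
  | _, _, besideR Φ _, c => fun p => .inl (Φ.incl c p)
  | _, _, besideL _ Φ, c => fun p => .inr (Φ.incl c p)
  | _, _, cast ha hb Φ, c => by subst ha hb; exact Φ.incl c

/-- The pieces outside the hole. -/
def ext : {a b : ℕ} → (Φ : Hole m n a b) → (c : Diag m n) → Φ.Ext → (Φ.obj c).Piece
  | _, _, hole, _ => Empty.elim
  | _, _, stackR Φ _, c => Sum.map (Φ.ext c) id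
  | _, _, stackL _ Φ, c => Sum.map id (Φ.ext c)
  | _, _, besideR Φ _, c => Sum.map (Φ.ext c) id
  | _, _, besideL _ Φ, c => Sum.map id (Φ.ext c)
  | _, _, cast ha hb Φ, c => by subst ha hb; exact Φ.ext c

/-- Fill the hole with a cobordism. -/
def cob : {a b : ℕ} → (Φ : Hole m n a b) → {c c' : Diag m n} → Cob c c' → Cob (Φ.obj c) (Φ.obj c')
  | _, _, hole, _, _, f => f
  | _, _, stackR Φ z, _, _, f => (Φ.cob f).stack (.refl z.diag)
  | _, _, stackL z Φ, _, _, f => .stack (.refl z.diag) (Φ.cob f)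
  | _, _, besideR Φ z, _, _, f => (Φ.cob f).beside (.refl z.diag)
  | _, _, besideL z Φ, _, _, f => .beside (.refl z.diag) (Φ.cob f)
  | _, _, cast ha hb Φ, _, _, f => (Φ.cob f).cast ha hb

/-- Fill the hole with a linear combination of cobordisms. -/
def hom : {a b : ℕ} → (Φ : Hole m n a b) → {c c' : Diag m n} → CobHom c c' →
    CobHom (Φ.obj c) (Φ.obj c')
  | _, _, hole, _, _, x => x
  | _, _, stackR Φ z, _, _, x => stackHom (Φ.hom x) (cls (.refl z.diag))
  | _, _, stackL z Φ, _, _, x => stackHom (cls (.refl z.diag)) (Φ.hom x)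
  | _, _, besideR Φ z, _, _, x => besideHom (Φ.hom x) (cls (.refl z.diag))
  | _, _, besideL z Φ, _, _, x => besideHom (cls (.refl z.diag)) (Φ.hom x)
  | _, _, cast ha hb Φ, _, _, x => by subst ha hb; exact Φ.hom x

/-- The pieces of the surface inside the hole. -/
def surfIncl : {a b : ℕ} → (Φ : Hole m n a b) → {c c' : Diag m n} → (f : Cob c c') →
    f.surface.Piece → (Φ.cob f).surface.Piece
  | _, _, hole, _, _, _ => id
  | _, _, stackR Φ _, _, _, f => fun p => .inl (Φ.surfIncl f p)
  | _, _, stackL _ Φ, _, _, f => fun p => .inr (Φ.surfIncl f p)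
  | _, _, besideR Φ _, _, _, f => fun p => .inl (Φ.surfIncl f p)
  | _, _, besideL _ Φ, _, _, f => fun p => .inr (Φ.surfIncl f p)
  | _, _, cast ha hb Φ, _, _, f => by subst ha hb; exact Φ.surfIncl f

/-- A function on the pieces of a surface from functions on the pieces inside and outside the
hole. -/
def surfMap {C : Type} : {a b : ℕ} → (Φ : Hole m n a b) → {c c' : Diag m n} → (f : Cob c c') →
    (f.surface.Piece → C) → (Φ.Ext → C) → (Φ.cob f).surface.Piece → C
  | _, _, hole, _, _, _, u, _ => u
  | _, _, stackR Φ _, _, _, f, u, v =>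
      Sum.elim (Φ.surfMap f u fun q => v (.inl q)) fun q => v (.inr q)
  | _, _, stackL _ Φ, _, _, f, u, v =>
      Sum.elim (fun q => v (.inl q)) (Φ.surfMap f u fun q => v (.inr q))
  | _, _, besideR Φ _, _, _, f, u, v =>
      Sum.elim (Φ.surfMap f u fun q => v (.inl q)) fun q => v (.inr q)
  | _, _, besideL _ Φ, _, _, f, u, v =>
      Sum.elim (fun q => v (.inl q)) (Φ.surfMap f u fun q => v (.inr q))
  | _, _, cast ha hb Φ, _, _, f, u, v => by subst ha hb; exact Φ.surfMap f u v

section Pieces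

variable {a b : ℕ} (Φ : Hole m n a b) {c c' : Diag m n} (f : Cob c c')

theorem piece_cases (c : Diag m n) (x : (Φ.obj c).Piece) :
    (∃ p, x = Φ.incl c p) ∨ ∃ q, x = Φ.ext c q := by
  induction Φ with
  | hole => exact .inl ⟨x, rfl⟩
  | stackR Φ z ih =>
    rcases x with x | x
    · rcases ih x with ⟨p, rfl⟩ | ⟨q, rfl⟩
      · exact .inl ⟨p, rfl⟩
      · exact .inr ⟨.inl q, rfl⟩
    · exact .inr ⟨.inr x, rfl⟩
  | stackL z Φ ih =>
    rcases x with x | x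
    · exact .inr ⟨.inl x, rfl⟩
    · rcases ih x with ⟨p, rfl⟩ | ⟨q, rfl⟩
      · exact .inl ⟨p, rfl⟩
      · exact .inr ⟨.inr q, rfl⟩
  | besideR Φ z ih =>
    rcases x with x | x
    · rcases ih x with ⟨p, rfl⟩ | ⟨q, rfl⟩
      · exact .inl ⟨p, rfl⟩
      · exact .inr ⟨.inl q, rfl⟩
    · exact .inr ⟨.inr x, rfl⟩
  | besideL z Φ ih =>
    rcases x with x | x
    · exact .inr ⟨.inl x, rfl⟩
    · rcases ih x with ⟨p, rfl⟩ | ⟨q, rfl⟩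
      · exact .inl ⟨p, rfl⟩
      · exact .inr ⟨.inr q, rfl⟩
  | cast ha hb Φ ih => subst ha hb; exact ih x

theorem surfIncl_conn {p q : f.surface.Piece} (h : f.surface.conn p q) :
    (Φ.cob f).surface.conn (Φ.surfIncl f p) (Φ.surfIncl f q) := by
  induction Φ with
  | hole => exact h
  | stackR Φ z ih => exact glueConn_inl ih
  | stackL z Φ ih => exact glueConn_inr ih
  | besideR Φ z ih => exact glueConn_inl ih
  | besideL z Φ ih => exact glueConn_inr ih
  | cast ha hb Φ ih => subst ha hb; exact ih

theorem surface_inn_incl (p : c.Piece) :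
    (Φ.cob f).surface.inn (Φ.incl c p) = Φ.surfIncl f (f.surface.inn p) := by
  induction Φ with
  | hole => rfl
  | stackR Φ z ih => exact congrArg Sum.inl ih
  | stackL z Φ ih => exact congrArg Sum.inr ih
  | besideR Φ z ih => exact congrArg Sum.inl ih
  | besideL z Φ ih => exact congrArg Sum.inr ih
  | cast ha hb Φ ih => subst ha hb; exact ih

theorem surface_out_incl (p : c'.Piece) :
    (Φ.cob f).surface.out (Φ.incl c' p) = Φ.surfIncl f (f.surface.out p) := by
  induction Φ with
  | hole => rfl
  | stackR Φ z ih => exact congrArg Sum.inl ih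
  | stackL z Φ ih => exact congrArg Sum.inr ih
  | besideR Φ z ih => exact congrArg Sum.inl ih
  | besideL z Φ ih => exact congrArg Sum.inr ih
  | cast ha hb Φ ih => subst ha hb; exact ih

theorem refl_out_conn {k l : ℕ} (z : Diag k l) (q : z.Piece) :
    (Cob.refl z).surface.conn ((Cob.refl z).surface.out q) ((Cob.refl z).surface.inn q) :=
  Quotient.exact ((DIso.refl z).mk_out q)

theorem surface_out_ext (q : Φ.Ext) : (Φ.cob f).surface.conn
    ((Φ.cob f).surface.out (Φ.ext c' q)) ((Φ.cob f).surface.inn (Φ.ext c q)) := by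
  induction Φ with
  | hole => exact q.elim
  | stackR Φ z ih =>
    rcases q with q | q
    · exact glueConn_inl (ih q)
    · exact glueConn_inr (refl_out_conn z.diag q)
  | stackL z Φ ih =>
    rcases q with q | q
    · exact glueConn_inl (refl_out_conn z.diag q)
    · exact glueConn_inr (ih q)
  | besideR Φ z ih =>
    rcases q with q | q
    · exact glueConn_inl (ih q)
    · exact glueConn_inr (refl_out_conn z.diag q)
  | besideL z Φ ih =>
    rcases q with q | q
    · exact glueConn_inl (refl_out_conn z.diag q)
    · exact glueConn_inr (ih q)
  | cast ha hb Φ ih => subst ha hb; exact ih q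

theorem surface_cases (x : (Φ.cob f).surface.Piece) :
    (∃ p, x = Φ.surfIncl f p) ∨ ∃ q, x = (Φ.cob f).surface.inn (Φ.ext c q) := by
  induction Φ with
  | hole => exact .inl ⟨x, rfl⟩
  | stackR Φ z ih =>
    rcases x with x | x
    · rcases ih x with ⟨p, rfl⟩ | ⟨q, rfl⟩
      · exact .inl ⟨p, rfl⟩
      · exact .inr ⟨.inl q, rfl⟩
    · exact .inr ⟨.inr x, rfl⟩
  | stackL z Φ ih =>
    rcases x with x | x
    · exact .inr ⟨.inl x, rfl⟩
    · rcases ih x with ⟨p, rfl⟩ | ⟨q, rfl⟩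
      · exact .inl ⟨p, rfl⟩
      · exact .inr ⟨.inr q, rfl⟩
  | besideR Φ z ih =>
    rcases x with x | x
    · rcases ih x with ⟨p, rfl⟩ | ⟨q, rfl⟩
      · exact .inl ⟨p, rfl⟩
      · exact .inr ⟨.inl q, rfl⟩
    · exact .inr ⟨.inr x, rfl⟩
  | besideL z Φ ih =>
    rcases x with x | x
    · exact .inr ⟨.inl x, rfl⟩
    · rcases ih x with ⟨p, rfl⟩ | ⟨q, rfl⟩
      · exact .inl ⟨p, rfl⟩
      · exact .inr ⟨.inr q, rfl⟩
  | cast ha hb Φ ih => subst ha hb; exact ih x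

variable {C : Type}

theorem surfMap_incl (u : f.surface.Piece → C) (v : Φ.Ext → C) (p : f.surface.Piece) :
    Φ.surfMap f u v (Φ.surfIncl f p) = u p := by
  induction Φ with
  | hole => rfl
  | stackR Φ z ih => exact ih _
  | stackL z Φ ih => exact ih _
  | besideR Φ z ih => exact ih _
  | besideL z Φ ih => exact ih _
  | cast ha hb Φ ih => subst ha hb; exact ih v

theorem surfMap_ext (u : f.surface.Piece → C) (v : Φ.Ext → C) (q : Φ.Ext) :
    Φ.surfMap f u v ((Φ.cob f).surface.inn (Φ.ext c q)) = v q := by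
  induction Φ with
  | hole => exact q.elim
  | stackR Φ z ih =>
    rcases q with q | q
    · exact ih _ q
    · rfl
  | stackL z Φ ih =>
    rcases q with q | q
    · rfl
    · exact ih _ q
  | besideR Φ z ih =>
    rcases q with q | q
    · exact ih _ q
    · rfl
  | besideL z Φ ih =>
    rcases q with q | q
    · rfl
    · exact ih _ q
  | cast ha hb Φ ih => subst ha hb; exact ih v q

/-- The pieces outside the hole are vertical, so every gluing outside `f` is already visible in the
lower boundary diagram. -/
theorem respects_surface {h : (Φ.cob f).surface.Piece → C}
    (h1 : Respects f.surface.conn fun p => h (Φ.surfIncl f p))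
    (h2 : Respects (Φ.obj c).conn fun p => h ((Φ.cob f).surface.inn p)) :
    Respects (Φ.cob f).surface.conn h := by
  induction Φ with
  | hole => exact h1
  | stackR Φ z ih => exact .glue (ih (h := fun p => h (.inl p)) h1 h2.inl) h2.inr h2.glued
  | stackL z Φ ih => exact .glue h2.inl (ih (h := fun p => h (.inr p)) h1 h2.inr) h2.glued
  | besideR Φ z ih =>
    exact .glue (ih (h := fun p => h (.inl p)) h1 h2.inl) h2.inr fun k => k.elim
  | besideL z Φ ih =>
    exact .glue h2.inl (ih (h := fun p => h (.inr p)) h1 h2.inr) fun k => k.elim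
  | cast ha hb Φ ih => subst ha hb; exact ih h1 h2

/-- The exterior is a cylinder and has defect zero, so only the surface in the hole contributes. -/
theorem defect_surface {h : (Φ.cob f).surface.Piece → C}
    (hh : Respects (Φ.cob f).surface.conn h) : (Φ.cob f).surface.defect h =
      f.surface.defect fun p => h (Φ.surfIncl f p) := by
  induction Φ with
  | hole => rfl
  | stackR Φ z ih =>
    refine (Surface.defect_stack (Φ.cob f).surface (DIso.refl z.diag).surf h hh).trans ?_
    exact (congrArg₂ (· + ·) (ih hh.inl) ((DIso.refl z.diag).defect_surf _ hh.inr)).trans (add_zero _)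
  | stackL z Φ ih =>
    refine (Surface.defect_stack (DIso.refl z.diag).surf (Φ.cob f).surface h hh).trans ?_
    exact (congrArg₂ (· + ·) ((DIso.refl z.diag).defect_surf _ hh.inl) (ih hh.inr)).trans (zero_add _)
  | besideR Φ z ih =>
    refine (Surface.defect_beside (Φ.cob f).surface (DIso.refl z.diag).surf h).trans ?_
    exact (congrArg₂ (· + ·) (ih hh.inl) ((DIso.refl z.diag).defect_surf _ hh.inr)).trans (add_zero _)
  | besideL z Φ ih =>
    refine (Surface.defect_beside (DIso.refl z.diag).surf (Φ.cob f).surface h).trans ?_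
    exact (congrArg₂ (· + ·) ((DIso.refl z.diag).defect_surf _ hh.inl) (ih hh.inr)).trans (zero_add _)
  | cast ha hb Φ ih => subst ha hb; exact ih hh

theorem dots_surface (h : (Φ.cob f).surface.Piece → C) :
    push h (Φ.cob f).surface.dots = push (fun p => h (Φ.surfIncl f p)) f.surface.dots := by
  induction Φ with
  | hole => rfl
  | stackR Φ z ih =>
    refine (Surface.dots_stack (Φ.cob f).surface (DIso.refl z.diag).surf h).trans ?_
    rw [(DIso.refl z.diag).dots_surf, add_zero]
    exact ih _
  | stackL z Φ ih =>
    refine (Surface.dots_stack (DIso.refl z.diag).surf (Φ.cob f).surface h).trans ?_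
    rw [(DIso.refl z.diag).dots_surf, zero_add]
    exact ih _
  | besideR Φ z ih =>
    refine (Surface.dots_beside (Φ.cob f).surface (DIso.refl z.diag).surf h).trans ?_
    rw [(DIso.refl z.diag).dots_surf, add_zero]
    exact ih _
  | besideL z Φ ih =>
    refine (Surface.dots_beside (DIso.refl z.diag).surf (Φ.cob f).surface h).trans ?_
    rw [(DIso.refl z.diag).dots_surf, zero_add]
    exact ih _
  | cast ha hb Φ ih => subst ha hb; exact ih h

theorem hom_add (x y : CobHom c c') : Φ.hom (x + y) = Φ.hom x + Φ.hom y := by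
  induction Φ with
  | hole => rfl
  | stackR Φ z ih => exact (congrArg (fun u => stackHom u _) ih).trans (LinearMap.map_add₂ stackHom _ _ _)
  | stackL z Φ ih => exact (congrArg (stackHom _) ih).trans ((stackHom _).map_add _ _)
  | besideR Φ z ih => exact (congrArg (fun u => besideHom u _) ih).trans (LinearMap.map_add₂ besideHom _ _ _)
  | besideL z Φ ih => exact (congrArg (besideHom _) ih).trans ((besideHom _).map_add _ _)
  | cast ha hb Φ ih => subst ha hb; exact ih

theorem hom_smul (r : Coeff) (x : CobHom c c') : Φ.hom (r • x) = r • Φ.hom x := by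
  induction Φ with
  | hole => rfl
  | stackR Φ z ih => exact (congrArg (fun u => stackHom u _) ih).trans (LinearMap.map_smul₂ stackHom _ _ _)
  | stackL z Φ ih => exact (congrArg (stackHom _) ih).trans ((stackHom _).map_smul _ _)
  | besideR Φ z ih => exact (congrArg (fun u => besideHom u _) ih).trans (LinearMap.map_smul₂ besideHom _ _ _)
  | besideL z Φ ih => exact (congrArg (besideHom _) ih).trans ((besideHom _).map_smul _ _)
  | cast ha hb Φ ih => subst ha hb; exact ih

theorem hom_cls : Φ.hom (cls f) = cls (Φ.cob f) := by
  induction Φ with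
  | hole => rfl
  | stackR Φ z ih => exact (congrArg (fun u => stackHom u _) ih).trans (stackHom_cls _ _)
  | stackL z Φ ih => exact (congrArg (stackHom _) ih).trans (stackHom_cls _ _)
  | besideR Φ z ih => exact (congrArg (fun u => besideHom u _) ih).trans (besideHom_cls _ _)
  | besideL z Φ ih => exact (congrArg (besideHom _) ih).trans (besideHom_cls _ _)
  | cast ha hb Φ ih => subst ha hb; exact ih

end Pieces

/-! ### The functors given by planar diagrams with a hole -/

/-- The action on morphisms. -/
def map : {a b : ℕ} → (Φ : Hole m n a b) → {x y : GrDiag m n} → (x ⟶ y) →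
    ((⟨Φ.obj x.diag, Φ.shift x.shift⟩ : GrDiag a b) ⟶ ⟨Φ.obj y.diag, Φ.shift y.shift⟩)
  | _, _, hole, _, _, f => f
  | _, _, stackR (a := a) (k := k) (b := b) Φ z, x, y, f =>
    ((stack_biadditive a k b).fixRight z).map (X := ⟨Φ.obj x.diag, Φ.shift x.shift⟩)
      (Y := ⟨Φ.obj y.diag, Φ.shift y.shift⟩) (Φ.map f)
  | _, _, stackL (a := a) (k := k) (b := b) z Φ, x, y, f =>
    ((stack_biadditive a k b).fixLeft z).map (X := ⟨Φ.obj x.diag, Φ.shift x.shift⟩)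
      (Y := ⟨Φ.obj y.diag, Φ.shift y.shift⟩) (Φ.map f)
  | _, _, besideR (a := a) (b := b) (a' := a') (b' := b') Φ z, x, y, f =>
    ((beside_biadditive a b a' b').fixRight z).map (X := ⟨Φ.obj x.diag, Φ.shift x.shift⟩)
      (Y := ⟨Φ.obj y.diag, Φ.shift y.shift⟩) (Φ.map f)
  | _, _, besideL (a := a) (b := b) (a' := a') (b' := b') z Φ, x, y, f =>
    ((beside_biadditive a b a' b').fixLeft z).map (X := ⟨Φ.obj x.diag, Φ.shift x.shift⟩)
      (Y := ⟨Φ.obj y.diag, Φ.shift y.shift⟩) (Φ.map f)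
  | _, _, cast ha hb Φ, _, _, f => by subst ha hb; exact Φ.map f

variable {a b : ℕ}

theorem map_val (Φ : Hole m n a b) {x y : GrDiag m n} (f : x ⟶ y) : (Φ.map f).1 = Φ.hom f.1 := by
  induction Φ with
  | hole => rfl
  | stackR Φ z ih => exact congrArg (fun u => stackHom u (cls (.refl z.diag))) ih
  | stackL z Φ ih => exact congrArg (fun u => stackHom (cls (.refl z.diag)) u) ih
  | besideR Φ z ih => exact congrArg (fun u => besideHom u (cls (.refl z.diag))) ih
  | besideL z Φ ih => exact congrArg (fun u => besideHom (cls (.refl z.diag)) u) ih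
  | cast ha hb Φ ih => subst ha hb; exact ih

/-- The functor that fills the hole. -/
def functor (Φ : Hole m n a b) : GrDiag m n ⥤ GrDiag a b where
  obj x := ⟨Φ.obj x.diag, Φ.shift x.shift⟩
  map f := Φ.map f
  map_id x := by
    induction Φ with
    | hole => rfl
    | stackR Φ z ih => exact (congrArg _ ih).trans (CategoryTheory.Functor.map_id _ _)
    | stackL z Φ ih => exact (congrArg _ ih).trans (CategoryTheory.Functor.map_id _ _)
    | besideR Φ z ih => exact (congrArg _ ih).trans (CategoryTheory.Functor.map_id _ _)
    | besideL z Φ ih => exact (congrArg _ ih).trans (CategoryTheory.Functor.map_id _ _)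
    | cast ha hb Φ ih => subst ha hb; exact ih
  map_comp f g := by
    induction Φ with
    | hole => rfl
    | stackR Φ z ih => exact (congrArg _ ih).trans (CategoryTheory.Functor.map_comp _ _ _)
    | stackL z Φ ih => exact (congrArg _ ih).trans (CategoryTheory.Functor.map_comp _ _ _)
    | besideR Φ z ih => exact (congrArg _ ih).trans (CategoryTheory.Functor.map_comp _ _ _)
    | besideL z Φ ih => exact (congrArg _ ih).trans (CategoryTheory.Functor.map_comp _ _ _)
    | cast ha hb Φ ih => subst ha hb; exact ih

instance (Φ : Hole m n a b) : Φ.functor.Additive where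
  map_add {_ _ f g} := Subtype.ext ((Φ.map_val (f + g)).trans ((Φ.hom_add f.1 g.1).trans
    (congrArg₂ (· + ·) (Φ.map_val f).symm (Φ.map_val g).symm)))

/-- The pieces outside the hole, and the boundary points of the hole. -/
abbrev Frame (Φ : Hole m n a b) : Type := Φ.Ext ⊕ (Fin m ⊕ Fin n)

/-- The pieces of the frame. -/
def frame (Φ : Hole m n a b) (c : Diag m n) : Φ.Frame → (Φ.obj c).Piece :=
  Sum.elim (Φ.ext c) (Sum.elim (fun i => Φ.incl c (c.top i)) fun i => Φ.incl c (c.bot i))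

/-- An isotopy of planar diagrams with a hole. -/
structure Move (Φ Ψ : Hole m n a b) where
  iso (c : Diag m n) : DIso (Φ.obj c) (Ψ.obj c)
  incl (c : Diag m n) (p : c.Piece) :
    (iso c).comps (Quotient.mk _ (Φ.incl c p)) = Quotient.mk _ (Ψ.incl c p)
  ext (q : Φ.Ext) : ∃ r, ∀ c,
    (iso c).comps (Quotient.mk _ (Φ.ext c q)) = Quotient.mk _ (Ψ.frame c r)
  ext_symm (q : Ψ.Ext) : ∃ r, ∀ c,
    (iso c).comps (Quotient.mk _ (Φ.frame c r)) = Quotient.mk _ (Ψ.ext c q)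

/-- Exterior pieces, and the strands over boundary points of the hole, trace out vertical pieces of
every surface that fills the hole. -/
theorem inn_frame (Φ : Hole m n a b) {c c' : Diag m n} (f : Cob c c') (q : Φ.Frame) :
    (Φ.cob f).surface.conn ((Φ.cob f).surface.inn (Φ.frame c q))
      ((Φ.cob f).surface.out (Φ.frame c' q)) := by
  rcases q with q | i | i
  · exact Setoid.symm' _ (Φ.surface_out_ext f q)
  · change (Φ.cob f).surface.conn ((Φ.cob f).surface.inn (Φ.incl c (c.top i)))
      ((Φ.cob f).surface.out (Φ.incl c' (c'.top i)))
    rw [Φ.surface_inn_incl, Φ.surface_out_incl]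
    exact Φ.surfIncl_conn f (f.surface_compat.top i)
  · change (Φ.cob f).surface.conn ((Φ.cob f).surface.inn (Φ.incl c (c.bot i)))
      ((Φ.cob f).surface.out (Φ.incl c' (c'.bot i)))
    rw [Φ.surface_inn_incl, Φ.surface_out_incl]
    exact Φ.surfIncl_conn f (f.surface_compat.bot i)

theorem surfMap_inn (Φ : Hole m n a b) {c c' : Diag m n} (f : Cob c c') {C : Type}
    (u : f.surface.Piece → C) (w : (Φ.obj c).Piece → C)
    (h : ∀ p, u (f.surface.inn p) = w (Φ.incl c p)) (p : (Φ.obj c).Piece) :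
    Φ.surfMap f u (fun q => w (Φ.ext c q)) ((Φ.cob f).surface.inn p) = w p := by
  rcases Φ.piece_cases c p with ⟨p, rfl⟩ | ⟨q, rfl⟩
  · rw [Φ.surface_inn_incl, Φ.surfMap_incl, h]
  · rw [Φ.surfMap_ext]

namespace Move

variable {Φ Ψ : Hole m n a b} (e : Move Φ Ψ)

/-- Both surfaces consist of `f` and vertical pieces of the exterior. The isotopy matches the parts
inside the hole with each other, and sends an exterior piece to a frame element which does not
depend on the diagram in the hole. Without this uniformity the isotopies for `c` and `c'` would be
unrelated outside the hole. -/
theorem homeo {c c' : Diag m n} (f : Cob c c') :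
    ((Φ.cob f).surface.comp (e.iso c').surf).Homeo ((e.iso c).surf.comp (Ψ.cob f).surface) := by
  have hS := (Φ.cob f).surface_compat
  have hT := (Ψ.cob f).surface_compat
  let w := fun p => Surface.innComp hT ((e.iso c).comps (Quotient.mk _ p))
  let w' := fun p => Surface.innComp hS ((e.iso c).comps.symm (Quotient.mk _ p))
  let u := fun s => Quotient.mk (Ψ.cob f).surface.conn (Ψ.surfIncl f s)
  let u' := fun s => Quotient.mk (Φ.cob f).surface.conn (Φ.surfIncl f s)
  have hw : ∀ p, u (f.surface.inn p) = w (Φ.incl c p) := fun p =>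
    (congrArg (Quotient.mk _) (Ψ.surface_inn_incl f p).symm).trans
      (congrArg (Surface.innComp hT) (e.incl c p).symm)
  have hw' : ∀ p, u' (f.surface.inn p) = w' (Ψ.incl c p) := fun p =>
    (congrArg (Quotient.mk _) (Φ.surface_inn_incl f p).symm).trans
      (congrArg (Surface.innComp hS) ((Equiv.symm_apply_eq _).2 (e.incl c p).symm).symm)
  let φ := Φ.surfMap f u fun q => w (Φ.ext c q)
  let ψ := Ψ.surfMap f u' fun q => w' (Ψ.ext c q)
  have hi : ∀ p, φ ((Φ.cob f).surface.inn p) = w p := Φ.surfMap_inn f u w hw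
  have hi' : ∀ p, ψ ((Ψ.cob f).surface.inn p) = w' p := Ψ.surfMap_inn f u' w' hw'
  have hs : ∀ s, φ (Φ.surfIncl f s) = u s := Φ.surfMap_incl f u _
  have hs' : ∀ s, ψ (Ψ.surfIncl f s) = u' s := Ψ.surfMap_incl f u' _
  have hφ : Respects (Φ.cob f).surface.conn φ := Φ.respects_surface f
    (fun x y h => by
      simp only [hs]; exact Quotient.sound (Ψ.surfIncl_conn f h))
    (fun x y h => by
      simp only [hi]
      exact congrArg (fun x => Surface.innComp hT ((e.iso c).comps x)) (Quotient.sound h))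
  have hψ : Respects (Ψ.cob f).surface.conn ψ := Ψ.respects_surface f
    (fun x y h => by
      simp only [hs']; exact Quotient.sound (Φ.surfIncl_conn f h))
    (fun x y h => by
      simp only [hi']
      exact congrArg (fun x => Surface.innComp hS ((e.iso c).comps.symm x)) (Quotient.sound h))
  have k : ∀ x, hψ.desc (Surface.innComp hT x) =
      Surface.innComp hS ((e.iso c).comps.symm x) := fun x => by
    obtain ⟨p, rfl⟩ := Quotient.exists_rep x; exact hi' p
  have k' : ∀ x, hφ.desc (Surface.innComp hS x) =
      Surface.innComp hT ((e.iso c).comps x) := fun x => by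
    obtain ⟨p, rfl⟩ := Quotient.exists_rep x; exact hi p
  refine DIso.homeo_naturality hS hT (e.iso c) (e.iso c') φ ψ hφ hψ ?_ ?_ hi ?_ ?_ ?_
  · intro p
    rcases Φ.surface_cases f p with ⟨s, rfl⟩ | ⟨q, rfl⟩
    · rw [hs]; exact hs' s
    · rw [hi]
      exact (k _).trans (by rw [Equiv.symm_apply_apply]; rfl)
  · intro p
    rcases Ψ.surface_cases f p with ⟨s, rfl⟩ | ⟨q, rfl⟩
    · rw [hs']; exact hs s
    · rw [hi']
      exact (k' _).trans (by rw [Equiv.apply_symm_apply]; rfl)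
  · intro p
    rcases Φ.piece_cases c' p with ⟨p, rfl⟩ | ⟨q, rfl⟩
    · rw [Φ.surface_out_incl, hs, e.incl]
      exact congrArg (Quotient.mk _) (Ψ.surface_out_incl f p).symm
    · refine (hφ (Φ.surface_out_ext f q)).trans ((hi _).trans ?_)
      change Surface.innComp hT ((e.iso c).comps (Quotient.mk _ (Φ.ext c q))) = _
      -- The same frame element `r` serves the lower and the upper diagram, and it is vertical in
      -- the surface.
      obtain ⟨r, hr⟩ := e.ext q
      rw [hr, hr]
      exact Quotient.sound (Ψ.inn_frame f r)
  · intro C F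
    rw [Φ.defect_surface f (hφ.then F),
      Ψ.defect_surface f (h := fun p => F (Quotient.mk _ p)) ((Respects.mk _).then F)]
    simp only [hs]; rfl
  · intro C F
    rw [Φ.dots_surface f, Ψ.dots_surface f]
    simp only [hs]; rfl

theorem naturality {c c' : Diag m n} (x : CobHom c c') :
    compHom (Φ.hom x) (cls (e.iso c').cob) = compHom (cls (e.iso c).cob) (Ψ.hom x) := by
  induction x using CobHom.induction with
  | h0 =>
    have h0 : ∀ {a b : ℕ} (Φ : Hole m n a b), Φ.hom (0 : CobHom c c') = 0 := fun Φ => by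
      simpa using Φ.hom_smul 0 (0 : CobHom c c')
    simp [h0]
  | hadd x y hx hy => simp only [hom_add, map_add, LinearMap.add_apply, hx, hy]
  | hcls r f =>
    simp only [hom_smul, map_smul, LinearMap.smul_apply, hom_cls, compHom_cls]
    exact congrArg _ (cls_eq_of_homeo (e.homeo f))

/-- The natural isomorphism induced by an isotopy. -/
def natIso (h : ∀ k, Φ.shift k = Ψ.shift k) : Φ.functor ≅ Ψ.functor :=
  NatIso.ofComponents (fun x => (e.iso x.diag).iso (h x.shift)) fun f => Subtype.ext
    ((congrArg (fun u => compHom u _) (Φ.map_val f)).trans ((e.naturality f.1).trans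
      (congrArg (fun u => compHom _ u) (Ψ.map_val f)).symm))

end Move

end Hole

end SpinNet
end

/-! ### Calculus of isotopies of diagrams with a hole -/

noncomputable section
namespace SpinNet

namespace Hole

variable {m n a b k l : ℕ}

namespace Move

variable {Φ Ψ Ω : Hole m n a b}

theorem frame_of_ext (e : Move Φ Ψ) (q : Φ.Frame) : ∃ r, ∀ c,
    (e.iso c).comps (Quotient.mk _ (Φ.frame c q)) = Quotient.mk _ (Ψ.frame c r) := by
  rcases q with q | i | i
  · exact e.ext q
  · exact ⟨.inr (.inl i), fun c => e.incl c _⟩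
  · exact ⟨.inr (.inr i), fun c => e.incl c _⟩

/-- The identity. -/
def refl (Φ : Hole m n a b) : Move Φ Φ where
  iso _ := .refl _
  incl _ _ := rfl
  ext q := ⟨.inl q, fun _ => rfl⟩
  ext_symm q := ⟨.inl q, fun _ => rfl⟩

/-- The inverse. -/
def symm (e : Move Φ Ψ) : Move Ψ Φ where
  iso c := (e.iso c).symm
  incl c p := (Equiv.symm_apply_eq _).2 (e.incl c p).symm
  ext q := (e.ext_symm q).imp fun _ h c => (Equiv.symm_apply_eq _).2 (h c).symm
  ext_symm q := (e.ext q).imp fun _ h c => (Equiv.symm_apply_eq _).2 (h c).symm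

/-- The composite. -/
def trans (e : Move Φ Ψ) (e' : Move Ψ Ω) : Move Φ Ω where
  iso c := (e.iso c).trans (e'.iso c)
  incl c p := (congrArg _ (e.incl c p)).trans (e'.incl c p)
  ext q := by
    obtain ⟨r, hr⟩ := e.ext q
    obtain ⟨r', hr'⟩ := e'.frame_of_ext r
    exact ⟨r', fun c => (congrArg _ (hr c)).trans (hr' c)⟩
  ext_symm q := by
    obtain ⟨r, hr⟩ := e'.ext_symm q
    obtain ⟨r', hr'⟩ := e.symm.frame_of_ext r
    exact ⟨r', fun c => (congrArg _ ((Equiv.symm_apply_eq _).1 (hr' c)).symm).trans (hr c)⟩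

/-- Stack a diagram below. -/
def stackR {Φ Ψ : Hole m n a k} (e : Move Φ Ψ) {z z' : GrDiag k b} (d : DIso z.diag z'.diag) :
    Move (Φ.stackR z) (Ψ.stackR z') where
  iso c := (e.iso c).stack d
  incl c p := congrArg (glueInl _ _ _ _) (e.incl c p)
  ext := by
    rintro (q | q)
    · obtain ⟨r | r, h⟩ := e.ext q
      · exact ⟨.inl (.inl r), fun c => congrArg (glueInl _ _ _ _) (h c)⟩
      · exact ⟨.inr r, fun c => (congrArg (glueInl _ _ _ _) (h c)).trans (by rcases r with r | r <;> rfl)⟩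
    · obtain ⟨r, h⟩ := Quotient.exists_rep (d.comps (Quotient.mk _ q))
      exact ⟨.inl (.inr r), fun c => congrArg (glueInr _ _ _ _) h.symm⟩
  ext_symm := by
    rintro (q | q)
    · obtain ⟨r | r, h⟩ := e.ext_symm q
      · exact ⟨.inl (.inl r), fun c => congrArg (glueInl _ _ _ _) (h c)⟩
      · exact ⟨.inr r, fun c => Eq.trans (by rcases r with r | r <;> rfl) (congrArg (glueInl _ _ _ _) (h c))⟩
    · obtain ⟨r, h⟩ := Quotient.exists_rep (d.comps.symm (Quotient.mk _ q))
      exact ⟨.inl (.inr r), fun c => congrArg (glueInr _ _ _ _) ((Equiv.symm_apply_eq _).1 h.symm).symm⟩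

/-- Stack a diagram above. -/
def stackL {Φ Ψ : Hole m n k b} {z z' : GrDiag a k} (d : DIso z.diag z'.diag) (e : Move Φ Ψ) :
    Move (Φ.stackL z) (Ψ.stackL z') where
  iso c := d.stack (e.iso c)
  incl c p := congrArg (glueInr _ _ _ _) (e.incl c p)
  ext := by
    rintro (q | q)
    · obtain ⟨r, h⟩ := Quotient.exists_rep (d.comps (Quotient.mk _ q))
      exact ⟨.inl (.inl r), fun c => congrArg (glueInl _ _ _ _) h.symm⟩
    · obtain ⟨r | r, h⟩ := e.ext q
      · exact ⟨.inl (.inr r), fun c => congrArg (glueInr _ _ _ _) (h c)⟩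
      · exact ⟨.inr r, fun c => (congrArg (glueInr _ _ _ _) (h c)).trans (by rcases r with r | r <;> rfl)⟩
  ext_symm := by
    rintro (q | q)
    · obtain ⟨r, h⟩ := Quotient.exists_rep (d.comps.symm (Quotient.mk _ q))
      exact ⟨.inl (.inl r), fun c => congrArg (glueInl _ _ _ _) ((Equiv.symm_apply_eq _).1 h.symm).symm⟩
    · obtain ⟨r | r, h⟩ := e.ext_symm q
      · exact ⟨.inl (.inr r), fun c => congrArg (glueInr _ _ _ _) (h c)⟩
      · exact ⟨.inr r, fun c => Eq.trans (by rcases r with r | r <;> rfl) (congrArg (glueInr _ _ _ _) (h c))⟩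

/-- Put a diagram on the right. -/
def besideR {Φ Ψ : Hole m n a b} (e : Move Φ Ψ) {z z' : GrDiag k l} (d : DIso z.diag z'.diag) :
    Move (Φ.besideR z) (Ψ.besideR z') where
  iso c := (e.iso c).beside d
  incl c p := congrArg (glueInl _ _ _ _) (e.incl c p)
  ext := by
    rintro (q | q)
    · obtain ⟨r | r, h⟩ := e.ext q
      · exact ⟨.inl (.inl r), fun c => congrArg (glueInl _ _ _ _) (h c)⟩
      · exact ⟨.inr r, fun c => (congrArg (glueInl _ _ _ _) (h c)).trans (by rcases r with r | r <;> rfl)⟩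
    · obtain ⟨r, h⟩ := Quotient.exists_rep (d.comps (Quotient.mk _ q))
      exact ⟨.inl (.inr r), fun c => congrArg (glueInr _ _ _ _) h.symm⟩
  ext_symm := by
    rintro (q | q)
    · obtain ⟨r | r, h⟩ := e.ext_symm q
      · exact ⟨.inl (.inl r), fun c => congrArg (glueInl _ _ _ _) (h c)⟩
      · exact ⟨.inr r, fun c => Eq.trans (by rcases r with r | r <;> rfl) (congrArg (glueInl _ _ _ _) (h c))⟩
    · obtain ⟨r, h⟩ := Quotient.exists_rep (d.comps.symm (Quotient.mk _ q))
      exact ⟨.inl (.inr r), fun c => congrArg (glueInr _ _ _ _) ((Equiv.symm_apply_eq _).1 h.symm).symm⟩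

/-- Put a diagram on the left. -/
def besideL {Φ Ψ : Hole m n k l} {z z' : GrDiag a b} (d : DIso z.diag z'.diag) (e : Move Φ Ψ) :
    Move (Φ.besideL z) (Ψ.besideL z') where
  iso c := d.beside (e.iso c)
  incl c p := congrArg (glueInr _ _ _ _) (e.incl c p)
  ext := by
    rintro (q | q)
    · obtain ⟨r, h⟩ := Quotient.exists_rep (d.comps (Quotient.mk _ q))
      exact ⟨.inl (.inl r), fun c => congrArg (glueInl _ _ _ _) h.symm⟩
    · obtain ⟨r | r, h⟩ := e.ext q
      · exact ⟨.inl (.inr r), fun c => congrArg (glueInr _ _ _ _) (h c)⟩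
      · exact ⟨.inr r, fun c => (congrArg (glueInr _ _ _ _) (h c)).trans (by rcases r with r | r <;> rfl)⟩
  ext_symm := by
    rintro (q | q)
    · obtain ⟨r, h⟩ := Quotient.exists_rep (d.comps.symm (Quotient.mk _ q))
      exact ⟨.inl (.inl r), fun c => congrArg (glueInl _ _ _ _) ((Equiv.symm_apply_eq _).1 h.symm).symm⟩
    · obtain ⟨r | r, h⟩ := e.ext_symm q
      · exact ⟨.inl (.inr r), fun c => congrArg (glueInr _ _ _ _) (h c)⟩
      · exact ⟨.inr r, fun c => Eq.trans (by rcases r with r | r <;> rfl) (congrArg (glueInr _ _ _ _) (h c))⟩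

/-- Associativity of stacking below. -/
def assocR (Φ : Hole m n a k) (y : GrDiag k l) (z : GrDiag l b) :
    Move ((Φ.stackR y).stackR z) (Φ.stackR ⟨y.diag.stack z.diag, y.shift + z.shift⟩) where
  iso c := .assoc _ _ _
  incl _ _ := rfl
  ext := by
    rintro ((q | q) | q)
    exacts [⟨.inl (.inl q), fun _ => rfl⟩, ⟨.inl (.inr (.inl q)), fun _ => rfl⟩,
      ⟨.inl (.inr (.inr q)), fun _ => rfl⟩]
  ext_symm := by
    rintro (q | q | q)
    exacts [⟨.inl (.inl (.inl q)), fun _ => rfl⟩, ⟨.inl (.inl (.inr q)), fun _ => rfl⟩,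
      ⟨.inl (.inr q), fun _ => rfl⟩]

/-- Associativity of stacking above. -/
def assocL (Φ : Hole m n l b) (y : GrDiag a k) (z : GrDiag k l) :
    Move (Φ.stackL ⟨y.diag.stack z.diag, y.shift + z.shift⟩) ((Φ.stackL z).stackL y) where
  iso c := .assoc _ _ _
  incl _ _ := rfl
  ext := by
    rintro ((q | q) | q)
    exacts [⟨.inl (.inl q), fun _ => rfl⟩, ⟨.inl (.inr (.inl q)), fun _ => rfl⟩,
      ⟨.inl (.inr (.inr q)), fun _ => rfl⟩]
  ext_symm := by
    rintro (q | q | q)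
    exacts [⟨.inl (.inl (.inl q)), fun _ => rfl⟩, ⟨.inl (.inl (.inr q)), fun _ => rfl⟩,
      ⟨.inl (.inr q), fun _ => rfl⟩]

/-- Associativity of stacking above and below. -/
def assocM (Φ : Hole m n k l) (y : GrDiag a k) (z : GrDiag l b) :
    Move ((Φ.stackL y).stackR z) ((Φ.stackR z).stackL y) where
  iso c := .assoc _ _ _
  incl _ _ := rfl
  ext := by
    rintro ((q | q) | q)
    exacts [⟨.inl (.inl q), fun _ => rfl⟩, ⟨.inl (.inr (.inl q)), fun _ => rfl⟩,
      ⟨.inl (.inr (.inr q)), fun _ => rfl⟩]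
  ext_symm := by
    rintro (q | q | q)
    exacts [⟨.inl (.inl (.inl q)), fun _ => rfl⟩, ⟨.inl (.inl (.inr q)), fun _ => rfl⟩,
      ⟨.inl (.inr q), fun _ => rfl⟩]

/-- Interchange, with the hole in the upper left corner. -/
def interchangeTL {a' k' b' : ℕ} (Φ : Hole m n a k) (y : GrDiag k b) (z : GrDiag a' k')
    (w : GrDiag k' b') :
    Move ((Φ.stackR y).besideR ⟨z.diag.stack w.diag, z.shift + w.shift⟩)
      ((Φ.besideR z).stackR ⟨y.diag.beside w.diag, y.shift + w.shift⟩) where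
  iso c := .interchange _ _ _ _
  incl _ _ := rfl
  ext := by
    rintro ((q | q) | (q | q))
    exacts [⟨.inl (.inl (.inl q)), fun _ => rfl⟩, ⟨.inl (.inr (.inl q)), fun _ => rfl⟩,
      ⟨.inl (.inl (.inr q)), fun _ => rfl⟩, ⟨.inl (.inr (.inr q)), fun _ => rfl⟩]
  ext_symm := by
    rintro ((q | q) | (q | q))
    exacts [⟨.inl (.inl (.inl q)), fun _ => rfl⟩, ⟨.inl (.inr (.inl q)), fun _ => rfl⟩,
      ⟨.inl (.inl (.inr q)), fun _ => rfl⟩, ⟨.inl (.inr (.inr q)), fun _ => rfl⟩]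

/-- Interchange, with the hole in the lower left corner. -/
def interchangeBL {a' k' b' : ℕ} (Φ : Hole m n k b) (y : GrDiag a k) (z : GrDiag a' k')
    (w : GrDiag k' b') :
    Move ((Φ.stackL y).besideR ⟨z.diag.stack w.diag, z.shift + w.shift⟩)
      ((Φ.besideR w).stackL ⟨y.diag.beside z.diag, y.shift + z.shift⟩) where
  iso c := .interchange _ _ _ _
  incl _ _ := rfl
  ext := by
    rintro ((q | q) | (q | q))
    exacts [⟨.inl (.inl (.inl q)), fun _ => rfl⟩, ⟨.inl (.inr (.inl q)), fun _ => rfl⟩,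
      ⟨.inl (.inl (.inr q)), fun _ => rfl⟩, ⟨.inl (.inr (.inr q)), fun _ => rfl⟩]
  ext_symm := by
    rintro ((q | q) | (q | q))
    exacts [⟨.inl (.inl (.inl q)), fun _ => rfl⟩, ⟨.inl (.inr (.inl q)), fun _ => rfl⟩,
      ⟨.inl (.inl (.inr q)), fun _ => rfl⟩, ⟨.inl (.inr (.inr q)), fun _ => rfl⟩]

/-- Interchange, with the hole in the upper right corner. -/
def interchangeTR {a' k' b' : ℕ} (Φ : Hole m n a' k') (y : GrDiag k' b') (z : GrDiag a k)
    (w : GrDiag k b) :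
    Move ((Φ.stackR y).besideL ⟨z.diag.stack w.diag, z.shift + w.shift⟩)
      ((Φ.besideL z).stackR ⟨w.diag.beside y.diag, w.shift + y.shift⟩) where
  iso c := .interchange _ _ _ _
  incl _ _ := rfl
  ext := by
    rintro ((q | q) | (q | q))
    exacts [⟨.inl (.inl (.inl q)), fun _ => rfl⟩, ⟨.inl (.inr (.inl q)), fun _ => rfl⟩,
      ⟨.inl (.inl (.inr q)), fun _ => rfl⟩, ⟨.inl (.inr (.inr q)), fun _ => rfl⟩]
  ext_symm := by
    rintro ((q | q) | (q | q))
    exacts [⟨.inl (.inl (.inl q)), fun _ => rfl⟩, ⟨.inl (.inr (.inl q)), fun _ => rfl⟩,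
      ⟨.inl (.inl (.inr q)), fun _ => rfl⟩, ⟨.inl (.inr (.inr q)), fun _ => rfl⟩]

/-- Interchange, with the hole in the lower right corner. -/
def interchangeBR {a' k' b' : ℕ} (Φ : Hole m n k' b') (y : GrDiag a' k') (z : GrDiag a k)
    (w : GrDiag k b) :
    Move ((Φ.stackL y).besideL ⟨z.diag.stack w.diag, z.shift + w.shift⟩)
      ((Φ.besideL w).stackL ⟨z.diag.beside y.diag, z.shift + y.shift⟩) where
  iso c := .interchange _ _ _ _
  incl _ _ := rfl
  ext := by
    rintro ((q | q) | (q | q))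
    exacts [⟨.inl (.inl (.inl q)), fun _ => rfl⟩, ⟨.inl (.inr (.inl q)), fun _ => rfl⟩,
      ⟨.inl (.inl (.inr q)), fun _ => rfl⟩, ⟨.inl (.inr (.inr q)), fun _ => rfl⟩]
  ext_symm := by
    rintro ((q | q) | (q | q))
    exacts [⟨.inl (.inl (.inl q)), fun _ => rfl⟩, ⟨.inl (.inr (.inl q)), fun _ => rfl⟩,
      ⟨.inl (.inl (.inr q)), fun _ => rfl⟩, ⟨.inl (.inr (.inr q)), fun _ => rfl⟩]

end Move

end Hole

end SpinNet
end

noncomputable section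
namespace SpinNet

/-! ### Bending strands -/

theorem mk_glue_of_eq {A B K : Type} {s : Setoid A} {t : Setoid B} {f : K → A} {g : K → B} {x : A}
    {y : B} (k : K) (hf : f k = x) (hg : g k = y) :
    Quotient.mk (glueConn s t f g) (.inl x) = Quotient.mk (glueConn s t f g) (.inr y) := by
  subst hf hg; exact mk_glue k

section Split

theorem split_last {m : ℕ} : (finSumFinEquiv.symm (Fin.last m) : Fin m ⊕ Fin 1) = .inr 0 := by
  rw [Equiv.symm_apply_eq]; rfl

theorem split_castSucc {m : ℕ} (i : Fin m) :
    (finSumFinEquiv.symm i.castSucc : Fin m ⊕ Fin 1) = .inl i := by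
  rw [Equiv.symm_apply_eq]; rfl

theorem split_last_two {m : ℕ} :
    (finSumFinEquiv.symm (Fin.last (m + 1)) : Fin m ⊕ Fin 2) = .inr 1 := by
  rw [Equiv.symm_apply_eq]; rfl

theorem split_castSucc_last {m : ℕ} :
    (finSumFinEquiv.symm (Fin.last m).castSucc : Fin m ⊕ Fin 2) = .inr 0 := by
  rw [Equiv.symm_apply_eq]; rfl

theorem split_castSucc_castSucc {m : ℕ} (i : Fin m) :
    (finSumFinEquiv.symm i.castSucc.castSucc : Fin m ⊕ Fin 2) = .inl i := by
  rw [Equiv.symm_apply_eq]; rfl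

theorem split_zero {m : ℕ} (i : Fin (m + 0)) :
    (finSumFinEquiv.symm i : Fin m ⊕ Fin 0) = .inl i := by
  rw [Equiv.symm_apply_eq]; rfl

/-- A function on `m + 2` points that is equal on the last two. -/
def capFun {m : ℕ} {C : Type} (u : Fin m → C) (x : C) (k : Fin (m + 2)) : C :=
  Sum.elim u (fun _ => x) (finSumFinEquiv.symm k)

variable {m n : ℕ} {C : Type}

theorem capFun_last (u : Fin m → C) (x : C) : capFun u x (Fin.last (m + 1)) = x := by
  rw [capFun, split_last_two]; rfl

theorem capFun_castSucc_last (u : Fin m → C) (x : C) :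
    capFun u x (Fin.last m).castSucc = x := by
  rw [capFun, split_castSucc_last]; rfl

theorem capFun_castSucc_castSucc (u : Fin m → C) (x : C) (i : Fin m) :
    capFun u x i.castSucc.castSucc = u i := by
  rw [capFun, split_castSucc_castSucc]; rfl

theorem beside_strand_top_last (c : Diag m n) :
    ((c.beside (.strands 1)).top (Fin.last m) : c.Piece ⊕ Fin 1) = .inr (0 : Fin 1) :=
  congrArg (Sum.map c.top id) split_last

theorem beside_strand_bot_last (c : Diag m n) :
    ((c.beside (.strands 1)).bot (Fin.last n) : c.Piece ⊕ Fin 1) = .inr (0 : Fin 1) :=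
  congrArg (Sum.map c.bot id) split_last

theorem beside_strand_top_castSucc (c : Diag m n) (i : Fin m) :
    ((c.beside (.strands 1)).top i.castSucc : c.Piece ⊕ Fin 1) = .inl (c.top i) :=
  congrArg (Sum.map c.top id) (split_castSucc i)

theorem beside_strand_bot_castSucc (c : Diag m n) (i : Fin n) :
    ((c.beside (.strands 1)).bot i.castSucc : c.Piece ⊕ Fin 1) = .inl (c.bot i) :=
  congrArg (Sum.map c.bot id) (split_castSucc i)

theorem strands_cap_bot (k : Fin (m + 2)) :
    (((Diag.strands m).beside .cap).bot k : Fin m ⊕ Unit) = capFun .inl (.inr ()) k := by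
  change Sum.map id (fun _ => ()) (finSumFinEquiv.symm k) = _
  unfold capFun
  rcases finSumFinEquiv.symm k <;> rfl

theorem strands_cup_top (k : Fin (m + 2)) :
    (((Diag.strands m).beside .cup).top k : Fin m ⊕ Unit) = capFun .inl (.inr ()) k := by
  change Sum.map id (fun _ => ()) (finSumFinEquiv.symm k) = _
  unfold capFun
  rcases finSumFinEquiv.symm k <;> rfl

theorem strands_cap_top (k : Fin m) :
    (((Diag.strands m).beside .cap).top k : Fin m ⊕ Unit) = .inl k := by
  exact congrArg (Sum.map id Fin.elim0) (split_zero k)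

theorem strands_cup_bot (k : Fin m) :
    (((Diag.strands m).beside .cup).bot k : Fin m ⊕ Unit) = .inl k := by
  exact congrArg (Sum.map id Fin.elim0) (split_zero k)

end Split

namespace Hole

variable {m n : ℕ}

/-- Put a strand on the right. -/
abbrev addStrand {m n a b : ℕ} (Φ : Hole m n a b) : Hole m n (a + 1) (b + 1) :=
  Φ.besideR (⟨.strands 1, 0⟩ : GrDiag 1 1)

/-- Strands and an arc `∩`. -/
abbrev capR (m : ℕ) : GrDiag m (m + 2) := ⟨((Diag.strands m).beside .cap : Diag m (m + 2)), 0⟩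

/-- Strands and an arc `∪`. -/
abbrev cupR (m : ℕ) : GrDiag (m + 2) m := ⟨((Diag.strands m).beside .cup : Diag (m + 2) m), 0⟩

/-- Bend the last top strand to the bottom. -/
def bendDown {m n a b : ℕ} (Φ : Hole m n (a + 1) b) : Hole m n a (b + 1) :=
  .stackL (capR a) Φ.addStrand

/-- Bend the last bottom strand to the top. -/
def bendUp {m n a b : ℕ} (Φ : Hole m n a (b + 1)) : Hole m n (a + 1) b :=
  .stackR Φ.addStrand (cupR b)

/-- Bending the last strand down and up again. -/
def bendDownUpIso (c : Diag (m + 1) n) :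
    DIso ((Hole.hole (m := m + 1) (n := n)).bendDown.bendUp.obj c) c := by
  -- The component of the strand being bent: both arcs and both added strands belong to it. The
  -- other pieces added above and below prolong the remaining boundary points.
  let x := Quotient.mk c.conn (c.top (Fin.last m))
  let φ1 : Fin m ⊕ Unit → c.Components :=
    Sum.elim (fun i => Quotient.mk _ (c.top i.castSucc)) fun _ => x
  let φ2 : c.Piece ⊕ Fin 1 → c.Components := Sum.elim (Quotient.mk _) fun _ => x
  let φ3 : Fin n ⊕ Unit → c.Components :=
    Sum.elim (fun i => Quotient.mk _ (c.bot i)) fun _ => x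
  let s1 := glueConn (K := Empty) (⊥ : Setoid (Fin m)) (⊥ : Setoid Unit) Empty.elim Empty.elim
  let s2 := glueConn (K := Empty) c.conn (⊥ : Setoid (Fin 1)) Empty.elim Empty.elim
  let s12 := glueConn s1 s2 ((Diag.strands m).beside .cap).bot (c.beside (.strands 1)).top
  let s4 := glueConn (K := Empty) s12 (⊥ : Setoid (Fin 1)) Empty.elim Empty.elim
  let s5 := glueConn (K := Empty) (⊥ : Setoid (Fin n)) (⊥ : Setoid Unit) Empty.elim Empty.elim
  let w : Diag m (n + 1) :=
    ((Diag.strands m).beside .cap : Diag m (m + 2)).stack (c.beside (.strands 1))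
  let s := glueConn s4 s5 (w.beside (.strands 1)).bot ((Diag.strands n).beside .cup).top
  -- These identifications are read off the gluing points. Those named `g2`, `g3`, `g5` and `g6`
  -- follow the bent strand from the last upper point of `c` through `∩`, the inner strand and `∪`
  -- to the outer strand; `g1` and `g4` concern the other strands.
  have g1 : ∀ i : Fin m, Quotient.mk s (.inl (.inl (.inl (.inl i)))) =
      Quotient.mk s (.inl (.inl (.inr (.inl (c.top i.castSucc))))) := fun i =>
    congrArg (fun y => glueInl s4 s5 _ _ (glueInl s12 _ _ _ y)) (mk_glue_of_eq (s := s1) (t := s2)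
      i.castSucc.castSucc ((strands_cap_bot _).trans (capFun_castSucc_castSucc _ _ _))
      (beside_strand_top_castSucc _ _))
  have g2 : Quotient.mk s (.inl (.inl (.inl (.inr ())))) =
      Quotient.mk s (.inl (.inl (.inr (.inl (c.top (Fin.last m)))))) :=
    congrArg (fun y => glueInl s4 s5 _ _ (glueInl s12 _ _ _ y)) (mk_glue_of_eq (s := s1) (t := s2)
      (Fin.last m).castSucc ((strands_cap_bot _).trans (capFun_castSucc_last _ _))
      (beside_strand_top_castSucc _ _))
  have g3 : Quotient.mk s (.inl (.inl (.inl (.inr ())))) =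
      Quotient.mk s (.inl (.inl (.inr (.inr 0)))) :=
    congrArg (fun y => glueInl s4 s5 _ _ (glueInl s12 _ _ _ y)) (mk_glue_of_eq (s := s1) (t := s2)
      (Fin.last (m + 1)) ((strands_cap_bot _).trans (capFun_last _ _))
      (beside_strand_top_last _))
  have g4 : ∀ i : Fin n, Quotient.mk s (.inl (.inl (.inr (.inl (c.bot i))))) =
      Quotient.mk s (.inr (.inl i)) := fun i =>
    mk_glue_of_eq (s := s4) (t := s5) i.castSucc.castSucc
      ((beside_strand_bot_castSucc w i.castSucc).trans
        (congrArg (fun y => Sum.inl (Sum.inr y)) (beside_strand_bot_castSucc c i)))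
      ((strands_cup_top _).trans (capFun_castSucc_castSucc _ _ _))
  have g5 : Quotient.mk s (.inl (.inl (.inr (.inr 0)))) = Quotient.mk s (.inr (.inr ())) :=
    mk_glue_of_eq (s := s4) (t := s5) (Fin.last n).castSucc
      ((beside_strand_bot_castSucc w (Fin.last n)).trans
        (congrArg (fun y => Sum.inl (Sum.inr y)) (beside_strand_bot_last c)))
      ((strands_cup_top _).trans (capFun_castSucc_last _ _))
  have g6 : Quotient.mk s (.inl (.inr 0)) = Quotient.mk s (.inr (.inr ())) :=
    mk_glue_of_eq (s := s4) (t := s5) (Fin.last (n + 1)) (beside_strand_bot_last w)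
      ((strands_cup_top _).trans (capFun_last _ _))
  let φ : (((Fin m ⊕ Unit) ⊕ (c.Piece ⊕ Fin 1)) ⊕ Fin 1) ⊕ (Fin n ⊕ Unit) → c.Components :=
    Sum.elim (Sum.elim (Sum.elim φ1 φ2) fun _ => x) φ3
  have hφ : Respects s φ := by
    refine .glue (.glue (.glue (.glue (.bot _) (.bot _) fun k => k.elim)
      (.glue (.mk _) (.bot _) fun k => k.elim) fun k => ?_) (.bot _) fun k => k.elim)
      (.glue (.bot _) (.bot _) fun k => k.elim) fun k => ?_
    · change φ1 (((Diag.strands m).beside .cap).bot k) = φ2 ((c.beside (.strands 1)).top k)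
      refine (congrArg φ1 (strands_cap_bot k)).trans ?_
      induction k using Fin.lastCases with
      | last =>
        exact (congrArg φ1 (capFun_last Sum.inl (Sum.inr ()))).trans
          (congrArg φ2 (beside_strand_top_last c)).symm
      | cast k =>
        refine Eq.trans ?_ (congrArg φ2 (beside_strand_top_castSucc c k)).symm
        induction k using Fin.lastCases with
        | last => exact congrArg φ1 (capFun_castSucc_last Sum.inl (Sum.inr ()))
        | cast k => exact congrArg φ1 (capFun_castSucc_castSucc Sum.inl (Sum.inr ()) _)
    · change Sum.elim (Sum.elim φ1 φ2) (fun _ => x) ((w.beside (.strands 1)).bot k) =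
        φ3 (((Diag.strands n).beside .cup).top k)
      refine Eq.trans ?_ (congrArg φ3 (strands_cup_top k)).symm
      induction k using Fin.lastCases with
      | last =>
        exact (congrArg (Sum.elim (Sum.elim φ1 φ2) fun _ => x)
          (beside_strand_bot_last w)).trans (congrArg φ3 (capFun_last Sum.inl (Sum.inr ()))).symm
      | cast k =>
        refine (congrArg (Sum.elim (Sum.elim φ1 φ2) fun _ => x)
          (beside_strand_bot_castSucc w k)).trans ?_
        change φ2 ((c.beside (.strands 1)).bot k) = _
        induction k using Fin.lastCases with
        | last =>
          exact (congrArg φ2 (beside_strand_bot_last c)).trans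
            (congrArg φ3 (capFun_castSucc_last Sum.inl (Sum.inr ()))).symm
        | cast k =>
          exact (congrArg φ2 (beside_strand_bot_castSucc c k)).trans
            (congrArg φ3 (capFun_castSucc_castSucc Sum.inl (Sum.inr ()) _)).symm
  have hψ : Respects c.conn fun p => Quotient.mk s (.inl (.inl (.inr (.inl p)))) :=
    fun _ _ h => Quotient.sound (glueConn_inl (glueConn_inl (glueConn_inr (glueConn_inl h))))
  refine .ofMaps φ _ hφ hψ ?_ (fun _ => rfl) ?_ ?_
  · rintro ((((i | i) | (p | i)) | i) | (i | i))
    · exact (g1 i).symm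
    · exact g2.symm
    · rfl
    · obtain rfl : i = (0 : Fin 1) := Subsingleton.elim (α := Fin 1) i 0
      exact g2.symm.trans g3
    · obtain rfl : i = (0 : Fin 1) := Subsingleton.elim (α := Fin 1) i 0
      exact g2.symm.trans (g3.trans (g5.trans g6.symm))
    · exact g4 i
    · exact g2.symm.trans (g3.trans g5)
  · intro i
    induction i using Fin.lastCases with
    | last => exact congrArg (fun y => φ (.inl y)) (beside_strand_top_last w)
    | cast i =>
      refine (congrArg (fun y => φ (.inl y)) (beside_strand_top_castSucc w i)).trans ?_
      exact congrArg φ1 (strands_cap_top i)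
  · intro i
    exact congrArg φ3 (strands_cup_bot i)

/-- Bending the last strand down and up again. -/
def bendDownUp (m n : ℕ) :
    Move (Hole.hole (m := m + 1) (n := n)).bendDown.bendUp .hole where
  iso := bendDownUpIso
  incl _ _ := rfl
  -- Every exterior piece lies on a strand that ends at a boundary point of the hole, so boundary
  -- points suffice as frame elements.
  ext := by
    rintro (((((i | i) | (q | i)) | i) | (i | i)))
    exacts [⟨.inr (.inl i.castSucc), fun _ => rfl⟩, ⟨.inr (.inl (Fin.last m)), fun _ => rfl⟩,
      q.elim, ⟨.inr (.inl (Fin.last m)), fun _ => rfl⟩,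
      ⟨.inr (.inl (Fin.last m)), fun _ => rfl⟩, ⟨.inr (.inr i), fun _ => rfl⟩,
      ⟨.inr (.inl (Fin.last m)), fun _ => rfl⟩]
  ext_symm q := q.elim

/-- Bending the last strand up and down again. -/
def bendUpDownIso (c : Diag m (n + 1)) :
    DIso ((Hole.hole (m := m) (n := n + 1)).bendUp.bendDown.obj c) c := by
  -- The component of the last lower strand, which now carries all the bends: `g2`, `g3`, `g5` and
  -- `g6` lead from it through `∪`, the inner strand and `∩` to the outer strand.
  let x := Quotient.mk c.conn (c.bot (Fin.last n))
  let φ1 : Fin n ⊕ Unit → c.Components :=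
    Sum.elim (fun i => Quotient.mk _ (c.bot i.castSucc)) fun _ => x
  let φ2 : c.Piece ⊕ Fin 1 → c.Components := Sum.elim (Quotient.mk _) fun _ => x
  let φ3 : Fin m ⊕ Unit → c.Components :=
    Sum.elim (fun i => Quotient.mk _ (c.top i)) fun _ => x
  let s1 := glueConn (K := Empty) (⊥ : Setoid (Fin n)) (⊥ : Setoid Unit) Empty.elim Empty.elim
  let s2 := glueConn (K := Empty) c.conn (⊥ : Setoid (Fin 1)) Empty.elim Empty.elim
  let s12 := glueConn s2 s1 (c.beside (.strands 1)).bot ((Diag.strands n).beside .cup).top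
  let s4 := glueConn (K := Empty) s12 (⊥ : Setoid (Fin 1)) Empty.elim Empty.elim
  let s5 := glueConn (K := Empty) (⊥ : Setoid (Fin m)) (⊥ : Setoid Unit) Empty.elim Empty.elim
  let w : Diag (m + 1) n :=
    (c.beside (.strands 1)).stack ((Diag.strands n).beside .cup : Diag (n + 2) n)
  let s := glueConn s5 s4 ((Diag.strands m).beside .cap).bot (w.beside (.strands 1)).top
  have g1 : ∀ i : Fin n, Quotient.mk s (.inr (.inl (.inl (.inl (c.bot i.castSucc))))) =
      Quotient.mk s (.inr (.inl (.inr (.inl i)))) := fun i =>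
    congrArg (fun y => glueInr s5 s4 _ _ (glueInl s12 _ _ _ y)) (mk_glue_of_eq (s := s2) (t := s1)
      i.castSucc.castSucc (beside_strand_bot_castSucc _ _)
      ((strands_cup_top _).trans (capFun_castSucc_castSucc _ _ _)))
  have g2 : Quotient.mk s (.inr (.inl (.inl (.inl (c.bot (Fin.last n)))))) =
      Quotient.mk s (.inr (.inl (.inr (.inr ())))) :=
    congrArg (fun y => glueInr s5 s4 _ _ (glueInl s12 _ _ _ y)) (mk_glue_of_eq (s := s2) (t := s1)
      (Fin.last n).castSucc (beside_strand_bot_castSucc _ _)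
      ((strands_cup_top _).trans (capFun_castSucc_last _ _)))
  have g3 : Quotient.mk s (.inr (.inl (.inl (.inr 0)))) =
      Quotient.mk s (.inr (.inl (.inr (.inr ())))) :=
    congrArg (fun y => glueInr s5 s4 _ _ (glueInl s12 _ _ _ y)) (mk_glue_of_eq (s := s2) (t := s1)
      (Fin.last (n + 1)) (beside_strand_bot_last _)
      ((strands_cup_top _).trans (capFun_last _ _)))
  have g4 : ∀ i : Fin m, Quotient.mk s (.inl (.inl i)) =
      Quotient.mk s (.inr (.inl (.inl (.inl (c.top i))))) := fun i =>
    mk_glue_of_eq (s := s5) (t := s4) i.castSucc.castSucc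
      ((strands_cap_bot _).trans (capFun_castSucc_castSucc _ _ _))
      ((beside_strand_top_castSucc w i.castSucc).trans
        (congrArg (fun y => Sum.inl (Sum.inl y)) (beside_strand_top_castSucc c i)))
  have g5 : Quotient.mk s (.inl (.inr ())) = Quotient.mk s (.inr (.inl (.inl (.inr 0)))) :=
    mk_glue_of_eq (s := s5) (t := s4) (Fin.last m).castSucc
      ((strands_cap_bot _).trans (capFun_castSucc_last _ _))
      ((beside_strand_top_castSucc w (Fin.last m)).trans
        (congrArg (fun y => Sum.inl (Sum.inl y)) (beside_strand_top_last c)))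
  have g6 : Quotient.mk s (.inl (.inr ())) = Quotient.mk s (.inr (.inr 0)) :=
    mk_glue_of_eq (s := s5) (t := s4) (Fin.last (m + 1))
      ((strands_cap_bot _).trans (capFun_last _ _)) (beside_strand_top_last w)
  let φ : (Fin m ⊕ Unit) ⊕ (((c.Piece ⊕ Fin 1) ⊕ (Fin n ⊕ Unit)) ⊕ Fin 1) → c.Components :=
    Sum.elim φ3 (Sum.elim (Sum.elim φ2 φ1) fun _ => x)
  have hφ : Respects s φ := by
    refine .glue (.glue (.bot _) (.bot _) fun k => k.elim)
      (.glue (.glue (.glue (.mk _) (.bot _) fun k => k.elim)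
      (.glue (.bot _) (.bot _) fun k => k.elim) fun k => ?_) (.bot _) fun k => k.elim)
      fun k => ?_
    · change φ2 ((c.beside (.strands 1)).bot k) = φ1 (((Diag.strands n).beside .cup).top k)
      refine Eq.trans ?_ (congrArg φ1 (strands_cup_top k)).symm
      induction k using Fin.lastCases with
      | last =>
        exact (congrArg φ2 (beside_strand_bot_last c)).trans
          (congrArg φ1 (capFun_last Sum.inl (Sum.inr ()))).symm
      | cast k =>
        refine (congrArg φ2 (beside_strand_bot_castSucc c k)).trans ?_
        induction k using Fin.lastCases with
        | last => exact (congrArg φ1 (capFun_castSucc_last Sum.inl (Sum.inr ()))).symm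
        | cast k => exact (congrArg φ1 (capFun_castSucc_castSucc Sum.inl (Sum.inr ()) _)).symm
    · change φ3 (((Diag.strands m).beside .cap).bot k) =
        Sum.elim (Sum.elim φ2 φ1) (fun _ => x) ((w.beside (.strands 1)).top k)
      refine (congrArg φ3 (strands_cap_bot k)).trans ?_
      induction k using Fin.lastCases with
      | last =>
        exact (congrArg φ3 (capFun_last Sum.inl (Sum.inr ()))).trans
          (congrArg (Sum.elim (Sum.elim φ2 φ1) fun _ => x) (beside_strand_top_last w)).symm
      | cast k =>
        refine Eq.trans ?_ (congrArg (Sum.elim (Sum.elim φ2 φ1) fun _ => x)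
          (beside_strand_top_castSucc w k)).symm
        change _ = φ2 ((c.beside (.strands 1)).top k)
        induction k using Fin.lastCases with
        | last =>
          exact (congrArg φ3 (capFun_castSucc_last Sum.inl (Sum.inr ()))).trans
            (congrArg φ2 (beside_strand_top_last c)).symm
        | cast k =>
          exact (congrArg φ3 (capFun_castSucc_castSucc Sum.inl (Sum.inr ()) _)).trans
            (congrArg φ2 (beside_strand_top_castSucc c k)).symm
  have hψ : Respects c.conn fun p => Quotient.mk s (.inr (.inl (.inl (.inl p)))) :=
    fun _ _ h => Quotient.sound (glueConn_inr (glueConn_inl (glueConn_inl (glueConn_inl h))))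
  refine .ofMaps φ _ hφ hψ ?_ (fun _ => rfl) ?_ ?_
  · rintro ((i | i) | (((p | i) | (i | i)) | i))
    · exact (g4 i).symm
    · exact g2.trans (g3.symm.trans g5.symm)
    · rfl
    · obtain rfl : i = (0 : Fin 1) := Subsingleton.elim (α := Fin 1) i 0
      exact g2.trans g3.symm
    · exact g1 i
    · exact g2
    · obtain rfl : i = (0 : Fin 1) := Subsingleton.elim (α := Fin 1) i 0
      exact g2.trans (g3.symm.trans (g5.symm.trans g6))
  · intro i
    exact congrArg φ3 (strands_cap_top i)
  · intro i
    induction i using Fin.lastCases with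
    | last => exact congrArg (fun y => φ (.inr y)) (beside_strand_bot_last w)
    | cast i =>
      refine (congrArg (fun y => φ (.inr y)) (beside_strand_bot_castSucc w i)).trans ?_
      exact congrArg φ1 (strands_cup_bot i)

/-- Bending the last strand up and down again. -/
def bendUpDown (m n : ℕ) :
    Move (Hole.hole (m := m) (n := n + 1)).bendUp.bendDown .hole where
  iso := bendUpDownIso
  incl _ _ := rfl
  ext := by
    rintro ((i | i) | (((q | i) | (i | i)) | i))
    exacts [⟨.inr (.inl i), fun _ => rfl⟩, ⟨.inr (.inr (Fin.last n)), fun _ => rfl⟩,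
      q.elim, ⟨.inr (.inr (Fin.last n)), fun _ => rfl⟩, ⟨.inr (.inr i.castSucc), fun _ => rfl⟩,
      ⟨.inr (.inr (Fin.last n)), fun _ => rfl⟩, ⟨.inr (.inr (Fin.last n)), fun _ => rfl⟩]
  ext_symm q := q.elim

end Hole

end SpinNet
end

noncomputable section
namespace SpinNet

/-! ### Closing up strands -/

/-- Zero strands at the right can be omitted. -/
def DIso.besideZero {m n : ℕ} (c : Diag m n) : DIso (c.beside (.strands 0) : Diag m n) c :=
  .ofMaps (a := (c.beside (.strands 0) : Diag m n))
    (Sum.elim (Quotient.mk _) fun i : Fin 0 => i.elim0)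
    (fun p => Quotient.mk (glueConn (K := Empty) c.conn (⊥ : Setoid (Fin 0)) Empty.elim Empty.elim)
      (.inl p))
    (.glue (K := Empty) (s := c.conn) (t := (⊥ : Setoid (Fin 0))) (f := Empty.elim)
      (g := Empty.elim) (.mk _) (.bot _) fun k => k.elim)
    (fun _ _ h => Quotient.sound (glueConn_inl h))
    (by rintro (p | i); exacts [rfl, Fin.elim0 i]) (fun _ => rfl)
    (fun i => congrArg (fun x => Sum.elim (Quotient.mk c.conn) (fun i : Fin 0 => i.elim0)
      (Sum.map c.top id x)) (split_zero i))
    (fun i => congrArg (fun x => Sum.elim (Quotient.mk c.conn) (fun i : Fin 0 => i.elim0)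
      (Sum.map c.bot id x)) (split_zero i))

namespace Hole

variable {m n a b a' b' : ℕ}

/-- An isotopy from a transported diagram. -/
def Move.ofCast {Φ : Hole m n a b} {Ψ : Hole m n a' b'} (ha : a = a') (hb : b = b')
    (E : ∀ c, (Φ.obj c).Components ≃ (Ψ.obj c).Components)
    (top : ∀ c i, E c (Quotient.mk _ ((Φ.obj c).top i)) =
      Quotient.mk _ ((Ψ.obj c).top (Fin.cast ha i)))
    (bot : ∀ c i, E c (Quotient.mk _ ((Φ.obj c).bot i)) =
      Quotient.mk _ ((Ψ.obj c).bot (Fin.cast hb i)))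
    (incl : ∀ c p, E c (Quotient.mk _ (Φ.incl c p)) = Quotient.mk _ (Ψ.incl c p))
    (ext : ∀ q : Φ.Ext, ∃ r, ∀ c,
      E c (Quotient.mk _ (Φ.ext c q)) = Quotient.mk _ (Ψ.frame c r))
    (ext_symm : ∀ q : Ψ.Ext, ∃ r, ∀ c,
      E c (Quotient.mk _ (Φ.frame c r)) = Quotient.mk _ (Ψ.ext c q)) :
    Move (Φ.cast ha hb) Ψ := by
  subst ha hb
  exact ⟨fun c => ⟨E c, top c, bot c⟩, incl, ext, ext_symm⟩

/-- Several strands, as one strand followed by the others. -/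
def strandsEquiv (A : Type) (m : ℕ) : (A ⊕ Fin 1) ⊕ Fin m ≃ A ⊕ Fin (m + 1) :=
  (Equiv.sumAssoc _ _ _).trans (Equiv.sumCongr (.refl _)
    (finSumFinEquiv.trans (finCongr (add_comm 1 m))))

theorem sumMap_split {A : Type} (m : ℕ) (f : Fin a → A) (h : a + 1 + m = a + (m + 1))
    (i : Fin (a + 1 + m)) :
    strandsEquiv A m (Sum.map (fun j => Sum.map f id (finSumFinEquiv.symm j)) id
      (finSumFinEquiv.symm i)) = Sum.map f id (finSumFinEquiv.symm (Fin.cast h i)) := by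
  obtain ⟨j, rfl⟩ := finSumFinEquiv.surjective i
  rw [Equiv.symm_apply_apply]
  rcases j with j | j
  · obtain ⟨j, rfl⟩ := finSumFinEquiv.surjective j
    rw [Sum.map_inl, Equiv.symm_apply_apply]
    rcases j with j | j
    · have : Fin.cast h (finSumFinEquiv (Sum.inl (finSumFinEquiv (Sum.inl j)))) =
        finSumFinEquiv (Sum.inl j) := Fin.ext rfl
      rw [this, Equiv.symm_apply_apply]; rfl
    · have : Fin.cast h (finSumFinEquiv (Sum.inl (finSumFinEquiv (Sum.inr j)))) =
        finSumFinEquiv (Sum.inr (Fin.cast (add_comm 1 m) (finSumFinEquiv (.inl j)))) := Fin.ext rfl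
      rw [this, Equiv.symm_apply_apply]; rfl
  · have : Fin.cast h (finSumFinEquiv (Sum.inr j)) =
        finSumFinEquiv (Sum.inr (Fin.cast (add_comm 1 m) (finSumFinEquiv (.inr j)))) :=
      Fin.ext (add_assoc _ _ _)
    rw [this, Equiv.symm_apply_apply]; rfl

/-- Adding one strand and then `m` strands. -/
def addStrands (a b m : ℕ) : Move
    (((hole (m := a) (n := b)).addStrand.besideR ⟨.strands m, 0⟩).cast (add_assoc a 1 m |>.trans
      (congrArg (a + ·) (add_comm 1 m))) (add_assoc b 1 m |>.trans
      (congrArg (b + ·) (add_comm 1 m))))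
    ((hole (m := a) (n := b)).besideR ⟨.strands (m + 1), 0⟩) :=
  .ofCast _ _ (fun c => compEquiv
      (s := glueConn (K := Empty) (glueConn (K := Empty) c.conn (⊥ : Setoid (Fin 1)) Empty.elim
        Empty.elim) (⊥ : Setoid (Fin m)) Empty.elim Empty.elim)
      (t := glueConn (K := Empty) c.conn (⊥ : Setoid (Fin (m + 1))) Empty.elim Empty.elim)
      (strandsEquiv c.Piece m)
      (fun _ _ h => glueConn_le (strandsEquiv c.Piece m)
        (fun _ _ h => glueConn_le (fun x => strandsEquiv c.Piece m (.inl x))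
          (fun _ _ h => glueConn_inl h) (fun _ _ h => by obtain rfl := h; exact Setoid.refl' _ _)
          (fun k => k.elim) h)
        (fun _ _ h => by obtain rfl := h; exact Setoid.refl' _ _) (fun k => k.elim) h)
      (fun _ _ h => glueConn_le (strandsEquiv c.Piece m).symm
        (fun _ _ h => glueConn_inl (glueConn_inl h))
        (fun _ _ h => by obtain rfl := h; exact Setoid.refl' _ _) (fun k => k.elim) h))
    (fun c i => congrArg (Quotient.mk _) (sumMap_split m c.top _ i))
    (fun c i => congrArg (Quotient.mk _) (sumMap_split m c.bot _ i))
    (fun _ _ => rfl)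
    (by
      rintro ((q | q) | q)
      · exact q.elim
      · exact ⟨.inl (.inr (Fin.cast (add_comm 1 m) (finSumFinEquiv (.inl q)))), fun _ => rfl⟩
      · exact ⟨.inl (.inr (Fin.cast (add_comm 1 m) (finSumFinEquiv (.inr q)))), fun _ => rfl⟩)
    (by
      rintro (q | q)
      · exact q.elim
      · obtain ⟨q, rfl⟩ := (finSumFinEquiv.trans (finCongr (add_comm 1 m))).surjective q
        rcases q with q | q
        · exact ⟨.inl (.inl (.inr q)), fun _ => rfl⟩
        · exact ⟨.inl (.inr q), fun _ => rfl⟩)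

/-- A transport in the middle of a diagram cancels. -/
def Move.castCancel {k : ℕ} (h : a = k) (L : Diag b a) (Φ : Hole m n a a) :
    Move (((Φ.cast h h).stackL ⟨L.cast rfl h, 0⟩).stackR ⟨(L.cast rfl h).flip, 0⟩)
      ((Φ.stackL ⟨L, 0⟩).stackR ⟨L.flip, 0⟩) := by
  subst h
  exact ⟨fun _ => .refl _, fun _ _ => rfl, fun q => ⟨.inl q, fun _ => rfl⟩,
    fun q => ⟨.inl q, fun _ => rfl⟩⟩

/-- Close up the last strand. -/
def closeLast (Φ : Hole m n (a + 1) (a + 1)) : Hole m n a a := Φ.bendDown.stackR (cupR a)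

/-- Close up all strands. -/
def closure (Φ : Hole m n a a) : Hole m n 0 0 :=
  .stackL ⟨.rainbow a, 0⟩ ((Φ.besideR ⟨.strands a, 0⟩).stackR ⟨(Diag.rainbow a).flip, 0⟩)

/-- Strands to the right of a partial closure. -/
def closeLastBeside (Φ : Hole m n (a + 1) (a + 1)) (k : ℕ) :
    Move (Φ.closeLast.besideR ⟨.strands k, 0⟩)
      (((Φ.addStrand.besideR ⟨.strands k, 0⟩).stackL
        ⟨((Diag.strands a).beside .cap : Diag a (a + 2)).beside (.strands k), 0⟩).stackR
        ⟨((Diag.strands a).beside .cup : Diag (a + 2) a).beside (.strands k), 0⟩) :=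
  -- The strands on the right are doubled twice: the interchange law moves first `∪` and then `∩`
  -- past them.
  ((Move.refl Φ.closeLast).besideR (z' := ⟨(Diag.strands k).stack (.strands k), 0 + 0⟩)
    (DIso.leftUnit (.strands k)).symm).trans
  ((Move.interchangeTL Φ.bendDown (cupR a) ⟨.strands k, 0⟩ ⟨.strands k, 0⟩).trans
  (Move.stackR (((Move.refl Φ.bendDown).besideR
      (z' := ⟨(Diag.strands k).stack (.strands k), 0 + 0⟩)
      (DIso.leftUnit (.strands k)).symm).trans
    ((Move.interchangeBL Φ.addStrand (capR a) ⟨.strands k, 0⟩ ⟨.strands k, 0⟩).trans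
      (.stackL (DIso.refl _) (.refl _)))) (DIso.refl _)))

/-- Closing up all strands, one after the other. -/
def closureSucc (a : ℕ) : Move (hole (m := a + 1) (n := a + 1)).closure
    (hole (m := a + 1) (n := a + 1)).closeLast.closure :=
  -- By its recursive definition the rainbow on a + 1 arcs has an innermost `∩` between `a` strands
  -- on either side. If the a + 1 strands on the right are split into one and `a`, this arc and its
  -- reflection close the last strand of the hole, and the outer arcs close the rest. The numbers of
  -- points a + 2 + a and a + 1 + (a + 1) are only propositionally equal, hence the transports,
  -- which cancel in the middle.
  let Y := (hole (m := a + 1) (n := a + 1)).addStrand.besideR (⟨.strands a, 0⟩ : GrDiag a a)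
  have h : a + 2 + a = a + 1 + (a + 1) := by omega
  let W := Y.cast h h
  let L : Diag (a + a) (a + 2 + a) :=
    ((Diag.strands a).beside .cap : Diag a (a + 2)).beside (.strands a)
  let K : Diag (a + a) (a + 1 + (a + 1)) := L.cast rfl h
  (Move.stackL (DIso.refl _) (Move.stackR (addStrands (a + 1) (a + 1) a).symm (DIso.refl _))).trans
  ((Move.assocL (W.stackR ⟨(Diag.rainbow (a + 1)).flip, 0⟩) ⟨.rainbow a, 0⟩ ⟨K, 0⟩).trans
  (Move.stackL (DIso.refl _)
    ((Move.stackL (DIso.refl _)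
      (Move.assocR W ⟨K.flip, 0⟩ ⟨(Diag.rainbow a).flip, 0⟩).symm).trans
    ((Move.assocM (W.stackR ⟨K.flip, 0⟩) ⟨K, 0⟩ ⟨(Diag.rainbow a).flip, 0⟩).symm.trans
    (Move.stackR ((Move.assocM W ⟨K, 0⟩ ⟨K.flip, 0⟩).symm.trans
      ((Move.castCancel h L Y).trans (closeLastBeside hole a).symm)) (DIso.refl _))))))

/-- Closing up zero strands. -/
def closureZero : Move (hole (m := 0) (n := 0)).closure hole where
  iso c := (DIso.leftUnit _).trans ((DIso.rightUnit _).trans (DIso.besideZero c))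
  incl _ _ := rfl
  ext := by
    rintro (q | ((q | q) | q))
    exacts [Fin.elim0 q, q.elim, Fin.elim0 q, Fin.elim0 q]
  ext_symm q := q.elim

end Hole

end SpinNet
end

noncomputable section
namespace SpinNet

/-! ### Morphism spaces -/

section Coyo

variable {C D : Type} [Category.{0} C] [Category.{0} D] [Preadditive C] [Preadditive D]

/-- Morphism spaces out of isomorphic objects. -/
def coyoCongr {X Y : C} (e : X ≅ Y) : coyo X ≅ coyo Y := preadditiveCoyoneda.mapIso e.symm.op

/-- A natural bijection of morphism spaces, given by composition with a fixed morphism. -/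
def coyoIso {X : C} (F : C ⥤ D) [F.Additive] {Y : D} (u : Y ⟶ F.obj X)
    (E : ∀ Z, (X ⟶ Z) ≃ (Y ⟶ F.obj Z)) (hE : ∀ Z f, E Z f = u ≫ F.map f) : coyo X ≅ F ⋙ coyo Y :=
  have hadd : ∀ Z (f g : X ⟶ Z), E Z (f + g) = E Z f + E Z g := fun Z f g => by
    rw [hE, hE, hE, F.map_add, Preadditive.comp_add]
  have hnat : ∀ Z Z' (f : X ⟶ Z) (g : Z ⟶ Z'), E Z' (f ≫ g) = E Z f ≫ F.map g :=
    fun Z Z' f g => by rw [hE, hE, F.map_comp, Category.assoc]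
  NatIso.ofComponents (fun Z => AddEquiv.toAddCommGrpIso (X := (coyo X).obj Z)
    (Y := (F ⋙ coyo Y).obj Z) { E Z with map_add' := hadd Z }) fun {Z Z'} g => by
      ext f
      exact hnat Z Z' f g

theorem comp_comp_comp_comp {C : Type*} [Category* C] {v w x y z : C} (f : v ⟶ w) (g : w ⟶ x)
    (h : x ⟶ y) (k : y ⟶ z) : f ≫ g ≫ h ≫ k = (f ≫ g ≫ h) ≫ k := by simp

/-- Morphism spaces under a fully faithful functor. -/
def coyoFullyFaithful (F : C ⥤ D) [F.Additive] (hF : F.FullyFaithful) (X : C) :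
    coyo X ≅ F ⋙ coyo (F.obj X) :=
  coyoIso F (𝟙 _) (fun _ => hF.homEquiv) (fun _ _ => (Category.id_comp _).symm)

end Coyo

namespace GrDiag

variable {m k n : ℕ}

/-- Stacking a fixed diagram below. -/
abbrev stackR {k n : ℕ} (m : ℕ) (z : GrDiag k n) : GrDiag m k ⥤ GrDiag m n :=
  (stack_biadditive m k n).fixRight z

/-- Stacking a fixed diagram above. -/
abbrev stackL {m k : ℕ} (n : ℕ) (z : GrDiag m k) : GrDiag k n ⥤ GrDiag m n :=
  (stack_biadditive m k n).fixLeft z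

open Bicategory in
/-- A diagram below can be moved to the other side. -/
theorem coyo_stackR {a k n : ℕ} (w : GrDiag a k) (y : Diag k n) :
    Nonempty (coyo (⟨w.diag.stack y, w.shift + y.index⟩ : GrDiag a n) ≅
      stackR a ⟨y.flip, 0⟩ ⋙ coyo w) := by
  obtain ⟨adj⟩ := y.exists_adjunction
  let W : (⟨a⟩ : Pt) ⟶ ⟨k⟩ := w
  -- The bijection of the adjunction inserts the unit below `W` and then stacks `f` with the
  -- reflected diagram. Written as composition with one fixed morphism it is natural and additive.
  refine ⟨coyoIso (stackR a ⟨y.flip, 0⟩) ((ρ_ W).inv ≫ W ◁ adj.unit ≫ (α_ _ _ _).inv)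
    (fun Z => adj.homEquiv₂ (g := W) (h := (Z : (⟨a⟩ : Pt) ⟶ ⟨n⟩))) fun Z f => ?_⟩
  exact comp_comp_comp_comp (C := (⟨a⟩ : Pt) ⟶ ⟨k⟩) _ _ _ _

open Bicategory in
/-- A diagram above can be moved to the other side. -/
theorem coyo_stackL {b k n : ℕ} (w : GrDiag n b) (y : Diag n k) :
    Nonempty (coyo (⟨y.flip.stack w.diag, 0 + w.shift⟩ : GrDiag k b) ≅
      stackL b ⟨y, y.index⟩ ⋙ coyo w) := by
  obtain ⟨adj⟩ := y.exists_adjunction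
  let W : (⟨n⟩ : Pt) ⟶ ⟨b⟩ := w
  refine ⟨coyoIso (stackL b ⟨y, y.index⟩) ((λ_ W).inv ≫ adj.unit ▷ W ≫ (α_ _ _ _).hom)
    (fun Z => (adj.homEquiv₁ (g := W) (h := (Z : (⟨k⟩ : Pt) ⟶ ⟨b⟩))).symm) fun Z f => ?_⟩
  exact comp_comp_comp_comp (C := (⟨n⟩ : Pt) ⟶ ⟨b⟩) _ _ _ _

end GrDiag

namespace Hole

variable {m n : ℕ}

/-- Bending down the last strand is an equivalence. -/
def bendEquivalence (m n : ℕ) : GrDiag (m + 1) n ≌ GrDiag m (n + 1) :=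
  .mk (hole (m := m + 1) (n := n)).bendDown.functor (hole (m := m) (n := n + 1)).bendUp.functor
    ((bendDownUp m n).natIso fun k => by simp [shift, bendDown, bendUp]).symm
    ((bendUpDown m n).natIso fun k => by simp [shift, bendDown, bendUp])

/-- Bending down the last of several strands. -/
def bendDownStrands (m : ℕ) (d : ℤ) :
    (hole (m := m + 1) (n := m + 1)).bendDown.functor.obj ⟨.strands (m + 1), d⟩ ≅
      ⟨(Diag.strands m).stack ((Diag.strands m).beside .cap : Diag m (m + 2)),
        d - 1 + ((Diag.strands m).beside .cap : Diag m (m + 2)).index⟩ :=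
  DIso.iso (((DIso.refl ((Diag.strands m).beside .cap : Diag m (m + 2))).stack
    (DIso.strandsBeside (m + 1) 1)).trans ((DIso.rightUnit _).trans (DIso.leftUnit _).symm))
    (by simp [shift, bendDown, Diag.index])

/-- Bending down the last strand is an equivalence and turns the identity diagram on m + 1 strands
into `m` strands with an extra `∩` below. By adjunction this `∩` moves to the target as `∪`, where
it completes the closure of the last strand; its index 1 accounts for the shift by one. -/
theorem coyo_closeLast (m : ℕ) (d : ℤ) :
    Nonempty (coyo (⟨.strands (m + 1), d⟩ : GrDiag (m + 1) (m + 1)) ≅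
      (hole (m := m + 1) (n := m + 1)).closeLast.functor ⋙ coyo ⟨.strands m, d - 1⟩) := by
  obtain ⟨e⟩ := GrDiag.coyo_stackR (⟨.strands m, d - 1⟩ : GrDiag m m)
    ((Diag.strands m).beside .cap : Diag m (m + 2))
  exact ⟨coyoFullyFaithful (hole (m := m + 1) (n := m + 1)).bendDown.functor
    (bendEquivalence m (m + 1)).fullyFaithfulFunctor _ ≪≫
    Functor.isoWhiskerLeft _ (coyoCongr (bendDownStrands m d) ≪≫ e)⟩

/-- Morphisms out of the identity diagram are morphisms from the empty diagram to the closure. -/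
theorem coyo_closure : ∀ (m : ℕ) (d : ℤ),
    Nonempty (coyo (⟨.strands m, d⟩ : GrDiag m m) ≅
      (hole (m := m) (n := m)).closure.functor ⋙ coyo ⟨.strands 0, d - m⟩)
  | 0, d => ⟨coyoCongr (DIso.iso (.refl _) (by simp)) ≪≫ Functor.isoWhiskerRight
      (closureZero.natIso fun k => by simp [shift, closure]).symm (coyo ⟨.strands 0, d - (0 : ℕ)⟩)⟩
  | m + 1, d => by
    obtain ⟨e⟩ := coyo_closeLast m d
    obtain ⟨e'⟩ := coyo_closure m (d - 1)
    exact ⟨e ≪≫ Functor.isoWhiskerLeft _ (e' ≪≫ Functor.isoWhiskerLeft _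
      (coyoCongr (DIso.iso (.refl _) (by push_cast; ring)))) ≪≫
      Functor.isoWhiskerRight ((closureSucc m).natIso fun k => by
        simp [shift, closure, closeLast, bendDown]).symm (coyo ⟨.strands 0, d - (m + 1 : ℕ)⟩)⟩

end Hole

end SpinNet
end

noncomputable section
namespace SpinNet

/-! ### Components of planar diagrams -/

section Merge

variable {X Y : Type} [Fintype X]

open Classical in
/-- Identifying the ends of edges one after another: each edge lowers the weight by one, so that
weights remain at most one. -/
theorem exists_merge [Finite Y] {I : Type} (R : Setoid X) (h₀ : X → Y)
    (hR : ∀ x y, h₀ x = h₀ y → R x y) (p q : I → X) (hpq : ∀ i, R (p i) (q i)) (w : X → ℤ)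
    (hw : ∀ y, push h₀ w y ≤ 1) (S : Finset I) :
    ∃ h : X → Y, (∀ x y, h₀ x = h₀ y → h x = h y) ∧ (∀ i ∈ S, h (p i) = h (q i)) ∧
      (∀ x y, h x = h y → R x y) ∧
      ∀ y, push h (fun x => w x - ∑ i ∈ S, if q i = x then 1 else 0) y ≤ 1 := by
  have := Fintype.ofFinite Y
  induction S using Finset.induction_on with
  | empty => exact ⟨h₀, fun _ _ h => h, by simp, hR, by simpa using hw⟩
  | insert i S hi ih =>
    obtain ⟨h, h1, h2, h3, h4⟩ := ih
    set w' : X → ℤ := fun x => w x - ∑ i ∈ S, if q i = x then 1 else 0 with hw'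
    have hsum : (fun x => w x - ∑ j ∈ insert i S, if q j = x then 1 else 0) =
        fun x => w' x - if q i = x then 1 else 0 := by
      funext x
      rw [Finset.sum_insert hi, hw']
      ring
    -- The new edge merges the class of `p i` into that of `q i`.
    let φ : Y → Y := fun y => if y = h (p i) then h (q i) else y
    have hδ : ∀ y, push (fun x => φ (h x)) (fun x => if q i = x then 1 else 0) y =
        if y = h (q i) then (1 : ℤ) else 0 := by
      intro y
      have hφ : φ (h (q i)) = h (q i) := by simp only [φ]; split_ifs <;> rfl
      simp only [push]
      rw [Finset.sum_eq_single (q i)]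
      · simp [hφ, eq_comm]
      · intro x _ hx
        simp [hx.symm]
      · simp
    refine ⟨fun x => φ (h x), fun x y e => congrArg φ (h1 x y e), ?_, ?_, ?_⟩
    · intro j hj
      rcases Finset.mem_insert.1 hj with rfl | hj
      · simp only [φ]; split_ifs <;> simp_all
      · exact congrArg φ (h2 j hj)
    · intro x y e
      simp only [φ] at e
      have key : ∀ x, h x = h (p i) → R x (q i) := fun x hx => R.trans (h3 _ _ hx) (hpq i)
      split_ifs at e with hx hy hy
      · exact R.trans (key _ hx) (R.symm (key _ hy))
      · exact R.trans (key _ hx) (h3 _ _ e)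
      · exact R.trans (h3 _ _ e) (R.symm (key _ hy))
      · exact h3 _ _ e
    · intro y
      rw [hsum, push_sub, Pi.sub_apply, hδ, ← push_push]
      have hφ : push φ (push h w') y = ∑ z, if φ z = y then push h w' z else 0 := by
        simp only [push]
      rw [hφ]
      -- If both ends already lie in one class, its weight merely drops. Otherwise two classes of
      -- weight at most one are joined, and subtracting one for the edge leaves at most 1 + 1 - 1.
      by_cases hpqi : h (p i) = h (q i)
      · have : ∀ z, φ z = z := fun z => by simp only [φ]; split_ifs with e; exacts [(e.trans hpqi).symm, rfl]
        simp only [this, Finset.sum_ite_eq', Finset.mem_univ, if_true]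
        have := h4 y
        split_ifs <;> linarith
      · by_cases hy : y = h (q i)
        · subst hy
          have : ∀ z, (if φ z = h (q i) then push h w' z else 0) =
              (if z = h (p i) then push h w' z else 0) + if z = h (q i) then push h w' z else 0 := by
            intro z
            simp only [φ]
            split_ifs <;> simp_all
          simp only [this, Finset.sum_add_distrib, Finset.sum_ite_eq', Finset.mem_univ, if_true]
          linarith [h4 (h (p i)), h4 (h (q i))]
        · have : ∀ z, (if φ z = y then push h w' z else 0) =
              if z = y then (if y = h (p i) then 0 else push h w' z) else 0 := by
            intro z
            simp only [φ]
            split_ifs <;> simp_all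
          simp only [this, Finset.sum_ite_eq', Finset.mem_univ, if_true, if_neg hy]
          have := h4 y
          split_ifs <;> linarith

theorem push_congr_ker {Z : Type} (h : X → Y) (h' : X → Z) (e : ∀ x y, h x = h y ↔ h' x = h' y)
    (w : X → ℤ) (x : X) : push h w (h x) = push h' w (h' x) := by
  simp only [push]
  refine Finset.sum_congr rfl fun y _ => ?_
  by_cases hy : h y = h x
  · rw [if_pos hy, if_pos ((e y x).1 hy)]
  · rw [if_neg hy, if_neg fun h' => hy ((e y x).2 h')]

end Merge

theorem compSum_disjoint_le {A B : Type} [Fintype A] [Fintype B] {s : Setoid A}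
    {t : Setoid B} {χ : A → ℤ} {χ' : B → ℤ} (h1 : ∀ c, compSum s χ c ≤ 1)
    (h2 : ∀ c, compSum t χ' c ≤ 1) (y : Comp s ⊕ Comp t) :
    push (Sum.map (Quotient.mk s) (Quotient.mk t)) (Sum.elim χ χ') y ≤ 1 := by
  rw [push_sum, Pi.add_apply]
  simp only [Sum.map_inl, Sum.map_inr, Sum.elim_inl, Sum.elim_inr]
  rcases y with y | y
  · rw [push_inl_inl, push_inr_inl, add_zero]
    exact h1 y
  · rw [push_inl_inr, push_inr_inr, zero_add]
    exact h2 y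

/-- Gluing along contractible pieces keeps Euler characteristics of components at most one. -/
theorem compSum_glueEuler_le {A B K : Type} [Fintype A] [Fintype B] [Fintype K] {s : Setoid A}
    {t : Setoid B} {f : K → A} {g : K → B} {χ : A → ℤ} {χ' : B → ℤ} (h1 : ∀ c, compSum s χ c ≤ 1)
    (h2 : ∀ c, compSum t χ' c ≤ 1) (c) :
    compSum (glueConn s t f g) (glueEuler χ χ' g fun _ => 1) c ≤ 1 := by
  classical
  -- The classes of the two parts are the vertices of a graph with one edge for each `k`. The
  -- resulting function has exactly the classes of the glued space as fibres, and the weight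
  -- subtracted for `k` sits at `g k`, as in `glueEuler`.
  obtain ⟨h, e1, e2, e3, e4⟩ := exists_merge (X := A ⊕ B) (Y := Comp s ⊕ Comp t) (glueConn s t f g)
    (Sum.map (Quotient.mk s) (Quotient.mk t)) (by
      rintro (x | x) (y | y) e
      · exact glueConn_inl (Quotient.exact (Sum.inl_injective e))
      · simp at e
      · simp at e
      · exact glueConn_inr (Quotient.exact (Sum.inr_injective e)))
    (fun k => .inl (f k)) (fun k => .inr (g k)) (fun k => glueConn_glue k) (Sum.elim χ χ')
    (compSum_disjoint_le h1 h2) Finset.univ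
  have hh : Respects (glueConn s t f g) h :=
    .glue (fun a a' haa => e1 _ _ (congrArg Sum.inl (Quotient.sound haa)))
      (fun b b' hbb => e1 _ _ (congrArg Sum.inr (Quotient.sound hbb)))
      fun k => e2 k (Finset.mem_univ _)
  have hker : ∀ x y, h x = h y ↔ Quotient.mk (glueConn s t f g) x = Quotient.mk _ y := by
    intro x y
    exact ⟨fun e => Quotient.sound (e3 x y e), fun e => hh (Quotient.exact e)⟩
  obtain ⟨x, rfl⟩ := Quotient.exists_rep c
  have hw : glueEuler χ χ' g (fun _ => 1) =
      fun x => Sum.elim χ χ' x - ∑ k, if (Sum.inr (g k) : A ⊕ B) = x then 1 else 0 := by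
    funext x
    rcases x with x | x
    · simp [glueEuler]
    · simp [glueEuler, push]
  unfold compSum
  rw [hw, ← push_congr_ker h _ hker]
  convert e4 (h x)

theorem compSum_bot {A : Type} [Fintype A] (w : A → ℤ) (x : A) :
    compSum (⊥ : Setoid A) w (Quotient.mk _ x) = w x :=
  (push_congr_ker (fun a : A => a) (Quotient.mk ⊥)
    (fun _ _ => ⟨fun e => congrArg _ e, fun e => Quotient.exact e⟩) w x).symm.trans
      (congrFun (push_id w) x)

/-- The Euler characteristic of a component of a planar diagram is at most one. -/
theorem Diag.euler_le : ∀ {m n : ℕ} (a : Diag m n) (c : a.Components),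
    compSum a.conn a.euler c ≤ 1
  | _, _, strands n, c => by
    obtain ⟨x, rfl⟩ := Quotient.exists_rep c
    exact (compSum_bot (A := Fin n) _ x).le
  | _, _, cap, c => by
    obtain ⟨x, rfl⟩ := Quotient.exists_rep c
    exact (compSum_bot (A := Unit) _ x).le
  | _, _, cup, c => by
    obtain ⟨x, rfl⟩ := Quotient.exists_rep c
    exact (compSum_bot (A := Unit) _ x).le
  | _, _, stack a b, c => compSum_glueEuler_le a.euler_le b.euler_le c
  | _, _, beside a b, c => by
    have := compSum_glueEuler_le (K := Empty) (f := Empty.elim) (g := Empty.elim)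
      a.euler_le b.euler_le c
    rwa [Subsingleton.elim (fun _ : Empty => (1 : ℤ)) Empty.elim] at this

namespace Diag

variable {m n : ℕ}

/-- The component containing a boundary point. -/
def bdry (a : Diag m n) : Fin m ⊕ Fin n → a.Components :=
  Sum.elim (fun i => Quotient.mk _ (a.top i)) fun i => Quotient.mk _ (a.bot i)

open Classical in
/-- A boundary point is joined to exactly one other boundary point. -/
theorem card_bdry (a : Diag m n) (x : Fin m ⊕ Fin n) :
    (Finset.univ.filter fun y => a.bdry y = a.bdry x).card = 2 := by
  have key : 2 * compSum a.conn a.euler (a.bdry x) =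
      ((Finset.univ.filter fun y => a.bdry y = a.bdry x).card : ℤ) := by
    refine (congrFun (a.two_smul_push_euler _ (Respects.mk a.conn)) (a.bdry x)).trans ?_
    rw [Finset.card_filter, Fintype.sum_sum_type]
    push_cast
    exact congrArg₂ (fun x y : ℤ => x + y) (Finset.sum_congr rfl fun _ _ => by congr)
      (Finset.sum_congr rfl fun _ _ => by congr)
  -- The number of boundary points on the component is twice an integer which is at most one, and it
  -- is positive; so it is two.
  have h1 := a.euler_le (a.bdry x)
  have h2 : 0 < (Finset.univ.filter fun y => a.bdry y = a.bdry x).card :=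
    Finset.card_pos.2 ⟨x, by simp⟩
  omega

/-- Three boundary points on a component cannot be distinct. -/
theorem bdry_eq_of_ne (a : Diag m n) {x y z : Fin m ⊕ Fin n} (hxy : x ≠ y)
    (h : a.bdry y = a.bdry x) (h' : a.bdry z = a.bdry x) : z = x ∨ z = y := by
  classical
  by_contra! hz
  have h3 : ({x, y, z} : Finset (Fin m ⊕ Fin n)).card = 3 := by
    rw [Finset.card_eq_three]
    exact ⟨x, y, z, hxy, hz.1.symm, hz.2.symm, rfl⟩
  have := Finset.card_le_card (s := {x, y, z})
    (t := Finset.univ.filter fun y => a.bdry y = a.bdry x) (by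
      intro u hu
      simp only [Finset.mem_insert, Finset.mem_singleton] at hu
      rcases hu with rfl | rfl | rfl <;> simp [h, h'])
  rw [a.card_bdry, h3] at this
  omega

theorem exists_partner (a : Diag m n) (x : Fin m ⊕ Fin n) : ∃ y, x ≠ y ∧ a.bdry y = a.bdry x := by
  classical
  obtain ⟨y, hy, hyx⟩ := Finset.exists_mem_ne (by rw [a.card_bdry x]; norm_num) x
  exact ⟨y, hyx.symm, (Finset.mem_filter.1 hy).2⟩

/-- Two diagrams induce the same matching of boundary points if one refines the other. -/
theorem bdry_iff {a b : Diag m n} (h : ∀ x y, x ≠ y → a.bdry y = a.bdry x → b.bdry y = b.bdry x)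
    (x y) : a.bdry y = a.bdry x ↔ b.bdry y = b.bdry x := by
  by_cases hxy : x = y
  · subst hxy; simp
  refine ⟨h x y hxy, fun e => ?_⟩
  obtain ⟨z, hz, hzx⟩ := a.exists_partner x
  rcases b.bdry_eq_of_ne hxy e (h x z hz hzx) with rfl | rfl
  · exact absurd rfl hz
  · exact hzx

end Diag

/-- Both maps identify the same points, so their images are in bijection; as the two finite sets
have the same cardinality, this extends to the complements. Applied to components of diagrams, the
complements are the circles. -/
theorem exists_equiv_of_ker {P X Y : Type} [Finite X] [Finite Y] (f : P → X) (g : P → Y)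
    (h : ∀ x y, f y = f x ↔ g y = g x) (hc : Nat.card X = Nat.card Y) :
    ∃ e : X ≃ Y, ∀ p, e (f p) = g p := by
  have := Fintype.ofFinite X
  have := Fintype.ofFinite Y
  classical
  obtain ⟨e₀⟩ : Nonempty (X ≃ Y) := by
    rw [← Fintype.card_eq, ← Nat.card_eq_fintype_card, ← Nat.card_eq_fintype_card, hc]
  let E : {y // y ∈ Set.range fun p => e₀ (f p)} ≃ {y // y ∈ Set.range g} :=
    (Setoid.quotientKerEquivRange fun p => e₀ (f p)).symm.trans
      ((Quotient.congrRight fun x y => by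
        change e₀ (f x) = e₀ (f y) ↔ g x = g y
        rw [e₀.apply_eq_iff_eq]; exact h y x).trans (Setoid.quotientKerEquivRange g))
  have hE : ∀ p, E ⟨e₀ (f p), ⟨p, rfl⟩⟩ = ⟨g p, ⟨p, rfl⟩⟩ := by
    intro p
    have : (Setoid.quotientKerEquivRange fun p => e₀ (f p)).symm ⟨e₀ (f p), ⟨p, rfl⟩⟩ =
        Quotient.mk _ p := by
      rw [Equiv.symm_apply_eq]; rfl
    simp only [E, Equiv.trans_apply, this]
    rfl
  refine ⟨e₀.trans E.extendSubtype, fun p => ?_⟩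
  exact (E.extendSubtype_apply_of_mem (e₀ (f p)) ⟨p, rfl⟩).trans (congrArg Subtype.val (hE p))

/-- Planar diagrams with the same matching of boundary points and the same number of components
are isotopic. -/
theorem DIso.exists_of_bdry {m n : ℕ} {a b : Diag m n}
    (h : ∀ x y, a.bdry y = a.bdry x ↔ b.bdry y = b.bdry x)
    (hc : Nat.card a.Components = Nat.card b.Components) : Nonempty (DIso a b) := by
  obtain ⟨e, he⟩ := exists_equiv_of_ker a.bdry b.bdry h hc
  exact ⟨⟨e, fun i => he (.inl i), fun i => he (.inr i)⟩⟩

/-! ### Returns -/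

section Words

variable {C : Type}

open Classical in
/-- Multiply a reduced word by a letter of order two. -/
def actLetter (x : C) : List C → List C
  | [] => [x]
  | y :: l => if x = y then l else x :: y :: l

theorem actLetter_isChain {l : List C} (hl : l.IsChain (· ≠ ·)) (x : C) :
    (actLetter x l).IsChain (· ≠ ·) := by
  cases l with
  | nil => simp [actLetter]
  | cons y l =>
    simp only [actLetter]
    split_ifs with h
    · exact hl.tail
    · exact List.IsChain.cons_cons h hl

/-- The letters generate a free product of groups of order two, which acts on its reduced words;
this is the relation that each letter squares to the identity. -/
theorem actLetter_actLetter {l : List C} (hl : l.IsChain (· ≠ ·)) (x : C) :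
    actLetter x (actLetter x l) = l := by
  cases l with
  | nil => simp [actLetter]
  | cons y l =>
    by_cases h : x = y
    · subst h
      cases l with
      | nil => simp [actLetter]
      | cons z l =>
        have : x ≠ z := by simpa using (List.isChain_cons_cons.1 hl).1
        simp [actLetter, this]
    · simp [actLetter, h]

/-- Multiply a reduced word by a word. -/
def actWord (w l : List C) : List C := w.foldr actLetter l

theorem actWord_isChain {l : List C} (hl : l.IsChain (· ≠ ·)) :
    ∀ w : List C, (actWord w l).IsChain (· ≠ ·)
  | [] => hl
  | x :: w => actLetter_isChain (actWord_isChain hl w) x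

theorem actWord_nil : ∀ {w : List C}, w.IsChain (· ≠ ·) → actWord w [] = w
  | [], _ => rfl
  | [x], _ => rfl
  | x :: y :: w, h => by
    have h' := List.isChain_cons_cons.1 h
    have := actWord_nil h'.2
    change actLetter x (actWord (y :: w) []) = _
    rw [this]
    simp [actLetter, h'.1]

theorem length_actLetter_le (x : C) (l : List C) : (actLetter x l).length ≤ l.length + 1 := by
  cases l with
  | nil => simp [actLetter]
  | cons y l =>
    simp only [actLetter]
    split_ifs
    · simp only [List.length_cons]; omega
    · simp

/-- A letter lengthens a reduced word by at most one. If the outcome is at least as long as the word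
that was multiplied, no cancellation can have occurred. -/
theorem actWord_eq_self : ∀ {w : List C}, w.length ≤ (actWord w []).length → actWord w [] = w
  | [], _ => rfl
  | x :: w, h => by
    have h1 := length_actLetter_le x (actWord w [])
    have h2 : w.length ≤ (actWord w []).length := by
      have : w.length + 1 ≤ (actLetter x (actWord w [])).length := h
      omega
    have e := actWord_eq_self h2
    change actLetter x (actWord w []) = _
    have h3 : w.length + 1 ≤ (actLetter x w).length := by
      have : w.length + 1 ≤ (actLetter x (actWord w [])).length := h
      rwa [e] at this
    rw [e]
    cases w with
    | nil => rfl
    | cons y w =>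
      simp only [actLetter] at h3 ⊢
      split_ifs at h3 ⊢
      · simp at h3
      · rfl

/-- A reduced word is its own product; a word of no greater length with the same product must then
be reduced as well, and equal to it. -/
theorem eq_of_actWord_eq {v w : List C} (hv : v.IsChain (· ≠ ·))
    (h : actWord v [] = actWord w []) (hl : w.length ≤ v.length) : v = w := by
  rw [actWord_nil hv] at h
  rwa [actWord_eq_self (by rwa [← h])] at h

theorem actWord_append (v w l : List C) : actWord (v ++ w) l = actWord v (actWord w l) :=
  List.foldr_append

theorem ofFn_sumMap {A B : Type} {m n : ℕ} (φ : A ⊕ B → C) (f : Fin m → A) (g : Fin n → B) :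
    List.ofFn (fun i => φ (Sum.map f g (finSumFinEquiv.symm i))) =
      List.ofFn (fun i => φ (.inl (f i))) ++ List.ofFn fun i => φ (.inr (g i)) := by
  rw [List.ofFn_add]
  refine congrArg₂ _ (congrArg _ (funext fun i => ?_)) (congrArg _ (funext fun i => ?_))
  · exact congrArg (fun x => φ (Sum.map f g x)) (finSumFinEquiv_symm_apply_castAdd i)
  · exact congrArg (fun x => φ (Sum.map f g x)) (finSumFinEquiv_symm_apply_natAdd i)

/-- The words read off the upper and the lower boundary points of a planar diagram agree. -/
theorem Diag.actWord_top : ∀ {m n : ℕ} (a : Diag m n) (h : a.Piece → C), Respects a.conn h →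
    ∀ {l : List C}, l.IsChain (· ≠ ·) → actWord (List.ofFn fun i => h (a.top i)) l =
      actWord (List.ofFn fun i => h (a.bot i)) l
  | _, _, strands _, _, _, _, _ => rfl
  -- The two ends of an arc give the same letter twice, which cancels, and the other side of the arc
  -- contributes the empty word.
  | _, _, cap, h, _, l, hl => by
    refine (actLetter_actLetter hl (h ())).symm.trans ?_
    simp [List.ofFn_succ, actWord, bot]
  | _, _, cup, h, _, l, hl => by
    refine Eq.trans ?_ (actLetter_actLetter hl (h ()))
    simp [List.ofFn_succ, actWord, top]
  | _, _, stack a b, h, hh, l, hl => by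
    refine (a.actWord_top _ hh.inl hl).trans (Eq.trans ?_ (b.actWord_top _ hh.inr hl))
    exact congrArg (fun w => actWord (List.ofFn w) l) (funext fun k => hh.glued k)
  | _, _, beside a b, h, hh, l, hl => by
    refine (congrArg (actWord · l) (ofFn_sumMap h a.top b.top)).trans
      (Eq.trans ?_ (congrArg (actWord · l) (ofFn_sumMap h a.bot b.bot)).symm)
    rw [actWord_append, actWord_append, b.actWord_top _ hh.inr hl]
    exact a.actWord_top _ hh.inl (actWord_isChain hl _)

end Words

theorem ofFn_isChain_or {C : Type} {m : ℕ} (f : Fin m → C) :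
    (List.ofFn f).IsChain (· ≠ ·) ∨ ∃ (i j : ℕ) (h : i + 2 + j = m),
      f ⟨i, by omega⟩ = f ⟨i + 1, by omega⟩ := by
  by_cases H : (List.ofFn f).IsChain (· ≠ ·)
  · exact .inl H
  · right
    rw [List.isChain_iff_getElem] at H
    push Not at H
    obtain ⟨i, hi, e⟩ := H
    simp only [List.length_ofFn] at hi
    exact ⟨i, m - i - 2, by omega, by simpa using e⟩

namespace Diag

variable {m n : ℕ}

/-- The diagram has an arc joining two adjacent upper boundary points. -/
def TopReturn (a : Diag m n) : Prop := ∃ (i j : ℕ) (h : i + 2 + j = m),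
  a.conn (a.top ⟨i, by omega⟩) (a.top ⟨i + 1, by omega⟩)

/-- The diagram has an arc joining two adjacent lower boundary points. -/
def BotReturn (a : Diag m n) : Prop := ∃ (i j : ℕ) (h : i + 2 + j = n),
  a.conn (a.bot ⟨i, by omega⟩) (a.bot ⟨i + 1, by omega⟩)

/-- The boundary points are joined by vertical strands. -/
def IsVertical (a : Diag m n) : Prop := m = n ∧ ∀ (i : ℕ) (h : i < m) (h' : i < n),
  a.conn (a.top ⟨i, h⟩) (a.bot ⟨i, h'⟩)

theorem isVertical_of_ofFn_eq (a : Diag m n)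
    (h : (List.ofFn fun i => (Quotient.mk a.conn (a.top i))) =
      List.ofFn fun i => Quotient.mk a.conn (a.bot i)) : a.IsVertical := by
  refine ⟨by simpa using congrArg List.length h, fun i hm hn => Quotient.exact ?_⟩
  have := congrArg (fun l => l[i]?) h
  simpa [hm, hn] using this

/-- If no two adjacent upper points are joined, the word of components along the top is reduced. It
represents the same group element as the word along the bottom, which is not longer, so the two
words coincide letter by letter. -/
theorem topReturn_or (a : Diag m n) (h : n ≤ m) : a.TopReturn ∨ a.IsVertical := by
  rcases ofFn_isChain_or fun i => Quotient.mk a.conn (a.top i) with H | ⟨i, j, hij, e⟩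
  · exact .inr (a.isVertical_of_ofFn_eq (eq_of_actWord_eq H
      (a.actWord_top _ (.mk _) List.isChain_nil) (by simpa)))
  · exact .inl ⟨i, j, hij, Quotient.exact e⟩

theorem botReturn_or (a : Diag m n) (h : m ≤ n) : a.BotReturn ∨ a.IsVertical := by
  rcases ofFn_isChain_or fun i => Quotient.mk a.conn (a.bot i) with H | ⟨i, j, hij, e⟩
  · exact .inr (a.isVertical_of_ofFn_eq (eq_of_actWord_eq H
      (a.actWord_top _ (.mk _) List.isChain_nil).symm (by simpa)).symm)
  · exact .inl ⟨i, j, hij, Quotient.exact e⟩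

end Diag

end SpinNet
end

noncomputable section
namespace SpinNet

/-! ### Circles -/

/-- The components of a disjoint union. -/
def compDisjoint {A B : Type} (s : Setoid A) (t : Setoid B) :
    Comp (glueConn (K := Empty) s t Empty.elim Empty.elim) ≃ Comp s ⊕ Comp t where
  toFun := Respects.desc (h := Sum.elim (fun x => Sum.inl (Quotient.mk s x))
    fun x => Sum.inr (Quotient.mk t x)) (.glue (fun _ _ h => congrArg Sum.inl (Quotient.sound h))
      (fun _ _ h => congrArg Sum.inr (Quotient.sound h)) fun k => k.elim)
  invFun := Sum.elim (glueInl s t Empty.elim Empty.elim) (glueInr s t Empty.elim Empty.elim)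
  left_inv := by rintro ⟨x | x⟩ <;> rfl
  right_inv := by
    rintro (x | x)
    · obtain ⟨x, rfl⟩ := Quotient.exists_rep x; rfl
    · obtain ⟨x, rfl⟩ := Quotient.exists_rep x; rfl

namespace Diag

variable {m n : ℕ}

/-- Add a circle at the right. -/
def addCircle (a : Diag m n) : Diag m n := (a.beside circle : Diag (m + 0) (n + 0))

/-- Add several circles at the right. -/
def addCircles (a : Diag m n) : ℕ → Diag m n
  | 0 => a
  | N + 1 => (a.addCircles N).addCircle

instance : Subsingleton circle.Components :=
  ⟨by
    have key : ∀ x : Unit ⊕ Unit,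
        glueConn (⊥ : Setoid Unit) (⊥ : Setoid Unit) cap.bot cup.top x (.inl ()) := by
      rintro (x | x)
      · exact Setoid.refl' _ _
      · exact Setoid.symm' _ (glueConn_glue (f := cap.bot) (g := cup.top) 0)
    rintro ⟨x⟩ ⟨y⟩
    exact Quotient.sound (Setoid.trans' _ (key x) (Setoid.symm' _ (key y)))⟩

theorem card_components_addCircle (a : Diag m n) :
    Nat.card a.addCircle.Components = Nat.card a.Components + 1 := by
  have : Nat.card circle.Components = 1 :=
    Nat.card_eq_one_iff_unique.2 ⟨inferInstance, ⟨Quotient.mk _ (Sum.inl () : Unit ⊕ Unit)⟩⟩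
  rw [← this, ← Nat.card_sum]
  exact Nat.card_congr (compDisjoint a.conn circle.conn)

theorem compDisjoint_bdry (a : Diag m n) (x : Fin m ⊕ Fin n) :
    compDisjoint a.conn circle.conn (a.addCircle.bdry x) = .inl (a.bdry x) := by
  rcases x with i | i
  · exact congrArg (fun x => compDisjoint a.conn circle.conn (Quotient.mk _
      (Sum.map a.top circle.top x))) (split_zero i)
  · exact congrArg (fun x => compDisjoint a.conn circle.conn (Quotient.mk _
      (Sum.map a.bot circle.bot x))) (split_zero i)

theorem bdry_addCircle (a : Diag m n) (x y : Fin m ⊕ Fin n) :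
    a.addCircle.bdry y = a.addCircle.bdry x ↔ a.bdry y = a.bdry x :=
  ⟨fun e => Sum.inl_injective ((compDisjoint_bdry a y).symm.trans
      ((congrArg _ e).trans (compDisjoint_bdry a x))),
    fun e => (compDisjoint a.conn circle.conn).injective ((compDisjoint_bdry a y).trans
      ((congrArg _ e).trans (compDisjoint_bdry a x).symm))⟩

theorem card_components_addCircles (a : Diag m n) : ∀ N,
    Nat.card (a.addCircles N).Components = Nat.card a.Components + N
  | 0 => rfl
  | N + 1 => by
    rw [addCircles, card_components_addCircle, card_components_addCircles a N, add_assoc]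

theorem bdry_addCircles (a : Diag m n) (x y : Fin m ⊕ Fin n) : ∀ N,
    (a.addCircles N).bdry y = (a.addCircles N).bdry x ↔ a.bdry y = a.bdry x
  | 0 => .rfl
  | N + 1 => (bdry_addCircle _ _ _).trans (bdry_addCircles a x y N)

end Diag

namespace DIso

variable {m k n : ℕ}

/-- Circles can be moved into the upper diagram. -/
def stackAddCircle (a : Diag m k) (b : Diag k n) :
    DIso (a.stack b).addCircle (a.addCircle.stack b) :=
  (((refl (a.stack b)).beside (rightUnit Diag.circle).symm).trans
    (interchange a b Diag.circle (.strands 0))).trans ((refl a.addCircle).stack (besideZero b))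

/-- Circles can be moved into the lower diagram. -/
def addCircleStack (a : Diag m k) (b : Diag k n) :
    DIso (a.stack b).addCircle (a.stack b.addCircle) :=
  (((refl (a.stack b)).beside (leftUnit Diag.circle).symm).trans
    (interchange a b (.strands 0) Diag.circle)).trans ((besideZero a).stack (refl b.addCircle))

/-- Diagrams with the same matching of boundary points differ at most in their number of circles.
Adding to each as many circles as the other has components makes the numbers of components equal,
without having to count circles. -/
theorem exists_addCircles {a b : Diag m n}
    (h : ∀ x y, a.bdry y = a.bdry x ↔ b.bdry y = b.bdry x) :
    Nonempty (DIso (a.addCircles (Nat.card b.Components)) (b.addCircles (Nat.card a.Components))) :=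
  exists_of_bdry (fun x y => (a.bdry_addCircles x y _).trans
    ((h x y).trans (b.bdry_addCircles x y _).symm)) (by
      rw [Diag.card_components_addCircles, Diag.card_components_addCircles, add_comm])

theorem exists_stack_addCircles (a : Diag m k) (b : Diag k n) : ∀ N,
    ∃ a' : Diag m k, Nonempty (DIso ((a.stack b).addCircles N) (a'.stack b))
  | 0 => ⟨a, ⟨refl _⟩⟩
  | N + 1 => by
    obtain ⟨a', ⟨e⟩⟩ := exists_stack_addCircles a b N
    exact ⟨a'.addCircle, ⟨(e.beside (refl Diag.circle)).trans (stackAddCircle a' b)⟩⟩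

theorem exists_addCircles_stack (a : Diag m k) (b : Diag k n) : ∀ N,
    ∃ b' : Diag k n, Nonempty (DIso ((a.stack b).addCircles N) (a.stack b'))
  | 0 => ⟨b, ⟨refl _⟩⟩
  | N + 1 => by
    obtain ⟨b', ⟨e⟩⟩ := exists_addCircles_stack a b N
    exact ⟨b'.addCircle, ⟨(e.beside (refl Diag.circle)).trans (addCircleStack a b')⟩⟩

end DIso

namespace GrDiag

variable {m k n : ℕ}

/-- The empty diagram is a direct summand of a circle: create a sphere with a dot. -/
def retractCircle : Retract (⟨.strands 0, 0⟩ : GrDiag 0 0) ⟨.circle, 1⟩ where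
  i := Pt.ofCob .birth rfl
  r := Pt.ofCob (.comp (.dot Diag.circle (Sum.inl () : Unit ⊕ Unit)) .death) rfl
  retract := Subtype.ext (by
    refine (compHom_cls _ _).trans (Eq.trans ?_ ((Submodule.Quotient.eq _).2
      (Null.sphere_dot (Sum.inl () : Unit ⊕ Unit))))
    exact (cls_eq_of_homeo (Surface.Homeo.assoc _ _ _)).symm)

theorem nonempty_retract_addCircle (a : Diag m n) (k : ℤ) :
    Nonempty (Retract (⟨a, k⟩ : GrDiag m n) ⟨a.addCircle, k + 1⟩) :=
  ⟨(Retract.ofIso (DIso.iso (DIso.besideZero a).symm (by simp))).trans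
    (retractCircle.map ((beside_biadditive m n 0 0).fixLeft ⟨a, k⟩))⟩

theorem nonempty_retract_addCircles (a : Diag m n) (k : ℤ) : ∀ N : ℕ,
    Nonempty (Retract (⟨a, k⟩ : GrDiag m n) ⟨a.addCircles N, k + N⟩)
  | 0 => ⟨Retract.ofIso (DIso.iso (.refl a) (by simp))⟩
  | N + 1 => by
    obtain ⟨r⟩ := nonempty_retract_addCircles a k N
    obtain ⟨r'⟩ := nonempty_retract_addCircle (a.addCircles N) (k + N)
    exact ⟨(r.trans r').trans (Retract.ofIso (DIso.iso (.refl _) (by push_cast; ring)))⟩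

end GrDiag

/-! ### Turnbacks -/

namespace Diag

variable {m n m' n' : ℕ}

theorem beside_top_castAdd (a : Diag m n) (b : Diag m' n') (k : Fin m) :
    (a.beside b).top (Fin.castAdd m' k) = (Sum.inl (a.top k) : a.Piece ⊕ b.Piece) :=
  congrArg (Sum.map a.top b.top) (finSumFinEquiv_symm_apply_castAdd k)

theorem beside_top_natAdd (a : Diag m n) (b : Diag m' n') (k : Fin m') :
    (a.beside b).top (Fin.natAdd m k) = (Sum.inr (b.top k) : a.Piece ⊕ b.Piece) :=
  congrArg (Sum.map a.top b.top) (finSumFinEquiv_symm_apply_natAdd k)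

theorem beside_bot_castAdd (a : Diag m n) (b : Diag m' n') (k : Fin n) :
    (a.beside b).bot (Fin.castAdd n' k) = (Sum.inl (a.bot k) : a.Piece ⊕ b.Piece) :=
  congrArg (Sum.map a.bot b.bot) (finSumFinEquiv_symm_apply_castAdd k)

theorem beside_bot_natAdd (a : Diag m n) (b : Diag m' n') (k : Fin n') :
    (a.beside b).bot (Fin.natAdd n k) = (Sum.inr (b.bot k) : a.Piece ⊕ b.Piece) :=
  congrArg (Sum.map a.bot b.bot) (finSumFinEquiv_symm_apply_natAdd k)

/-- `i` strands, a turnback, and `j` strands. -/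
def turnAt (i j : ℕ) : Diag (i + 2 + j) (i + 2 + j) := (capAt i j).flip.stack (capAt i j)

theorem turnAt_top_bot (i j : ℕ) (k : Fin (i + 2 + j)) (h : k.1 ≠ i) (h' : k.1 ≠ i + 1) :
    (turnAt i j).conn ((turnAt i j).top k) ((turnAt i j).bot k) := by
  have key : ∀ l : Fin (i + 0 + j), (capAt i j).flip.top k = (capAt i j).flip.bot l →
      (capAt i j).top l = (capAt i j).bot k →
      (turnAt i j).conn ((turnAt i j).top k) ((turnAt i j).bot k) := by
    intro l h1 h2
    change glueConn _ _ (capAt i j).flip.bot (capAt i j).top (.inl ((capAt i j).flip.top k))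
      (.inr ((capAt i j).bot k))
    rw [h1, ← h2]
    exact glueConn_glue l
  induction k using Fin.addCases with
  | left k =>
    induction k using Fin.addCases with
    | left k =>
      refine key (Fin.castAdd j (Fin.castAdd 0 k)) ?_ ?_
      · exact (beside_top_castAdd _ _ _).trans ((congrArg Sum.inl ((beside_top_castAdd
          (strands i) cup k).trans (beside_bot_castAdd (strands i) cup k).symm)).trans
          (beside_bot_castAdd _ _ _).symm)
      · exact (beside_top_castAdd _ _ _).trans ((congrArg Sum.inl ((beside_top_castAdd
          (strands i) cap k).trans (beside_bot_castAdd (strands i) cap k).symm)).trans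
          (beside_bot_castAdd _ _ _).symm)
    | right k =>
      simp only [Fin.val_castAdd, Fin.val_natAdd] at h h'
      omega
  | right k =>
    refine key (Fin.natAdd (i + 0) k) ?_ ?_
    · exact (beside_top_natAdd _ _ _).trans (beside_bot_natAdd _ _ _).symm
    · exact (beside_top_natAdd _ _ _).trans (beside_bot_natAdd _ _ _).symm

theorem turnAt_top (i j : ℕ) (h : i < i + 2 + j) (h' : i + 1 < i + 2 + j) :
    (turnAt i j).top ⟨i, h⟩ = (turnAt i j).top ⟨i + 1, h'⟩ := by
  have key : ∀ t : Fin 2, (capAt i j).flip.top (Fin.castAdd j (Fin.natAdd i t)) =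
      (Sum.inl (Sum.inr () : Fin i ⊕ Unit) : (Fin i ⊕ Unit) ⊕ Fin j) := fun t =>
    (beside_top_castAdd _ _ _).trans (congrArg Sum.inl (beside_top_natAdd (strands i) cup t))
  exact congrArg Sum.inl ((key 0).trans (key 1).symm)

theorem turnAt_bot (i j : ℕ) (h : i < i + 2 + j) (h' : i + 1 < i + 2 + j) :
    (turnAt i j).bot ⟨i, h⟩ = (turnAt i j).bot ⟨i + 1, h'⟩ := by
  have key : ∀ t : Fin 2, (capAt i j).bot (Fin.castAdd j (Fin.natAdd i t)) =
      (Sum.inl (Sum.inr () : Fin i ⊕ Unit) : (Fin i ⊕ Unit) ⊕ Fin j) := fun t =>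
    (beside_bot_castAdd _ _ _).trans (congrArg Sum.inl (beside_bot_natAdd (strands i) cap t))
  exact congrArg Sum.inr ((key 0).trans (key 1).symm)

/-- Inserting a turnback next to an arc creates a circle. -/
theorem bdry_turnAt_stack {i j : ℕ} (a : Diag (i + 2 + j) n)
    (h : a.conn (a.top ⟨i, by omega⟩) (a.top ⟨i + 1, by omega⟩)) (x y : Fin (i + 2 + j) ⊕ Fin n) :
    a.bdry y = a.bdry x ↔ ((turnAt i j).stack a).bdry y = ((turnAt i j).stack a).bdry x := by
  let p : Fin (i + 2 + j) ⊕ Fin n := .inl ⟨i, by omega⟩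
  let q : Fin (i + 2 + j) ⊕ Fin n := .inl ⟨i + 1, by omega⟩
  have hpq : p ≠ q := by simp [p, q]
  have hqp : a.bdry q = a.bdry p := (Quotient.sound h).symm
  have hqp' : ((turnAt i j).stack a).bdry q = ((turnAt i j).stack a).bdry p :=
    congrArg (fun x => Quotient.mk ((turnAt i j).stack a).conn (Sum.inl x))
      (turnAt_top i j (by omega) (by omega)).symm
  -- The component of the return contains only the boundary points `p` and `q`, which the upper arc
  -- of the turnback joins again. Every other boundary point is unaffected, as it passes the
  -- turnback along a vertical strand.
  have hmem : ∀ x, a.bdry x = a.bdry p → ((turnAt i j).stack a).bdry x =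
      ((turnAt i j).stack a).bdry p := by
    intro x hx
    rcases a.bdry_eq_of_ne hpq hqp hx with rfl | rfl
    · rfl
    · exact hqp'
  have hout : ∀ x, a.bdry x ≠ a.bdry p → ((turnAt i j).stack a).bdry x =
      glueInr (turnAt i j).conn a.conn (turnAt i j).bot a.top (a.bdry x) := by
    intro x hx
    rcases x with k | k
    · refine Quotient.sound (Setoid.trans' _ (glueConn_inl (turnAt_top_bot i j k ?_ ?_))
        (glueConn_glue (f := (turnAt i j).bot) (g := a.top) k))
      · exact fun hk => hx (congrArg (fun k => a.bdry (.inl k)) (Fin.ext hk))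
      · exact fun hk => hx ((congrArg (fun k => a.bdry (.inl k)) (Fin.ext hk)).trans hqp)
    · rfl
  refine bdry_iff (fun x y _ e => ?_) x y
  by_cases hx : a.bdry x = a.bdry p
  · rw [hmem x hx, hmem y (e.trans hx)]
  · rw [hout x hx, hout y (by rwa [e]), e]

/-- The mirror image of `bdry_turnAt_stack`. -/
theorem bdry_stack_turnAt {i j : ℕ} (a : Diag m (i + 2 + j))
    (h : a.conn (a.bot ⟨i, by omega⟩) (a.bot ⟨i + 1, by omega⟩)) (x y : Fin m ⊕ Fin (i + 2 + j)) :
    a.bdry y = a.bdry x ↔ (a.stack (turnAt i j)).bdry y = (a.stack (turnAt i j)).bdry x := by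
  let p : Fin m ⊕ Fin (i + 2 + j) := .inr ⟨i, by omega⟩
  let q : Fin m ⊕ Fin (i + 2 + j) := .inr ⟨i + 1, by omega⟩
  have hpq : p ≠ q := by simp [p, q]
  have hqp : a.bdry q = a.bdry p := (Quotient.sound h).symm
  have hqp' : (a.stack (turnAt i j)).bdry q = (a.stack (turnAt i j)).bdry p :=
    congrArg (fun x => Quotient.mk (a.stack (turnAt i j)).conn (Sum.inr x))
      (turnAt_bot i j (by omega) (by omega)).symm
  have hmem : ∀ x, a.bdry x = a.bdry p → (a.stack (turnAt i j)).bdry x =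
      (a.stack (turnAt i j)).bdry p := by
    intro x hx
    rcases a.bdry_eq_of_ne hpq hqp hx with rfl | rfl
    · rfl
    · exact hqp'
  have hout : ∀ x, a.bdry x ≠ a.bdry p → (a.stack (turnAt i j)).bdry x =
      glueInl a.conn (turnAt i j).conn a.bot (turnAt i j).top (a.bdry x) := by
    intro x hx
    rcases x with k | k
    · rfl
    · refine Quotient.sound (Setoid.symm' _ (Setoid.trans' _
        (glueConn_glue (f := a.bot) (g := (turnAt i j).top) k)
        (glueConn_inr (turnAt_top_bot i j k ?_ ?_))))
      · exact fun hk => hx (congrArg (fun k => a.bdry (.inr k)) (Fin.ext hk))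
      · exact fun hk => hx ((congrArg (fun k => a.bdry (.inr k)) (Fin.ext hk)).trans hqp)
  refine bdry_iff (fun x y _ e => ?_) x y
  by_cases hx : a.bdry x = a.bdry p
  · rw [hmem x hx, hmem y (e.trans hx)]
  · rw [hout x hx, hout y (by rwa [e]), e]

end Diag

namespace GrDiag

variable {m n : ℕ}

/-- A diagram with a return at the top factors through fewer points. -/
theorem exists_retract_of_topReturn (y : GrDiag m n) (h : y.diag.TopReturn) :
    ∃ (i j : ℕ) (hij : i + 2 + j = m) (s : GrDiag (i + 0 + j) n),
      Nonempty (Retract y ((stackL n ⟨((Diag.capAt i j).cast rfl hij).flip, 0⟩).obj s)) := by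
  obtain ⟨i, j, rfl, hc⟩ := h
  obtain ⟨y, k⟩ := y
  -- The diagram and its composite with a turnback have the same matching, so they become isotopic
  -- after adding circles. The diagram is a summand of itself with circles, and on the other side
  -- the circles are absorbed into the lower factor; the upper half of the turnback then splits off.
  obtain ⟨e⟩ := DIso.exists_addCircles (y.bdry_turnAt_stack hc)
  obtain ⟨r⟩ := nonempty_retract_addCircles y k (Nat.card ((Diag.turnAt i j).stack y).Components)
  obtain ⟨s, ⟨e'⟩⟩ := DIso.exists_addCircles_stack (Diag.turnAt i j) y (Nat.card y.Components)
  refine ⟨i, j, rfl, ⟨(Diag.capAt i j).stack s, _⟩, ⟨r.trans (Retract.ofIso (DIso.iso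
    ((e.trans e').trans (DIso.assoc (Diag.capAt i j).flip (Diag.capAt i j) s))
    (zero_add _).symm))⟩⟩

/-- A diagram with a return at the bottom factors through fewer points. -/
theorem exists_retract_of_botReturn (y : GrDiag m n) (h : y.diag.BotReturn) :
    ∃ (i j : ℕ) (hij : i + 2 + j = n) (s : GrDiag m (i + 0 + j)),
      Nonempty (Retract y ((stackR m ⟨(Diag.capAt i j).cast rfl hij, 0⟩).obj s)) := by
  obtain ⟨i, j, rfl, hc⟩ := h
  obtain ⟨y, k⟩ := y
  obtain ⟨e⟩ := DIso.exists_addCircles (y.bdry_stack_turnAt hc)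
  obtain ⟨r⟩ := nonempty_retract_addCircles y k (Nat.card (y.stack (Diag.turnAt i j)).Components)
  obtain ⟨s, ⟨e'⟩⟩ := DIso.exists_stack_addCircles y (Diag.turnAt i j) (Nat.card y.Components)
  refine ⟨i, j, rfl, ⟨s.stack (Diag.capAt i j).flip, _⟩, ⟨r.trans (Retract.ofIso (DIso.iso
    ((e.trans e').trans (DIso.assoc s (Diag.capAt i j).flip (Diag.capAt i j)).symm)
    (add_zero _).symm))⟩⟩

/-- The identity diagram is a direct summand of a diagram with vertical strands only. -/
theorem exists_retract_of_isVertical (y : GrDiag n n) (h : y.diag.IsVertical) :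
    ∃ k, Nonempty (Retract (⟨.strands n, k⟩ : GrDiag n n) y) := by
  obtain ⟨y, l⟩ := y
  have hb : ∀ x x', (Diag.strands n).bdry x' = (Diag.strands n).bdry x ↔
      y.bdry x' = y.bdry x := by
    have hs : ∀ x, y.bdry x = Quotient.mk _ (y.top (Sum.elim id id x)) := by
      rintro (i | i)
      · rfl
      · exact (Quotient.sound (h.2 i.1 i.2 i.2)).symm
    have hs' : ∀ x, (Diag.strands n).bdry x = Quotient.mk _ (Sum.elim id id x : Fin n) := by
      rintro (i | i) <;> rfl
    refine Diag.bdry_iff fun x x' _ e => ?_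
    rw [hs', hs'] at e
    rw [hs, hs]
    exact congrArg (fun i => Quotient.mk _ (y.top i)) (Quotient.exact (s := (⊥ : Setoid (Fin n))) e)
  have hinj : Function.Injective fun c : (Diag.strands n).Components =>
      y.bdry (.inl (Quotient.out (s := (⊥ : Setoid (Fin n))) c)) := by
    intro c c' e
    have := (hb _ _).2 e
    have hout : ∀ c : (Diag.strands n).Components,
        (Diag.strands n).bdry (.inl (Quotient.out (s := (⊥ : Setoid (Fin n))) c)) = c :=
      fun c => Quotient.out_eq (s := (⊥ : Setoid (Fin n))) c
    rwa [hout, hout] at this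
  -- Different strands lie on different components, and `N` counts the components left over, which
  -- are circles.
  obtain ⟨N, hN⟩ := Nat.exists_eq_add_of_le (Nat.card_le_card_of_injective _ hinj)
  obtain ⟨e⟩ := DIso.exists_of_bdry (a := (Diag.strands n).addCircles N)
    (fun x x' => (Diag.bdry_addCircles _ x x' N).trans (hb x x')) (by
      rw [Diag.card_components_addCircles, hN])
  obtain ⟨r⟩ := nonempty_retract_addCircles (.strands n) (l - N) N
  exact ⟨l - N, ⟨r.trans (Retract.ofIso (e.iso (by ring)))⟩⟩

end GrDiag

namespace IsUniversalProjector

variable {n : ℕ} {P : Cplx n n}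

/-- A vertical summand would contain a shifted identity diagram as a direct summand, and so would
the chain object, contrary to the definition of a universal projector. -/
theorem not_isVertical (hP : IsUniversalProjector n P) {i : ℕ} (hi : i ≠ 0) (j : (P.X i).ι) :
    ¬ ((P.X i).X j).diag.IsVertical := fun h => by
  obtain ⟨k, ⟨r⟩⟩ := GrDiag.exists_retract_of_isVertical _ h
  refine (hP.no_identity_summand i hi k).false ((r.map (Mat_.embedding _)).trans
    ⟨matIncl _ j, matProj _ j, ?_⟩)
  have := matIncl_comp (𝟙 (P.X i)) j j
  rw [Category.id_comp, Mat_.id_apply_self] at this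
  exact this.trans ((Mat_.embedding _).map_id _)

theorem topReturn (hP : IsUniversalProjector n P) {i : ℕ} (hi : i ≠ 0) (j : (P.X i).ι) :
    ((P.X i).X j).diag.TopReturn :=
  (Diag.topReturn_or _ le_rfl).resolve_right (hP.not_isVertical hi j)

theorem botReturn (hP : IsUniversalProjector n P) {i : ℕ} (hi : i ≠ 0) (j : (P.X i).ι) :
    ((P.X i).X j).diag.BotReturn :=
  (Diag.botReturn_or _ le_rfl).resolve_right (hP.not_isVertical hi j)

end IsUniversalProjector

end SpinNet
end

noncomputable section
namespace SpinNet

/-! ### Complexes killed by diagrams -/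

namespace Biadditive

variable {C D E : Type} [Category.{0} C] [Category.{0} D] [Category.{0} E] [Preadditive C]
  [Preadditive D] [Preadditive E] {F : C × D ⥤ E} (hF : Biadditive F)

/-- A direct summand of the fixed second variable. -/
theorem kills_fixRight_of_retract {z z' : D} (r : Retract z z') (G : E ⥤ AddCommGrpCat.{0})
    [G.Additive] {K : ChainComplex (Mat_ C) ℕ} (h : Kills (hF.fixRight z' ⋙ G) K) :
    Kills (hF.fixRight z ⋙ G) K := by
  have e : ∀ {x y : D} (f : x ⟶ y) {c c' : C} (g : c ⟶ c'),
      F.map (X := (c, x)) (Y := (c', x)) (g, 𝟙 x) ≫ F.map (X := (c', x)) (Y := (c', y)) (𝟙 c', f) =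
        F.map (X := (c, x)) (Y := (c, y)) (𝟙 c, f) ≫
          F.map (X := (c, y)) (Y := (c', y)) (g, 𝟙 y) := by
    intros
    rw [← F.map_comp, ← F.map_comp]
    simp
  let α : ∀ {x y : D} (_ : x ⟶ y), hF.fixRight x ⟶ hF.fixRight y := fun {x y} f =>
    { app := fun c => F.map (X := (c, x)) (Y := (c, y)) (𝟙 c, f)
      naturality := fun _ _ g => e f g }
  refine h.of_retract (Functor.whiskerRight (α r.i) G) (Functor.whiskerRight (α r.r) G) ?_
  ext c : 2
  change G.map (F.map (X := (c, z)) (Y := (c, z')) (𝟙 c, r.i)) ≫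
    G.map (F.map (X := (c, z')) (Y := (c, z)) (𝟙 c, r.r)) = 𝟙 (G.obj (F.obj (c, z)))
  rw [← G.map_comp, ← F.map_comp, ← G.map_id, ← F.map_id]
  exact congrArg (fun f => G.map (F.map (X := (c, z)) (Y := (c, z)) f))
    (Prod.ext (Category.comp_id _) r.retract)

/-- A direct summand of the fixed first variable. -/
theorem kills_fixLeft_of_retract {z z' : C} (r : Retract z z') (G : E ⥤ AddCommGrpCat.{0})
    [G.Additive] {K : ChainComplex (Mat_ D) ℕ} (h : Kills (hF.fixLeft z' ⋙ G) K) :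
    Kills (hF.fixLeft z ⋙ G) K := by
  have e : ∀ {x y : C} (f : x ⟶ y) {c c' : D} (g : c ⟶ c'),
      F.map (X := (x, c)) (Y := (x, c')) (𝟙 x, g) ≫ F.map (X := (x, c')) (Y := (y, c')) (f, 𝟙 c') =
        F.map (X := (x, c)) (Y := (y, c)) (f, 𝟙 c) ≫
          F.map (X := (y, c)) (Y := (y, c')) (𝟙 y, g) := by
    intros
    rw [← F.map_comp, ← F.map_comp]
    simp
  let α : ∀ {x y : C} (_ : x ⟶ y), hF.fixLeft x ⟶ hF.fixLeft y := fun {x y} f =>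
    { app := fun c => F.map (X := (x, c)) (Y := (y, c)) (f, 𝟙 c)
      naturality := fun _ _ g => e f g }
  refine h.of_retract (Functor.whiskerRight (α r.i) G) (Functor.whiskerRight (α r.r) G) ?_
  ext c : 2
  change G.map (F.map (X := (z, c)) (Y := (z', c)) (r.i, 𝟙 c)) ≫
    G.map (F.map (X := (z', c)) (Y := (z, c)) (r.r, 𝟙 c)) = 𝟙 (G.obj (F.obj (z, c)))
  rw [← G.map_comp, ← F.map_comp, ← G.map_id, ← F.map_id]
  exact congrArg (fun f => G.map (F.map (X := (z, c)) (Y := (z, c)) f))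
    (Prod.ext r.retract (Category.comp_id _))

end Biadditive

namespace GrDiag

variable {m k n m' n' : ℕ}

/-- Vertical composition of shifted diagrams. -/
abbrev vert (x : GrDiag m k) (y : GrDiag k n) : GrDiag m n := (stackFunctor m k n).obj (x, y)

/-- Juxtaposition of shifted diagrams. -/
abbrev horiz (x : GrDiag m n) (y : GrDiag m' n') : GrDiag (m + m') (n + n') :=
  (besideFunctor m n m' n').obj (x, y)

/-- Strands. -/
abbrev one (n : ℕ) : GrDiag n n := ⟨.strands n, 0⟩

/-- The functor of putting a diagram to the right. -/
abbrev besideR (m n : ℕ) (z : GrDiag m' n') : GrDiag m n ⥤ GrDiag (m + m') (n + n') :=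
  (beside_biadditive m n m' n').fixRight z

/-- The functor of putting a diagram to the left. -/
abbrev besideL (m' n' : ℕ) (z : GrDiag m n) : GrDiag m' n' ⥤ GrDiag (m + m') (n + n') :=
  (beside_biadditive m n m' n').fixLeft z

/-- The shift of a stacked diagram. -/
def stackRShift (m : ℕ) (y : Diag k n) (l l' : ℤ) :
    stackR m ⟨y, l'⟩ ≅ stackR m ⟨y, l⟩ ⋙ qShift (l' - l) :=
  NatIso.ofComponents (fun x => DIso.iso (.refl _) (by
    change x.shift + l' = x.shift + l + (l' - l)
    ring)) fun f => Subtype.ext ((compHom_refl _).trans (refl_compHom _).symm)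

/-- The shift of a stacked diagram. -/
def stackLShift (n : ℕ) (y : Diag m k) (l l' : ℤ) :
    stackL n ⟨y, l'⟩ ≅ stackL n ⟨y, l⟩ ⋙ qShift (l' - l) :=
  NatIso.ofComponents (fun x => DIso.iso (.refl _) (by
    change l' + x.shift = l + x.shift + (l' - l)
    ring)) fun f => Subtype.ext ((compHom_refl _).trans (refl_compHom _).symm)

end GrDiag

namespace Cplx

open GrDiag

variable {m k n l m' n' k' : ℕ}

/-- The complex becomes contractible when the diagram is put below it. -/
def DiesBelow (K : Cplx m k) (y : GrDiag k n) : Prop :=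
  ∀ (G : GrDiag m n ⥤ AddCommGrpCat.{0}) [G.Additive], Kills (stackR m y ⋙ G) K

/-- The complex becomes contractible when the diagram is put above it. -/
def DiesAbove (K : Cplx k n) (y : GrDiag m k) : Prop :=
  ∀ (G : GrDiag m n ⥤ AddCommGrpCat.{0}) [G.Additive], Kills (stackL n y ⋙ G) K

theorem diesBelow_of_contractible {K : Cplx m k} {y : Diag k n} (h : (K.below y).Contractible) :
    K.DiesBelow ⟨y, 0⟩ := fun G _ =>
  contractible_of_iso ((stack_biadditive m k n).evFixRight G ⟨y, 0⟩ K).symm (Kills.of_contractible G h)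

theorem diesAbove_of_contractible {K : Cplx k n} {y : Diag m k} (h : (above y K).Contractible) :
    K.DiesAbove ⟨y, 0⟩ := fun G _ =>
  contractible_of_iso ((stack_biadditive m k n).evFixLeft G ⟨y, 0⟩ K).symm (Kills.of_contractible G h)

namespace DiesBelow

variable {K : Cplx m k}

theorem shift {y : Diag k n} {l : ℤ} (h : K.DiesBelow ⟨y, l⟩) (l' : ℤ) : K.DiesBelow ⟨y, l'⟩ :=
  fun G _ => (h (GrDiag.qShift (l' - l) ⋙ G)).congr
    (Functor.isoWhiskerRight (stackRShift m y l l') G)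

theorem of_retract {y y' : GrDiag k n} (h : K.DiesBelow y') (r : Retract y y') : K.DiesBelow y :=
  fun G _ => (stack_biadditive m k n).kills_fixRight_of_retract r G (h G)

theorem vert {y : GrDiag k n} (h : K.DiesBelow y) (z : GrDiag n l) : K.DiesBelow (y.vert z) :=
  fun G _ => (h (stackR m z ⋙ G)).congr (Functor.isoWhiskerRight
    (Hole.Move.assocR (.hole (m := m) (n := k)) y z |>.natIso fun k => by
      simp [Hole.shift, add_assoc]).symm G)

theorem below {z : Diag k n} {y : GrDiag n l} (h : K.DiesBelow (GrDiag.vert ⟨z, 0⟩ y)) :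
    (K.below z).DiesBelow y := fun G _ =>
  contractible_of_iso ((stack_biadditive m k n).evFixRight (stackR m y ⋙ G) ⟨z, 0⟩ K)
    ((h G).congr (Functor.isoWhiskerRight
      (Hole.Move.assocR (.hole (m := m) (n := k)) ⟨z, 0⟩ y |>.natIso fun k => by
        simp [Hole.shift]) G))

/-- Here it matters that all test functors are admitted at once: a summand of `K` glued on top of
`L` is absorbed into the functor applied to `L`. -/
theorem stack {L : Cplx k n} {y : GrDiag n l} (h : L.DiesBelow y) (K : Cplx m k) :
    (K.stack L).DiesBelow y := fun G _ =>
  (stack_biadditive m k n).kills_left (stackR m y ⋙ G) K L fun p j =>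
    (h (stackL l ((K.X p).X j) ⋙ G)).congr (Functor.isoWhiskerRight
      (Hole.Move.assocM (.hole (m := k) (n := n)) ((K.X p).X j) y |>.natIso fun k => by
        simp [Hole.shift, add_assoc]) G)

/-- For the case that the projector responsible sits in `K`, with `L` between it and `y`: each
summand of `L` together with `y` is then a diagram below `K`. -/
theorem stack_of_forall {L : Cplx k n} {y : GrDiag n l}
    (h : ∀ z : GrDiag k n, K.DiesBelow (z.vert y)) : (K.stack L).DiesBelow y := fun G _ =>
  (stack_biadditive m k n).kills_right (stackR m y ⋙ G) K L fun q j =>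
    (h ((L.X q).X j) G).congr (Functor.isoWhiskerRight
      (Hole.Move.assocR (.hole (m := m) (n := k)) ((L.X q).X j) y |>.natIso fun k => by
        simp [Hole.shift, add_assoc]) G)

/-- The diagram below the left complex of a juxtaposition. -/
theorem beside_left {y : GrDiag k n} (h : K.DiesBelow y) (L : Cplx m' k') :
    (K.beside L).DiesBelow (y.horiz (one k')) := fun G _ =>
  (beside_biadditive m k m' k').kills_right (stackR _ (y.horiz (one k')) ⋙ G) K L fun q j =>
    (h (besideR m n ((L.X q).X j) ⋙ G)).congr (Functor.isoWhiskerRight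
      -- The neighbouring summand is first prolonged by vertical strands at its bottom, so that the
      -- interchange law applies.
      ((((Hole.Move.refl (.stackR .hole y)).besideR (z := (L.X q).X j)
          (z' := ((L.X q).X j).vert (one k')) (DIso.rightUnit ((L.X q).X j).diag).symm).trans
        (Hole.Move.interchangeTL (.hole (m := m) (n := k)) y ((L.X q).X j) (one k'))).natIso
          fun k => by simp [Hole.shift]; ring).symm G)

/-- The diagram below the right complex of a juxtaposition. -/
theorem beside_right {y : GrDiag k n} (h : K.DiesBelow y) (L : Cplx m' k') :
    (L.beside K).DiesBelow ((one k').horiz y) := fun G _ =>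
  (beside_biadditive m' k' m k).kills_left (stackR _ ((one k').horiz y) ⋙ G) L K fun q j =>
    (h (besideL m n ((L.X q).X j) ⋙ G)).congr (Functor.isoWhiskerRight
      (((Hole.Move.besideL (z := (L.X q).X j)
          (z' := ((L.X q).X j).vert (one k')) (DIso.rightUnit ((L.X q).X j).diag).symm
            (Hole.Move.refl (.stackR .hole y))).trans
        (Hole.Move.interchangeTR (.hole (m := m) (n := k)) y ((L.X q).X j) (one k'))).natIso
          fun k => by simp [Hole.shift]; ring).symm G)

end DiesBelow

namespace DiesAbove

variable {K : Cplx k n}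

theorem shift {y : Diag m k} {l : ℤ} (h : K.DiesAbove ⟨y, l⟩) (l' : ℤ) : K.DiesAbove ⟨y, l'⟩ :=
  fun G _ => (h (GrDiag.qShift (l' - l) ⋙ G)).congr
    (Functor.isoWhiskerRight (stackLShift n y l l') G)

theorem of_retract {y y' : GrDiag m k} (h : K.DiesAbove y') (r : Retract y y') : K.DiesAbove y :=
  fun G _ => (stack_biadditive m k n).kills_fixLeft_of_retract r G (h G)

theorem vert {y : GrDiag m k} (h : K.DiesAbove y) (z : GrDiag l m) : K.DiesAbove (z.vert y) :=
  fun G _ => (h (stackL n z ⋙ G)).congr (Functor.isoWhiskerRight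
    (Hole.Move.assocL (.hole (m := k) (n := n)) z y |>.natIso fun k => by
      simp [Hole.shift, add_assoc]) G)

theorem below {y : GrDiag m k} (h : K.DiesAbove y) (z : Diag n l) : (K.below z).DiesAbove y :=
  fun G _ => contractible_of_iso
    ((stack_biadditive k n l).evFixRight (stackL l y ⋙ G) ⟨z, 0⟩ K)
    ((h (stackR m ⟨z, 0⟩ ⋙ G)).congr (Functor.isoWhiskerRight
      (Hole.Move.assocM (.hole (m := k) (n := n)) y ⟨z, 0⟩ |>.natIso fun k => by
        simp [Hole.shift]).symm G))

theorem stack {y : GrDiag m k} (h : K.DiesAbove y) (L : Cplx n l) : (K.stack L).DiesAbove y :=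
  fun G _ => (stack_biadditive k n l).kills_right (stackL l y ⋙ G) K L fun q j =>
    (h (stackR m ((L.X q).X j) ⋙ G)).congr (Functor.isoWhiskerRight
      (Hole.Move.assocM (.hole (m := k) (n := n)) y ((L.X q).X j) |>.natIso fun k => by
        simp [Hole.shift, add_assoc]).symm G)

/-- The diagram above the left complex of a juxtaposition. -/
theorem beside_left {y : GrDiag m k} (h : K.DiesAbove y) (L : Cplx k' n') :
    (K.beside L).DiesAbove (y.horiz (one k')) := fun G _ =>
  (beside_biadditive k n k' n').kills_right (stackL _ (y.horiz (one k')) ⋙ G) K L fun q j =>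
    (h (besideR m n ((L.X q).X j) ⋙ G)).congr (Functor.isoWhiskerRight
      ((((Hole.Move.refl (.stackL y .hole)).besideR (z := (L.X q).X j)
          (z' := (one k').vert ((L.X q).X j)) (DIso.leftUnit ((L.X q).X j).diag).symm).trans
        (Hole.Move.interchangeBL (.hole (m := k) (n := n)) y (one k') ((L.X q).X j))).natIso
          fun k => by simp [Hole.shift]; ring).symm G)

/-- The diagram above the right complex of a juxtaposition. -/
theorem beside_right {y : GrDiag m k} (h : K.DiesAbove y) (L : Cplx k' n') :
    (L.beside K).DiesAbove ((one k').horiz y) := fun G _ =>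
  (beside_biadditive k' n' k n).kills_left (stackL _ ((one k').horiz y) ⋙ G) L K fun q j =>
    (h (besideL m n ((L.X q).X j) ⋙ G)).congr (Functor.isoWhiskerRight
      (((Hole.Move.besideL (z := (L.X q).X j)
          (z' := (one k').vert ((L.X q).X j)) (DIso.leftUnit ((L.X q).X j).diag).symm
            (Hole.Move.refl (.stackL y .hole))).trans
        (Hole.Move.interchangeBR (.hole (m := k) (n := n)) y (one k') ((L.X q).X j))).natIso
          fun k => by simp [Hole.shift]; ring).symm G)

end DiesAbove

end Cplx

namespace IsUniversalProjector

open GrDiag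

variable {n n' : ℕ} {P : Cplx n n}

/-- Diagrams with fewer strands below a universal projector kill it. -/
theorem diesBelow (hP : IsUniversalProjector n P) (h : n' < n) (y : GrDiag n n') :
    P.DiesBelow y := by
  -- With fewer lower than upper points the diagram cannot be vertical, so it has a return at the
  -- top, directly below the projector.
  obtain ⟨i, j, hij, s, ⟨r⟩⟩ := exists_retract_of_topReturn y
    ((y.diag.topReturn_or h.le).resolve_right fun hv => h.ne' hv.1)
  exact ((Cplx.diesBelow_of_contractible (hP.kills_below i j hij)).vert s).of_retract r

/-- Diagrams with fewer strands above a universal projector kill it. -/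
theorem diesAbove (hP : IsUniversalProjector n P) (h : n' < n) (y : GrDiag n' n) :
    P.DiesAbove y := by
  obtain ⟨i, j, hij, s, ⟨r⟩⟩ := exists_retract_of_botReturn y
    ((y.diag.botReturn_or h.le).resolve_right fun hv => h.ne hv.1)
  exact ((Cplx.diesAbove_of_contractible (hP.kills_above i j hij)).vert s).of_retract r

end IsUniversalProjector

end SpinNet
end

noncomputable section
namespace SpinNet

/-! ### Bookkeeping of summands up to retracts -/

/-! ### Summands of gluings -/

section GeneratedBy

variable {C D E : Type} [Category.{0} C] [Category.{0} D] [Category.{0} E] [Preadditive C]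
  [Preadditive D] [Preadditive E]

/-- The object is a direct summand of a finite direct sum of objects with the property `S`. -/
def GeneratedBy (S : C → Prop) (M : Mat_ C) : Prop :=
  ∃ (J : Type) (_ : Fintype J) (Z : J → C) (α : ∀ j, M ⟶ (Mat_.embedding C).obj (Z j))
    (β : ∀ j, (Mat_.embedding C).obj (Z j) ⟶ M), (∀ j, S (Z j)) ∧ ∑ j, α j ≫ β j = 𝟙 M

namespace GeneratedBy

variable {S : C → Prop} {M N : Mat_ C}

theorem of_forall (h : ∀ j, S (M.X j)) : GeneratedBy S M :=
  ⟨M.ι, inferInstance, M.X, matProj M, matIncl M, h, sum_matProj_matIncl M⟩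

theorem mono {T : C → Prop} (h : GeneratedBy S M) (hST : ∀ z, S z → T z) : GeneratedBy T M := by
  obtain ⟨J, i, Z, α, β, hS, hsum⟩ := h
  exact ⟨J, i, Z, α, β, fun j => hST _ (hS j), hsum⟩

theorem of_sum {K : Type} [Fintype K] (N : K → Mat_ C) (f : ∀ k, M ⟶ N k) (g : ∀ k, N k ⟶ M)
    (hfg : ∑ k, f k ≫ g k = 𝟙 M) (h : ∀ k, GeneratedBy S (N k)) : GeneratedBy S M := by
  choose J _ Z α β hS hsum using h
  refine ⟨Σ k, J k, inferInstance, fun x => Z x.1 x.2, fun x => f x.1 ≫ α x.1 x.2,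
    fun x => β x.1 x.2 ≫ g x.1, fun x => hS x.1 x.2, ?_⟩
  rw [Fintype.sum_sigma, ← hfg]
  refine Finset.sum_congr rfl fun k _ => ?_
  have : ∀ j, (f k ≫ α k j) ≫ β k j ≫ g k = f k ≫ (α k j ≫ β k j) ≫ g k := by simp
  simp only [this]
  rw [← Preadditive.comp_sum, ← Preadditive.sum_comp, hsum, Category.id_comp]

theorem of_retract (r : Retract M N) (h : GeneratedBy S N) : GeneratedBy S M :=
  of_sum (K := Unit) (fun _ => N) (fun _ => r.i) (fun _ => r.r) (by simp) fun _ => h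

theorem component (h : GeneratedBy S M) (j : M.ι) :
    GeneratedBy S ((Mat_.embedding C).obj (M.X j)) := by
  refine h.of_retract ⟨matIncl M j, matProj M j, ?_⟩
  have := matIncl_comp (𝟙 M) j j
  rw [Category.id_comp, Mat_.id_apply_self] at this
  exact this.trans ((Mat_.embedding _).map_id _)

theorem map {T : D → Prop} (H : Mat_ C ⥤ Mat_ D) [H.Additive] (h : GeneratedBy S M)
    (hH : ∀ z, S z → GeneratedBy T (H.obj ((Mat_.embedding C).obj z))) :
    GeneratedBy T (H.obj M) := by
  obtain ⟨J, _, Z, α, β, hS, hsum⟩ := h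
  refine of_sum _ (fun j => H.map (α j)) (fun j => H.map (β j)) ?_ fun j => hH _ (hS j)
  simp only [← H.map_comp, ← H.map_sum, hsum, H.map_id]

variable {F : C × D ⥤ E} (hF : Biadditive F)

theorem mat {S' : D → Prop} {T : E → Prop} {M' : Mat_ D} (h : GeneratedBy S M)
    (h' : GeneratedBy S' M') (hT : ∀ x y, S x → S' y → T (F.obj (x, y))) :
    GeneratedBy T ((hF.matCurried.obj M).obj M') :=
  h.map (hF.matCurried.flip.obj M') fun x hx =>
    h'.map (hF.matCurried.obj ((Mat_.embedding C).obj x)) fun y hy =>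
      of_forall fun _ => hT x y hx hy

/-- The chain objects of a total complex are biproducts known only up to isomorphism, so their
formal summands cannot be named. Being a retract of a finite sum of known diagrams is the usable
substitute: it passes back to formal summands by `component`. -/
theorem mapBifunctor {T : E → Prop} (K : ChainComplex (Mat_ C) ℕ) (L : ChainComplex (Mat_ D) ℕ)
    (n : ℕ) (h : ∀ p q, p + q = n → GeneratedBy T ((hF.matCurried.obj (K.X p)).obj (L.X q))) :
    GeneratedBy T ((HomologicalComplex.mapBifunctor K L hF.matCurried (.down ℕ)).X n) := by
  refine of_sum (K := Finset.HasAntidiagonal.antidiagonal n)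
    (fun pq => (hF.matCurried.obj (K.X pq.1.1)).obj (L.X pq.1.2))
    (fun pq => TotalComplex.proj hF.matCurried K L pq.1.1 pq.1.2 n)
    (fun pq => TotalComplex.incl hF.matCurried K L pq.1.1 pq.1.2 n) ?_
    fun pq => h _ _ (Finset.HasAntidiagonal.mem_antidiagonal.1 pq.2)
  exact (Finset.sum_coe_sort _ fun pq : ℕ × ℕ => TotalComplex.proj hF.matCurried K L pq.1 pq.2 n ≫
    TotalComplex.incl hF.matCurried K L pq.1 pq.2 n).trans (TotalComplex.sum_proj_incl _ _ _ _)

end GeneratedBy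

end GeneratedBy

namespace GrDiag

variable {m k n l m' n' k' l' : ℕ}

/-- The diagram factors, as a direct summand, through a given diagram above. -/
def FactorsAbove (y : GrDiag m k) (z : GrDiag m n) : Prop :=
  ∃ s : GrDiag k n, Nonempty (Retract z (y.vert s))

/-- The diagram factors, as a direct summand, through a given diagram below. -/
def FactorsBelow (y : GrDiag k n) (z : GrDiag m n) : Prop :=
  ∃ s : GrDiag m k, Nonempty (Retract z (s.vert y))

/-- Reassociation. -/
def assocIso (x : GrDiag m k) (y : GrDiag k n) (z : GrDiag n l) :
    (x.vert y).vert z ≅ x.vert (y.vert z) :=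
  DIso.iso (DIso.assoc _ _ _) (add_assoc _ _ _)

namespace FactorsAbove

variable {y : GrDiag m k} {z : GrDiag m n}

theorem vert (h : FactorsAbove y z) (w : GrDiag n l) : FactorsAbove y (z.vert w) := by
  obtain ⟨s, ⟨r⟩⟩ := h
  exact ⟨s.vert w, ⟨(r.map (stackR m w)).trans (.ofIso (assocIso y s w))⟩⟩

theorem horiz_left (h : FactorsAbove y z) (w : GrDiag m' n') :
    FactorsAbove (y.horiz (one m')) (z.horiz w) := by
  obtain ⟨s, ⟨r⟩⟩ := h
  exact ⟨s.horiz w, ⟨(r.map (besideR m n w)).trans (.ofIso (DIso.iso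
    (((DIso.refl (y.diag.stack s.diag)).beside (DIso.leftUnit w.diag).symm).trans
      (DIso.interchange y.diag s.diag (.strands m') w.diag)) (by
        change y.shift + s.shift + w.shift = y.shift + 0 + (s.shift + w.shift)
        ring)))⟩⟩

theorem horiz_right (h : FactorsAbove y z) (w : GrDiag m' n') :
    FactorsAbove ((one m').horiz y) (w.horiz z) := by
  obtain ⟨s, ⟨r⟩⟩ := h
  exact ⟨w.horiz s, ⟨(r.map (besideL m n w)).trans (.ofIso (DIso.iso
    (((DIso.leftUnit w.diag).symm.beside (DIso.refl (y.diag.stack s.diag))).trans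
      (DIso.interchange (.strands m') w.diag y.diag s.diag)) (by
        change w.shift + (y.shift + s.shift) = 0 + y.shift + (w.shift + s.shift)
        ring)))⟩⟩

/-- After gluing `x` on top, the narrow place lies in the interior of the diagram. It can equally be
regarded as the upper end of the lower part `s`, and this is the part that can be moved to the
target of Hom. -/
theorem exists_factorsBelow (h : FactorsAbove y z) (x : GrDiag l m) :
    ∃ s : GrDiag k n, FactorsBelow s (x.vert z) := by
  obtain ⟨s, ⟨r⟩⟩ := h
  exact ⟨s, x.vert y, ⟨(r.map (stackL n x)).trans (.ofIso (assocIso x y s).symm)⟩⟩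

end FactorsAbove

namespace FactorsBelow

variable {y : GrDiag k n} {z : GrDiag m n}

theorem vert (h : FactorsBelow y z) (w : GrDiag l m) : FactorsBelow y (w.vert z) := by
  obtain ⟨s, ⟨r⟩⟩ := h
  exact ⟨w.vert s, ⟨(r.map (stackL n w)).trans (.ofIso (assocIso w s y).symm)⟩⟩

theorem horiz_left (h : FactorsBelow y z) (w : GrDiag m' n') :
    FactorsBelow (y.horiz (one n')) (z.horiz w) := by
  obtain ⟨s, ⟨r⟩⟩ := h
  exact ⟨s.horiz w, ⟨(r.map (besideR m n w)).trans (.ofIso (DIso.iso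
    (((DIso.refl (s.diag.stack y.diag)).beside (DIso.rightUnit w.diag).symm).trans
      (DIso.interchange s.diag y.diag w.diag (.strands n'))) (by
        change s.shift + y.shift + w.shift = s.shift + w.shift + (y.shift + 0)
        ring)))⟩⟩

theorem horiz_right (h : FactorsBelow y z) (w : GrDiag m' n') :
    FactorsBelow ((one n').horiz y) (w.horiz z) := by
  obtain ⟨s, ⟨r⟩⟩ := h
  exact ⟨w.horiz s, ⟨(r.map (besideL m n w)).trans (.ofIso (DIso.iso
    (((DIso.rightUnit w.diag).symm.beside (DIso.refl (s.diag.stack y.diag))).trans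
      (DIso.interchange w.diag (.strands n') s.diag y.diag)) (by
        change w.shift + (s.shift + y.shift) = w.shift + s.shift + (0 + y.shift)
        ring)))⟩⟩

end FactorsBelow

end GrDiag

namespace Cplx

open GrDiag

variable {m k n : ℕ}

/-- Morphisms from all shifts of the diagram to the complex form a contractible complex. -/
def Misses (K : Cplx m n) (z : GrDiag m n) : Prop :=
  ∀ d, Kills (coyo ((GrDiag.qShift d).obj z)) K

/-- Hom into `K` is additive in the source, so the identity of the complex for `M.X j` is a sum of
maps through the contractible complexes of the generators, shifted alike. -/
theorem misses_of_generatedBy {K : Cplx m n} {M : BN m n} (h : GeneratedBy K.Misses M) (j : M.ι) :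
    K.Misses (M.X j) := by
  intro d
  obtain ⟨J, _, Z, α, β, hZ, hsum⟩ : GeneratedBy (fun z => Kills (coyo z) K)
      ((Mat_.embedding _).obj ((GrDiag.qShift d).obj (M.X j))) :=
    (h.component j).map (Functor.mapMat_ (GrDiag.qShift d)) fun z hz => .of_forall fun _ => hz d
  have key : ∑ j, (complexCoyo K).map (β j).op ≫ (complexCoyo K).map (α j).op = 𝟙 _ := by
    simp only [← Functor.map_comp, ← op_comp, ← Functor.map_sum, ← op_sum, hsum]
    exact (complexCoyo K).map_id _
  exact contractible_of_iso (evCoyo _ K).symm (contractible_of_sum _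
    (fun j => contractible_of_iso (evCoyo (Z j) K) (hZ j))
    (fun j => (complexCoyo K).map (β j).op) (fun j => (complexCoyo K).map (α j).op) key)

theorem Misses.of_retract {K : Cplx m n} {z z' : GrDiag m n} (h : K.Misses z')
    (r : Retract z z') : K.Misses z :=
  misses_of_generatedBy ((GeneratedBy.of_forall (M := (Mat_.embedding _).obj z')
    fun _ => h).of_retract (r.map (Mat_.embedding _))) PUnit.unit

/-- By adjunction Hom(s·y, K) is Hom out of `s` into `K` with the reflection of `y` glued below, and
that complex dies by assumption. -/
theorem misses_of_factorsBelow {K : Cplx m n} {z : GrDiag m n} {y : GrDiag k n}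
    (h : FactorsBelow y z) (hy : ∀ l, K.DiesBelow ⟨y.diag.flip, l⟩) : K.Misses z := by
  obtain ⟨s, ⟨r⟩⟩ := h
  refine Misses.of_retract (fun d => ?_) r
  obtain ⟨e⟩ := coyo_stackR (⟨s.diag, s.shift + y.shift + d - y.diag.index⟩ : GrDiag m k) y.diag
  exact (hy 0 _).congr (coyoCongr (DIso.iso (.refl _) (sub_add_cancel _ _).symm) ≪≫ e)

/-- The same at the top, where the reflected upper factor in the source becomes `y` glued above the
target. -/
theorem misses_of_factorsAbove {K : Cplx m n} {z : GrDiag m n} {y : Diag k m} {l : ℤ}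
    (h : FactorsAbove ⟨y.flip, l⟩ z) (hy : ∀ l, K.DiesAbove ⟨y, l⟩) : K.Misses z := by
  obtain ⟨s, ⟨r⟩⟩ := h
  refine Misses.of_retract (fun d => ?_) r
  obtain ⟨e⟩ := coyo_stackL (⟨s.diag, l + s.shift + d⟩ : GrDiag k n) y
  exact (hy y.index _).congr (coyoCongr (DIso.iso (.refl _) (zero_add _).symm) ≪≫ e)

/-- Homomorphisms into a complex that misses all summands in nonzero degrees. -/
theorem homCplx_equiv_of_misses {A B : Cplx m n} (d : ℤ) {v : Diag m n}
    (e : Nonempty (A.X 0 ≅ ofDiag v 0))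
    (h : ∀ i, i ≠ 0 → ∀ j, B.Misses ((A.X i).X j)) :
    Nonempty (HomotopyEquiv (homCplx A B d)
      ((ev (coyo (⟨v, d⟩ : GrDiag m n)) B).extend ComplexShape.embeddingDownNat)) :=
  homCplx_equiv A B d v e.some fun i hi j => h i hi j d

/-- `|A⟩` is the complex of homomorphisms from the empty diagram. -/
theorem ket_equiv (A : Cplx 0 0) (d : ℤ) : Nonempty (HomotopyEquiv (ket A d)
      ((ev (coyo (⟨.strands 0, d⟩ : GrDiag 0 0)) A).extend ComplexShape.embeddingDownNat)) := by
  refine homCplx_equiv_of_misses d ⟨HomologicalComplex.singleObjXSelf _ _ _⟩ fun i hi => ?_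
  refine misses_of_generatedBy ⟨Empty, inferInstance, Empty.elim, fun j => j.elim,
    fun j => j.elim, fun j => j.elim, ?_⟩
  exact (HomologicalComplex.isZero_single_obj_X _ _ _ _ hi).eq_of_src _ _

/-- Closing up a complex. -/
theorem ket_tr_equiv {a : ℕ} (A : Cplx a a) (d : ℤ) : Nonempty (HomotopyEquiv
    ((ev (coyo (⟨.strands a, d⟩ : GrDiag a a)) A).extend ComplexShape.embeddingDownNat)
    (ket A.tr (d - a))) := by
  obtain ⟨f⟩ := ket_equiv A.tr (d - a)
  obtain ⟨e⟩ := Hole.coyo_closure a d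
  refine ⟨(extendHomotopyEquiv (HomotopyEquiv.ofIso ?_) _).trans f.symm⟩
  refine evCongr e A ≪≫ Iso.symm ?_
  -- Evaluating the trace peels off the rainbow above, its reflection below and the strands on the
  -- right; what remains is the closure functor applied to `A`.
  exact (stack_biadditive 0 (a + a) 0).evFixLeft _ ⟨.rainbow a, 0⟩ _ ≪≫
    (stack_biadditive (a + a) (a + a) 0).evFixRight _ ⟨(Diag.rainbow a).flip, 0⟩ _ ≪≫
    (beside_biadditive a a a a).evFixRight _ ⟨.strands a, 0⟩ A

/-- A diagram in the source can be moved to the target. -/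
theorem ev_coyo_stack {m k n : ℕ} (B : Cplx m n) (w : Diag m k) (y : Diag k n) (d : ℤ) :
    Nonempty (ev (coyo (⟨w.stack y, d⟩ : GrDiag m n)) B ≅
      ev (coyo (⟨w, d - y.index⟩ : GrDiag m k)) (B.below y.flip)) := by
  obtain ⟨e⟩ := coyo_stackR (⟨w, d - y.index⟩ : GrDiag m k) y
  exact ⟨evCongr (coyoCongr (DIso.iso (.refl _) (sub_add_cancel _ _).symm) ≪≫ e) B ≪≫
    ((stack_biadditive m n k).evFixRight _ ⟨y.flip, 0⟩ B).symm⟩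

end Cplx

end SpinNet
end

noncomputable section
namespace SpinNet

/-! ### Spin networks -/

section

variable {C D E : Type} [Category.{0} C] [Category.{0} D] [Category.{0} E] [Preadditive C]
  [Preadditive D] [Preadditive E] {F : C × D ⥤ E} (hF : Biadditive F)

/-- The degree zero part of a total complex. -/
theorem Biadditive.nonempty_iso_zero {K : ChainComplex (Mat_ C) ℕ} {L : ChainComplex (Mat_ D) ℕ}
    {x : C} {y : D} (eK : Nonempty (K.X 0 ≅ (Mat_.embedding C).obj x))
    (eL : Nonempty (L.X 0 ≅ (Mat_.embedding D).obj y)) :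
    Nonempty ((HomologicalComplex.mapBifunctor K L hF.matCurried (.down ℕ)).X 0 ≅
      (Mat_.embedding E).obj (F.obj (x, y))) := by
  obtain ⟨eK⟩ := eK
  obtain ⟨eL⟩ := eL
  have key := TotalComplex.sum_proj_incl hF.matCurried K L 0
  rw [Finset.Nat.antidiagonal_zero, Finset.sum_singleton] at key
  let e : (HomologicalComplex.mapBifunctor K L hF.matCurried (.down ℕ)).X 0 ≅
      (hF.matCurried.obj (K.X 0)).obj (L.X 0) :=
    ⟨TotalComplex.proj hF.matCurried K L 0 0 0, TotalComplex.incl hF.matCurried K L 0 0 0, key,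
      TotalComplex.incl_proj_self hF.matCurried K L 0 0 0 rfl⟩
  exact ⟨e ≪≫ (hF.matCurried.mapIso eK).app (L.X 0) ≪≫
    (hF.matCurried.obj ((Mat_.embedding C).obj x)).mapIso eL ≪≫ (hF.matFixLeft x).app y⟩

end

namespace Cplx

open GrDiag

variable {m k n m' n' : ℕ}

theorem below_zero {K : Cplx m k} {x : GrDiag m k} (e : Nonempty (K.X 0 ≅ (Mat_.embedding _).obj x))
    (v : Diag k n) : Nonempty ((K.below v).X 0 ≅ (Mat_.embedding _).obj (x.vert ⟨v, 0⟩)) := by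
  obtain ⟨e⟩ := e
  exact ⟨((stack_biadditive m k n).matCurried.flip.obj (ofDiag v 0)).mapIso e ≪≫
    ((stack_biadditive m k n).matFixRight ⟨v, 0⟩).app x⟩

theorem generatedBy_below {K : Cplx m k} {p : ℕ} {S : GrDiag m k → Prop}
    (h : GeneratedBy S (K.X p)) (v : Diag k n) :
    GeneratedBy (fun z => ∃ x, z = x.vert ⟨v, 0⟩ ∧ S x) ((K.below v).X p) :=
  h.map ((stack_biadditive m k n).matCurried.flip.obj (ofDiag v 0)) fun x hx =>
    .of_forall fun _ => ⟨x, rfl, hx⟩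

theorem generatedBy_stack {K : Cplx m k} {L : Cplx k n} {S : ℕ → GrDiag m k → Prop}
    {T : ℕ → GrDiag k n → Prop} (hK : ∀ p, GeneratedBy (S p) (K.X p))
    (hL : ∀ q, GeneratedBy (T q) (L.X q)) (i : ℕ) :
    GeneratedBy (fun z => ∃ p q x y, p + q = i ∧ z = vert x y ∧ S p x ∧ T q y)
      ((K.stack L).X i) :=
  .mapBifunctor (stack_biadditive m k n) K L i fun p q hpq =>
    (hK p).mat _ (hL q) fun x y hx hy => ⟨p, q, x, y, hpq, rfl, hx, hy⟩

theorem generatedBy_beside {K : Cplx m k} {L : Cplx m' n'} {S : ℕ → GrDiag m k → Prop}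
    {T : ℕ → GrDiag m' n' → Prop} (hK : ∀ p, GeneratedBy (S p) (K.X p))
    (hL : ∀ q, GeneratedBy (T q) (L.X q)) (i : ℕ) :
    GeneratedBy (fun z => ∃ p q x y, p + q = i ∧ z = horiz x y ∧ S p x ∧ T q y)
      ((K.beside L).X i) :=
  .mapBifunctor (beside_biadditive m k m' n') K L i fun p q hpq =>
    (hK p).mat _ (hL q) fun x y hx hy => ⟨p, q, x, y, hpq, rfl, hx, hy⟩

end Cplx

section

open GrDiag

variable {m n : ℕ}

/-- A diagram with a return at the top factors through fewer strands above. -/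
theorem GrDiag.exists_factorsAbove {z : GrDiag m n} (h : z.diag.TopReturn) :
    ∃ (k : ℕ) (_ : k < m) (y : Diag k m), FactorsAbove ⟨y.flip, 0⟩ z := by
  obtain ⟨i, j, hij, s, r⟩ := exists_retract_of_topReturn z h
  exact ⟨i + 0 + j, by omega, (Diag.capAt i j).cast rfl hij, s, r⟩

/-- A diagram with a return at the bottom factors through fewer strands below. -/
theorem GrDiag.exists_factorsBelow {z : GrDiag m n} (h : z.diag.BotReturn) :
    ∃ (k : ℕ) (_ : k < n) (y : Diag k n), FactorsBelow ⟨y, 0⟩ z := by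
  obtain ⟨i, j, hij, s, r⟩ := exists_retract_of_botReturn z h
  exact ⟨i + 0 + j, by omega, (Diag.capAt i j).cast rfl hij, s, r⟩

end

/-- The diagram has returns at the top and at the bottom. -/
def GrDiag.Returns {m n : ℕ} (z : GrDiag m n) : Prop := z.diag.TopReturn ∧ z.diag.BotReturn

theorem IsUniversalProjector.generatedBy {n : ℕ} {P : Cplx n n} (hP : IsUniversalProjector n P)
    (p : ℕ) : GeneratedBy (fun z => p ≠ 0 → z.Returns) (P.X p) :=
  .of_forall fun j hp => ⟨hP.topReturn hp j, hP.botReturn hp j⟩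

section Networks

open GrDiag

variable {P : (n : ℕ) → Cplx n n}

theorem beside_zero (hP : ∀ n, IsUniversalProjector n (P n)) (b c : ℕ) : Nonempty (((P b).beside (P c)).X 0 ≅
    (Mat_.embedding _).obj ((one b).horiz (one c))) :=
  (beside_biadditive b b c c).nonempty_iso_zero (hP b).degree_zero (hP c).degree_zero

/-- In nonzero total degree at least one of the two projectors is in nonzero degree, where its terms
have returns on both sides. -/
theorem generatedBy_projectors (hP : ∀ n, IsUniversalProjector n (P n)) (b c i : ℕ) :
    GeneratedBy (fun z => ∃ x y, z = horiz x y ∧ (i ≠ 0 → x.Returns ∨ y.Returns))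
      (((P b).beside (P c)).X i) :=
  (Cplx.generatedBy_beside (hP b).generatedBy (hP c).generatedBy i).mono
    fun z ⟨p, q, x, y, hpq, hz, hx, hy⟩ => ⟨x, y, hz, fun hi => by
      by_cases hp : p = 0
      · exact .inr (hy (by omega))
      · exact .inl (hx hp)⟩

section Vertex

theorem vertexNet_zero (hP : ∀ n, IsUniversalProjector n (P n))
    (a b c : ℕ) (h : Admissible a b c) : Nonempty ((vertexNet P a b c h).X 0 ≅ ofDiag (vertexDiag a b c h) 0) := by
  obtain ⟨e⟩ := (stack_biadditive a (b + c) (b + c)).nonempty_iso_zero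
    (Cplx.below_zero (hP a).degree_zero (vertexDiag a b c h)) (beside_zero hP b c)
  exact ⟨e ≪≫ (Mat_.embedding _).mapIso (DIso.iso (((DIso.leftUnit _).stack
    (DIso.strandsBeside b c)).trans (DIso.rightUnit _)) rfl)⟩

theorem vertexNet_generatedBy (hP : ∀ n, IsUniversalProjector n (P n))
    (a b c : ℕ) (h : Admissible a b c) (i : ℕ) :
    GeneratedBy (fun z => ∃ w x y, z = vert (vert w ⟨vertexDiag a b c h, 0⟩) (horiz x y) ∧
      (i ≠ 0 → w.Returns ∨ x.Returns ∨ y.Returns)) ((vertexNet P a b c h).X i) :=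
  (Cplx.generatedBy_stack (fun p => Cplx.generatedBy_below ((hP a).generatedBy p) _)
    (generatedBy_projectors hP b c) i).mono (by
    rintro z ⟨p, q, u, v, hpq, rfl, ⟨w, rfl, hw⟩, ⟨x, y, rfl, hxy⟩⟩
    refine ⟨w, x, y, rfl, fun hi => ?_⟩
    by_cases hp : p = 0
    · exact .inr (hxy (by omega))
    · exact .inl (hw hp))

theorem vertexNet_diesAbove (hP : ∀ n, IsUniversalProjector n (P n))
    (a b c : ℕ) (h : Admissible a b c) {a' : ℕ} (h' : a' < a) (y : GrDiag a' a) :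
    (vertexNet P a b c h).DiesAbove y :=
  (((hP a).diesAbove h' y).below _).stack _

/-- Whatever summand of the lower projectors lies in between, the vertex diagram, this summand and
`y` form a diagram from `a` points to fewer, which kills the projector on the edge `a`. -/
theorem vertexNet_diesBelow (hP : ∀ n, IsUniversalProjector n (P n))
    (a b c : ℕ) (h : Admissible a b c) {a' : ℕ} (h' : a' < a) (y : GrDiag (b + c) a') :
    (vertexNet P a b c h).DiesBelow y :=
  Cplx.DiesBelow.stack_of_forall fun _ => Cplx.DiesBelow.below ((hP a).diesBelow h' _)

/-- The return at the free lower end of the left edge is reflected and moved below the target, where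
it narrows the projector on the same edge. -/
theorem misses_of_botReturn_left (hP : ∀ n, IsUniversalProjector n (P n))
    (b c : ℕ) {a : ℕ} (K : Cplx a (b + c)) {x : GrDiag b b} (hx : x.Returns)
    (y : GrDiag c c) (w : GrDiag a (b + c)) :
    (K.stack ((P b).beside (P c))).Misses (w.vert (x.horiz y)) := by
  obtain ⟨k, hk, z, hz⟩ := GrDiag.exists_factorsBelow hx.2
  exact Cplx.misses_of_factorsBelow ((hz.horiz_left y).vert w) fun l =>
    Cplx.DiesBelow.shift (l := 0 + 0) (Cplx.DiesBelow.stack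
      (((hP b).diesBelow hk ⟨z.flip, 0⟩).beside_left (P c)) K) l

theorem misses_of_botReturn_right (hP : ∀ n, IsUniversalProjector n (P n))
    (b c : ℕ) {a : ℕ} (K : Cplx a (b + c)) {y : GrDiag c c} (hy : y.Returns)
    (x : GrDiag b b) (w : GrDiag a (b + c)) :
    (K.stack ((P b).beside (P c))).Misses (w.vert (x.horiz y)) := by
  obtain ⟨k, hk, z, hz⟩ := GrDiag.exists_factorsBelow hy.2
  exact Cplx.misses_of_factorsBelow ((hz.horiz_right x).vert w) fun l =>
    Cplx.DiesBelow.shift (l := 0 + 0) (Cplx.DiesBelow.stack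
      (((hP c).diesBelow hk ⟨z.flip, 0⟩).beside_right (P b)) K) l

/-- In nonzero degree one of the three projectors contributes a term with returns. A return on the
upper edge is moved above the target and one on a lower edge below it; in each case it meets the
projector on the corresponding edge. -/
theorem vertexNet_misses (hP : ∀ n, IsUniversalProjector n (P n))
    (a b c : ℕ) (h : Admissible a b c) (i : ℕ) (hi : i ≠ 0) (j : ((vertexNet P a b c h).X i).ι) :
    (vertexNet P a b c h).Misses (((vertexNet P a b c h).X i).X j) := by
  refine Cplx.misses_of_generatedBy ((vertexNet_generatedBy hP a b c h i).mono ?_) j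
  rintro z ⟨w, x, y, rfl, hwxy⟩
  rcases hwxy hi with hw | hx | hy
  · obtain ⟨k, hk, u, hu⟩ := GrDiag.exists_factorsAbove hw.1
    exact Cplx.misses_of_factorsAbove ((hu.vert _).vert _) fun l =>
      vertexNet_diesAbove hP a b c h hk _
  · exact misses_of_botReturn_left hP b c _ hx _ _
  · exact misses_of_botReturn_right hP b c _ hy _ _

end Vertex

end Networks

end SpinNet
end

/-! ### Endomorphism complexes of the three networks -/

noncomputable section
namespace SpinNet

open GrDiag

section Networks

variable {P : (n : ℕ) → Cplx n n}

theorem projector_misses (hP : ∀ n, IsUniversalProjector n (P n)) (a i : ℕ) (hi : i ≠ 0)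
    (j : ((P a).X i).ι) : (P a).Misses (((P a).X i).X j) := by
  obtain ⟨k, hk, u, hu⟩ := GrDiag.exists_factorsAbove ((hP a).topReturn hi j)
  exact Cplx.misses_of_factorsAbove hu fun l => (hP a).diesAbove hk _

variable (a b c d i : ℕ) (h : Admissible i a b)
  (h' : Admissible i c d)

theorem iNet_zero (hP : ∀ n, IsUniversalProjector n (P n)) :
    Nonempty ((iNet P a b c d i h h').X 0 ≅
      ofDiag ((vertexDiag i a b h).flip.stack (vertexDiag i c d h')) 0) := by
  obtain ⟨e⟩ := (stack_biadditive (a + b) i (c + d)).nonempty_iso_zero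
    (Cplx.below_zero (beside_zero hP a b) (vertexDiag i a b h).flip)
    (vertexNet_zero hP i c d h')
  exact ⟨e ≪≫ (Mat_.embedding _).mapIso (DIso.iso (((((DIso.strandsBeside a b).stack
    (DIso.refl _)).trans (DIso.leftUnit _))).stack (DIso.refl _)) rfl)⟩

/-- The four outer edges are treated like the edges of a vertex: their returns face the boundary and
are moved directly. The inner edge `i` has no free end and needs a separate argument. -/
theorem iNet_misses (hP : ∀ n, IsUniversalProjector n (P n)) (p : ℕ) (hp : p ≠ 0)
    (j : ((iNet P a b c d i h h').X p).ι) :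
    (iNet P a b c d i h h').Misses (((iNet P a b c d i h h').X p).X j) := by
  refine Cplx.misses_of_generatedBy ((Cplx.generatedBy_stack
    (fun p => Cplx.generatedBy_below (generatedBy_projectors hP a b p) _)
    (vertexNet_generatedBy hP i c d h') p).mono ?_) j
  rintro z ⟨r, s, _, _, hrs, rfl, ⟨_, rfl, x, y, rfl, hxy⟩, ⟨w, u, v, rfl, hwuv⟩⟩
  by_cases hr : r = 0
  · rcases hwuv (by omega) with hw | hu | hv
    -- A return on the inner edge makes the summand pass through k < i points in its interior. The
    -- whole part below this narrow place is moved under the target, where it reduces the outgoing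
    -- points to `k` and thereby kills the projector on the edge `i`.
    · obtain ⟨k, hk, t, ht⟩ := GrDiag.exists_factorsAbove hw.1
      obtain ⟨q, hq⟩ := ((ht.vert _).vert _).exists_factorsBelow _
      exact Cplx.misses_of_factorsBelow hq fun l =>
        (vertexNet_diesBelow hP i c d h' hk _).stack _
    · obtain ⟨k, hk, t, ht⟩ := GrDiag.exists_factorsBelow hu.2
      exact Cplx.misses_of_factorsBelow (((ht.horiz_left v).vert _).vert _) fun l =>
        Cplx.DiesBelow.shift (l := 0 + 0) (Cplx.DiesBelow.stack (Cplx.DiesBelow.stack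
          (((hP c).diesBelow hk ⟨t.flip, 0⟩).beside_left (P d)) _) _) l
    · obtain ⟨k, hk, t, ht⟩ := GrDiag.exists_factorsBelow hv.2
      exact Cplx.misses_of_factorsBelow (((ht.horiz_right u).vert _).vert _) fun l =>
        Cplx.DiesBelow.shift (l := 0 + 0) (Cplx.DiesBelow.stack (Cplx.DiesBelow.stack
          (((hP d).diesBelow hk ⟨t.flip, 0⟩).beside_right (P c)) _) _) l
  · rcases hxy hr with hx | hy
    · obtain ⟨k, hk, t, ht⟩ := GrDiag.exists_factorsAbove hx.1
      exact Cplx.misses_of_factorsAbove (y := t.beside (.strands b))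
        (((ht.horiz_left y).vert _).vert _) fun l =>
        Cplx.DiesAbove.shift (l := 0 + 0) (Cplx.DiesAbove.stack (Cplx.DiesAbove.below
          (((hP a).diesAbove hk ⟨t, 0⟩).beside_left (P b)) _) _) l
    · obtain ⟨k, hk, t, ht⟩ := GrDiag.exists_factorsAbove hy.1
      exact Cplx.misses_of_factorsAbove (y := Diag.beside (.strands a) t)
        (((ht.horiz_right x).vert _).vert _) fun l =>
        Cplx.DiesAbove.shift (l := 0 + 0) (Cplx.DiesAbove.stack (Cplx.DiesAbove.below
          (((hP b).diesAbove hk ⟨t, 0⟩).beside_right (P a)) _) _) l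

/-- Gluing a projector to a complex that dies below fewer strands is gluing the identity. -/
theorem stack_projector_equiv (hP : ∀ n, IsUniversalProjector n (P n)) {m n i : ℕ} (K : Cplx m i)
    (hK : ∀ k < i, ∀ y : GrDiag i k, K.DiesBelow y) (v : Diag i n)
    (G : GrDiag m n ⥤ AddCommGrpCat.{0}) [G.Additive] :
    Nonempty (HomotopyEquiv (ev G (K.stack ((P i).below v))) (ev G (K.below v))) := by
  obtain ⟨e⟩ := Cplx.below_zero (hP i).degree_zero v
  obtain ⟨f⟩ := (stack_biadditive m i n).equiv_right G K ((P i).below v) ⟨v, 0⟩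
    (e ≪≫ (Mat_.embedding _).mapIso (DIso.iso (DIso.leftUnit v) rfl)) fun q hq j => by
      -- In nonzero degree each term of the projector has a return facing `K`, so it factors through
      -- fewer strands next to `K` and contributes nothing.
      obtain ⟨k, hk, u, s, ⟨r⟩⟩ := GrDiag.exists_factorsAbove ((hP i).topReturn hq j.1)
      exact (Cplx.DiesBelow.vert (((hK k hk ⟨u.flip, 0⟩).vert s).of_retract r) ⟨v, 0⟩) G
  exact ⟨f.trans (HomotopyEquiv.ofIso ((stack_biadditive m i n).evFixRight G ⟨v, 0⟩ K).symm)⟩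

/-- The reflected vertex followed by `y` has fewer than `i` lower points, so it already kills the
lower vertex of the network. -/
theorem iNet_below_diesBelow (hP : ∀ n, IsUniversalProjector n (P n)) (k : ℕ) (hk : k < i)
    (y : GrDiag i k) :
    ((iNet P a b c d i h h').below (vertexDiag i c d h').flip).DiesBelow y :=
  Cplx.DiesBelow.below ((vertexNet_diesBelow hP i c d h' hk _).stack _)

/-- Endomorphisms of a complex with vanishing contributions in nonzero degrees. -/
theorem endCplx_equiv {m n : ℕ} {A : Cplx m n} {v : Diag m n} (e : Nonempty (A.X 0 ≅ ofDiag v 0))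
    (hA : ∀ i, i ≠ 0 → ∀ j, A.Misses ((A.X i).X j)) {B : Cplx m m} (s : ℤ)
    (f : ∀ d, Nonempty (HomotopyEquiv (ev (coyo (⟨v, d⟩ : GrDiag m n)) A)
      (ev (coyo (⟨.strands m, d - s⟩ : GrDiag m m)) B))) :
    GrCplx.HEquiv (endCplx A) (GrCplx.qShift (s + m) (ket B.tr)) := fun d => by
  obtain ⟨e1⟩ := Cplx.homCplx_equiv_of_misses d e hA
  obtain ⟨e2⟩ := f d
  obtain ⟨e3⟩ := Cplx.ket_tr_equiv B (d - s)
  -- The shift `s` from moving the diagram and the shift `m` from closing `m` strands add up.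
  rw [sub_sub] at e3
  exact ⟨(e1.trans (extendHomotopyEquiv e2 _)).trans e3⟩

/-- Endomorphisms of a universal projector. -/
theorem endCplx_projector (hP : ∀ n, IsUniversalProjector n (P n)) (a : ℕ) :
    GrCplx.HEquiv (endCplx (P a)) (GrCplx.qShift a (ket (P a).tr)) := by
  have := endCplx_equiv (hP a).degree_zero (projector_misses hP a) (B := P a) 0 fun d => by
    rw [sub_zero]
    exact ⟨.refl _⟩
  rwa [zero_add] at this

/-- Endomorphisms of a trivalent vertex. -/
theorem endCplx_vertexNet (hP : ∀ n, IsUniversalProjector n (P n)) (a b c : ℕ)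
    (h : Admissible a b c) : GrCplx.HEquiv (endCplx (vertexNet P a b c h))
      (GrCplx.qShift ((a + b + c) / 2) (ket (thetaNet P a b c h))) := by
  have key := endCplx_equiv (vertexNet_zero hP a b c h) (vertexNet_misses hP a b c h)
    (B := (vertexNet P a b c h).below (vertexDiag a b c h).flip) (vertexDiag a b c h).index
    fun d => by
      obtain ⟨e⟩ := Cplx.ev_coyo_stack (vertexNet P a b c h) (.strands a) (vertexDiag a b c h) d
      exact ⟨HomotopyEquiv.ofIso (evCongr (coyoCongr (DIso.iso (DIso.leftUnit _).symm rfl)) _ ≪≫ e)⟩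
  -- Twice the index is b + c - a, so twice the left side is a + b + c and the integer division is
  -- exact.
  have hs : (vertexDiag a b c h).index + a = ((a : ℤ) + b + c) / 2 := by
    have := (vertexDiag a b c h).two_mul_index
    push_cast at this
    omega
  rwa [hs] at key

/-- Endomorphisms of a network with four ends. -/
theorem endCplx_iNet (hP : ∀ n, IsUniversalProjector n (P n)) :
    GrCplx.HEquiv (endCplx (iNet P a b c d i h h'))
      (GrCplx.qShift ((a + b + c + d) / 2) (ket (pillNet P a b c d i h h'))) := by
  have key := endCplx_equiv (iNet_zero a b c d i h h' hP) (iNet_misses a b c d i h h' hP)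
    (B := ((iNet P a b c d i h h').below (vertexDiag i c d h').flip).stack
      ((P i).below (vertexDiag i a b h)))
    ((vertexDiag i c d h').index + (vertexDiag i a b h).flip.index) fun e => by
      -- The lower vertex of the source is moved to the target first, then the upper one; the latter
      -- was reflected in the source, so it appears upright below the target.
      obtain ⟨e1⟩ := Cplx.ev_coyo_stack (iNet P a b c d i h h') (vertexDiag i a b h).flip
        (vertexDiag i c d h') e
      obtain ⟨e2⟩ := Cplx.ev_coyo_stack
        ((iNet P a b c d i h h').below (vertexDiag i c d h').flip) (.strands (a + b))
        (vertexDiag i a b h).flip (e - (vertexDiag i c d h').index)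
      rw [Diag.flip_flip, sub_sub] at e2
      -- At this point the pill has plain strands instead of a projector on its second edge `i`; the
      -- projector is inserted.
      obtain ⟨e3⟩ := stack_projector_equiv hP
        ((iNet P a b c d i h h').below (vertexDiag i c d h').flip)
        (iNet_below_diesBelow a b c d i h h' hP) (vertexDiag i a b h)
        (coyo ⟨.strands (a + b),
          e - ((vertexDiag i c d h').index + (vertexDiag i a b h).flip.index)⟩)
      exact ⟨(HomotopyEquiv.ofIso (e1 ≪≫ evCongr (coyoCongr (DIso.iso
        (DIso.leftUnit _).symm rfl)) _ ≪≫ e2)).trans e3.symm⟩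
  -- The doubled indices are c + d - i and i - (a + b), so the inner label cancels and the division
  -- by two is again exact.
  have hs : (vertexDiag i c d h').index + (vertexDiag i a b h).flip.index + (a + b : ℕ) =
      ((a : ℤ) + b + c + d) / 2 := by
    have h1 := (vertexDiag i c d h').two_mul_index
    have h2 := (vertexDiag i a b h).flip.two_mul_index
    push_cast at h1 h2 ⊢
    omega
  rwa [hs] at key

end Networks

end SpinNet
end

theorem mainTheorem5 (P : (n : ℕ) → SpinNet.Cplx n n)
    (hP : ∀ n, SpinNet.IsUniversalProjector n (P n)) :
    (∀ a : ℕ,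
      SpinNet.GrCplx.HEquiv (SpinNet.endCplx (P a))
        (SpinNet.GrCplx.qShift a (SpinNet.ket (P a).tr))) ∧
    (∀ (a b c : ℕ) (h : SpinNet.Admissible a b c),
      SpinNet.GrCplx.HEquiv (SpinNet.endCplx (SpinNet.vertexNet P a b c h))
        (SpinNet.GrCplx.qShift ((a + b + c) / 2) (SpinNet.ket (SpinNet.thetaNet P a b c h)))) ∧
    (∀ (a b c d i : ℕ) (h : SpinNet.Admissible i a b) (h' : SpinNet.Admissible i c d),
      SpinNet.GrCplx.HEquiv (SpinNet.endCplx (SpinNet.iNet P a b c d i h h'))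
        (SpinNet.GrCplx.qShift ((a + b + c + d) / 2)
          (SpinNet.ket (SpinNet.pillNet P a b c d i h h')))) :=
  ⟨SpinNet.endCplx_projector hP, SpinNet.endCplx_vertexNet hP,
    fun a b c d i h h' => SpinNet.endCplx_iNet a b c d i h h' hP⟩
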